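/- **Setting.** Let $\mathcal O\subset\mathbb R^d$ be a bounded open set, $H=L^2(\mathcal O)$ with norm $|\cdot|$ and scalar product $(\cdot,\cdot)$, $T>0$, $\lambda>0$, $x\in H$. Let $(\Omega,\mathcal F,\mathbb P)$ be a probability space with a filtration $(\mathcal F_t)_{t\ge0}$, let $\{\beta_j\}$ be an independent system of real $(\mathcal F_t)$-Brownian motions (they are independent and adapted, and after each time $s$ their joint increments are independent of $\mathcal F_s$), let $\{e_j\}$ be an orthonormal basis of $H$ and $\mu_j\in\mathbb R$. Put $$W(t,\xi)=\sum_{j}\mu_je_j(\xi)\beta_j(t).$$ Write $\|m\|_{\rm mult}=\sup\{|mu|;\ |u|=1\}$ for the norm of a function $m$ as a multiplier of $H$. Assume: * $e_j$ and $e_j^2$ are multipliers of $H$ and, with $\gamma_j=\max\{\|e_j\|_{\rm mult},\|e_j^2\|_{\rm mult}^{1/2},1\}$, one has $\nu=\sum_j\mu_j^2\gamma_j^2<\infty$ and $\lambda>\nu$; * $e^{\pm W(t)}$ are, $\mathbb P$-a.s., multipliers of $H$ with $|e^{\pm W(t)}z|\le Z(t)|z|$ for all $z\in H$, $t\in[0,T]$,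 where $Z\ge0$ is adapted with $\sup_{[0,T]}Z<\infty$ a.s., and $t\mapsto e^{\pm W(t)}\in L(H,H)$ is a.s. continuous on $[0,T]$. Put $\mu=\frac12\sum_j\mu_j^2e_j^2$ and $\delta=\frac12(\lambda-\nu)$. **Equation.** Let $K=\{z\in L^2(\mathcal O);\ z\ge0\text{ a.e.}\}$ with normal cone $N_K$. The problem is $$dX-\Delta X\,dt+\lambda X\,dt+N_K(X)\,dt\ni X\,dW\ \text{ in }(0,T)\times\mathcal O,\qquad X=0\ \text{ on }(0,T)\times\partial\mathcal O,\qquad X(0)=x .$$ It has the potential $\varphi:H\to[0,\infty]$, $\varphi(z)=\frac12\int_{\mathcal O}|\nabla z|^2d\xi$ if $z\in H^1_0(\mathcal O)\cap K$ and $\varphi(z)=\infty$ otherwise. Put $\psi^*(v)=\sup_{z\in H}\{(v,z)-\varphi(z)-\frac\delta2|z|^2\}$. **Spaces.** $\mathcal H$ is the space of $H$-valued processes $y$ on $(0,T)$ that have an adapted, jointly measurable version and satisfy $\mathbb E\int_0^T|e^{W(t)}y(t)|^2dt<\infty$. $\mathcal H_T$ is the space of $y_1:\Omega\to H$ with $\mathbb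 E|e^{W(T)}y_1|^2<\infty$. Both carry the corresponding weighted scalar products. $\Theta$ is the space of adapted $\theta\in L^2(\Omega;W^{1,2}([0,T];H))$, and $\mathcal X=\Theta'$ is its dual. **Operators.** $D(\mathcal B)$ is the set of $z\in\mathcal H$ such that a.s. $z\in W^{1,2}([0,T];H)$ and $z(0)=0$, and $\frac{dz}{dt}\in\mathcal H$; for these, $\mathcal Bz=\frac{dz}{dt}+(\mu+\nu+\delta)(z+x)$. An $H$-valued process $v\in L^2((0,T)\times\Omega;H)$ acts on $\Theta$ by $\theta\mapsto\mathbb E\int_0^T(v,\theta)dt$. For $(y,y_1)\in\mathcal H\times\mathcal H_T$ define $\widetilde{\mathcal B}(y,y_1)\in\mathcal X$ by $$\widetilde{\mathcal B}(y,y_1)(\theta)=\mathbb E(e^{W(T)}y_1,\theta(T))+\mathbb E\int_0^T\big(e^{W}((\nu+\delta)(y+x)+\mu x),\theta\big)dt-\mathbb E\int_0^T\Big(e^Wy,\frac{d\theta}{dt}\Big)dt .$$ **Functionals.** Let $\eta(z)=(\nu+\delta)|z|^2-\frac12\sum_j\mu_j^2|ze_j|^2$. Let $\kappa$ be either $\kappa=3\mu$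 (the coefficient that results from Itô's product rule for $(e^Wx,e^Wy)$) or $\kappa=1+\mu$. Put $$\begin{aligned}\widetilde G_1(y,y_1)=\ &\mathbb E\int_0^T\varphi(e^W(y+x))dt+\mathbb E\int_0^T\Big(\big(e^W((\nu+\delta)(y+x)+\mu x),e^Wx\big)+\tfrac\delta2|e^W(y+x)|^2+\eta(e^Wy)\Big)dt\\&-\mathbb E\int_0^T(e^Wy,e^W\kappa x)dt+\tfrac12\mathbb E|e^{W(T)}y_1|^2+\mathbb E(e^{W(T)}y_1,e^{W(T)}x),\end{aligned}$$ $G_2(v)=\mathbb E\int_0^T\psi^*(v(t))dt$, and $$\overline G(y,y_1,u)=\widetilde G_1(y,y_1)+\inf\ \liminf_{n\to\infty}G_2(v_n),$$ where the infimum is over all sequences $z_n\in D(\mathcal B)$, $v_n=-e^W\mathcal Bz_n$, such that $z_n\to y$ weakly in $\mathcal H$, $z_n(T)\to y_1$ weakly in $\mathcal H_T$ and $v_n\to u$ weakly in $\mathcal X$ (it is $\infty$ if there are none). **Variational solution.** A process $X=e^W(y+x)$ is a variational solution if, for some $y_1,u$, the triple $(y,y_1,u)$ minimizes $\overline G$ over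 all $(y,y_1,u)\in\mathcal H\times\mathcal H_T\times\mathcal X$ with $\widetilde{\mathcal B}(y,y_1)+u=0$. **Claim.** For either choice of $\kappa$, this minimization problem has a unique solution $(y,y_1,u)$ (up to a.e. equality). Consequently the stochastic obstacle problem has a unique variational solution $X$. It satisfies $X\in L^2((0,T)\times\Omega;H^1_0(\mathcal O))$, and $X\ge0$ a.e. in $\mathcal O$, for almost every $(t,\omega)\in(0,T)\times\Omega$. -/

import Mathlib

open MeasureTheory ProbabilityTheory Filter Topology Set
open scoped NNReal ENNReal

noncomputable section

namespace StochObstacle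

/-- The Euclidean space `ℝ^d`. -/
abbrev E (d : ℕ) : Type := EuclideanSpace ℝ (Fin d)

/-! ### The space `L²(O)`, multipliers, the Dirichlet energy and the obstacle cone -/

section Space

variable {d : ℕ} (O : Set (E d))

/-- Lebesgue measure on `O`. -/
abbrev vol : Measure (E d) := (volume : Measure (E d)).restrict O

/-- The Hilbert space `H = L²(O)`. -/
abbrev L2 : Type := Lp ℝ 2 (vol O)

/-- The Hilbert space `L²(O; ℝ^d)`, in which gradients live. -/
abbrev L2vec : Type := Lp (E d) 2 (vol O)

open Classical in
/-- Pointwise product `m z` of a function `m` on `O` with `z ∈ L²(O)`, as an element of `L²(O)`;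
it is `0` if `m z` is not square integrable (which never happens if `m` is a multiplier). -/
def mul (m : E d → ℝ) (z : L2 O) : L2 O :=
  if h : MemLp (fun ξ => m ξ * z ξ) 2 (vol O) then h.toLp (fun ξ => m ξ * z ξ) else 0

/-- The norm `sup {|m u| ; |u| = 1}` of `m` as a multiplier of `L²(O)`
(it is `∞` if `m` is not a multiplier). -/
def multNorm (m : E d → ℝ) : ℝ≥0∞ :=
  ⨆ (u : L2 O) (_ : ‖u‖ = 1), eLpNorm (fun ξ => m ξ * u ξ) 2 (vol O)

/-- The graph of the gradient on `H¹₀(O)`: the closure in `L²(O) × L²(O; ℝ^d)` of the set of pairs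
`(f, ∇f)`, where `f` runs through the smooth functions with compact support in `O`. So `z ∈ H¹₀(O)`
with weak gradient `g` if and only if `(z, g)` belongs to this set. -/
def h10Graph : Set (L2 O × L2vec O) :=
  closure {p | ∃ f : E d → ℝ, ContDiff ℝ (⊤ : ℕ∞) f ∧ HasCompactSupport f ∧ tsupport f ⊆ O ∧
    p.1 =ᵐ[vol O] f ∧ p.2 =ᵐ[vol O] gradient f}

/-- The closed quadratic form `½ (A₀ z, z) = ½ ∫_O |∇z|² dξ` of the Dirichlet Laplacian
`A₀ = -Δ`, with value `∞` outside `H¹₀(O)` (there is at most one `g` for each `z`). -/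
def dirichletEnergy (z : L2 O) : ℝ≥0∞ :=
  ⨅ (g : L2vec O) (_ : (z, g) ∈ h10Graph O), ENNReal.ofReal (1 / 2 * ‖g‖ ^ 2)

/-- The cone `K` of nonnegative functions in `L²(O)`. -/
def cone : Set (L2 O) := {z | ∀ᵐ ξ ∂(vol O), 0 ≤ z ξ}

open Classical in
/-- The indicator function `I_K` of convex analysis. -/
def indK (z : L2 O) : ℝ≥0∞ := if z ∈ cone O then 0 else ∞

/-- The convex potential `φ(z) = ½ (A₀ z, z) + I_K(z)` of the operator `-Δ + N_K`. -/
def phi (z : L2 O) : ℝ≥0∞ := dirichletEnergy O z + indK O z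

/-- `ψ(z) = φ(z) + (δ/2) |z|²`. -/
def psi (δ : ℝ) (z : L2 O) : ℝ≥0∞ := phi O z + ENNReal.ofReal (δ / 2 * ‖z‖ ^ 2)

/-- The conjugate `ψ*(v) = sup {(v, z) - ψ(z) ; z ∈ H}`. It is nonnegative, because `ψ(0) = 0`. -/
def psiStar (δ : ℝ) (v : L2 O) : EReal :=
  ⨆ z : L2 O, ((inner ℝ v z : ℝ) : EReal) - ((psi O δ z : ℝ≥0∞) : EReal)

end Space

/-! ### The Sobolev space `W^{1,2}([0,T];H)` -/

section W12

variable (H : Type*) [NormedAddCommGroup H] (T : ℝ)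

/-- The space `W^{1,2}([0,T];H)`: an element is given by its initial value `θ(0)` and its
derivative `θ' ∈ L²(0,T;H)`. The norm `(|θ(0)|² + ∫₀ᵀ |θ'|²)^{1/2}` is equivalent to the usual
one. -/
abbrev W12 : Type _ := WithLp 2 (H × Lp H 2 ((volume : Measure ℝ).restrict (Ioc 0 T)))

variable {H T} [InnerProductSpace ℝ H]

/-- The value at time `t ∈ [0,T]` of an element of `W^{1,2}([0,T];H)`,
`θ(t) = θ(0) + ∫₀ᵗ θ'(s) ds`. -/
def W12.eval (θ : W12 H T) (t : ℝ) : H :=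
  θ.fst + ∫ s in Ioc 0 t, θ.snd s ∂((volume : Measure ℝ).restrict (Ioc 0 T))

lemma W12.integrable_snd {H : Type*} [NormedAddCommGroup H] {T : ℝ} (θ : W12 H T) :
    Integrable θ.snd ((volume : Measure ℝ).restrict (Ioc 0 T)) :=
  (Lp.memLp θ.snd).integrable (by norm_num)

lemma W12.eval_add (θ η : W12 H T) (t : ℝ) : (θ + η).eval t = θ.eval t + η.eval t := by
  unfold W12.eval
  have h : (θ + η).snd =ᵐ[(volume : Measure ℝ).restrict (Ioc 0 T)] fun s => θ.snd s + η.snd s := by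
    rw [WithLp.add_snd]
    exact Lp.coeFn_add _ _
  rw [integral_congr_ae (ae_restrict_of_ae h),
    integral_add θ.integrable_snd.restrict η.integrable_snd.restrict, WithLp.add_fst]
  abel

lemma W12.eval_smul (c : ℝ) (θ : W12 H T) (t : ℝ) : (c • θ).eval t = c • θ.eval t := by
  unfold W12.eval
  have h : (c • θ).snd =ᵐ[(volume : Measure ℝ).restrict (Ioc 0 T)] fun s => c • θ.snd s := by
    rw [WithLp.smul_snd]
    exact Lp.coeFn_smul _ _
  rw [integral_congr_ae (ae_restrict_of_ae h), integral_smul, WithLp.smul_fst, smul_add]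

lemma W12.eval_zero (t : ℝ) : (0 : W12 H T).eval t = 0 := by
  have h := W12.eval_smul (0 : ℝ) (0 : W12 H T) t
  rwa [zero_smul, zero_smul] at h

end W12

/-- The space of test processes: all `θ ∈ L²(Ω; W^{1,2}([0,T];H))` that are adapted to `ℱ`. -/
def testSpace {Ω : Type*} {mΩ : MeasurableSpace Ω}
    (H : Type*) [NormedAddCommGroup H] [InnerProductSpace ℝ H] (T : ℝ)
    (P : Measure Ω) (ℱ : Filtration ℝ≥0 mΩ) : Submodule ℝ (Lp (W12 H T) 2 P) where
  carrier := {θ | ∀ t ∈ Icc 0 T,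
    AEStronglyMeasurable[ℱ t.toNNReal] (fun ω => (θ ω).eval t) P}
  add_mem' := by
    intro a b ha hb t ht
    refine ((ha t ht).add (hb t ht)).congr ?_
    filter_upwards [Lp.coeFn_add a b] with ω hω
    rw [hω]
    exact (W12.eval_add _ _ t).symm
  zero_mem' := by
    intro t _
    refine (aestronglyMeasurable_const (b := (0 : H))).congr ?_
    filter_upwards [Lp.coeFn_zero (W12 H T) 2 P] with ω hω
    rw [hω]
    exact (W12.eval_zero t).symm
  smul_mem' := by
    intro c a ha t ht
    refine ((ha t ht).const_smul c).congr ?_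
    filter_upwards [Lp.coeFn_smul c a] with ω hω
    rw [hω]
    exact (W12.eval_smul c _ t).symm

/-! ### Brownian motions -/

/-- `β₀, β₁, …` is an independent system of real Brownian motions relative to the filtration `ℱ`:
they are independent Brownian motions, they are adapted, and after each time `s` their increments
are independent of `ℱ s`. -/
structure IsBrownianSystem {Ω : Type*} {mΩ : MeasurableSpace Ω} (P : Measure Ω)
    (ℱ : Filtration ℝ≥0 mΩ) (β : ℕ → ℝ≥0 → Ω → ℝ) : Prop where
  brownian : ∀ j, IsBrownianReal (β j) P
  independent : iIndepFun (fun j ω t => β j t ω) P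
  adapted : ∀ j, StronglyAdapted ℱ (β j)
  increments : ∀ s : ℝ≥0, Indep (ℱ s)
    (⨆ (j : ℕ) (r : ℝ≥0), MeasurableSpace.comap (fun ω => β j (s + r) ω - β j s ω) inferInstance) P

/-! ### The data of the problem -/

/-- The data of the stochastic obstacle problem
`dX - ΔX dt + λ X dt + N_K(X) dt ∋ X dW` in `(0,T) × O`, `X = 0` on the boundary, `X(0) = x`.
These are raw data; the hypotheses on them are stated separately. -/
structure Data (d : ℕ) (Ω : Type*) [mΩ : MeasurableSpace Ω] where
  /-- the spatial domain -/
  O : Set (E d)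
  /-- the time horizon -/
  T : ℝ
  /-- the coefficient `λ` -/
  lam : ℝ
  /-- the probability -/
  P : Measure Ω
  /-- the filtration -/
  ℱ : Filtration ℝ≥0 mΩ
  /-- the Brownian motions `β_j` -/
  β : ℕ → ℝ≥0 → Ω → ℝ
  /-- the orthonormal basis `e_j` of `L²(O)` -/
  e : HilbertBasis ℕ ℝ (L2 O)
  /-- the coefficients `μ_j` of the noise -/
  c : ℕ → ℝ
  /-- the initial value -/
  x : L2 O

namespace Data

variable {d : ℕ} {Ω : Type*} [mΩ : MeasurableSpace Ω] (D : Data d Ω)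

/-- `H = L²(O)`. -/
abbrev H : Type := L2 D.O

/-- The measure `dt ⊗ P` on `(0,T) × Ω`. -/
abbrev Q : Measure (ℝ × Ω) := ((volume : Measure ℝ).restrict (Ioc 0 D.T)).prod D.P

/-- `𝔼 ∫₀ᵀ f(t) dt` for a real process `f`. -/
def EI (f : ℝ → Ω → ℝ) : ℝ := ∫ ω, (∫ t in Ioc 0 D.T, f t ω) ∂D.P

/-- `𝔼 ∫₀ᵀ f(t) dt` for a process `f` with values in `[0,∞]`. -/
def EIpos (f : ℝ → Ω → ℝ≥0∞) : ℝ≥0∞ := ∫⁻ ω, (∫⁻ t in Ioc 0 D.T, f t ω) ∂D.P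

/-- The Wiener process `W(t,ξ) = ∑_j μ_j e_j(ξ) β_j(t)`, as the limit of the partial sums. -/
def W (t : ℝ) (ω : Ω) (ξ : E d) : ℝ :=
  limUnder atTop (fun n : ℕ => ∑ j ∈ Finset.range n, D.c j * D.e j ξ * D.β j t.toNNReal ω)

/-- `γ_j`, the maximum of the multiplier norm of `e_j`, of the square root of the multiplier norm
of `e_j²`, and of `1`. -/
def γ (j : ℕ) : ℝ≥0∞ :=
  max (max (multNorm D.O (D.e j)) (multNorm D.O (fun ξ => D.e j ξ ^ 2) ^ (1 / 2 : ℝ))) 1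

/-- `ν = ∑_j μ_j² γ_j²` with values in `[0,∞]`. -/
def νInf : ℝ≥0∞ := ∑' j, ENNReal.ofReal (D.c j ^ 2) * D.γ j ^ 2

/-- `ν` as a real number. -/
def ν : ℝ := D.νInf.toReal

/-- `δ = (λ - ν) / 2`. -/
def δ : ℝ := (D.lam - D.ν) / 2

/-- The multiplier `μ = ½ ∑_j μ_j² e_j²`. -/
def μ (ξ : E d) : ℝ := 1 / 2 * ∑' j, D.c j ^ 2 * D.e j ξ ^ 2

/-- Multiplication by `e^{W(t)}`. -/
def expW (t : ℝ) (ω : Ω) (z : D.H) : D.H := mul D.O (fun ξ => Real.exp (D.W t ω ξ)) z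

/-- `η(z) = (ν + δ) |z|² - ½ ∑_j μ_j² |z e_j|²`. -/
def η (z : D.H) : ℝ :=
  (D.ν + D.δ) * ‖z‖ ^ 2 - 1 / 2 * ∑' j, D.c j ^ 2 * ‖mul D.O (D.e j) z‖ ^ 2

/-- The hypothesis that `e^{W(t)}` and `e^{-W(t)}` (`σ = 1` and `σ = -1`) are multipliers of
`L²(O)`, with norm bounded by an adapted process `Z` with bounded paths, and that they depend
continuously on `t` in the operator norm. -/
def ExpWMultiplier : Prop :=
  (∃ Z : ℝ≥0 → Ω → ℝ, StronglyAdapted D.ℱ Z ∧ (∀ t ω, 0 ≤ Z t ω) ∧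
    ∀ᵐ ω ∂D.P, BddAbove ((fun t => Z t ω) '' Icc 0 D.T.toNNReal) ∧
      ∀ t ∈ Icc 0 D.T, ∀ σ ∈ ({1, -1} : Set ℝ), ∀ z : D.H,
        eLpNorm (fun ξ => Real.exp (σ * D.W t ω ξ) * z ξ) 2 (vol D.O) ≤
          ENNReal.ofReal (Z t.toNNReal ω * ‖z‖)) ∧
  ∀ᵐ ω ∂D.P, ∀ s ∈ Icc 0 D.T, ∀ σ ∈ ({1, -1} : Set ℝ), ∀ ε > 0, ∀ᶠ t in 𝓝[Icc 0 D.T] s,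
    ∀ z : D.H,
      eLpNorm (fun ξ => (Real.exp (σ * D.W t ω ξ) - Real.exp (σ * D.W s ω ξ)) * z ξ) 2 (vol D.O) ≤
        ENNReal.ofReal (ε * ‖z‖)

/-! ### The spaces `𝓗` and `𝓧` -/

/-- The `H`-valued process `y` has an adapted (and jointly measurable) version. -/
def HasAdaptedVersion (y : ℝ → Ω → D.H) : Prop :=
  ∃ y' : ℝ → Ω → D.H, StronglyMeasurable (fun p : ℝ × Ω => y' p.1 p.2) ∧
    (∀ t ∈ Icc 0 D.T, StronglyMeasurable[D.ℱ t.toNNReal] (y' t)) ∧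
    ∀ᵐ p ∂D.Q, y p.1 p.2 = y' p.1 p.2

/-- Membership in the space `𝓗` of processes with an adapted version and
`𝔼 ∫₀ᵀ |e^{W(t)} y(t)|² dt < ∞`. -/
def MemH (y : ℝ → Ω → D.H) : Prop :=
  D.HasAdaptedVersion y ∧ MemLp (fun p : ℝ × Ω => D.expW p.1 p.2 (y p.1 p.2)) 2 D.Q

/-- The scalar product `𝔼 ∫₀ᵀ (e^{W(t)} y(t), e^{W(t)} z(t)) dt` of `𝓗`. -/
def innerH (y z : ℝ → Ω → D.H) : ℝ :=
  D.EI fun t ω => inner ℝ (D.expW t ω (y t ω)) (D.expW t ω (z t ω))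

/-- Membership in the space of terminal values: `𝔼 |e^{W(T)} y₁|² < ∞`. -/
def MemTerm (y₁ : Ω → D.H) : Prop := MemLp (fun ω => D.expW D.T ω (y₁ ω)) 2 D.P

/-- The scalar product `𝔼 (e^{W(T)} y₁, e^{W(T)} z₁)` of the space of terminal values. -/
def innerTerm (y₁ z₁ : Ω → D.H) : ℝ :=
  ∫ ω, inner ℝ (D.expW D.T ω (y₁ ω)) (D.expW D.T ω (z₁ ω)) ∂D.P

/-- The adapted test processes in `L²(Ω; W^{1,2}([0,T];H))`. -/
abbrev Test : Type _ := testSpace D.H D.T D.P D.ℱ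

/-- The space `𝓧`, dual to the space of test processes. -/
abbrev X : Type _ := StrongDual ℝ D.Test

variable {D} in
/-- The path of a test process, `θ(t)`. -/
def Test.val (θ : D.Test) (t : ℝ) (ω : Ω) : D.H := ((θ : Lp (W12 D.H D.T) 2 D.P) ω).eval t

variable {D} in
/-- The time derivative of a test process, `dθ/dt`. -/
def Test.deriv (θ : D.Test) (t : ℝ) (ω : Ω) : D.H := ((θ : Lp (W12 D.H D.T) 2 D.P) ω).snd t

/-! ### The operators `𝓑` and its weak form -/

/-- `z ∈ D(𝓑)` with `dz/dt = z'`: almost surely `z ∈ W^{1,2}([0,T];H)` and `z(0) = 0`, and both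
`z` and `dz/dt` belong to `𝓗`. -/
structure InDomB (z z' : ℝ → Ω → D.H) : Prop where
  memH : D.MemH z
  memH_deriv : D.MemH z'
  path : ∀ᵐ ω ∂D.P, MemLp (fun t => z' t ω) 2 ((volume : Measure ℝ).restrict (Ioc 0 D.T)) ∧
    ∀ t ∈ Icc 0 D.T, z t ω = ∫ s in Ioc 0 t, z' s ω

/-- `e^W 𝓑 z`, where `𝓑 z = dz/dt + (μ + ν + δ) (z + x)` and `dz/dt = z'`. -/
def eWB (z z' : ℝ → Ω → D.H) (t : ℝ) (ω : Ω) : D.H :=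
  D.expW t ω (z' t ω + mul D.O (fun ξ => D.μ ξ + D.ν + D.δ) (z t ω + D.x))

/-- The weak form of `e^W 𝓑`, tested with `θ`. -/
def Bweak (y : ℝ → Ω → D.H) (y₁ : Ω → D.H) (θ : D.Test) : ℝ :=
  (∫ ω, inner ℝ (D.expW D.T ω (y₁ ω)) (θ.val D.T ω) ∂D.P) +
  D.EI (fun t ω => inner ℝ
    (D.expW t ω ((D.ν + D.δ) • (y t ω + D.x) + mul D.O D.μ D.x)) (θ.val t ω)) -
  D.EI (fun t ω => inner ℝ (D.expW t ω (y t ω)) (θ.deriv t ω))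

/-! ### The functionals -/

/-- The functional `G̃₁`. The function `κ` is the coefficient of its cross term
`-𝔼 ∫₀ᵀ (e^W y, e^W κ x) dt`. -/
def G1 (κ : E d → ℝ) (y : ℝ → Ω → D.H) (y₁ : Ω → D.H) : EReal :=
  ((D.EIpos fun t ω => phi D.O (D.expW t ω (y t ω + D.x)) : ℝ≥0∞) : EReal) +
  ((D.EI (fun t ω =>
      inner ℝ (D.expW t ω ((D.ν + D.δ) • (y t ω + D.x) + mul D.O D.μ D.x)) (D.expW t ω D.x)
      + D.δ / 2 * ‖D.expW t ω (y t ω + D.x)‖ ^ 2 + D.η (D.expW t ω (y t ω)))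
    - D.EI (fun t ω => inner ℝ (D.expW t ω (y t ω)) (D.expW t ω (mul D.O κ D.x)))
    + 1 / 2 * (∫ ω, ‖D.expW D.T ω (y₁ ω)‖ ^ 2 ∂D.P)
    + D.innerTerm y₁ (fun _ => D.x) : ℝ) : EReal)

/-- `G₂(v) = 𝔼 ∫₀ᵀ ψ*(v(t)) dt`. -/
def G2 (v : ℝ → Ω → D.H) : ℝ≥0∞ := D.EIpos fun t ω => (psiStar D.O D.δ (v t ω)).toENNReal

/-- The sequence `(z_n, z_n(T), v_n)`, where `z_n ∈ D(𝓑)`, `dz_n/dt = z_n'` and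
`v_n = - e^W 𝓑 z_n`, converges weakly to `(y, y₁, u)`. -/
structure Approximates (z z' : ℕ → ℝ → Ω → D.H) (y : ℝ → Ω → D.H) (y₁ : Ω → D.H) (u : D.X) :
    Prop where
  mem : ∀ n, D.InDomB (z n) (z' n)
  memTerm : ∀ n, D.MemTerm (z n D.T)
  tendsto_H : ∀ w, D.MemH w → Tendsto (fun n => D.innerH (z n) w) atTop (𝓝 (D.innerH y w))
  tendsto_term : ∀ h, D.MemTerm h →
    Tendsto (fun n => D.innerTerm (z n D.T) h) atTop (𝓝 (D.innerTerm y₁ h))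
  tendsto_X : ∀ θ : D.Test,
    Tendsto (fun n => D.EI fun t ω => inner ℝ (-D.eWB (z n) (z' n) t ω) (θ.val t ω)) atTop
      (𝓝 (u θ))

/-- The relaxation of `G₂` along `e^W 𝓑 z + v = 0`: the infimum of `liminf G₂(v_n)` over all
sequences `z_n ∈ D(𝓑)`, `v_n = - e^W 𝓑 z_n`, such that `(z_n, z_n(T), v_n) → (y, y₁, u)` weakly. -/
def G2relaxed (y : ℝ → Ω → D.H) (y₁ : Ω → D.H) (u : D.X) : ℝ≥0∞ :=
  ⨅ (z : ℕ → ℝ → Ω → D.H) (z' : ℕ → ℝ → Ω → D.H) (_ : D.Approximates z z' y y₁ u),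
    liminf (fun n => D.G2 fun t ω => -D.eWB (z n) (z' n) t ω) atTop

/-- The relaxed functional `G̅`. -/
def Gbar (κ : E d → ℝ) (y : ℝ → Ω → D.H) (y₁ : Ω → D.H) (u : D.X) : EReal :=
  D.G1 κ y y₁ + ((D.G2relaxed y y₁ u : ℝ≥0∞) : EReal)

/-! ### Variational solutions -/

/-- The admissible triples of the minimization problem. -/
structure Admissible (y : ℝ → Ω → D.H) (y₁ : Ω → D.H) (u : D.X) : Prop where
  memH : D.MemH y
  memTerm : D.MemTerm y₁
  constraint : ∀ θ : D.Test, D.Bweak y y₁ θ + u θ = 0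

/-- The triple `(y, y₁, u)` minimizes `G̅` among all admissible triples. -/
def IsMinimizer (κ : E d → ℝ) (y : ℝ → Ω → D.H) (y₁ : Ω → D.H) (u : D.X) : Prop :=
  D.Admissible y y₁ u ∧
    ∀ w w₁ v, D.Admissible w w₁ v → D.Gbar κ y y₁ u ≤ D.Gbar κ w w₁ v

/-- The process `Y` is a variational solution: `Y = e^W (y + x)` for a minimizer `(y, y₁, u)`. -/
def IsVariationalSolution (κ : E d → ℝ) (Y : ℝ → Ω → D.H) : Prop :=
  ∃ y y₁ u, D.IsMinimizer κ y y₁ u ∧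
    ∀ᵐ p ∂D.Q, Y p.1 p.2 = D.expW p.1 p.2 (y p.1 p.2 + D.x)

/-- Membership in `L²((0,T) × Ω; H¹₀(O))`: the process `Y` and its weak gradient `G` are square
integrable, and `Y ∈ H¹₀(O)` almost everywhere. -/
def MemL2H10 (Y : ℝ → Ω → D.H) : Prop :=
  MemLp (fun p : ℝ × Ω => Y p.1 p.2) 2 D.Q ∧
  ∃ G : ℝ × Ω → L2vec D.O, MemLp G 2 D.Q ∧ ∀ᵐ p ∂D.Q, (Y p.1 p.2, G p) ∈ h10Graph D.O

end Data

end StochObstacle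

end

/-!
The rescaled variables `h = e^W y` and `h₁ = e^{W(T)} y₁` run through a Hilbert space: `h` through
the closed subspace `Data.adapted` of the square integrable processes on `(0,T) × Ω` that have an
adapted version, and `h₁` through `L²(Ω; H)`. The space of pairs is `Data.Pt`, and the substitution
is `toPt`, which is onto by `exists_toPt`. For each pair, exactly one functional `u` satisfies the
constraint (`exists_functional_Bweak`). So the problem is to minimize a functional on a Hilbert
space, and by `Gbar_eq` this functional is a sum of two terms. The first, `convexPart`, is convex and
lower semicontinuous with values in `[0,∞]`. The second, `quadPart`, is a continuous quadratic
function. It is strongly convex because the multiplication by `μ` is bounded by `ν / 2`, so that the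
quadratic form `η` has the lower bound `δ |z|²`, where `δ > 0`. By the parallelogram law, such a sum
has a unique minimizer if it is finite somewhere (`exists_unique_minimizer`). At the minimizer the
potential is finite, and this says that `X = e^W (y + x)` is in `H¹₀` and nonnegative almost
everywhere. The gradient is a measurable function of `X` by `exists_measurable_gradient`.

The convex part contains the relaxation of `G₂`, that is, its lower envelope along weakly convergent
sequences. The sublevel sets of `G₂` are convex, so their weak and strong closures agree
(`mem_closure_of_weak_limit`), and the relaxation is given by the strong closures of the sublevel
sets: `relaxation_le_G2relaxed` and `G2relaxed_le_relaxation`. The second of these needs that the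
convergence in the dual of the test processes follows from the other two. It does, because the
functional given by `-e^W 𝓑 z` is `-Bweak z (z(T))` (`EI_eWB`), and `Bweak` is continuous in `h` and
`h₁` (`exists_Bweak_eq`).

The identity `EI_eWB` is Itô's product rule for `e^W` and Sobolev paths, in expectation. No
stochastic integral is needed. At almost every fixed point `ξ`, the variable `W(t, ξ)` is a sum of
independent Gaussian variables (`ae_tendsto_gaussian_series`), so that `e^{kW(t,ξ) - k²μ(ξ)t}` is a
martingale (`Standing.lintegral_exp_W_point`). Hence, in an expectation with data known at time `s`,
the multiplier `e^{kW(s)}` may be replaced by `e^{kW(T) - k²μ(T-s)}` (`Standing.integral_mart`). The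
latter depends smoothly on `s`, so the deterministic product rule applies to it along each path
(`Standing.mart_product`), and the derivative of the exponent is Itô's correction
(`Standing.product_rule`).

It remains to find a point at which both convex functionals are finite (`exists_feasible`). In the
obstacle problem, replace the subdifferential of `φ` by its Yosida approximation, which is Lipschitz
continuous, and keep a linear damping term. The equation then becomes an integral equation for
`e^{-W} X`, and its solution is found by Picard iteration (`exists_mild_solution`). The product rule
with `k = 2` is the energy identity (`energy_identity`). It yields bounds for `X`, for the terminal
value and for `G₂` that do not depend on the parameter `ε` of the approximation; the potential is
bounded at the resolvent of `X`, whose distance to `X` is of the order of `√ε`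
(`exists_penalized`). No limit of the equations is taken: the bounds define a decreasing sequence
of bounded closed convex sets, and these have a common point (`nonempty_iInter_of_convex_closed`).
-/

noncomputable section

namespace StochObstacle

section

/-! ### Minimization and Yosida approximation in a Hilbert space -/

section Hilbert

variable {V : Type*} [NormedAddCommGroup V] [InnerProductSpace ℝ V]

lemma norm_midpoint_sub_sq (a b z : V) :
    ‖(1 / 2 : ℝ) • (a + b) - z‖ ^ 2 + ‖a - b‖ ^ 2 / 4 = (‖a - z‖ ^ 2 + ‖b - z‖ ^ 2) / 2 := by
  have h := parallelogram_law_with_norm ℝ ((1 / 2 : ℝ) • (a - z)) ((1 / 2 : ℝ) • (b - z))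
  have h1 : (1 / 2 : ℝ) • (a - z) + (1 / 2 : ℝ) • (b - z) = (1 / 2 : ℝ) • (a + b) - z := by
    module
  have h2 : (1 / 2 : ℝ) • (a - z) - (1 / 2 : ℝ) • (b - z) = (1 / 2 : ℝ) • (a - b) := by module
  rw [h1, h2, norm_smul, norm_smul, norm_smul,
    show ‖(1 / 2 : ℝ)‖ = 1 / 2 by norm_num] at h
  nlinarith [h]

variable [CompleteSpace V]

/-- Bounded closed convex sets of a Hilbert space have the countable intersection property:
the elements of least norm form a Cauchy sequence. -/
lemma nonempty_iInter_of_convex_closed (K : ℕ → Set V) (hanti : Antitone K)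
    (hcl : ∀ n, IsClosed (K n)) (hcv : ∀ n, Convex ℝ (K n)) (B : ℝ)
    (hB : ∀ n, ∃ v ∈ K n, ‖v‖ ≤ B) : (⋂ n, K n).Nonempty := by
  have hne : ∀ n, (K n).Nonempty := fun n => (hB n).imp fun v hv => hv.1
  choose v hvK hv using fun n =>
    exists_norm_eq_iInf_of_complete_convex (hne n) (hcl n).isComplete (hcv n) 0
  have hmin : ∀ n, ∀ w ∈ K n, ‖v n‖ ≤ ‖w‖ := by
    intro n w hw
    have h1 : ‖v n‖ = ⨅ w : K n, ‖(0 : V) - w‖ := by rw [← hv n]; simp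
    rw [h1]
    have := ciInf_le (f := fun w : K n => ‖(0 : V) - w‖)
      ⟨0, by rintro _ ⟨w, rfl⟩; exact norm_nonneg _⟩ ⟨w, hw⟩
    simpa using this
  -- The least norms increase to a limit, and the parallelogram law turns this into convergence.
  have hmono : Monotone fun n => ‖v n‖ ^ 2 := by
    intro n m hnm
    have := hmin n (v m) (hanti hnm (hvK m))
    simp only
    gcongr
  have hbdd : BddAbove (range fun n => ‖v n‖ ^ 2) := by
    refine ⟨B ^ 2, ?_⟩
    rintro _ ⟨n, rfl⟩
    obtain ⟨w, hw, hwB⟩ := hB n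
    have := (hmin n w hw).trans hwB
    simp only
    gcongr
  have hlim := tendsto_atTop_ciSup hmono hbdd
  have hdist : ∀ n m, n ≤ m → ‖v n - v m‖ ^ 2 ≤ 2 * (‖v m‖ ^ 2 - ‖v n‖ ^ 2) := by
    intro n m hnm
    have hmid : (1 / 2 : ℝ) • (v n + v m) ∈ K n := by
      rw [smul_add]
      exact hcv n (hvK n) (hanti hnm (hvK m)) (by norm_num) (by norm_num) (by norm_num)
    have h1 := hmin n _ hmid
    have h2 := norm_midpoint_sub_sq (v n) (v m) 0
    simp only [sub_zero] at h2
    nlinarith [norm_nonneg (v n), norm_nonneg ((1 / 2 : ℝ) • (v n + v m))]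
  have hC : CauchySeq v := by
    rw [Metric.cauchySeq_iff']
    intro ε hε
    obtain ⟨N, hN⟩ := Metric.cauchySeq_iff'.1 hlim.cauchySeq (ε ^ 2 / 2) (by positivity)
    refine ⟨N, fun n hn => ?_⟩
    have h1 := hN n hn
    rw [Real.dist_eq, abs_lt] at h1
    have h2 := hdist N n hn
    rw [dist_comm, dist_eq_norm]
    exact lt_of_pow_lt_pow_left₀ 2 hε.le (by linarith)
  obtain ⟨w, hw⟩ := cauchySeq_tendsto_of_complete hC
  refine ⟨w, mem_iInter.2 fun n => (hcl n).mem_of_tendsto hw ?_⟩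
  filter_upwards [eventually_ge_atTop n] with m hm using hanti hm (hvK m)

/-- A strongly convex lower semicontinuous functional on a Hilbert space that is not identically
`∞` has a unique minimizer. -/
lemma exists_unique_minimizer (A : V → ℝ≥0∞) (q : V → ℝ) (c C : ℝ) (hc : 0 < c)
    (hA : LowerSemicontinuous A)
    (hAc : ∀ a b, A ((1 / 2 : ℝ) • (a + b)) ≤ (A a + A b) / 2)
    (hq : Continuous q) (hqC : ∀ a, C ≤ q a)
    (hqc : ∀ a b, q ((1 / 2 : ℝ) • (a + b)) + c * ‖a - b‖ ^ 2 ≤ (q a + q b) / 2)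
    (hfin : ∃ a, A a ≠ ∞) :
    ∃ a, A a ≠ ∞ ∧ (∀ b, ((A a : ℝ≥0∞) : EReal) + (q a : ℝ) ≤ (A b : ℝ≥0∞) + (q b : ℝ)) ∧
      ∀ b, ((A b : ℝ≥0∞) : EReal) + (q b : ℝ) ≤ (A a : ℝ≥0∞) + (q a : ℝ) → b = a := by
  classical
  -- The finite values of the functional, and their infimum.
  let S : Set ℝ := {r | ∃ a, A a ≠ ∞ ∧ r = (A a).toReal + q a}
  have hSne : S.Nonempty := by
    obtain ⟨a, ha⟩ := hfin
    exact ⟨_, a, ha, rfl⟩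
  have hSb : BddBelow S := by
    refine ⟨C, ?_⟩
    rintro _ ⟨a, -, rfl⟩
    have := hqC a
    have h0 : 0 ≤ (A a).toReal := ENNReal.toReal_nonneg
    linarith
  set m := sInf S with hm
  have hle : ∀ a, A a ≠ ∞ → m ≤ (A a).toReal + q a := fun a ha => csInf_le hSb ⟨a, ha, rfl⟩
  -- Strong convexity bounds the distance of two almost minimizers.
  have hkey : ∀ a b, A a ≠ ∞ → A b ≠ ∞ →
      c * ‖a - b‖ ^ 2 ≤ ((A a).toReal + q a + ((A b).toReal + q b)) / 2 - m := by
    intro a b ha hb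
    have h1 := hAc a b
    have hfin' : (A a + A b) / 2 ≠ ∞ :=
      ENNReal.div_ne_top (ENNReal.add_ne_top.2 ⟨ha, hb⟩) (by norm_num)
    have h2 := hle ((1 / 2 : ℝ) • (a + b)) (ne_top_of_le_ne_top hfin' h1)
    have h3 := ENNReal.toReal_mono hfin' h1
    rw [ENNReal.toReal_div, ENNReal.toReal_add ha hb, ENNReal.toReal_ofNat] at h3
    have h4 := hqc a b
    linarith
  have hex : ∀ n : ℕ, ∃ a, A a ≠ ∞ ∧ (A a).toReal + q a < m + 1 / (n + 1) := by
    intro n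
    obtain ⟨_, ⟨a, ha, rfl⟩, h⟩ := exists_lt_of_csInf_lt hSne
      (show sInf S < m + 1 / ((n : ℝ) + 1) by rw [← hm]; have := @Nat.one_div_pos_of_nat ℝ _ _ _ n; linarith)
    exact ⟨a, ha, h⟩
  choose s hs1 hs2 using hex
  have hC : CauchySeq s := by
    refine cauchySeq_of_le_tendsto_0 (fun n : ℕ => Real.sqrt ((1 / ((n : ℝ) + 1)) / c)) ?_ ?_
    · intro n k N hn hk
      have h1 := hkey (s n) (s k) (hs1 n) (hs1 k)
      have h2 := hs2 n
      have h3 := hs2 k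
      have h4 : 1 / ((n : ℝ) + 1) ≤ 1 / ((N : ℝ) + 1) := Nat.one_div_le_one_div hn
      have h5 : 1 / ((k : ℝ) + 1) ≤ 1 / ((N : ℝ) + 1) := Nat.one_div_le_one_div hk
      rw [dist_eq_norm]
      apply Real.le_sqrt_of_sq_le
      rw [le_div_iff₀ hc]
      linarith
    · have h := (tendsto_one_div_add_atTop_nhds_zero_nat (𝕜 := ℝ)).div_const c
      have h' := (Real.continuous_sqrt.tendsto _).comp h
      simpa [Function.comp_def] using h'
  obtain ⟨a, ha⟩ := cauchySeq_tendsto_of_complete hC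
  have hA_le : A a ≤ ENNReal.ofReal (m - q a) := by
    refine le_of_forall_lt fun r hr => ?_
    have hr' : r ≠ ∞ := hr.ne_top
    obtain ⟨r', hr1, hr2⟩ := exists_between hr
    have hev := ha.eventually (hA a r' hr2)
    have hr2' : r' ≠ ∞ := hr2.ne_top
    have hlim : r'.toReal ≤ m - q a := by
      have hlim1 : Tendsto (fun n : ℕ => m + 1 / ((n : ℝ) + 1) - q (s n)) atTop
          (𝓝 (m + 0 - q a)) :=
        (tendsto_const_nhds.add (tendsto_one_div_add_atTop_nhds_zero_nat (𝕜 := ℝ))).sub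
          ((hq.tendsto a).comp ha)
      rw [add_zero] at hlim1
      refine ge_of_tendsto hlim1 ?_
      filter_upwards [hev] with n hn
      have h1 := ENNReal.toReal_mono (hs1 n) hn.le
      have h2 := hs2 n
      linarith
    calc r < r' := hr1
      _ = ENNReal.ofReal r'.toReal := (ENNReal.ofReal_toReal hr2').symm
      _ ≤ _ := ENNReal.ofReal_le_ofReal hlim
  have hAa : A a ≠ ∞ := ne_top_of_le_ne_top ENNReal.ofReal_ne_top hA_le
  have hma : (A a).toReal + q a ≤ m := by
    by_cases h : 0 ≤ m - q a
    · have := ENNReal.toReal_mono ENNReal.ofReal_ne_top hA_le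
      rw [ENNReal.toReal_ofReal h] at this
      linarith
    · push Not at h
      -- `q a = lim q (s n) ≤ m`, as `A ≥ 0`, so this case does not occur.
      have hlim1 : Tendsto (fun n : ℕ => m + 1 / ((n : ℝ) + 1) - q (s n)) atTop
          (𝓝 (m + 0 - q a)) :=
        (tendsto_const_nhds.add (tendsto_one_div_add_atTop_nhds_zero_nat (𝕜 := ℝ))).sub
          ((hq.tendsto a).comp ha)
      rw [add_zero] at hlim1
      have : 0 ≤ m - q a := by
        refine ge_of_tendsto' hlim1 fun n => ?_
        have h2 := hs2 n
        have h0 : 0 ≤ (A (s n)).toReal := ENNReal.toReal_nonneg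
        linarith
      linarith
  have hcoe : ∀ b, A b ≠ ∞ →
      ((A b : ℝ≥0∞) : EReal) + (q b : ℝ) = (((A b).toReal + q b : ℝ) : EReal) := by
    intro b hb
    rw [EReal.coe_add]
    congr 1
    exact (EReal.coe_ennreal_toReal hb).symm
  refine ⟨a, hAa, fun b => ?_, fun b hb => ?_⟩
  · by_cases hb : A b = ∞
    · rw [hb]; simp
    · rw [hcoe a hAa, hcoe b hb]
      exact_mod_cast hma.trans (hle b hb)
  · have hb' : A b ≠ ∞ := by
      rintro h
      rw [h, hcoe a hAa, EReal.coe_ennreal_top, EReal.top_add_coe] at hb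
      exact EReal.coe_ne_top _ (top_le_iff.1 hb)
    rw [hcoe a hAa, hcoe b hb'] at hb
    have hb2 : (A b).toReal + q b ≤ (A a).toReal + q a := by exact_mod_cast hb
    have h := hkey b a hb' hAa
    have h0 : c * ‖b - a‖ ^ 2 ≤ 0 := by linarith
    have h1 : ‖b - a‖ ^ 2 ≤ 0 := by nlinarith
    have h2 : ‖b - a‖ = 0 := by nlinarith [norm_nonneg (b - a)]
    exact sub_eq_zero.1 (norm_eq_zero.1 h2)

/-- The resolvent `J = (1 + ε ∂ℓ)⁻¹` and the Yosida approximation `f = (1 - J) / ε` of the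
subdifferential of a convex lower semicontinuous function `ℓ ≥ 0` with `ℓ 0 = 0`. -/
lemma exists_yosida (ℓ : V → ℝ≥0∞) (hl : LowerSemicontinuous ℓ)
    (hc : ∀ a b (s : ℝ), 0 ≤ s → s ≤ 1 →
      ℓ (s • a + (1 - s) • b) ≤ ENNReal.ofReal s * ℓ a + ENNReal.ofReal (1 - s) * ℓ b)
    (h0 : ℓ 0 = 0) {ε : ℝ} (hε : 0 < ε) :
    ∃ J f : V → V, (∀ z, z - J z = ε • f z) ∧ (∀ z, ℓ (J z) ≠ ∞) ∧
      (∀ z w, ℓ w ≠ ∞ → inner ℝ (f z) (w - J z) ≤ (ℓ w).toReal - (ℓ (J z)).toReal) ∧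
      f 0 = 0 ∧ ∀ z z', ‖f z - f z'‖ ≤ ε⁻¹ * ‖z - z'‖ := by
  have hex : ∀ z : V, ∃ a, ℓ a ≠ ∞ ∧ ∀ b, ((ℓ a : ℝ≥0∞) : EReal) + (‖a - z‖ ^ 2 / (2 * ε) : ℝ) ≤
      (ℓ b : ℝ≥0∞) + (‖b - z‖ ^ 2 / (2 * ε) : ℝ) := by
    intro z
    have hmid : ∀ a b, ℓ ((1 / 2 : ℝ) • (a + b)) ≤ (ℓ a + ℓ b) / 2 := by
      intro a b
      have h := hc a b (1 / 2) (by norm_num) (by norm_num)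
      rw [show (1 : ℝ) - 1 / 2 = 1 / 2 by norm_num, ← smul_add, ← mul_add] at h
      refine h.trans (le_of_eq ?_)
      rw [ENNReal.div_eq_inv_mul]
      congr 1
      rw [one_div, ENNReal.ofReal_inv_of_pos (by norm_num), ENNReal.ofReal_ofNat]
    have hq : ∀ a b : V, ‖(1 / 2 : ℝ) • (a + b) - z‖ ^ 2 / (2 * ε) + 1 / (8 * ε) * ‖a - b‖ ^ 2 ≤
        (‖a - z‖ ^ 2 / (2 * ε) + ‖b - z‖ ^ 2 / (2 * ε)) / 2 := by
      intro a b
      have h := norm_midpoint_sub_sq a b z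
      have h' : ‖(1 / 2 : ℝ) • (a + b) - z‖ ^ 2 =
        (‖a - z‖ ^ 2 + ‖b - z‖ ^ 2) / 2 - ‖a - b‖ ^ 2 / 4 := by linarith
      rw [h']
      apply le_of_eq
      field_simp
      ring
    obtain ⟨a, h1, h2, -⟩ := exists_unique_minimizer ℓ (fun a => ‖a - z‖ ^ 2 / (2 * ε))
      (1 / (8 * ε)) 0 (by positivity) hl hmid (by fun_prop) (fun a => by positivity) hq
      ⟨0, by simp [h0]⟩
    exact ⟨a, h1, h2⟩
  choose J hJ hmin using hex
  have hreal : ∀ z w, ℓ w ≠ ∞ → (ℓ (J z)).toReal + ‖J z - z‖ ^ 2 / (2 * ε) ≤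
      (ℓ w).toReal + ‖w - z‖ ^ 2 / (2 * ε) := by
    intro z w hw
    have h := hmin z w
    rw [← EReal.coe_ennreal_toReal hw, ← EReal.coe_ennreal_toReal (hJ z)] at h
    exact_mod_cast h
  let f : V → V := fun z => ε⁻¹ • (z - J z)
  have hf : ∀ z, z - J z = ε • f z := fun z => by simp [f, smul_smul, hε.ne']
  -- Comparison of the minimizer `J z` with the points of the segment towards `w`, divided by the
  -- length `s → 0` of the step.
  have hsub : ∀ z w, ℓ w ≠ ∞ →
      inner ℝ (f z) (w - J z) ≤ (ℓ w).toReal - (ℓ (J z)).toReal := by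
    intro z w hw
    have hs : ∀ s ∈ Ioo (0 : ℝ) 1, inner ℝ (f z) (w - J z) ≤
        (ℓ w).toReal - (ℓ (J z)).toReal + s * (‖w - J z‖ ^ 2 / (2 * ε)) := by
      rintro s ⟨hs0, hs1⟩
      have h1 := hc w (J z) s hs0.le hs1.le
      have hfin : ENNReal.ofReal s * ℓ w + ENNReal.ofReal (1 - s) * ℓ (J z) ≠ ∞ :=
        ENNReal.add_ne_top.2 ⟨ENNReal.mul_ne_top ENNReal.ofReal_ne_top hw,
          ENNReal.mul_ne_top ENNReal.ofReal_ne_top (hJ z)⟩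
      have h2 := hreal z _ (ne_top_of_le_ne_top hfin h1)
      have h3 := ENNReal.toReal_mono hfin h1
      rw [ENNReal.toReal_add (ENNReal.mul_ne_top ENNReal.ofReal_ne_top hw)
        (ENNReal.mul_ne_top ENNReal.ofReal_ne_top (hJ z)), ENNReal.toReal_mul,
        ENNReal.toReal_mul, ENNReal.toReal_ofReal hs0.le,
        ENNReal.toReal_ofReal (by linarith : 0 ≤ 1 - s)] at h3
      have h4 : s • w + (1 - s) • J z - z = s • (w - J z) - (z - J z) := by module
      rw [h4, norm_sub_rev (J z) z, hf z, norm_sub_sq_real (s • (w - J z)), norm_smul s,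
        real_inner_smul_left, inner_smul_right, real_inner_comm, Real.norm_of_nonneg hs0.le] at h2
      set I := inner ℝ (f z) (w - J z)
      set N := ‖ε • f z‖ ^ 2
      have h5 : ((s * ‖w - J z‖) ^ 2 - 2 * (s * (ε * I)) + N) / (2 * ε) =
        s * (s * (‖w - J z‖ ^ 2 / (2 * ε))) - s * I + N / (2 * ε) := by field_simp
      rw [h5] at h2
      have h6 : s * I ≤ s * ((ℓ w).toReal - (ℓ (J z)).toReal + s * (‖w - J z‖ ^ 2 / (2 * ε))) := by
        linarith
      exact le_of_mul_le_mul_left h6 hs0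
    have hlim : Tendsto (fun s : ℝ => (ℓ w).toReal - (ℓ (J z)).toReal +
        s * (‖w - J z‖ ^ 2 / (2 * ε))) (𝓝[>] 0) (𝓝 ((ℓ w).toReal - (ℓ (J z)).toReal +
        0 * (‖w - J z‖ ^ 2 / (2 * ε)))) :=
      (Continuous.tendsto (by fun_prop) 0).mono_left nhdsWithin_le_nhds
    rw [zero_mul, add_zero] at hlim
    refine ge_of_tendsto hlim ?_
    filter_upwards [Ioo_mem_nhdsGT (show (0 : ℝ) < 1 by norm_num)] with s h using hs s h
  -- The subgradient inequalities at `z` and `z'`, added.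
  have hmono : ∀ z z', 0 ≤ inner ℝ (f z - f z') (J z - J z') := by
    intro z z'
    have h1 := hsub z _ (hJ z')
    have h2 := hsub z' _ (hJ z)
    have h3 : inner ℝ (f z - f z') (J z - J z') =
        - inner ℝ (f z) (J z' - J z) - inner ℝ (f z') (J z - J z') := by
      rw [inner_sub_left, ← inner_neg_right, neg_sub]
    linarith
  refine ⟨J, f, hf, hJ, hsub, ?_, fun z z' => ?_⟩
  · have h1 := hsub 0 0 (by simp [h0])
    have h2 : (0 : V) - J 0 = ε • f 0 := hf 0
    rw [h2, inner_smul_right, real_inner_self_eq_norm_sq, h0] at h1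
    have h3 : 0 ≤ (ℓ (J 0)).toReal := ENNReal.toReal_nonneg
    have h4 : ‖f 0‖ ^ 2 ≤ 0 := by
      have : ε * ‖f 0‖ ^ 2 ≤ ε * 0 := by simp at h1 ⊢; linarith
      exact le_of_mul_le_mul_left this hε
    exact norm_eq_zero.1 (by nlinarith [norm_nonneg (f 0)])
  · have h1 : z - z' = (J z - J z') + ε • (f z - f z') := by
      rw [smul_sub, ← hf, ← hf]; abel
    have h2 : ε ^ 2 * ‖f z - f z'‖ ^ 2 ≤ ‖z - z'‖ ^ 2 := by
      rw [h1, norm_add_sq_real, inner_smul_right, real_inner_comm, norm_smul, mul_pow,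
        Real.norm_of_nonneg hε.le]
      nlinarith [hmono z z', sq_nonneg ‖J z - J z'‖, mul_nonneg hε.le (hmono z z')]
    rw [← mul_pow] at h2
    have h3 := le_of_sq_le_sq h2 (norm_nonneg _)
    rw [inv_mul_eq_div, le_div_iff₀ hε]
    linarith

end Hilbert

end

section

/-! ### The Dirichlet energy and the potential -/

section Energy

variable {d : ℕ} (O : Set (E d))

instance : Fact ((2 : ℝ≥0∞) ≠ ∞) := ⟨by norm_num⟩

instance : MeasurableSpace (L2 O) := borel _
instance : BorelSpace (L2 O) := ⟨rfl⟩
instance : MeasurableSpace (L2vec O) := borel _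
instance : BorelSpace (L2vec O) := ⟨rfl⟩

/-- The graph of the gradient on `H¹₀(O)` as a closed subspace. -/
def h10Submodule : Submodule ℝ (L2 O × L2vec O) :=
  Submodule.topologicalClosure
    { carrier := {p | ∃ f : E d → ℝ, ContDiff ℝ (⊤ : ℕ∞) f ∧ HasCompactSupport f ∧ tsupport f ⊆ O ∧
        p.1 =ᵐ[vol O] f ∧ p.2 =ᵐ[vol O] gradient f}
      add_mem' := by
        rintro p q ⟨f, hf, hfc, hfs, h1, h2⟩ ⟨g, hg, hgc, hgs, h3, h4⟩
        refine ⟨f + g, hf.add hg, hfc.add hgc,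
          (tsupport_add f g).trans (union_subset hfs hgs), ?_, ?_⟩
        · exact (Lp.coeFn_add p.1 q.1).trans (h1.add h3)
        · refine (Lp.coeFn_add p.2 q.2).trans ((h2.add h4).trans (Eventually.of_forall fun ξ => ?_))
          have hd : fderiv ℝ (f + g) ξ = fderiv ℝ f ξ + fderiv ℝ g ξ :=
            fderiv_add (hf.differentiable (by simp) ξ) (hg.differentiable (by simp) ξ)
          simp [gradient, hd]
      zero_mem' := by
        refine ⟨0, contDiff_const, HasCompactSupport.zero, by simp, Lp.coeFn_zero _ _ _,
          (Lp.coeFn_zero _ _ _).trans (Eventually.of_forall fun ξ => ?_)⟩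
        simp [gradient, show (0 : E d → ℝ) = fun _ => 0 from rfl]
      smul_mem' := by
        rintro c p ⟨f, hf, hfc, hfs, h1, h2⟩
        refine ⟨c • f, contDiff_const.smul hf, hfc.smul_left, ?_, ?_, ?_⟩
        · exact (closure_mono (Function.support_const_smul_subset c f)).trans hfs
        · exact (Lp.coeFn_smul c p.1).trans (h1.const_smul c)
        · refine (Lp.coeFn_smul c p.2).trans
            ((h2.const_smul c).trans (Eventually.of_forall fun ξ => ?_))
          have hd : fderiv ℝ (c • f) ξ = c • fderiv ℝ f ξ :=
            fderiv_const_smul (hf.differentiable (by simp) ξ) c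
          simp [gradient, hd] }

lemma mem_h10Submodule {p : L2 O × L2vec O} : p ∈ h10Submodule O ↔ p ∈ h10Graph O := Iff.rfl

lemma isClosed_h10Graph : IsClosed (h10Graph O) := isClosed_closure

lemma dirichletEnergy_le {z : L2 O} {g : L2vec O} (h : (z, g) ∈ h10Graph O) :
    dirichletEnergy O z ≤ ENNReal.ofReal (1 / 2 * ‖g‖ ^ 2) :=
  iInf₂_le g h

/-- A sublevel set of the Dirichlet energy is closed, and the infimum in the definition of the
energy is attained. -/
lemma exists_gradient_of_frequently {z : L2 O} {r : ℝ}
    (h : ∀ ε > 0, ∃ z', ‖z' - z‖ < ε ∧ dirichletEnergy O z' ≤ ENNReal.ofReal r) :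
    ∃ g, (z, g) ∈ h10Graph O ∧ ENNReal.ofReal (1 / 2 * ‖g‖ ^ 2) ≤ ENNReal.ofReal r := by
  wlog hr : 0 ≤ r generalizing r
  · have hr0 : ENNReal.ofReal r = ENNReal.ofReal 0 := by
      rw [ENNReal.ofReal_zero, ENNReal.ofReal_of_nonpos (le_of_not_ge hr)]
    rw [hr0] at h ⊢
    exact this h le_rfl
  -- Pairs in the graph that are near `z` and have nearly the right energy: closed, convex, bounded.
  let K : ℕ → Set (WithLp 2 (L2 O × L2vec O)) := fun n =>
    {p | (p.fst, p.snd) ∈ h10Graph O} ∩ {p | ‖p.fst - z‖ ≤ 1 / ((n : ℝ) + 1)} ∩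
      {p | ‖p.snd‖ ≤ Real.sqrt (2 * (r + 1 / ((n : ℝ) + 1)))}
  have hfst : Continuous fun p : WithLp 2 (L2 O × L2vec O) => p.fst :=
    continuous_fst.comp (WithLp.prod_continuous_ofLp 2 _ _)
  have hsnd : Continuous fun p : WithLp 2 (L2 O × L2vec O) => p.snd :=
    continuous_snd.comp (WithLp.prod_continuous_ofLp 2 _ _)
  have hanti : Antitone K := by
    intro n m hnm p hp
    have hle : 1 / ((m : ℝ) + 1) ≤ 1 / ((n : ℝ) + 1) := Nat.one_div_le_one_div hnm
    exact ⟨⟨hp.1.1, hp.1.2.trans hle⟩, hp.2.trans (Real.sqrt_le_sqrt (by linarith))⟩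
  have hKcl : ∀ n, IsClosed (K n) := by
    intro n
    refine (((isClosed_h10Graph O).preimage (hfst.prodMk hsnd)).inter
      (isClosed_le ?_ continuous_const)).inter (isClosed_le ?_ continuous_const)
    · exact (hfst.sub continuous_const).norm
    · exact hsnd.norm
  have hKcv : ∀ n, Convex ℝ (K n) := by
    intro n
    refine Convex.inter (Convex.inter ?_ ?_) ?_
    · intro p hp q hq a b _ _ _
      exact (h10Submodule O).add_mem ((h10Submodule O).smul_mem a hp)
        ((h10Submodule O).smul_mem b hq)
    · intro p hp q hq a b ha hb hab
      have := (convex_closedBall z (1 / ((n : ℝ) + 1))) (mem_closedBall_iff_norm.2 hp)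
        (mem_closedBall_iff_norm.2 hq) ha hb hab
      exact mem_closedBall_iff_norm.1 this
    · intro p hp q hq a b ha hb hab
      have := (convex_closedBall (0 : L2vec O) (Real.sqrt (2 * (r + 1 / ((n : ℝ) + 1)))))
        (mem_closedBall_zero_iff.2 hp) (mem_closedBall_zero_iff.2 hq) ha hb hab
      exact mem_closedBall_zero_iff.1 this
  have hKB : ∀ n, ∃ v ∈ K n, ‖v‖ ≤ ‖z‖ + 1 + Real.sqrt (2 * (r + 1)) := by
    intro n
    have hn : 0 < 1 / ((n : ℝ) + 1) := Nat.one_div_pos_of_nat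
    have hn1 : 1 / ((n : ℝ) + 1) ≤ 1 := by
      rw [div_le_one (by positivity)]; linarith [(Nat.cast_nonneg n : (0 : ℝ) ≤ n)]
    obtain ⟨z', hz', hE⟩ := h _ hn
    have hlt : dirichletEnergy O z' < ENNReal.ofReal (r + 1 / ((n : ℝ) + 1)) :=
      hE.trans_lt ((ENNReal.ofReal_lt_ofReal_iff (by linarith)).2 (by linarith))
    simp only [dirichletEnergy, iInf_lt_iff] at hlt
    obtain ⟨g, hg, hlt⟩ := hlt
    have h1 := (ENNReal.ofReal_lt_ofReal_iff (by linarith)).1 hlt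
    have h2 : ‖g‖ ≤ Real.sqrt (2 * (r + 1 / ((n : ℝ) + 1))) :=
      Real.le_sqrt_of_sq_le (by linarith)
    refine ⟨WithLp.toLp 2 (z', g), ⟨⟨hg, hz'.le⟩, h2⟩, ?_⟩
    have h3 : ‖WithLp.toLp 2 (z', g)‖ ≤ ‖z'‖ + ‖g‖ := by
      rw [WithLp.prod_norm_eq_of_L2]
      exact Real.sqrt_le_iff.2 ⟨by positivity, by simp; nlinarith [norm_nonneg z', norm_nonneg g]⟩
    have h4 : ‖z'‖ ≤ ‖z‖ + 1 := by
      calc ‖z'‖ = ‖z + (z' - z)‖ := by congr 1; abel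
        _ ≤ ‖z‖ + ‖z' - z‖ := norm_add_le _ _
        _ ≤ _ := by linarith
    have h5 : Real.sqrt (2 * (r + 1 / ((n : ℝ) + 1))) ≤ Real.sqrt (2 * (r + 1)) :=
      Real.sqrt_le_sqrt (by linarith)
    linarith
  obtain ⟨p, hp⟩ := nonempty_iInter_of_convex_closed K hanti hKcl hKcv _ hKB
  rw [mem_iInter] at hp
  have h1 : p.fst = z := by
    rw [← sub_eq_zero, ← norm_le_zero_iff]
    exact ge_of_tendsto' (tendsto_one_div_add_atTop_nhds_zero_nat (𝕜 := ℝ)) fun n => (hp n).1.2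
  have h2 : ‖p.snd‖ ≤ Real.sqrt (2 * (r + 0)) := by
    refine ge_of_tendsto' ((Real.continuous_sqrt.tendsto _).comp
      ((tendsto_const_nhds.add (tendsto_one_div_add_atTop_nhds_zero_nat (𝕜 := ℝ))).const_mul 2))
      fun n => (hp n).2
  refine ⟨p.snd, h1 ▸ (hp 0).1.1, ENNReal.ofReal_le_ofReal ?_⟩
  have h3 := Real.sq_sqrt (show 0 ≤ 2 * (r + 0) by linarith)
  nlinarith [norm_nonneg p.snd, Real.sqrt_nonneg (2 * (r + 0))]

lemma exists_gradient {z : L2 O} (h : dirichletEnergy O z ≠ ∞) :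
    ∃ g, (z, g) ∈ h10Graph O ∧ ENNReal.ofReal (1 / 2 * ‖g‖ ^ 2) = dirichletEnergy O z := by
  obtain ⟨g, hg, h1⟩ := exists_gradient_of_frequently O (z := z) (r := (dirichletEnergy O z).toReal)
    fun ε hε => ⟨z, by simpa using hε, (ENNReal.ofReal_toReal h).ge⟩
  rw [ENNReal.ofReal_toReal h] at h1
  exact ⟨g, hg, h1.antisymm (iInf₂_le g hg)⟩

lemma lowerSemicontinuous_dirichletEnergy : LowerSemicontinuous (dirichletEnergy O) := by
  rw [lowerSemicontinuous_iff_isClosed_preimage]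
  intro r
  by_cases hr : r = ∞
  · simp [hr]
  · rw [← closure_subset_iff_isClosed]
    intro z hz
    rw [Metric.mem_closure_iff] at hz
    obtain ⟨g, hg, h⟩ := exists_gradient_of_frequently O (z := z) (r := r.toReal) fun ε hε => by
      obtain ⟨z', h1, h2⟩ := hz ε hε
      refine ⟨z', ?_, ?_⟩
      · rwa [← dist_eq_norm, dist_comm]
      · rwa [ENNReal.ofReal_toReal hr]
    rw [ENNReal.ofReal_toReal hr] at h
    exact (dirichletEnergy_le O hg).trans h

/-- The Dirichlet energy is convex: a convex combination of gradients is a gradient of the convex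
combination. -/
lemma dirichletEnergy_convex (a b : L2 O) (s : ℝ) (hs0 : 0 ≤ s) (hs1 : s ≤ 1) :
    dirichletEnergy O (s • a + (1 - s) • b) ≤
      ENNReal.ofReal s * dirichletEnergy O a + ENNReal.ofReal (1 - s) * dirichletEnergy O b := by
  rcases eq_or_lt_of_le hs0 with rfl | hs0
  · simp
  rcases eq_or_lt_of_le hs1 with rfl | hs1
  · simp
  by_cases ha : dirichletEnergy O a = ∞
  · rw [ha, ENNReal.mul_top (by simpa using hs0)]; simp
  by_cases hb : dirichletEnergy O b = ∞
  · rw [hb, ENNReal.mul_top (by simpa using hs1)]; simp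
  obtain ⟨g, hg, hga⟩ := exists_gradient O ha
  obtain ⟨k, hk, hkb⟩ := exists_gradient O hb
  have hmem : (s • a + (1 - s) • b, s • g + (1 - s) • k) ∈ h10Graph O :=
    (h10Submodule O).add_mem ((h10Submodule O).smul_mem s hg) ((h10Submodule O).smul_mem (1 - s) hk)
  refine (dirichletEnergy_le O hmem).trans ?_
  rw [← hga, ← hkb, ← ENNReal.ofReal_mul hs0.le, ← ENNReal.ofReal_mul (by linarith),
    ← ENNReal.ofReal_add (by positivity) (mul_nonneg (by linarith) (by positivity))]
  refine ENNReal.ofReal_le_ofReal ?_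
  have h1 : ‖s • g + (1 - s) • k‖ ≤ s * ‖g‖ + (1 - s) * ‖k‖ := by
    refine (norm_add_le _ _).trans (le_of_eq ?_)
    rw [norm_smul, norm_smul, Real.norm_of_nonneg hs0.le, Real.norm_of_nonneg (by linarith)]
  have h2 : ‖s • g + (1 - s) • k‖ ^ 2 ≤ (s * ‖g‖ + (1 - s) * ‖k‖) ^ 2 := by gcongr
  nlinarith [mul_nonneg (mul_nonneg hs0.le (by linarith : (0 : ℝ) ≤ 1 - s)) (sq_nonneg (‖g‖ - ‖k‖))]

lemma dirichletEnergy_zero : dirichletEnergy O 0 = 0 := by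
  refine le_antisymm ((iInf₂_le (0 : L2vec O) (h10Submodule O).zero_mem).trans ?_) zero_le
  simp

lemma mem_cone_iff {z : L2 O} : z ∈ cone O ↔ 0 ≤ z := Lp.coeFn_nonneg z

lemma isClosed_cone : IsClosed (cone O) := by
  have : cone O = Ici 0 := by ext z; exact mem_cone_iff O
  rw [this]
  exact isClosed_Ici

lemma indK_convex (a b : L2 O) (s : ℝ) (hs0 : 0 ≤ s) (hs1 : s ≤ 1) :
    indK O (s • a + (1 - s) • b) ≤
      ENNReal.ofReal s * indK O a + ENNReal.ofReal (1 - s) * indK O b := by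
  rcases eq_or_lt_of_le hs0 with rfl | hs0
  · simp
  rcases eq_or_lt_of_le hs1 with rfl | hs1
  · simp
  by_cases ha : a ∈ cone O
  · by_cases hb : b ∈ cone O
    · have : s • a + (1 - s) • b ∈ cone O := by
        rw [mem_cone_iff] at ha hb ⊢
        rw [← Lp.coeFn_nonneg] at ha hb ⊢
        filter_upwards [ha, hb, Lp.coeFn_add (s • a) ((1 - s) • b), Lp.coeFn_smul s a,
          Lp.coeFn_smul (1 - s) b] with ξ h1 h2 h3 h4 h5
        rw [h3, Pi.add_apply, h4, h5]
        simp only [Pi.zero_apply, Pi.smul_apply, smul_eq_mul] at h1 h2 ⊢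
        exact add_nonneg (mul_nonneg hs0.le h1) (mul_nonneg (by linarith) h2)
      simp [indK, this]
    · rw [show indK O b = ∞ by simp [indK, hb], ENNReal.mul_top (by simpa using hs1)]; simp
  · rw [show indK O a = ∞ by simp [indK, ha], ENNReal.mul_top (by simpa using hs0)]; simp

lemma lowerSemicontinuous_indK : LowerSemicontinuous (indK O) := by
  intro z r hr
  by_cases hz : z ∈ cone O
  · simp [indK, hz] at hr
  · filter_upwards [(isClosed_cone O).isOpen_compl.mem_nhds hz] with w hw
    have hw' : w ∉ cone O := hw
    have h1 : indK O z = ∞ := by simp [indK, hz]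
    have h2 : indK O w = ∞ := by simp [indK, hw']
    rwa [h1, ← h2] at hr

lemma lowerSemicontinuous_phi : LowerSemicontinuous (phi O) :=
  (lowerSemicontinuous_dirichletEnergy O).add (lowerSemicontinuous_indK O)

lemma measurable_phi : Measurable (phi O) := (lowerSemicontinuous_phi O).measurable

lemma phi_convex (a b : L2 O) (s : ℝ) (hs0 : 0 ≤ s) (hs1 : s ≤ 1) :
    phi O (s • a + (1 - s) • b) ≤ ENNReal.ofReal s * phi O a + ENNReal.ofReal (1 - s) * phi O b := by
  refine (add_le_add (dirichletEnergy_convex O a b s hs0 hs1) (indK_convex O a b s hs0 hs1)).trans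
    (le_of_eq ?_)
  simp only [phi]
  ring

lemma phi_zero : phi O 0 = 0 := by
  have h : (0 : L2 O) ∈ cone O := by rw [mem_cone_iff]
  simp [phi, dirichletEnergy_zero, indK, h]

lemma mem_cone_of_phi_ne_top {z : L2 O} (h : phi O z ≠ ∞) : z ∈ cone O := by
  by_contra hz
  exact h (by simp [phi, indK, hz])

/-- The gradient of `H¹₀` functions has a Borel measurable selection: on the orthogonal complement
of the kernel, the projection of the graph to `L²(O)` is injective, and so it is a measurable
embedding. -/
lemma exists_measurable_gradient : ∃ G : L2 O → L2vec O, Measurable G ∧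
    ∀ z, dirichletEnergy O z ≠ ∞ → (z, G z) ∈ h10Graph O ∧
      ENNReal.ofReal (1 / 2 * ‖G z‖ ^ 2) ≤ dirichletEnergy O z := by
  let 𝒢 : Submodule ℝ (WithLp 2 (L2 O × L2vec O)) :=
    (h10Submodule O).comap (WithLp.linearEquiv 2 ℝ (L2 O × L2vec O)).toLinearMap
  have hcl : IsClosed (𝒢 : Set (WithLp 2 (L2 O × L2vec O))) :=
    (isClosed_h10Graph O).preimage (WithLp.prod_continuous_ofLp 2 _ _)
  have hfst : Continuous fun p : WithLp 2 (L2 O × L2vec O) => p.fst :=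
    continuous_fst.comp (WithLp.prod_continuous_ofLp 2 _ _)
  have hsnd : Continuous fun p : WithLp 2 (L2 O × L2vec O) => p.snd :=
    continuous_snd.comp (WithLp.prod_continuous_ofLp 2 _ _)
  -- Pairs in the graph whose gradient is orthogonal to all gradients of zero.
  let S : Set (WithLp 2 (L2 O × L2vec O)) :=
    {p | p ∈ 𝒢 ∧ ∀ k, ((0 : L2 O), k) ∈ h10Graph O → inner ℝ p.snd k = 0}
  have hS : IsClosed S := by
    refine hcl.inter ?_
    have h : {p : WithLp 2 (L2 O × L2vec O) | ∀ k, ((0 : L2 O), k) ∈ h10Graph O →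
        inner ℝ p.snd k = 0} = ⋂ k ∈ {k | ((0 : L2 O), k) ∈ h10Graph O},
          {p : WithLp 2 (L2 O × L2vec O) | inner ℝ p.snd k = 0} := by
      ext p; simp
    change IsClosed {p : WithLp 2 (L2 O × L2vec O) | ∀ k, ((0 : L2 O), k) ∈ h10Graph O →
      inner ℝ p.snd k = 0}
    rw [h]
    exact isClosed_biInter fun k _ => isClosed_eq (hsnd.inner continuous_const) continuous_const
  -- If two pairs of `S` have the same function, the difference of their gradients is a gradient of
  -- zero, to which it is also orthogonal.
  have hinj : Function.Injective fun p : S => p.1.fst := by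
    rintro ⟨p, hp1, hp2⟩ ⟨q, hq1, hq2⟩ h
    simp only at h
    have hmem : ((0 : L2 O), p.snd - q.snd) ∈ h10Graph O := by
      have := (h10Submodule O).sub_mem hp1 hq1
      rw [mem_h10Submodule] at this
      convert! this using 1
      exact Prod.ext (sub_eq_zero.2 h).symm rfl
    have h1 := hp2 _ hmem
    have h2 := hq2 _ hmem
    have h3 : inner ℝ (p.snd - q.snd) (p.snd - q.snd) = 0 := by rw [inner_sub_left, h1, h2, sub_zero]
    have h4 : p.snd = q.snd := sub_eq_zero.1 (inner_self_eq_zero.1 h3)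
    ext1
    exact (WithLp.ofLp_injective 2) (Prod.ext h h4)
  have : SecondCountableTopology (L2 O) := Lp.SecondCountableTopology
  have : SecondCountableTopology (L2vec O) := Lp.SecondCountableTopology
  have : SecondCountableTopology (WithLp 2 (L2 O × L2vec O)) :=
    (WithLp.homeomorphProd 2 (L2 O) (L2vec O)).secondCountableTopology
  have : PolishSpace S := hS.polishSpace
  let : MeasurableSpace S := borel _
  have : BorelSpace S := ⟨rfl⟩
  have hemb : MeasurableEmbedding fun p : S => p.1.fst :=
    Continuous.measurableEmbedding (hfst.comp continuous_subtype_val) hinj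
  obtain ⟨G, hG, hGS⟩ := hemb.exists_measurable_extend (g := fun p : S => p.1.snd)
    (hsnd.comp continuous_subtype_val).measurable fun _ => ⟨0⟩
  refine ⟨G, hG, fun z hz => ?_⟩
  obtain ⟨g, hg, hge⟩ := exists_gradient O hz
  -- Subtract from `g` its projection to the gradients of zero.
  let N : Submodule ℝ (L2vec O) := (h10Submodule O).comap (LinearMap.inr ℝ (L2 O) (L2vec O))
  have hN : IsClosed (N : Set (L2vec O)) :=
    (isClosed_h10Graph O).preimage (continuous_const.prodMk continuous_id)
  have : CompleteSpace N := hN.completeSpace_coe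
  have hgN : g - N.starProjection g ∈ Nᗮ := N.sub_starProjection_mem_orthogonal g
  have hmem : (z, g - N.starProjection g) ∈ h10Graph O := by
    have h1 : ((0 : L2 O), N.starProjection g) ∈ h10Submodule O := N.starProjection_apply_mem g
    have := (h10Submodule O).sub_mem hg h1
    rw [mem_h10Submodule] at this
    simpa using this
  have hGz : G z = g - N.starProjection g := by
    have hpS : WithLp.toLp 2 (z, g - N.starProjection g) ∈ S := by
      refine ⟨hmem, fun k hk => ?_⟩
      rw [real_inner_comm]
      exact hgN k hk
    exact congrFun hGS ⟨_, hpS⟩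
  rw [hGz]
  refine ⟨hmem, ?_⟩
  rw [← hge]
  refine ENNReal.ofReal_le_ofReal ?_
  have h2 : ‖g‖ ^ 2 = ‖g - N.starProjection g‖ ^ 2 + ‖N.starProjection g‖ ^ 2 := by
    have h3 : g = (g - N.starProjection g) + N.starProjection g := by abel
    conv_lhs => rw [h3, norm_add_sq_real]
    rw [show inner ℝ (g - N.starProjection g) (N.starProjection g) = 0 from by
      rw [real_inner_comm]; exact hgN _ (N.starProjection_apply_mem g)]
    ring
  nlinarith [sq_nonneg ‖N.starProjection g‖]

end Energy

/-! ### The conjugate function -/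

section Conjugate

variable {d : ℕ} (O : Set (E d)) (δ : ℝ)

lemma toENNReal_psiStar (v : L2 O) : (psiStar O δ v).toENNReal =
    ⨆ (z : L2 O) (_ : psi O δ z ≠ ∞), ENNReal.ofReal (inner ℝ v z - (psi O δ z).toReal) := by
  have hle : ∀ c : ℝ≥0∞, (psiStar O δ v).toENNReal ≤ c ↔
      ∀ z, psi O δ z ≠ ∞ → ENNReal.ofReal (inner ℝ v z - (psi O δ z).toReal) ≤ c := by
    intro c
    have h1 : (psiStar O δ v).toENNReal ≤ c ↔ psiStar O δ v ≤ (c : EReal) := by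
      constructor
      · intro h
        have h0 : psiStar O δ v ≤ ((psiStar O δ v).toENNReal : EReal) := by
          rw [EReal.coe_toENNReal_eq_max]; exact le_max_right _ _
        exact h0.trans (by exact_mod_cast h)
      · intro h
        simpa using EReal.toENNReal_le_toENNReal h
    rw [h1, psiStar, iSup_le_iff]
    refine forall_congr' fun z => ?_
    by_cases hz : psi O δ z = ∞
    · simp [hz]
    · rw [← EReal.coe_ennreal_toReal hz, ← EReal.coe_sub]
      simp only [ne_eq, hz, not_false_eq_true, forall_const]
      constructor
      · intro h
        have := EReal.toENNReal_le_toENNReal h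
        rwa [EReal.real_coe_toENNReal, EReal.toENNReal_coe] at this
      · intro h
        calc ((inner ℝ v z - (psi O δ z).toReal : ℝ) : EReal)
            ≤ ((ENNReal.ofReal (inner ℝ v z - (psi O δ z).toReal) : ℝ≥0∞) : EReal) := by
              rw [EReal.coe_ennreal_ofReal]
              exact_mod_cast le_max_left _ _
          _ ≤ _ := by exact_mod_cast h
  refine eq_of_forall_ge_iff fun c => ?_
  rw [hle, iSup₂_le_iff]

lemma lowerSemicontinuous_psiStar :
    LowerSemicontinuous fun v : L2 O => (psiStar O δ v).toENNReal := by
  simp_rw [toENNReal_psiStar]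
  refine lowerSemicontinuous_iSup fun z => lowerSemicontinuous_iSup fun _ => ?_
  refine Continuous.lowerSemicontinuous (ENNReal.continuous_ofReal.comp ?_)
  fun_prop

lemma measurable_psiStar : Measurable fun v : L2 O => (psiStar O δ v).toENNReal :=
  (lowerSemicontinuous_psiStar O δ).measurable

lemma psiStar_convex (a b : L2 O) {s t : ℝ} (hs : 0 ≤ s) (ht : 0 ≤ t) (hst : s + t = 1) :
    (psiStar O δ (s • a + t • b)).toENNReal ≤
      ENNReal.ofReal s * (psiStar O δ a).toENNReal + ENNReal.ofReal t * (psiStar O δ b).toENNReal := by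
  rw [toENNReal_psiStar]
  refine iSup₂_le fun z hz => ?_
  have ha : ENNReal.ofReal (inner ℝ a z - (psi O δ z).toReal) ≤ (psiStar O δ a).toENNReal := by
    rw [toENNReal_psiStar]; exact le_iSup₂_of_le z hz le_rfl
  have hb : ENNReal.ofReal (inner ℝ b z - (psi O δ z).toReal) ≤ (psiStar O δ b).toENNReal := by
    rw [toENNReal_psiStar]; exact le_iSup₂_of_le z hz le_rfl
  have h2 : inner ℝ (s • a + t • b) z - (psi O δ z).toReal =
      s * (inner ℝ a z - (psi O δ z).toReal) + t * (inner ℝ b z - (psi O δ z).toReal) := by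
    rw [inner_add_left, real_inner_smul_left, real_inner_smul_left]
    linear_combination (psi O δ z).toReal * hst
  rw [h2]
  refine ENNReal.ofReal_add_le.trans ?_
  rw [ENNReal.ofReal_mul hs, ENNReal.ofReal_mul ht]
  gcongr

lemma psiStar_le {v : L2 O} {r : ℝ}
    (h : ∀ z, phi O z ≠ ∞ → inner ℝ v z - ((phi O z).toReal + δ / 2 * ‖z‖ ^ 2) ≤ r) (hδ : 0 ≤ δ) :
    (psiStar O δ v).toENNReal ≤ ENNReal.ofReal r := by
  rw [toENNReal_psiStar]
  refine iSup₂_le fun z hz => ENNReal.ofReal_le_ofReal ?_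
  have hz' : phi O z ≠ ∞ := (ENNReal.add_ne_top.1 hz).1
  have := h z hz'
  rwa [psi, ENNReal.toReal_add hz' ENNReal.ofReal_ne_top, ENNReal.toReal_ofReal (by positivity)]

end Conjugate

end

section

/-! ### Representatives and multipliers -/

section Representatives

variable {d : ℕ} (O : Set (E d))

open Classical in
/-- The class in `L²(O)` of a function, and `0` if the function is not square integrable. -/
def toL2 (g : E d → ℝ) : L2 O := if h : MemLp g 2 (vol O) then h.toLp g else 0

lemma toL2_ae {g : E d → ℝ} (h : MemLp g 2 (vol O)) : toL2 O g =ᵐ[vol O] g := by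
  rw [toL2, dif_pos h]; exact h.coeFn_toLp

lemma toL2_congr {f g : E d → ℝ} (h : f =ᵐ[vol O] g) : toL2 O f = toL2 O g := by
  by_cases hf : MemLp f 2 (vol O)
  · have hg := (memLp_congr_ae h).1 hf
    exact Lp.ext ((toL2_ae O hf).trans (h.trans (toL2_ae O hg).symm))
  · have hg := fun hg => hf ((memLp_congr_ae h).2 hg)
    rw [toL2, toL2, dif_neg hf, dif_neg hg]

lemma toL2_coe (z : L2 O) : toL2 O z = z := Lp.ext (toL2_ae O (Lp.memLp z))

lemma mul_eq_toL2 (m : E d → ℝ) (z : L2 O) : mul O m z = toL2 O fun ξ => m ξ * z ξ := rfl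

/-- Elements of `L²(O)` have representatives that depend on the element in a jointly measurable
way. -/
lemma exists_measurable_representative : ∃ ρ : L2 O → E d → ℝ,
    Measurable (Function.uncurry ρ) ∧ ∀ z, ρ z =ᵐ[vol O] z := by
  classical
  -- Approximation of `z` within `4⁻ⁿ` by an element of a countable dense set that depends measurably
  -- on `z`; the representatives of the approximations converge almost everywhere.
  have hdense : ∀ (n : ℕ) (z : L2 O), ∃ k, ‖z - TopologicalSpace.denseSeq (L2 O) k‖ < (1 / 4) ^ n := by
    intro n z
    obtain ⟨k, hk⟩ := (TopologicalSpace.denseRange_denseSeq (L2 O)).exists_dist_lt z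
      (show (0 : ℝ) < (1 / 4) ^ n by positivity)
    exact ⟨k, by rwa [← dist_eq_norm]⟩
  let N : ℕ → L2 O → ℕ := fun n z => Nat.find (hdense n z)
  have hN : ∀ n, Measurable (N n) := fun n =>
    measurable_find (hdense n) fun k => measurableSet_lt (by fun_prop) measurable_const
  let g : ℕ → L2 O → E d → ℝ := fun n z => TopologicalSpace.denseSeq (L2 O) (N n z)
  have hg : ∀ n, Measurable (Function.uncurry (g n)) := by
    intro n
    have h1 : Measurable fun p : ℕ × E d => (TopologicalSpace.denseSeq (L2 O) p.1 : E d → ℝ) p.2 :=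
      measurable_from_prod_countable_right fun k =>
        (Lp.stronglyMeasurable (TopologicalSpace.denseSeq (L2 O) k)).measurable
    exact h1.comp (((hN n).comp measurable_fst).prodMk measurable_snd)
  have hdist : ∀ n (z : L2 O), eLpNorm (g n z - (z : E d → ℝ)) 2 (vol O) ≤ ENNReal.ofReal ((1 / 4) ^ n) := by
    intro n z
    have h1 : ‖z - TopologicalSpace.denseSeq (L2 O) (N n z)‖ < (1 / 4) ^ n := Nat.find_spec (hdense n z)
    rw [norm_sub_rev, Lp.norm_def] at h1
    have h2 : eLpNorm (g n z - (z : E d → ℝ)) 2 (vol O) =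
        eLpNorm (TopologicalSpace.denseSeq (L2 O) (N n z) - z : L2 O) 2 (vol O) :=
      eLpNorm_congr_ae (Lp.coeFn_sub _ _).symm
    rw [h2, ← ENNReal.ofReal_toReal (Lp.eLpNorm_ne_top _)]
    exact ENNReal.ofReal_le_ofReal h1.le
  refine ⟨fun z ξ => limUnder atTop fun n => g n z ξ, ?_, fun z => ?_⟩
  · exact (StronglyMeasurable.limUnder (f := fun n => Function.uncurry (g n))
      fun n => (hg n).stronglyMeasurable).measurable
  · have hconv : ∀ᵐ ξ ∂(vol O), ∃ l, Tendsto (fun n => g n z ξ) atTop (𝓝 l) := by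
      refine Lp.ae_tendsto_of_cauchy_eLpNorm (p := 2) (f := fun n => g n z)
        (B := fun n => ENNReal.ofReal (4 * (1 / 4) ^ n))
        (fun n => (Lp.aestronglyMeasurable _)) (by norm_num) ?_ ?_
      · have hs : Summable fun n : ℕ => 4 * (1 / 4 : ℝ) ^ n :=
          (summable_geometric_of_lt_one (by norm_num) (by norm_num)).mul_left 4
        rw [← ENNReal.ofReal_tsum_of_nonneg (fun n => by positivity) hs]
        exact ENNReal.ofReal_ne_top
      · intro M n m hn hm
        have h1 : g n z - g m z = (g n z - (z : E d → ℝ)) - (g m z - (z : E d → ℝ)) := by abel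
        have hmeas : ∀ n, AEStronglyMeasurable (g n z - (z : E d → ℝ)) (vol O) := fun n =>
          (Lp.aestronglyMeasurable _).sub (Lp.aestronglyMeasurable _)
        calc eLpNorm (g n z - g m z) 2 (vol O)
            ≤ eLpNorm (g n z - (z : E d → ℝ)) 2 (vol O) + eLpNorm (g m z - (z : E d → ℝ)) 2 (vol O) := by
              rw [h1]; exact eLpNorm_sub_le (hmeas n) (hmeas m) (by norm_num)
          _ ≤ ENNReal.ofReal ((1 / 4) ^ M) + ENNReal.ofReal ((1 / 4) ^ M) := by
              refine add_le_add ((hdist n z).trans ?_) ((hdist m z).trans ?_)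
              · exact ENNReal.ofReal_le_ofReal
                  (pow_le_pow_of_le_one (by norm_num) (by norm_num) hn)
              · exact ENNReal.ofReal_le_ofReal
                  (pow_le_pow_of_le_one (by norm_num) (by norm_num) hm)
          _ < _ := by
              rw [← ENNReal.ofReal_add (by positivity) (by positivity)]
              have : (0 : ℝ) < (1 / 4) ^ M := by positivity
              exact (ENNReal.ofReal_lt_ofReal_iff (by positivity)).2 (by linarith)
    have hmeas : TendstoInMeasure (vol O) (fun n => g n z) atTop z := by
      refine tendstoInMeasure_of_tendsto_eLpNorm (p := 2) (by norm_num)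
        (fun n => Lp.aestronglyMeasurable _) (Lp.aestronglyMeasurable _) ?_
      refine tendsto_of_tendsto_of_tendsto_of_le_of_le tendsto_const_nhds ?_ (fun _ => zero_le)
        (fun n => hdist n z)
      rw [← ENNReal.ofReal_zero]
      exact ENNReal.tendsto_ofReal (tendsto_pow_atTop_nhds_zero_of_lt_one (by norm_num) (by norm_num))
    obtain ⟨ns, hns, hlim⟩ := hmeas.exists_seq_tendsto_ae
    filter_upwards [hconv, hlim] with ξ ⟨l, hl⟩ h2
    rw [hl.limUnder_eq]
    exact tendsto_nhds_unique (hl.comp hns.tendsto_atTop) h2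

/-- A jointly measurable choice of representatives of the elements of `L²(O)`. -/
def rep : L2 O → E d → ℝ := (exists_measurable_representative O).choose

lemma measurable_rep : Measurable (Function.uncurry (rep O)) :=
  (exists_measurable_representative O).choose_spec.1

lemma rep_ae (z : L2 O) : rep O z =ᵐ[vol O] z := (exists_measurable_representative O).choose_spec.2 z

/-- Fubini in the form used for `L²(O)`-valued functions: a jointly measurable function of a
parameter and of `ξ` is a strongly measurable `L²(O)`-valued function of the parameter. -/
lemma stronglyMeasurable_toL2 (b : HilbertBasis ℕ ℝ (L2 O)) {α : Type*} {m : MeasurableSpace α}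
    {g : α → E d → ℝ} (hg : Measurable (Function.uncurry g)) :
    StronglyMeasurable fun a => toL2 O (g a) := by
  classical
  have hS : MeasurableSet {a | MemLp (g a) 2 (vol O)} := by
    have h1 : {a | MemLp (g a) 2 (vol O)} = {a | ∫⁻ ξ, ‖g a ξ‖ₑ ^ (2 : ℝ) ∂(vol O) < ∞} := by
      ext a
      have hm : AEStronglyMeasurable (g a) (vol O) :=
        (hg.comp measurable_prodMk_left).aestronglyMeasurable
      simp only [mem_ofPred_eq]
      rw [show (MemLp (g a) 2 (vol O) ↔ eLpNorm (g a) 2 (vol O) < ∞) from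
        ⟨fun h => h.2, fun h => ⟨hm, h⟩⟩,
        eLpNorm_lt_top_iff_lintegral_rpow_enorm_lt_top (by norm_num) (by norm_num)]
      simp
    rw [h1]
    refine measurableSet_lt ?_ measurable_const
    exact Measurable.lintegral_prod_right' (f := fun p : α × E d => ‖g p.1 p.2‖ₑ ^ (2 : ℝ))
      (hg.enorm.pow_const _)
  -- The coefficients in the basis `b` are measurable, by Fubini's theorem.
  have hcoef : ∀ j, StronglyMeasurable fun a => inner ℝ (b j) (toL2 O (g a)) := by
    intro j
    have h1 : (fun a => inner ℝ (b j) (toL2 O (g a))) =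
        {a | MemLp (g a) 2 (vol O)}.indicator fun a => ∫ ξ, g a ξ * b j ξ ∂(vol O) := by
      funext a
      by_cases ha : MemLp (g a) 2 (vol O)
      · rw [indicator_of_mem (show a ∈ {a | MemLp (g a) 2 (vol O)} from ha), L2.inner_def]
        refine integral_congr_ae ?_
        filter_upwards [toL2_ae O ha] with ξ h
        simp [h]
      · rw [indicator_of_notMem (show a ∉ {a | MemLp (g a) 2 (vol O)} from ha), toL2, dif_neg ha,
          inner_zero_right]
    rw [h1]
    refine StronglyMeasurable.indicator ?_ hS
    exact StronglyMeasurable.integral_prod_right' (f := fun p : α × E d => g p.1 p.2 * b j p.2)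
      (hg.mul ((Lp.stronglyMeasurable (b j)).measurable.comp measurable_snd)).stronglyMeasurable
  refine stronglyMeasurable_of_tendsto atTop (f := fun n a =>
    ∑ j ∈ Finset.range n, inner ℝ (b j) (toL2 O (g a)) • b j) (fun n => ?_) ?_
  · exact Finset.stronglyMeasurable_fun_sum _ fun j _ => (hcoef j).smul_const _
  · rw [tendsto_pi_nhds]
    intro a
    have h := (b.hasSum_repr (toL2 O (g a))).tendsto_sum_nat
    simpa only [b.repr_apply_apply] using h

lemma measurable_rep_comp {α : Type*} {m : MeasurableSpace α} {y : α → L2 O}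
    (hy : StronglyMeasurable y) : Measurable fun p : α × E d => rep O (y p.1) p.2 :=
  (measurable_rep O).comp ((hy.measurable.comp measurable_fst).prodMk measurable_snd)

lemma stronglyMeasurable_mul (b : HilbertBasis ℕ ℝ (L2 O)) {α : Type*} {m : MeasurableSpace α}
    {g : α → E d → ℝ} (hg : Measurable (Function.uncurry g)) {y : α → L2 O}
    (hy : StronglyMeasurable y) : StronglyMeasurable fun a => mul O (g a) (y a) := by
  have h1 : (fun a => mul O (g a) (y a)) = fun a => toL2 O fun ξ => g a ξ * rep O (y a) ξ := by
    funext a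
    rw [mul_eq_toL2]
    refine toL2_congr O ?_
    filter_upwards [rep_ae O (y a)] with ξ h
    rw [h]
  rw [h1]
  exact stronglyMeasurable_toL2 O b (hg.mul (measurable_rep_comp O hy))

end Representatives

section Multipliers

variable {d : ℕ} (O : Set (E d))

/-- A function that multiplies `L²(O)` into itself: it is measurable and essentially bounded. -/
def IsMul (m : E d → ℝ) : Prop :=
  AEStronglyMeasurable m (vol O) ∧ ∃ C : ℝ, ∀ᵐ ξ ∂(vol O), |m ξ| ≤ C

/-- The norm of a multiplier of `L²(O)` bounds the multiplier essentially. -/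
lemma ae_le_of_multiplier {m : E d → ℝ} (hm : Measurable m) {C : ℝ≥0∞}
    (h : ∀ z : L2 O, eLpNorm (fun ξ => m ξ * z ξ) 2 (vol O) ≤ C * ‖z‖ₑ) :
    ∀ᵐ ξ ∂(vol O), ‖m ξ‖ₑ ≤ C := by
  have h2 : (fun ξ => ‖m ξ‖ₑ ^ 2) ≤ᵐ[vol O] fun _ => C ^ 2 := by
    -- The multiplier is tested on indicator functions.
    refine ae_le_of_forall_setLIntegral_le_of_sigmaFinite (by fun_prop) ?_
    intro s hs hsf
    let z : L2 O := indicatorConstLp 2 hs hsf.ne (1 : ℝ)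
    have hz := h z
    have h3 : eLpNorm (fun ξ => m ξ * z ξ) 2 (vol O) ^ 2 = ∫⁻ ξ in s, ‖m ξ‖ₑ ^ 2 ∂(vol O) := by
      rw [← lintegral_indicator hs, eLpNorm_eq_lintegral_rpow_enorm_toReal (by norm_num)
        (by norm_num), ← ENNReal.rpow_natCast, ← ENNReal.rpow_mul]
      norm_num
      refine lintegral_congr_ae ?_
      filter_upwards [indicatorConstLp_coeFn (p := 2) (hs := hs) (hμs := hsf.ne) (c := (1 : ℝ))]
        with ξ hξ
      rw [show z ξ = _ from hξ]
      by_cases hξs : ξ ∈ s <;> simp [hξs]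
    have h4 : ‖z‖ₑ ^ 2 = vol O s := by
      rw [Lp.enorm_def, eLpNorm_congr_ae indicatorConstLp_coeFn,
        eLpNorm_indicator_const hs (by norm_num) (by norm_num), ← ENNReal.rpow_natCast,
        ENNReal.mul_rpow_of_nonneg _ _ (by norm_num), ← ENNReal.rpow_mul]
      simp
    rw [← h3, setLIntegral_const, ← h4, ← mul_pow]
    gcongr
  filter_upwards [h2] with ξ hξ
  exact (ENNReal.pow_le_pow_left_iff two_ne_zero).1 hξ

lemma eLpNorm_mul_le_multNorm {m : E d → ℝ} (z : L2 O) :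
    eLpNorm (fun ξ => m ξ * z ξ) 2 (vol O) ≤ multNorm O m * ‖z‖ₑ := by
  by_cases hz : z = 0
  · have : eLpNorm (fun ξ => m ξ * z ξ) 2 (vol O) = 0 := by
      rw [← eLpNorm_zero (μ := vol O) (p := 2) (α := E d) (ε := ℝ)]
      refine eLpNorm_congr_ae ?_
      rw [hz]
      filter_upwards [Lp.coeFn_zero ℝ 2 (vol O)] with ξ h
      rw [h]; simp
    rw [this]; exact zero_le
  · have hz' : ‖z‖ ≠ 0 := norm_ne_zero_iff.2 hz
    have h1 : eLpNorm (fun ξ => m ξ * (‖z‖⁻¹ • z : L2 O) ξ) 2 (vol O) ≤ multNorm O m :=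
      le_iSup₂_of_le (f := fun (u : L2 O) (_ : ‖u‖ = 1) =>
        eLpNorm (fun ξ => m ξ * u ξ) 2 (vol O)) (‖z‖⁻¹ • z) (by simp [norm_smul, hz']) le_rfl
    have h2 : eLpNorm (fun ξ => m ξ * z ξ) 2 (vol O) =
        ‖z‖ₑ * eLpNorm (fun ξ => m ξ * (‖z‖⁻¹ • z : L2 O) ξ) 2 (vol O) := by
      rw [← enorm_norm z, ← eLpNorm_const_smul]
      refine eLpNorm_congr_ae ?_
      filter_upwards [Lp.coeFn_smul ‖z‖⁻¹ z] with ξ h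
      simp only [Pi.smul_apply, smul_eq_mul, h]
      field_simp
    rw [h2, mul_comm]
    gcongr

variable {O}

namespace IsMul

lemma memLp {m : E d → ℝ} (hm : IsMul O m) (z : L2 O) : MemLp (fun ξ => m ξ * z ξ) 2 (vol O) := by
  obtain ⟨h1, C, hC⟩ := hm
  refine MemLp.of_le_mul (Lp.memLp z) (h1.mul (Lp.aestronglyMeasurable z)) (c := C) ?_
  filter_upwards [hC] with ξ h
  rw [norm_mul]
  exact mul_le_mul_of_nonneg_right h (norm_nonneg _)

lemma mul_ae {m : E d → ℝ} (hm : IsMul O m) (z : L2 O) :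
    mul O m z =ᵐ[vol O] fun ξ => m ξ * z ξ := toL2_ae O (hm.memLp z)

lemma map_add {m : E d → ℝ} (hm : IsMul O m) (z w : L2 O) :
    mul O m (z + w) = mul O m z + mul O m w := by
  refine Lp.ext ?_
  filter_upwards [hm.mul_ae (z + w), hm.mul_ae z, hm.mul_ae w, Lp.coeFn_add z w,
    Lp.coeFn_add (mul O m z) (mul O m w)] with ξ h1 h2 h3 h4 h5
  rw [h1, h4, h5, Pi.add_apply, Pi.add_apply, h2, h3, mul_add]

lemma map_smul {m : E d → ℝ} (hm : IsMul O m) (c : ℝ) (z : L2 O) :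
    mul O m (c • z) = c • mul O m z := by
  refine Lp.ext ?_
  filter_upwards [hm.mul_ae (c • z), hm.mul_ae z, Lp.coeFn_smul c z,
    Lp.coeFn_smul c (mul O m z)] with ξ h1 h2 h3 h4
  rw [h1, h3, h4, Pi.smul_apply, Pi.smul_apply, h2, smul_eq_mul, smul_eq_mul]
  ring

lemma norm_mul_le {m : E d → ℝ} (hm : IsMul O m) {C : ℝ} (hC : ∀ᵐ ξ ∂(vol O), |m ξ| ≤ C)
    (z : L2 O) : ‖mul O m z‖ ≤ C * ‖z‖ := by
  refine Lp.norm_le_mul_norm_of_ae_le_mul ?_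
  filter_upwards [hC, hm.mul_ae z] with ξ h1 h2
  rw [h2, norm_mul]
  exact mul_le_mul_of_nonneg_right h1 (norm_nonneg _)

/-- A multiplier as a bounded operator of `L²(O)`. -/
def toCLM {m : E d → ℝ} (hm : IsMul O m) : L2 O →L[ℝ] L2 O :=
  LinearMap.mkContinuousOfExistsBound
    { toFun := mul O m, map_add' := hm.map_add, map_smul' := hm.map_smul }
    (hm.2.imp fun _ hC z => hm.norm_mul_le hC z)

lemma toCLM_apply {m : E d → ℝ} (hm : IsMul O m) (z : L2 O) : hm.toCLM z = mul O m z := rfl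

lemma inner_eq {m : E d → ℝ} (hm : IsMul O m) (z w : L2 O) :
    inner ℝ (mul O m z) w = ∫ ξ, m ξ * z ξ * w ξ ∂(vol O) := by
  rw [L2.inner_def]
  refine integral_congr_ae ?_
  filter_upwards [hm.mul_ae z] with ξ h
  simp [h]
  ring

lemma inner_comm {m : E d → ℝ} (hm : IsMul O m) (z w : L2 O) :
    inner ℝ (mul O m z) w = inner ℝ z (mul O m w) := by
  rw [real_inner_comm (mul O m w), hm.inner_eq, hm.inner_eq]
  congr 1
  funext ξ
  ring

lemma mul_mul {n : E d → ℝ} (hn : IsMul O n) (m : E d → ℝ) (z : L2 O) :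
    mul O m (mul O n z) = mul O (fun ξ => m ξ * n ξ) z := by
  refine toL2_congr O ?_
  filter_upwards [hn.mul_ae z] with ξ h
  simp only [h, mul_assoc]

lemma add {m n : E d → ℝ} (hm : IsMul O m) (hn : IsMul O n) : IsMul O fun ξ => m ξ + n ξ := by
  obtain ⟨h1, C, hC⟩ := hm
  obtain ⟨h2, C', hC'⟩ := hn
  refine ⟨h1.add h2, C + C', ?_⟩
  filter_upwards [hC, hC'] with ξ h h' using (abs_add_le _ _).trans (add_le_add h h')

lemma const (c : ℝ) : IsMul O fun _ => c := ⟨aestronglyMeasurable_const, |c|, by simp⟩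

lemma const_mul {m : E d → ℝ} (hm : IsMul O m) (c : ℝ) : IsMul O fun ξ => c * m ξ := by
  obtain ⟨h1, C, hC⟩ := hm
  refine ⟨h1.const_mul c, |c| * C, ?_⟩
  filter_upwards [hC] with ξ h
  rw [abs_mul]
  gcongr

lemma mul_add_const {m : E d → ℝ} (hm : IsMul O m) (c : ℝ) (z : L2 O) :
    StochObstacle.mul O (fun ξ => m ξ + c) z = StochObstacle.mul O m z + c • z := by
  refine Lp.ext ?_
  filter_upwards [(hm.add (const c)).mul_ae z, hm.mul_ae z, Lp.coeFn_smul c z,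
    Lp.coeFn_add (StochObstacle.mul O m z) (c • z)] with ξ h1 h2 h3 h4
  rw [h1, h4, Pi.add_apply, h2, h3, Pi.smul_apply, smul_eq_mul, add_mul]

end IsMul

lemma mul_one_eq (z : L2 O) : mul O (fun _ => 1) z = z := by
  rw [mul_eq_toL2]
  simp only [one_mul]
  exact toL2_coe O z

end Multipliers

end

section

/-! ### The coefficients of the problem -/

variable {d : ℕ} {Ω : Type*} [mΩ : MeasurableSpace Ω]

/-- The standing hypotheses on the data of the problem. -/
structure Standing (D : Data d Ω) : Prop where
  T_pos : 0 < D.T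
  brownian : IsBrownianSystem D.P D.ℱ D.β
  multiplier : ∀ j, multNorm D.O (D.e j) ≠ ∞ ∧ multNorm D.O (fun ξ => D.e j ξ ^ 2) ≠ ∞
  nu_lt : D.νInf < ENNReal.ofReal D.lam
  expW : D.ExpWMultiplier

namespace Standing

variable {D : Data d Ω} (hD : Standing D)

section Coefficients

include hD

omit hD in
lemma measurable_e (j : ℕ) : Measurable (D.e j : E d → ℝ) := (Lp.stronglyMeasurable _).measurable

lemma γ_ne_top (j : ℕ) : D.γ j ≠ ∞ := by
  rw [Data.γ, ne_eq, max_eq_top, max_eq_top]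
  simp only [ENNReal.one_ne_top, or_false, not_or]
  exact ⟨(hD.multiplier j).1, ENNReal.rpow_ne_top_of_nonneg (by norm_num) (hD.multiplier j).2⟩

omit hD in
lemma e_le (j : ℕ) : ∀ᵐ ξ ∂(vol D.O), ‖D.e j ξ‖ₑ ≤ D.γ j := by
  refine ae_le_of_multiplier D.O (measurable_e j) fun z => ?_
  refine (eLpNorm_mul_le_multNorm D.O z).trans ?_
  gcongr
  exact (le_max_left _ _).trans (le_max_left _ _)

lemma νInf_ne_top : D.νInf ≠ ∞ := hD.nu_lt.ne_top

omit hD in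
lemma ν_nonneg : 0 ≤ D.ν := ENNReal.toReal_nonneg

lemma ν_lt : D.ν < D.lam := by
  have h := hD.nu_lt
  rw [← ENNReal.ofReal_toReal hD.νInf_ne_top] at h
  exact (ENNReal.ofReal_lt_ofReal_iff_of_nonneg ENNReal.toReal_nonneg).1 h

lemma δ_pos : 0 < D.δ := by
  have := hD.ν_lt
  simp only [Data.δ]
  linarith

omit hD in
lemma ae_tsum_le : ∀ᵐ ξ ∂(vol D.O), ∑' j, ENNReal.ofReal (D.c j ^ 2 * D.e j ξ ^ 2) ≤ D.νInf := by
  filter_upwards [ae_all_iff.2 e_le] with ξ h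
  refine ENNReal.tsum_le_tsum fun j => ?_
  rw [ENNReal.ofReal_mul (sq_nonneg _)]
  gcongr
  have h1 : ENNReal.ofReal (D.e j ξ ^ 2) = ‖D.e j ξ‖ₑ ^ 2 := by
    rw [← ofReal_norm, ← ENNReal.ofReal_pow (norm_nonneg _), Real.norm_eq_abs, sq_abs]
  rw [h1]
  gcongr
  exact h j

omit hD in
lemma μ_eq (ξ : E d) :
    D.μ ξ = 1 / 2 * (∑' j, ENNReal.ofReal (D.c j ^ 2 * D.e j ξ ^ 2)).toReal := by
  rw [ENNReal.tsum_toReal_eq fun _ => ENNReal.ofReal_ne_top]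
  simp only [Data.μ]
  congr 2
  funext j
  rw [ENNReal.toReal_ofReal (by positivity)]

omit hD in
lemma μ_nonneg (ξ : E d) : 0 ≤ D.μ ξ := by
  rw [μ_eq]; positivity

omit hD in
lemma measurable_μ : Measurable D.μ := by
  have h : D.μ = fun ξ => 1 / 2 * (∑' j, ENNReal.ofReal (D.c j ^ 2 * D.e j ξ ^ 2)).toReal :=
    funext μ_eq
  rw [h]
  refine measurable_const.mul (Measurable.ennreal_toReal (Measurable.tsum fun j => ?_))
  exact (measurable_const.mul ((Lp.stronglyMeasurable (D.e j)).measurable.pow_const 2)).ennreal_ofReal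

lemma ae_μ_le : ∀ᵐ ξ ∂(vol D.O), D.μ ξ ≤ D.ν / 2 := by
  filter_upwards [ae_tsum_le] with ξ h
  have := ENNReal.toReal_mono hD.νInf_ne_top h
  rw [μ_eq, Data.ν]
  linarith

lemma ae_summable : ∀ᵐ ξ ∂(vol D.O), Summable fun j => D.c j ^ 2 * D.e j ξ ^ 2 := by
  filter_upwards [ae_tsum_le] with ξ h
  have h1 := ENNReal.summable_toReal (ne_top_of_le_ne_top hD.νInf_ne_top h)
  refine h1.congr fun j => ?_
  rw [ENNReal.toReal_ofReal (by positivity)]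

lemma isMul_μ : IsMul D.O D.μ := by
  refine ⟨measurable_μ.aestronglyMeasurable, D.ν / 2, ?_⟩
  filter_upwards [hD.ae_μ_le] with ξ h
  rwa [abs_of_nonneg (μ_nonneg ξ)]

lemma isMul_e (j : ℕ) : IsMul D.O (D.e j) := by
  refine ⟨(measurable_e j).aestronglyMeasurable, (D.γ j).toReal, ?_⟩
  filter_upwards [e_le j] with ξ h
  have := ENNReal.toReal_mono (hD.γ_ne_top j) h
  simpa using this

/-- The sum in the definition of `η` is the quadratic form of the multiplication by `μ`. -/
lemma inner_μ (z : D.H) :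
    inner ℝ (mul D.O D.μ z) z = 1 / 2 * ∑' j, D.c j ^ 2 * ‖mul D.O (D.e j) z‖ ^ 2 := by
  have hz : Integrable (fun ξ => z ξ ^ 2) (vol D.O) := (Lp.memLp z).integrable_sq
  have h1 : ∀ j, ∫⁻ ξ, ENNReal.ofReal (D.c j ^ 2 * D.e j ξ ^ 2 * z ξ ^ 2) ∂(vol D.O) =
      ENNReal.ofReal (D.c j ^ 2 * ‖mul D.O (D.e j) z‖ ^ 2) := by
    intro j
    have h2 : Integrable (fun ξ => (mul D.O (D.e j) z) ξ ^ 2) (vol D.O) :=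
      (Lp.memLp (mul D.O (D.e j) z)).integrable_sq
    have h3 : ‖mul D.O (D.e j) z‖ ^ 2 = ∫ ξ, (mul D.O (D.e j) z) ξ ^ 2 ∂(vol D.O) := by
      rw [← real_inner_self_eq_norm_sq, L2.inner_def]
      refine integral_congr_ae (Eventually.of_forall fun ξ => ?_)
      simp [sq]
    rw [h3, ← integral_const_mul, ofReal_integral_eq_lintegral_ofReal (h2.const_mul _)
      (Eventually.of_forall fun ξ => mul_nonneg (sq_nonneg _) (sq_nonneg _))]
    refine lintegral_congr_ae ?_
    filter_upwards [(hD.isMul_e j).mul_ae z] with ξ h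
    rw [h, mul_pow, mul_assoc]
  -- Summation over `j` under the integral.
  have h2 : ∫⁻ ξ, ENNReal.ofReal (2 * D.μ ξ * z ξ ^ 2) ∂(vol D.O) =
      ∑' j, ENNReal.ofReal (D.c j ^ 2 * ‖mul D.O (D.e j) z‖ ^ 2) := by
    simp_rw [← h1]
    rw [← lintegral_tsum]
    · refine lintegral_congr_ae ?_
      filter_upwards [ae_tsum_le] with ξ h
      have h4 : ENNReal.ofReal (2 * D.μ ξ) = ∑' j, ENNReal.ofReal (D.c j ^ 2 * D.e j ξ ^ 2) := by
        rw [μ_eq, ← mul_assoc]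
        rw [show (2 : ℝ) * (1 / 2) = 1 by norm_num, one_mul]
        exact ENNReal.ofReal_toReal (ne_top_of_le_ne_top hD.νInf_ne_top h)
      rw [ENNReal.ofReal_mul (mul_nonneg (by norm_num) (μ_nonneg ξ)), h4, ← ENNReal.tsum_mul_right]
      congr 1
      funext j
      rw [← ENNReal.ofReal_mul (by positivity)]
    · intro j
      exact (((measurable_e j).pow_const 2).const_mul _ |>.mul
        ((Lp.stronglyMeasurable z).measurable.pow_const 2)).ennreal_ofReal.aemeasurable
  have h5 : inner ℝ (mul D.O D.μ z) z = 1 / 2 * ∫ ξ, 2 * D.μ ξ * z ξ ^ 2 ∂(vol D.O) := by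
    rw [hD.isMul_μ.inner_eq, ← integral_const_mul]
    congr 1
    funext ξ
    ring
  rw [h5, integral_eq_lintegral_of_nonneg_ae (Eventually.of_forall fun ξ =>
    mul_nonneg (mul_nonneg (by norm_num) (μ_nonneg ξ)) (sq_nonneg _)), h2,
    ENNReal.tsum_toReal_eq fun _ => ENNReal.ofReal_ne_top]
  · congr 2
    funext j
    rw [ENNReal.toReal_ofReal (by positivity)]
  · exact ((measurable_μ.const_mul 2).mul
      ((Lp.stronglyMeasurable z).measurable.pow_const 2)).aestronglyMeasurable

/-- The quadratic form `η` is the one of the operator of multiplication by `ν + δ - μ`. -/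
lemma η_eq (z : D.H) : D.η z = (D.ν + D.δ) * ‖z‖ ^ 2 - inner ℝ (mul D.O D.μ z) z := by
  rw [hD.inner_μ, Data.η]

lemma norm_μ_le (z : D.H) : ‖mul D.O D.μ z‖ ≤ D.ν / 2 * ‖z‖ := by
  refine hD.isMul_μ.norm_mul_le ?_ z
  filter_upwards [hD.ae_μ_le] with ξ h
  rwa [abs_of_nonneg (μ_nonneg ξ)]

lemma inner_μ_le (z : D.H) : inner ℝ (mul D.O D.μ z) z ≤ D.ν / 2 * ‖z‖ ^ 2 := by
  refine (real_inner_le_norm _ _).trans ?_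
  rw [sq, ← mul_assoc]
  exact mul_le_mul_of_nonneg_right (hD.norm_μ_le z) (norm_nonneg _)

end Coefficients

end Standing

end

section

/-! ### Gaussian series -/

section GaussianSeries

variable {Ω : Type*} [mΩ : MeasurableSpace Ω] {P : Measure Ω} [IsProbabilityMeasure P]
  {Y : ℕ → Ω → ℝ} {v : ℝ≥0} {a : ℕ → ℝ}

/-- A weighted sum of independent centered Gaussian variables is centered Gaussian. -/
lemma map_sum_gaussian (hY : ∀ j, Measurable (Y j)) (hind : iIndepFun Y P)
    (hlaw : ∀ j, P.map (Y j) = gaussianReal 0 v) (n : ℕ) :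
    P.map (fun ω => ∑ j ∈ Finset.range n, a j * Y j ω) =
      gaussianReal 0 ((∑ j ∈ Finset.range n, a j ^ 2).toNNReal * v) := by
  induction n with
  | zero => simp [gaussianReal_zero_var]
  | succ n ih =>
    have hind' : iIndepFun (fun j ω => a j * Y j ω) P :=
      hind.comp (fun j y => a j * y) fun j => by fun_prop
    have h1 : IndepFun (fun ω => ∑ j ∈ Finset.range n, a j * Y j ω) (fun ω => a n * Y n ω) P := by
      have := hind'.indepFun_finsetSum_of_notMem (s := Finset.range n) (i := n)
        (fun j => (hY j).const_mul (a j)) (by simp)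
      convert! this using 1
      funext ω
      simp
    have h2 := gaussianReal_const_mul (X := Y n) (P := P) ⟨(hY n).aemeasurable, hlaw n⟩ (a n)
    have h3 := gaussianReal_add_gaussianReal_of_indepFun h1 ih h2.map_eq
    have h4 : (fun ω => ∑ j ∈ Finset.range (n + 1), a j * Y j ω) =
        (fun ω => ∑ j ∈ Finset.range n, a j * Y j ω) + fun ω => a n * Y n ω := by
      funext ω; simp [Finset.sum_range_succ]
    rw [h4, h3]
    congr 1
    · simp
    · rw [Finset.sum_range_succ, Real.toNNReal_add (Finset.sum_nonneg fun _ _ => sq_nonneg _)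
        (sq_nonneg _), add_mul]
      congr 2
      ext
      simp [Real.coe_toNNReal _ (sq_nonneg (a n))]

/-- A series of independent centered Gaussian variables with summable variances converges almost
surely, by the martingale convergence theorem. -/
lemma ae_tendsto_gaussian_series (hY : ∀ j, Measurable (Y j)) (hind : iIndepFun Y P)
    (hlaw : ∀ j, P.map (Y j) = gaussianReal 0 v) (ha : Summable fun j => a j ^ 2) :
    ∀ᵐ ω ∂P, ∃ l, Tendsto (fun n => ∑ j ∈ Finset.range n, a j * Y j ω) atTop (𝓝 l) := by
  let m : ℕ → MeasurableSpace Ω := fun j => MeasurableSpace.comap (Y j) inferInstance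
  have hm : ∀ j, m j ≤ mΩ := fun j => (hY j).comap_le
  -- The partial sums are a martingale for the filtration generated by the variables.
  let 𝒢 : Filtration ℕ mΩ :=
    { seq := fun n => ⨆ j ∈ Iio n, m j
      mono' := fun n k hnk => biSup_mono fun j hj => lt_of_lt_of_le hj hnk
      le' := fun n => iSup₂_le fun j _ => hm j }
  have hLp : ∀ j, MemLp (Y j) 2 P := by
    intro j
    have h1 : MemLp id 2 (P.map (Y j)) := by rw [hlaw]; exact memLp_id_gaussianReal 2
    exact h1.comp_of_map (hY j).aemeasurable
  let S : ℕ → Ω → ℝ := fun n ω => ∑ j ∈ Finset.range n, a j * Y j ω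
  have hSLp : ∀ n, MemLp (S n) 2 P := fun n => memLp_finsetSum _ fun j _ => (hLp j).const_mul (a j)
  have hYm : ∀ n j, j < n → Measurable[𝒢 n] (Y j) := fun n j hj =>
    (comap_measurable (Y j)).mono (le_iSup₂_of_le (f := fun j (_ : j ∈ Iio n) => m j) j hj le_rfl)
      le_rfl
  have hadp : StronglyAdapted 𝒢 S := fun n => by
    refine Measurable.stronglyMeasurable ?_
    exact Finset.measurable_fun_sum _ fun j hj => (hYm n j (Finset.mem_range.1 hj)).const_mul _
  have hmart : Martingale S 𝒢 P := by
    refine martingale_nat hadp (fun n => (hSLp n).integrable (by norm_num)) fun n => ?_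
    have h1 : S (n + 1) = S n + fun ω => a n * Y n ω := by
      funext ω; simp [S, Finset.sum_range_succ]
    have h2 : P[fun ω => a n * Y n ω | 𝒢 n] =ᵐ[P] fun _ => P[fun ω => a n * Y n ω] := by
      refine condExp_indep_eq (m₁ := m n) (hm n) (𝒢.le n)
        ((comap_measurable (Y n)).const_mul (a n)).stronglyMeasurable ?_
      have := indep_iSup_of_disjoint hm hind.iIndep (S := {n}) (T := Iio n) (by simp)
      rwa [iSup_singleton] at this
    have h3 : ∫ ω, a n * Y n ω ∂P = 0 := by
      rw [integral_const_mul]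
      have : ∫ ω, Y n ω ∂P = ∫ y, y ∂(P.map (Y n)) :=
        (integral_map (f := fun y => y) (hY n).aemeasurable
          measurable_id.aestronglyMeasurable).symm
      rw [this, hlaw, integral_id_gaussianReal, mul_zero]
    have h4 : P[S n | 𝒢 n] = S n :=
      condExp_of_stronglyMeasurable (𝒢.le n) (hadp n) ((hSLp n).integrable (by norm_num))
    rw [h1]
    have h5 := condExp_add (m := 𝒢 n) ((hSLp n).integrable (by norm_num))
      (((hLp n).const_mul (a n)).integrable (by norm_num))
    filter_upwards [h2, h5] with ω h2 h5
    rw [h5, Pi.add_apply, h2, h4, h3, add_zero]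
  -- The martingale is bounded in `L²`, and so in `L¹`.
  have hbdd : ∀ n, eLpNorm (S n) 1 P ≤ (Real.sqrt ((∑' j, a j ^ 2) * v)).toNNReal := by
    intro n
    refine (eLpNorm_le_eLpNorm_of_exponent_le (q := 2) (by norm_num)
      (hSLp n).aestronglyMeasurable).trans ?_
    have h1 : ∫ ω, S n ω ^ 2 ∂P = (∑ j ∈ Finset.range n, a j ^ 2) * v := by
      have hl := map_sum_gaussian (a := a) hY hind hlaw n
      have hSm : AEMeasurable (S n) P := (hSLp n).aemeasurable
      have h2 : ∫ ω, S n ω ^ 2 ∂P = ∫ y, y ^ 2 ∂(P.map (S n)) :=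
        (integral_map (f := fun y => y ^ 2) hSm
          (by fun_prop : Measurable fun y : ℝ => y ^ 2).aestronglyMeasurable).symm
      rw [h2, show P.map (S n) = _ from hl]
      have h3 := variance_id_gaussianReal (μ := 0) (v := (∑ j ∈ Finset.range n, a j ^ 2).toNNReal * v)
      rw [variance_of_integral_eq_zero (by fun_prop) (by simp)] at h3
      simp only [id] at h3
      rw [h3, NNReal.coe_mul, Real.coe_toNNReal _ (Finset.sum_nonneg fun _ _ => sq_nonneg _)]
    rw [eLpNorm_eq_lintegral_rpow_enorm_toReal (by norm_num) (by norm_num)]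
    have h2 : ∫⁻ ω, ‖S n ω‖ₑ ^ (2 : ℝ≥0∞).toReal ∂P = ENNReal.ofReal (∫ ω, S n ω ^ 2 ∂P) := by
      rw [ofReal_integral_eq_lintegral_ofReal (hSLp n).integrable_sq
        (Eventually.of_forall fun _ => sq_nonneg _)]
      refine lintegral_congr fun ω => ?_
      rw [← ofReal_norm, ENNReal.toReal_ofNat, ENNReal.ofReal_rpow_of_nonneg (norm_nonneg _)
        (by norm_num)]
      simp
    have h0 : 0 ≤ (∑ j ∈ Finset.range n, a j ^ 2) * (v : ℝ) :=
      mul_nonneg (Finset.sum_nonneg fun _ _ => sq_nonneg _) v.2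
    rw [h2, h1, ENNReal.ofReal_rpow_of_nonneg h0 (by norm_num)]
    refine ENNReal.ofReal_le_ofReal ?_
    rw [ENNReal.toReal_ofNat, ← Real.sqrt_eq_rpow]
    refine Real.sqrt_le_sqrt (mul_le_mul_of_nonneg_right ?_ v.2)
    exact ha.sum_le_tsum _ fun _ _ => sq_nonneg _
  filter_upwards [hmart.submartingale.ae_tendsto_limitProcess hbdd] with ω h using ⟨_, h⟩

/-- The exponential moments of a series of independent centered Gaussian variables. -/
lemma lintegral_exp_gaussian_series (hY : ∀ j, Measurable (Y j)) (hind : iIndepFun Y P)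
    (hlaw : ∀ j, P.map (Y j) = gaussianReal 0 v) (ha : Summable fun j => a j ^ 2) (k : ℝ) :
    ∫⁻ ω, ENNReal.ofReal (Real.exp (k * limUnder atTop
      fun n => ∑ j ∈ Finset.range n, a j * Y j ω)) ∂P =
      ENNReal.ofReal (Real.exp (k ^ 2 * ((∑' j, a j ^ 2) * v) / 2)) := by
  let S : ℕ → Ω → ℝ := fun n ω => ∑ j ∈ Finset.range n, a j * Y j ω
  have hS : ∀ n, Measurable (S n) := fun n =>
    Finset.measurable_fun_sum _ fun j _ => (hY j).const_mul (a j)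
  let L : Ω → ℝ := fun ω => limUnder atTop fun n => S n ω
  have hL : Measurable L := (StronglyMeasurable.limUnder fun n => (hS n).stronglyMeasurable).measurable
  have hconv : ∀ᵐ ω ∂P, Tendsto (fun n => S n ω) atTop (𝓝 (L ω)) := by
    filter_upwards [ae_tendsto_gaussian_series hY hind hlaw ha] with ω h
    exact tendsto_nhds_limUnder h
  -- The characteristic functions of the partial sums converge, so the limit is Gaussian.
  have hlim : P.map L = gaussianReal 0 ((∑' j, a j ^ 2).toNNReal * v) := by
    have : IsProbabilityMeasure (P.map L) := Measure.isProbabilityMeasure_map hL.aemeasurable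
    refine Measure.ext_of_charFun ?_
    funext u
    have h1 : Tendsto (fun n => charFun (P.map (S n)) u) atTop (𝓝 (charFun (P.map L) u)) := by
      have h2 : ∀ X : Ω → ℝ, Measurable X → charFun (P.map X) u =
          ∫ ω, Complex.exp (u * X ω * Complex.I) ∂P := by
        intro X hX
        rw [charFun_apply_real, integral_map hX.aemeasurable (by fun_prop)]
      simp_rw [h2 _ (hS _), h2 _ hL]
      refine tendsto_integral_of_dominated_convergence (fun _ => 1) (fun n => ?_)
        (integrable_const _) (fun n => ?_) ?_
      · have := hS n
        exact Measurable.aestronglyMeasurable (by fun_prop)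
      · refine Eventually.of_forall fun ω => ?_
        rw [← Complex.ofReal_mul, Complex.norm_exp_ofReal_mul_I]
      · filter_upwards [hconv] with ω h
        have hc : Continuous fun y : ℝ => Complex.exp (u * y * Complex.I) := by fun_prop
        exact (hc.tendsto _).comp h
    have h2 : Tendsto (fun n => charFun (P.map (S n)) u) atTop
        (𝓝 (charFun (gaussianReal 0 ((∑' j, a j ^ 2).toNNReal * v)) u)) := by
      have h3 : ∀ n, charFun (P.map (S n)) u = Complex.exp (u * (0 : ℝ) * Complex.I -
          (((∑ j ∈ Finset.range n, a j ^ 2) * v : ℝ) : ℂ) * u ^ 2 / 2) := by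
        intro n
        rw [show P.map (S n) = _ from map_sum_gaussian (a := a) hY hind hlaw n, charFun_gaussianReal,
          NNReal.coe_mul, Real.coe_toNNReal _ (Finset.sum_nonneg fun _ _ => sq_nonneg _)]
      simp_rw [h3]
      rw [charFun_gaussianReal, NNReal.coe_mul,
        Real.coe_toNNReal _ (tsum_nonneg fun _ => sq_nonneg _)]
      have hc : Continuous fun y : ℝ => Complex.exp (u * (0 : ℝ) * Complex.I -
          ((y * v : ℝ) : ℂ) * u ^ 2 / 2) := by fun_prop
      exact (hc.tendsto _).comp ha.hasSum.tendsto_sum_nat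
    exact tendsto_nhds_unique h1 h2
  have hmgf := mgf_gaussianReal hlim k
  rw [zero_mul, zero_add, NNReal.coe_mul, Real.coe_toNNReal _ (tsum_nonneg fun _ => sq_nonneg _),
    mgf] at hmgf
  have hint : Integrable (fun ω => Real.exp (k * L ω)) P := by
    -- The Bochner integral of a function that is not integrable is zero, but the moment generating
    -- function is positive.
    by_contra h
    rw [integral_undef h] at hmgf
    exact (Real.exp_pos _).ne hmgf
  rw [← ofReal_integral_eq_lintegral_ofReal hint (Eventually.of_forall fun _ => (Real.exp_pos _).le),
    hmgf]
  congr 2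
  ring

end GaussianSeries

end

section

/-! ### Adapted versions and the Wiener process -/

section Version

lemma stronglyMeasurable_limUnder {α F : Type*} {m : MeasurableSpace α} [NormedAddCommGroup F]
    [CompleteSpace F] [SecondCountableTopology F] {f : ℕ → α → F}
    (hf : ∀ n, StronglyMeasurable (f n)) :
    StronglyMeasurable fun a => limUnder atTop fun n => f n a := by
  let _ : MeasurableSpace F := borel F
  have : BorelSpace F := ⟨rfl⟩
  exact StronglyMeasurable.limUnder hf

/-- An almost surely left continuous process whose values are almost surely equal to adapted
random variables has a version that is jointly measurable and adapted: the limit of its values at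
the grid points to the left. -/
lemma exists_adapted_version {Ω : Type*} {mΩ : MeasurableSpace Ω} {P : Measure Ω}
    (ℱ : Filtration ℝ≥0 mΩ) {F : Type*} [NormedAddCommGroup F] [CompleteSpace F]
    [SecondCountableTopology F] (X : ℝ → Ω → F) {T : ℝ} (hT : 0 ≤ T)
    (hX : ∀ t ∈ Icc 0 T, AEStronglyMeasurable[ℱ t.toNNReal] (X t) P)
    (hc : ∀ᵐ ω ∂P, ∀ t ∈ Icc 0 T, ContinuousWithinAt (fun s => X s ω) (Icc 0 t) t) :
    ∃ Y : ℝ → Ω → F, StronglyMeasurable (fun p : ℝ × Ω => Y p.1 p.2) ∧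
      (∀ t, StronglyMeasurable[ℱ t.toNNReal] (Y t)) ∧
      ∀ᵐ ω ∂P, ∀ t ∈ Icc 0 T, Y t ω = X t ω := by
  classical
  let _ : MeasurableSpace F := borel F
  have : BorelSpace F := ⟨rfl⟩
  -- The grid point to the left of `t`, after `t` has been moved into the interval.
  let c : ℝ → ℝ := fun t => max 0 (min t T)
  let N : ℕ → ℝ → ℕ := fun n t => ⌊c t * (n + 1)⌋₊
  let g : ℕ → ℕ → ℝ := fun n k => k / (n + 1)
  have hc0 : ∀ t, 0 ≤ c t := fun t => le_max_left _ _
  have hcT : ∀ t, c t ≤ T := fun t => max_le hT (min_le_right _ _)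
  have hct : ∀ t, (c t).toNNReal ≤ t.toNNReal := fun t => by
    rcases le_total 0 t with h | h
    · exact Real.toNNReal_le_toNNReal (max_le h (min_le_left _ _))
    · have : c t = 0 := max_eq_left ((min_le_left _ _).trans h)
      simp [this]
  have hg0 : ∀ n k, 0 ≤ g n k := fun n k => by positivity
  have hgc : ∀ n t, g n (N n t) ≤ c t := fun n t => by
    simp only [g]
    rw [div_le_iff₀ (by positivity)]
    exact Nat.floor_le (mul_nonneg (hc0 t) (by positivity))
  have hgc' : ∀ (n : ℕ) t, c t - 1 / ((n : ℝ) + 1) ≤ g n (N n t) := fun n t => by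
    simp only [g]
    rw [le_div_iff₀ (by positivity), sub_mul, one_div_mul_cancel (by positivity)]
    exact (Nat.sub_one_lt_floor _).le
  have hglim : ∀ t, Tendsto (fun n => g n (N n t)) atTop (𝓝[Icc 0 (c t)] (c t)) := by
    intro t
    rw [tendsto_nhdsWithin_iff]
    refine ⟨tendsto_of_tendsto_of_tendsto_of_le_of_le ?_ tendsto_const_nhds (fun n => hgc' n t)
      fun n => hgc n t, Eventually.of_forall fun n => ⟨hg0 _ _, hgc n t⟩⟩
    simpa using tendsto_const_nhds.sub (tendsto_one_div_add_atTop_nhds_zero_nat (𝕜 := ℝ))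
  -- Adapted versions at the grid points.
  have hex : ∀ t, ∃ f : Ω → F, StronglyMeasurable[ℱ t.toNNReal] f ∧
      (t ∈ Icc 0 T → X t =ᵐ[P] f) := fun t => by
    by_cases h : t ∈ Icc 0 T
    · obtain ⟨f, hf, hXf⟩ := hX t h
      exact ⟨f, hf, fun _ => hXf⟩
    · exact ⟨fun _ => 0, @stronglyMeasurable_const _ _ (ℱ t.toNNReal) _ _, fun h' => absurd h' h⟩
  choose X' hX' hXX'0 using hex
  have hXX' : ∀ᵐ ω ∂P, ∀ n k, g n k ∈ Icc 0 T → X' (g n k) ω = X (g n k) ω := by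
    rw [ae_all_iff]; intro n
    rw [ae_all_iff]; intro k
    by_cases h : g n k ∈ Icc 0 T
    · filter_upwards [hXX'0 _ h] with ω hω _
      exact hω.symm
    · exact Eventually.of_forall fun ω h' => absurd h' h
  have hNm : ∀ n, Measurable (N n) := fun n => by
    refine Nat.measurable_floor.comp ?_
    fun_prop
  refine ⟨fun t ω => limUnder atTop fun n => X' (g n (N n t)) ω, ?_, fun t => ?_, ?_⟩
  · refine StronglyMeasurable.limUnder fun n => ?_
    have h1 : Measurable fun p : ℕ × Ω => X' (g n p.1) p.2 :=
      measurable_from_prod_countable_right fun k => ((hX' (g n k)).mono (ℱ.le _)).measurable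
    exact (h1.comp (((hNm n).comp measurable_fst).prodMk measurable_snd)).stronglyMeasurable
  · refine stronglyMeasurable_limUnder (m := ℱ t.toNNReal) fun n => ?_
    exact (hX' _).mono (ℱ.mono ((Real.toNNReal_le_toNNReal (hgc n t)).trans (hct t)))
  · filter_upwards [hc, hXX'] with ω h1 h2 t ht
    have hctt : c t = t := by
      simp only [c]; rw [min_eq_left ht.2, max_eq_right ht.1]
    have h3 := (h1 t ht).tendsto.comp (hctt ▸ hglim t)
    refine Tendsto.limUnder_eq (h3.congr fun n => ?_)
    exact (h2 n (N n t) ⟨hg0 _ _, (hgc n t).trans (hcT t)⟩).symm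

lemma measurable_limUnder_sum {α : Type*} {m : MeasurableSpace α} {f : ℕ → α → ℝ}
    (hf : ∀ j, Measurable (f j)) :
    Measurable fun p => limUnder atTop fun n : ℕ => ∑ j ∈ Finset.range n, f j p :=
  (StronglyMeasurable.limUnder fun _ =>
    (Finset.measurable_fun_sum (Finset.range _) fun j _ => hf j).stronglyMeasurable).measurable

lemma measurable_limUnder_sum_prod {α β : Type*} {m : MeasurableSpace α} {m' : MeasurableSpace β}
    {c : ℕ → ℝ} {e : ℕ → β → ℝ} {f : ℕ → α → ℝ} (he : ∀ j, Measurable (e j))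
    (hf : ∀ j, Measurable (f j)) :
    Measurable fun p : α × β => limUnder atTop
      fun n : ℕ => ∑ j ∈ Finset.range n, c j * e j p.2 * f j p.1 :=
  measurable_limUnder_sum fun j =>
    (((he j).comp measurable_snd).const_mul _).mul ((hf j).comp measurable_fst)

end Version

variable {d : ℕ} {Ω : Type*} [mΩ : MeasurableSpace Ω]

/-- The σ-algebra generated by the increments of the Brownian motions after the time `s`. -/
@[reducible]
def Data.futureIncrements (D : Data d Ω) (s : ℝ≥0) : MeasurableSpace Ω :=
  ⨆ (j : ℕ) (q : ℝ≥0), MeasurableSpace.comap (fun ω => D.β j (s + q) ω - D.β j s ω) inferInstance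

namespace Standing

variable {D : Data d Ω}

section

variable (hD : Standing D)
include hD

lemma measurable_β (j : ℕ) (t : ℝ≥0) : Measurable (D.β j t) :=
  ((hD.brownian.adapted j t).mono (D.ℱ.le t)).measurable

lemma measurable_W (t : ℝ) : Measurable fun p : Ω × E d => D.W t p.1 p.2 :=
  measurable_limUnder_sum_prod measurable_e fun j => hD.measurable_β j _

lemma measurable_W_adapted (t : ℝ) :
    Measurable[(D.ℱ t.toNNReal).prod inferInstance] fun p : Ω × E d => D.W t p.1 p.2 :=
  measurable_limUnder_sum_prod (m := D.ℱ t.toNNReal) measurable_e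
    fun j => (hD.brownian.adapted j _).measurable

lemma measurable_W_point (t : ℝ) (ξ : E d) :
    Measurable[D.ℱ t.toNNReal] fun ω => D.W t ω ξ :=
  measurable_limUnder_sum (m := D.ℱ t.toNNReal)
    fun j => (hD.brownian.adapted j _).measurable.const_mul _

lemma ae_β_zero : ∀ᵐ ω ∂D.P, ∀ j, D.β j 0 ω = 0 :=
  ae_all_iff.2 fun j => (hD.brownian.brownian j).toIsPreBrownianReal.eval_zero_ae_eq_zero

lemma ae_W_zero : ∀ᵐ ω ∂D.P, ∀ ξ, D.W 0 ω ξ = 0 := by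
  filter_upwards [hD.ae_β_zero] with ω h ξ
  simp only [Data.W, Real.toNNReal_zero, h, mul_zero, Finset.sum_const_zero]
  exact tendsto_const_nhds.limUnder_eq

/-- The Wiener process has a version that is jointly measurable and adapted. -/
lemma exists_W_version : ∃ w : ℝ → Ω → E d → ℝ,
    Measurable (fun p : (ℝ × Ω) × E d => w p.1.1 p.1.2 p.2) ∧
    (∀ t, Measurable[(D.ℱ t.toNNReal).prod inferInstance] fun p : Ω × E d => w t p.1 p.2) ∧
    ∀ᵐ ω ∂D.P, ∀ t ∈ Icc 0 D.T, D.W t ω = w t ω := by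
  choose β' h1 h2 h3 using fun j => exists_adapted_version D.ℱ (P := D.P)
    (fun t ω => D.β j t.toNNReal ω) hD.T_pos.le
    (fun t _ => (hD.brownian.adapted j t.toNNReal).aestronglyMeasurable) (by
      filter_upwards [(hD.brownian.brownian j).cont] with ω hω t _
      exact (hω.comp continuous_real_toNNReal).continuousWithinAt)
  refine ⟨fun t ω ξ => limUnder atTop
    (fun n : ℕ => ∑ j ∈ Finset.range n, D.c j * D.e j ξ * β' j t ω), ?_, fun t => ?_, ?_⟩
  · exact measurable_limUnder_sum_prod (f := fun j (p : ℝ × Ω) => β' j p.1 p.2) measurable_e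
      fun j => (h1 j).measurable
  · exact measurable_limUnder_sum_prod (m := D.ℱ t.toNNReal) measurable_e
      fun j => (h2 j t).measurable
  · filter_upwards [ae_all_iff.2 h3] with ω hω t ht
    funext ξ
    simp only [Data.W]
    congr 1
    funext n
    exact Finset.sum_congr rfl fun j _ => by rw [hω j t ht]

end

variable [IsProbabilityMeasure D.P] (hD : Standing D)
include hD

/-- The exponential martingale property of the Wiener process, at a fixed point `ξ`. -/
lemma lintegral_exp_W_point {ξ : E d} (hξ : Summable fun j => D.c j ^ 2 * D.e j ξ ^ 2) (k : ℝ)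
    {s r : ℝ} (hs : 0 ≤ s) (hsr : s ≤ r) {c : Ω → ℝ≥0∞} (hc : Measurable[D.ℱ s.toNNReal] c) :
    ∫⁻ ω, ENNReal.ofReal (Real.exp (k * D.W r ω ξ)) * c ω ∂D.P =
      ∫⁻ ω, ENNReal.ofReal (Real.exp (k * D.W s ω ξ + k ^ 2 * D.μ ξ * (r - s))) * c ω ∂D.P := by
  let a : ℕ → ℝ := fun j => D.c j * D.e j ξ
  have ha : Summable fun j => a j ^ 2 := hξ.congr fun j => (mul_pow _ _ _).symm
  have haμ : ∑' j, a j ^ 2 = 2 * D.μ ξ := by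
    simp only [Data.μ, a, mul_pow]; ring
  let Y : ℕ → Ω → ℝ := fun j ω => D.β j r.toNNReal ω - D.β j s.toNNReal ω
  have hYm : ∀ j, Measurable (Y j) := fun j => (hD.measurable_β j _).sub (hD.measurable_β j _)
  have hYind : iIndepFun Y D.P := hD.brownian.independent.comp
    (fun _ b => b r.toNNReal - b s.toNNReal) fun j => by fun_prop
  have hYlaw : ∀ j, D.P.map (Y j) = gaussianReal 0 (r - s).toNNReal := by
    intro j
    have h := ((hD.brownian.brownian j).toIsPreBrownianReal.hasLaw_sub r.toNNReal s.toNNReal).map_eq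
    rw [show D.P.map (Y j) = D.P.map (D.β j r.toNNReal - D.β j s.toNNReal) from rfl, h]
    congr 1
    ext
    rw [Real.coe_toNNReal _ (by linarith), coe_nndist, Real.dist_eq]
    simp only [NNReal.val_eq_coe, Real.coe_toNNReal _ hs, Real.coe_toNNReal _ (hs.trans hsr)]
    exact abs_of_nonneg (by linarith)
  let L : Ω → ℝ := fun ω => limUnder atTop fun n => ∑ j ∈ Finset.range n, a j * Y j ω
  have hconv : ∀ t : ℝ≥0, ∀ᵐ ω ∂D.P, ∃ l, Tendsto
      (fun n => ∑ j ∈ Finset.range n, a j * D.β j t ω) atTop (𝓝 l) := fun t =>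
    ae_tendsto_gaussian_series (hD.measurable_β · t)
      (hD.brownian.independent.comp (fun _ b => b t) fun j => by fun_prop)
      (fun j => ((hD.brownian.brownian j).toIsPreBrownianReal.hasLaw_eval t).map_eq) ha
  have hsum : ∀ᵐ ω ∂D.P, D.W r ω ξ = D.W s ω ξ + L ω := by
    filter_upwards [hconv r.toNNReal, hconv s.toNNReal] with ω h1 h2
    have h1' := tendsto_nhds_limUnder h1
    have h2' := tendsto_nhds_limUnder h2
    have h3 : L ω = D.W r ω ξ - D.W s ω ξ := by
      refine Tendsto.limUnder_eq ((h1'.sub h2').congr fun n => ?_)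
      rw [← Finset.sum_sub_distrib]
      exact Finset.sum_congr rfl fun j _ => by simp only [Y]; ring
    rw [h3]; ring
  -- The increment is measurable with respect to the increments of the Brownian motions after `s`.
  have h𝒢 : D.futureIncrements s.toNNReal ≤ mΩ := iSup₂_le fun j q =>
    ((hD.measurable_β j _).sub (hD.measurable_β j _)).comap_le
  have hY𝒢 : ∀ j, Measurable[D.futureIncrements s.toNNReal] (Y j) := by
    intro j
    have h1 : r.toNNReal = s.toNNReal + (r - s).toNNReal := by
      rw [← Real.toNNReal_add hs (by linarith)]; congr 1; ring
    have h2 : Y j = fun ω => D.β j (s.toNNReal + (r - s).toNNReal) ω - D.β j s.toNNReal ω := by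
      funext ω; simp only [Y, h1]
    rw [h2]
    exact (comap_measurable _).mono (le_iSup₂_of_le (f := fun (j : ℕ) (q : ℝ≥0) =>
      MeasurableSpace.comap (fun ω => D.β j (s.toNNReal + q) ω - D.β j s.toNNReal ω) inferInstance)
      j (r - s).toNNReal le_rfl) le_rfl
  have hL𝒢 : Measurable[D.futureIncrements s.toNNReal] L :=
    measurable_limUnder_sum (m := D.futureIncrements s.toNNReal) fun j => (hY𝒢 j).const_mul _
  have hWs := hD.measurable_W_point s ξ
  have h1 : ∫⁻ ω, ENNReal.ofReal (Real.exp (k * D.W r ω ξ)) * c ω ∂D.P =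
      ∫⁻ ω, (ENNReal.ofReal (Real.exp (k * D.W s ω ξ)) * c ω) *
        ENNReal.ofReal (Real.exp (k * L ω)) ∂D.P := by
    refine lintegral_congr_ae ?_
    filter_upwards [hsum] with ω h
    rw [h, mul_add, Real.exp_add, ENNReal.ofReal_mul (Real.exp_pos _).le]
    ring
  -- Independence factors the expectation.
  have h2 := lintegral_mul_eq_lintegral_mul_lintegral_of_independent_measurableSpace
    (f := fun ω => ENNReal.ofReal (Real.exp (k * D.W s ω ξ)) * c ω)
    (g := fun ω => ENNReal.ofReal (Real.exp (k * L ω)))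
    (D.ℱ.le s.toNNReal) h𝒢 (hD.brownian.increments s.toNNReal)
    ((Real.measurable_exp.comp (hWs.const_mul k)).ennreal_ofReal.mul hc)
    ((Real.measurable_exp.comp (hL𝒢.const_mul k)).ennreal_ofReal)
  rw [h1, h2, lintegral_exp_gaussian_series hYm hYind hYlaw ha k, haμ, Real.coe_toNNReal _ (by linarith),
    ← lintegral_mul_const']
  · refine lintegral_congr fun ω => ?_
    rw [Real.exp_add, ENNReal.ofReal_mul (Real.exp_pos _).le,
      show k ^ 2 * (2 * D.μ ξ * (r - s)) / 2 = k ^ 2 * D.μ ξ * (r - s) by ring]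
    ring
  · exact ENNReal.ofReal_ne_top

/-- The exponential martingale property of the Wiener process, integrated over the domain. -/
lemma lintegral_exp_W (k : ℝ) {s r : ℝ} (hs : 0 ≤ s) (hsr : s ≤ r) {c : Ω → E d → ℝ≥0∞}
    (hc : Measurable[(D.ℱ s.toNNReal).prod inferInstance] fun p : Ω × E d => c p.1 p.2) :
    ∫⁻ ω, ∫⁻ ξ, ENNReal.ofReal (Real.exp (k * D.W r ω ξ)) * c ω ξ ∂(vol D.O) ∂D.P =
      ∫⁻ ω, ∫⁻ ξ, ENNReal.ofReal (Real.exp (k * D.W s ω ξ + k ^ 2 * D.μ ξ * (r - s))) * c ω ξ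
        ∂(vol D.O) ∂D.P := by
  have hle : (D.ℱ s.toNNReal).prod (inferInstance : MeasurableSpace (E d)) ≤
      mΩ.prod inferInstance := sup_le_sup_right (MeasurableSpace.comap_mono (D.ℱ.le _)) _
  have hc' : Measurable fun p : Ω × E d => c p.1 p.2 := hc.mono hle le_rfl
  have hWr := hD.measurable_W r
  have hWs := hD.measurable_W s
  have hμ : Measurable D.μ := measurable_μ
  have hm1 : Measurable fun p : Ω × E d =>
      ENNReal.ofReal (Real.exp (k * D.W r p.1 p.2)) * c p.1 p.2 :=
    (Real.measurable_exp.comp (hWr.const_mul k)).ennreal_ofReal.mul hc'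
  have hm2 : Measurable fun p : Ω × E d =>
      ENNReal.ofReal (Real.exp (k * D.W s p.1 p.2 + k ^ 2 * D.μ p.2 * (r - s))) * c p.1 p.2 := by
    refine (Real.measurable_exp.comp ?_).ennreal_ofReal.mul hc'
    exact (hWs.const_mul k).add (((hμ.comp measurable_snd).const_mul _).mul_const _)
  -- Fubini's theorem reduces the assertion to a fixed `ξ`.
  rw [lintegral_lintegral_swap hm1.aemeasurable]
  refine Eq.trans ?_ (lintegral_lintegral_swap hm2.aemeasurable).symm
  refine lintegral_congr_ae ?_
  filter_upwards [hD.ae_summable] with ξ hξ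
  refine hD.lintegral_exp_W_point hξ k hs hsr ?_
  exact @Measurable.comp _ _ _ (D.ℱ s.toNNReal) ((D.ℱ s.toNNReal).prod inferInstance) _ _ _ hc
    (@measurable_prodMk_right _ _ (D.ℱ s.toNNReal) _ ξ)

end Standing

end

section

/-! ### Multiplication by exponentials of the Wiener process -/

variable {d : ℕ} {Ω : Type*} [mΩ : MeasurableSpace Ω] {D : Data d Ω}

variable (D) in
/-- Multiplication by `e^{k W(t)}`. -/
def Data.ex (k t : ℝ) (ω : Ω) (z : D.H) : D.H := mul D.O (fun ξ => Real.exp (k * D.W t ω ξ)) z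

lemma expW_eq (t : ℝ) (ω : Ω) : D.expW t ω = D.ex 1 t ω := by
  funext z
  simp only [Data.expW, Data.ex, one_mul]

variable (D) in
/-- The properties of a path of the Wiener process that hold almost surely: it starts at zero
and it is bounded, uniformly in time and almost everywhere in the domain. -/
structure GoodPath (ω : Ω) : Prop where
  measurable : ∀ t, Measurable (D.W t ω)
  zero : ∀ ξ, D.W 0 ω ξ = 0
  bdd : ∃ C : ℝ, ∀ t ∈ Icc 0 D.T, ∀ᵐ ξ ∂(vol D.O), |D.W t ω ξ| ≤ C

lemma ae_abs_le_of_multiplier {O : Set (E d)} {m : E d → ℝ} {C : ℝ} (hm : Measurable m) (hC : 0 ≤ C)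
    (h : ∀ z : L2 O, eLpNorm (fun ξ => m ξ * z ξ) 2 (vol O) ≤ ENNReal.ofReal (C * ‖z‖)) :
    ∀ᵐ ξ ∂(vol O), |m ξ| ≤ C := by
  have h1 := ae_le_of_multiplier O hm (C := ENNReal.ofReal C) fun z => by
    rw [← ofReal_norm z, ← ENNReal.ofReal_mul hC]; exact h z
  filter_upwards [h1] with ξ hξ
  rw [← ofReal_norm, ENNReal.ofReal_le_ofReal_iff hC] at hξ
  exact hξ

lemma Standing.goodPath_of {ω : Ω} {Z : ℝ → ℝ} {B : ℝ}
    (hZ0 : ∀ t, 0 ≤ Z t) (hB : ∀ t ∈ Icc 0 D.T, Z t ≤ B) (h0 : ∀ ξ, D.W 0 ω ξ = 0)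
    (h1 : ∀ t ∈ Icc 0 D.T, ∀ σ ∈ ({1, -1} : Set ℝ), ∀ z : D.H,
        eLpNorm (fun ξ => Real.exp (σ * D.W t ω ξ) * z ξ) 2 (vol D.O) ≤
          ENNReal.ofReal (Z t * ‖z‖)) : GoodPath D ω := by
  have hm : ∀ t, Measurable (D.W t ω) := fun t =>
    measurable_limUnder_sum fun j => ((measurable_e j).const_mul _).mul_const _
  refine ⟨hm, h0, ⟨Real.log (max B 1), fun t ht => ?_⟩⟩
  have htB : Z t ≤ max B 1 := le_max_of_le_left (hB t ht)
  have hpos : (0 : ℝ) < max B 1 := lt_max_of_lt_right one_pos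
  have h3 : ∀ σ ∈ ({1, -1} : Set ℝ), ∀ᵐ ξ ∂(vol D.O), σ * D.W t ω ξ ≤ Real.log (max B 1) := by
    intro σ hσ
    have h4 : Measurable fun ξ => Real.exp (σ * D.W t ω ξ) :=
      Real.measurable_exp.comp ((hm t).const_mul σ)
    filter_upwards [ae_abs_le_of_multiplier h4 (hZ0 _) (h1 t ht σ hσ)] with ξ hξ
    rw [Real.le_log_iff_exp_le hpos]
    exact (le_abs_self _).trans (hξ.trans htB)
  filter_upwards [h3 1 (by simp), h3 (-1) (by simp)] with ξ h4 h5
  rw [abs_le]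
  constructor <;> linarith

lemma Standing.ae_goodPath (hD : Standing D) : ∀ᵐ ω ∂D.P, GoodPath D ω := by
  have hE := hD.expW
  rw [Data.ExpWMultiplier] at hE
  obtain ⟨⟨Z, -, hZ0, hZ⟩, -⟩ := hE
  filter_upwards [hZ, hD.ae_W_zero] with ω h1 h0
  obtain ⟨⟨B, hB⟩, h1⟩ := h1
  exact goodPath_of (Z := fun t => Z t.toNNReal ω) (fun t => hZ0 _ ω)
    (fun t ht => hB ⟨t.toNNReal, ⟨zero_le, Real.toNNReal_le_toNNReal ht.2⟩, rfl⟩) h0 h1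

namespace GoodPath

variable {ω : Ω} (h : GoodPath D ω)
include h

lemma ae_exp_le (k : ℝ) : ∃ C : ℝ, 0 ≤ C ∧ ∀ t ∈ Icc 0 D.T, ∀ᵐ ξ ∂(vol D.O),
    |Real.exp (k * D.W t ω ξ)| ≤ C := by
  obtain ⟨C, hC⟩ := h.bdd
  refine ⟨Real.exp (|k| * C), (Real.exp_pos _).le, fun t ht => ?_⟩
  filter_upwards [hC t ht] with ξ hξ
  rw [Real.abs_exp]
  refine Real.exp_le_exp.2 ((le_abs_self _).trans ?_)
  rw [abs_mul]
  gcongr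

lemma isMul_exp (k : ℝ) {t : ℝ} (ht : t ∈ Icc 0 D.T) :
    IsMul D.O fun ξ => Real.exp (k * D.W t ω ξ) := by
  obtain ⟨C, -, hC⟩ := h.ae_exp_le k
  exact ⟨(Real.measurable_exp.comp ((h.measurable t).const_mul k)).aestronglyMeasurable, C, hC t ht⟩

lemma norm_ex_le (k : ℝ) : ∃ C : ℝ, 0 ≤ C ∧ ∀ t ∈ Icc 0 D.T, ∀ z, ‖D.ex k t ω z‖ ≤ C * ‖z‖ := by
  obtain ⟨C, hC0, hC⟩ := h.ae_exp_le k
  exact ⟨C, hC0, fun t ht z => (h.isMul_exp k ht).norm_mul_le (hC t ht) z⟩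

omit h in
lemma ex_zero_left (t : ℝ) (z : D.H) : D.ex 0 t ω z = z := by
  simp only [Data.ex, zero_mul, Real.exp_zero]
  exact mul_one_eq z

lemma ex_time_zero (k : ℝ) (z : D.H) : D.ex k 0 ω z = z := by
  simp only [Data.ex, h.zero, mul_zero, Real.exp_zero]
  exact mul_one_eq z

lemma ex_ex (k l : ℝ) {t : ℝ} (ht : t ∈ Icc 0 D.T) (z : D.H) :
    D.ex k t ω (D.ex l t ω z) = D.ex (k + l) t ω z := by
  simp only [Data.ex]
  rw [(h.isMul_exp l ht).mul_mul]
  simp only [add_mul, Real.exp_add]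

lemma ex_neg_ex (k : ℝ) {t : ℝ} (ht : t ∈ Icc 0 D.T) (z : D.H) :
    D.ex (-k) t ω (D.ex k t ω z) = z := by
  rw [h.ex_ex _ _ ht, neg_add_cancel, ex_zero_left]

lemma ex_ex_neg (k : ℝ) {t : ℝ} (ht : t ∈ Icc 0 D.T) (z : D.H) :
    D.ex k t ω (D.ex (-k) t ω z) = z := by
  rw [h.ex_ex _ _ ht, add_neg_cancel, ex_zero_left]

lemma ex_add (k : ℝ) {t : ℝ} (ht : t ∈ Icc 0 D.T) (z w : D.H) :
    D.ex k t ω (z + w) = D.ex k t ω z + D.ex k t ω w := (h.isMul_exp k ht).map_add z w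

lemma ex_smul (k : ℝ) {t : ℝ} (ht : t ∈ Icc 0 D.T) (c : ℝ) (z : D.H) :
    D.ex k t ω (c • z) = c • D.ex k t ω z := (h.isMul_exp k ht).map_smul c z

lemma ex_neg (k : ℝ) {t : ℝ} (ht : t ∈ Icc 0 D.T) (z : D.H) :
    D.ex k t ω (-z) = -D.ex k t ω z := by
  simpa using h.ex_smul k ht (-1) z

lemma ex_sub (k : ℝ) {t : ℝ} (ht : t ∈ Icc 0 D.T) (z w : D.H) :
    D.ex k t ω (z - w) = D.ex k t ω z - D.ex k t ω w := by
  rw [sub_eq_add_neg, h.ex_add k ht, h.ex_neg k ht, sub_eq_add_neg]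

lemma inner_ex (k : ℝ) {t : ℝ} (ht : t ∈ Icc 0 D.T) (z w : D.H) :
    inner ℝ (D.ex k t ω z) w = inner ℝ z (D.ex k t ω w) := (h.isMul_exp k ht).inner_comm z w

lemma ex_mul (k : ℝ) {t : ℝ} (ht : t ∈ Icc 0 D.T) {m : E d → ℝ} (hm : IsMul D.O m) (z : D.H) :
    D.ex k t ω (mul D.O m z) = mul D.O m (D.ex k t ω z) := by
  simp only [Data.ex]
  rw [hm.mul_mul, (h.isMul_exp k ht).mul_mul]
  simp only [mul_comm]

end GoodPath

namespace Standing

variable (hD : Standing D)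

lemma ae_Q_goodPath (hD : Standing D) [IsProbabilityMeasure D.P] :
    ∀ᵐ p ∂D.Q, p.1 ∈ Ioc 0 D.T ∧ GoodPath D p.2 := by
  have h1 : ∀ᵐ p ∂D.Q, p.1 ∈ Ioc 0 D.T :=
    Measure.quasiMeasurePreserving_fst.ae (ae_restrict_mem measurableSet_Ioc)
  have h2 : ∀ᵐ p ∂D.Q, GoodPath D p.2 := Measure.quasiMeasurePreserving_snd.ae hD.ae_goodPath
  filter_upwards [h1, h2] with p h1 h2 using ⟨h1, h2⟩

include hD

/-- Multiplication by `e^{kW(t)}` preserves measurability at a fixed time. -/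
lemma aesm_ex (k t : ℝ) {y : Ω → D.H} (hy : AEStronglyMeasurable[D.ℱ t.toNNReal] y D.P) :
    AEStronglyMeasurable[D.ℱ t.toNNReal] (fun ω => D.ex k t ω (y ω)) D.P := by
  obtain ⟨y', hy', hyy'⟩ := hy
  refine ⟨fun ω => D.ex k t ω (y' ω), ?_, ?_⟩
  · exact stronglyMeasurable_mul D.O D.e (m := D.ℱ t.toNNReal)
      (g := fun ω ξ => Real.exp (k * D.W t ω ξ)) (Real.measurable_exp.comp ((hD.measurable_W_adapted t).const_mul k)) hy'
  · filter_upwards [hyy'] with ω h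
    rw [h]

variable [IsProbabilityMeasure D.P]

/-- Multiplication by `e^{kW}` preserves the existence of an adapted version. -/
lemma hasAdaptedVersion_ex (k : ℝ) {y : ℝ → Ω → D.H} (hy : D.HasAdaptedVersion y) :
    D.HasAdaptedVersion fun t ω => D.ex k t ω (y t ω) := by
  obtain ⟨w, hw1, hw2, hw3⟩ := hD.exists_W_version
  obtain ⟨y', h1, h2, h3⟩ := hy
  refine ⟨fun t ω => mul D.O (fun ξ => Real.exp (k * w t ω ξ)) (y' t ω), ?_, fun t ht => ?_, ?_⟩
  · exact stronglyMeasurable_mul D.O D.e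
      (g := fun (p : ℝ × Ω) ξ => Real.exp (k * w p.1 p.2 ξ)) (Real.measurable_exp.comp (hw1.const_mul k)) h1
  · exact stronglyMeasurable_mul D.O D.e (m := D.ℱ t.toNNReal)
      (g := fun ω ξ => Real.exp (k * w t ω ξ)) (Real.measurable_exp.comp ((hw2 t).const_mul k)) (h2 t ht)
  · filter_upwards [h3, hD.ae_Q_goodPath, Measure.quasiMeasurePreserving_snd.ae hw3]
      with p h4 h5 h6
    simp only [Data.ex]
    rw [h4, h6 p.1 (Ioc_subset_Icc_self h5.1)]

/-- Multiplication by `e^{kW}` preserves joint measurability. -/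
lemma aesm_Q_ex (k : ℝ) {y : ℝ → Ω → D.H}
    (hy : AEStronglyMeasurable (fun p : ℝ × Ω => y p.1 p.2) D.Q) :
    AEStronglyMeasurable (fun p : ℝ × Ω => D.ex k p.1 p.2 (y p.1 p.2)) D.Q := by
  obtain ⟨w, hw1, -, hw3⟩ := hD.exists_W_version
  obtain ⟨y', h1, h3⟩ := hy
  refine ⟨fun p => mul D.O (fun ξ => Real.exp (k * w p.1 p.2 ξ)) (y' p), ?_, ?_⟩
  · exact stronglyMeasurable_mul D.O D.e
      (g := fun (p : ℝ × Ω) ξ => Real.exp (k * w p.1 p.2 ξ)) (Real.measurable_exp.comp (hw1.const_mul k)) h1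
  · filter_upwards [h3, hD.ae_Q_goodPath, Measure.quasiMeasurePreserving_snd.ae hw3]
      with p h4 h5 h6
    simp only [Data.ex]
    rw [h4, h6 p.1 (Ioc_subset_Icc_self h5.1)]

end Standing

section AdaptedVersion

lemma hasAdaptedVersion_congr {y z : ℝ → Ω → D.H} (hy : D.HasAdaptedVersion y)
    (h : ∀ᵐ p ∂D.Q, z p.1 p.2 = y p.1 p.2) : D.HasAdaptedVersion z := by
  obtain ⟨y', h1, h2, h3⟩ := hy
  refine ⟨y', h1, h2, ?_⟩
  filter_upwards [h, h3] with p h h3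
  rw [h, h3]

lemma _root_.StochObstacle.Data.HasAdaptedVersion.aesm {y : ℝ → Ω → D.H}
    (hy : D.HasAdaptedVersion y) :
    AEStronglyMeasurable (fun p : ℝ × Ω => y p.1 p.2) D.Q := by
  obtain ⟨y', h1, -, h3⟩ := hy
  exact ⟨_, h1, h3⟩

lemma _root_.StochObstacle.Data.HasAdaptedVersion.ae_aesm [IsProbabilityMeasure D.P] {y : ℝ → Ω → D.H}
    (hy : D.HasAdaptedVersion y) : ∀ᵐ t ∂((volume : Measure ℝ).restrict (Ioc 0 D.T)),
      AEStronglyMeasurable[D.ℱ t.toNNReal] (y t) D.P := by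
  obtain ⟨y', h1, h2, h3⟩ := hy
  filter_upwards [Measure.ae_ae_of_ae_prod h3, ae_restrict_mem measurableSet_Ioc] with t h4 h5
  exact ⟨y' t, h2 t (Ioc_subset_Icc_self h5), h4⟩

/-- An almost everywhere limit of processes with adapted versions has an adapted version. -/
lemma hasAdaptedVersion_of_tendsto {y : ℕ → ℝ → Ω → D.H} {z : ℝ → Ω → D.H}
    (hy : ∀ n, D.HasAdaptedVersion (y n))
    (h : ∀ᵐ p ∂D.Q, Tendsto (fun n => y n p.1 p.2) atTop (𝓝 (z p.1 p.2))) :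
    D.HasAdaptedVersion z := by
  choose y' h1 h2 h3 using hy
  refine ⟨fun t ω => limUnder atTop fun n => y' n t ω, stronglyMeasurable_limUnder h1,
    fun t ht => stronglyMeasurable_limUnder (m := D.ℱ t.toNNReal) fun n => h2 n t ht, ?_⟩
  filter_upwards [h, ae_all_iff.2 h3] with p h4 h5
  simp only [h5] at h4
  exact h4.limUnder_eq.symm

lemma hasAdaptedVersion_map {y z : ℝ → Ω → D.H} (hy : D.HasAdaptedVersion y)
    (hz : D.HasAdaptedVersion z) {f : D.H × D.H → D.H} (hf : Continuous f) :
    D.HasAdaptedVersion fun t ω => f (y t ω, z t ω) := by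
  obtain ⟨y', h1, h2, h3⟩ := hy
  obtain ⟨z', h1', h2', h3'⟩ := hz
  refine ⟨fun t ω => f (y' t ω, z' t ω), hf.comp_stronglyMeasurable (h1.prodMk h1'),
    fun t ht => hf.comp_stronglyMeasurable ((h2 t ht).prodMk (h2' t ht)), ?_⟩
  filter_upwards [h3, h3'] with p h4 h5
  rw [h4, h5]

lemma hasAdaptedVersion_const (z : D.H) : D.HasAdaptedVersion fun _ _ => z :=
  ⟨fun _ _ => z, stronglyMeasurable_const,
    fun t _ => @stronglyMeasurable_const _ _ (D.ℱ t.toNNReal) _ _, Eventually.of_forall fun _ => rfl⟩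

variable (D) in
/-- The square integrable processes that have an adapted version. -/
def Data.adapted : Submodule ℝ (Lp D.H 2 D.Q) where
  carrier := {f | D.HasAdaptedVersion fun t ω => f (t, ω)}
  add_mem' := by
    intro f g hf hg
    rw [mem_ofPred_eq] at hf hg ⊢
    obtain ⟨y, h1, h2, h3⟩ := hasAdaptedVersion_map hf hg continuous_add
    refine ⟨y, h1, h2, ?_⟩
    filter_upwards [h3, Lp.coeFn_add f g] with p h4 h5
    rw [← h4, h5, Pi.add_apply]
  zero_mem' := by
    rw [mem_ofPred_eq]
    obtain ⟨y, h1, h2, h3⟩ := hasAdaptedVersion_const (D := D) 0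
    refine ⟨y, h1, h2, ?_⟩
    filter_upwards [h3, Lp.coeFn_zero D.H 2 D.Q] with p h4 h5
    rw [← h4, h5, Pi.zero_apply]
  smul_mem' := by
    intro c f hf
    rw [mem_ofPred_eq] at hf ⊢
    obtain ⟨y, h1, h2, h3⟩ := hasAdaptedVersion_map hf hf (f := fun p => c • p.1)
      (continuous_fst.const_smul c)
    refine ⟨y, h1, h2, ?_⟩
    filter_upwards [h3, Lp.coeFn_smul c f] with p h4 h5
    rw [← h4, h5, Pi.smul_apply]

lemma mem_adapted {f : Lp D.H 2 D.Q} :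
    f ∈ D.adapted ↔ D.HasAdaptedVersion fun t ω => f (t, ω) := by
  rw [← SetLike.mem_coe]
  exact Set.mem_ofPred_eq ▸ Iff.rfl

lemma isClosed_adapted : IsClosed (D.adapted : Set (Lp D.H 2 D.Q)) := by
  refine isClosed_of_closure_subset fun f hf => ?_
  obtain ⟨u, hu, huf⟩ := mem_closure_iff_seq_limit.1 hf
  obtain ⟨ns, -, hns⟩ := (tendstoInMeasure_of_tendsto_Lp huf).exists_seq_tendsto_ae
  exact mem_adapted.2 <| hasAdaptedVersion_of_tendsto (y := fun n t ω => u (ns n) (t, ω))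
    (fun n => mem_adapted.1 (hu (ns n))) hns

end AdaptedVersion

end

section

/-! ### The product rule for Sobolev paths -/

section ProductRule

variable {F₁ F₂ F₃ : Type*} [NormedAddCommGroup F₁] [NormedSpace ℝ F₁] [CompleteSpace F₁]
  [NormedAddCommGroup F₂] [NormedSpace ℝ F₂] [CompleteSpace F₂]
  [NormedAddCommGroup F₃] [NormedSpace ℝ F₃] [CompleteSpace F₃] {T : ℝ}

/-- The function `f` is absolutely continuous on `[0,T]` with integrable derivative `f'`. -/
structure IsPrimitive {F : Type*} [NormedAddCommGroup F] [NormedSpace ℝ F] (T : ℝ)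
    (f f' : ℝ → F) : Prop where
  integrable : IntegrableOn f' (Ioc 0 T)
  eq : ∀ t ∈ Icc 0 T, f t = f 0 + ∫ s in Ioc 0 t, f' s

omit [CompleteSpace F₁] in
lemma IsPrimitive.continuousOn {f f' : ℝ → F₁} (h : IsPrimitive T f f') :
    ContinuousOn f (Icc 0 T) := by
  have h1 : ContinuousOn (fun t => f 0 + ∫ s in Ioc 0 t, f' s) (Icc 0 T) :=
    continuousOn_const.add (intervalIntegral.continuousOn_primitive
      (h.integrable.congr_set_ae Ioc_ae_eq_Icc.symm))
  exact h1.congr h.eq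

omit [CompleteSpace F₁] [CompleteSpace F₂] [CompleteSpace F₃] in
/-- Products of a continuous and of an integrable function. -/
lemma integrableOn_bilin (B : F₁ →L[ℝ] F₂ →L[ℝ] F₃) {f : ℝ → F₁} {g : ℝ → F₂}
    (hf : ContinuousOn f (Icc 0 T)) (hg : IntegrableOn g (Ioc 0 T)) :
    IntegrableOn (fun s => B (f s) (g s)) (Ioc 0 T) := by
  obtain ⟨C, hC⟩ := isCompact_Icc.exists_bound_of_continuousOn hf
  refine Integrable.mono' (hg.norm.const_mul (‖B‖ * C)) ?_ ?_
  · exact B.aestronglyMeasurable_comp₂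
      ((hf.mono Ioc_subset_Icc_self).aestronglyMeasurable measurableSet_Ioc)
      hg.aestronglyMeasurable
  · filter_upwards [ae_restrict_mem measurableSet_Ioc] with s hs
    refine (B.le_opNorm₂ _ _).trans ?_
    gcongr
    exact hC s (Ioc_subset_Icc_self hs)

lemma setIntegral_Iic_Ioc {F : Type*} [NormedAddCommGroup F] [NormedSpace ℝ F] (g : ℝ → F)
    {s : ℝ} (hs : s ∈ Ioc 0 T) :
    ∫ u in Ioc 0 T, (Iic s).indicator g u = ∫ u in Ioc 0 s, g u := by
  rw [setIntegral_indicator measurableSet_Iic]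
  congr 2
  ext u
  simp only [mem_inter_iff, mem_Ioc, mem_Iic]
  exact ⟨fun h => ⟨h.1.1, h.2⟩, fun h => ⟨⟨h.1, h.2.trans hs.2⟩, h.2⟩⟩

/-- The product rule: the double integral of `B (f' s) (g' u)` over the square is split along the
diagonal. -/
lemma IsPrimitive.bilin_eq (B : F₁ →L[ℝ] F₂ →L[ℝ] F₃) {f f' : ℝ → F₁} {g g' : ℝ → F₂}
    (hT : 0 ≤ T) (hf : IsPrimitive T f f') (hg : IsPrimitive T g g') :
    B (f T) (g T) = B (f 0) (g 0) + ∫ s in Ioc 0 T, (B (f' s) (g s) + B (f s) (g' s)) := by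
  let m : Measure ℝ := (volume : Measure ℝ).restrict (Ioc 0 T)
  have hTT : T ∈ Icc 0 T := ⟨hT, le_rfl⟩
  have hk : Integrable (fun p : ℝ × ℝ => B (f' p.1) (g' p.2)) (m.prod m) := by
    refine Integrable.mono' ((hf.integrable.norm.mul_prod hg.integrable.norm).const_mul ‖B‖) ?_ ?_
    · exact B.aestronglyMeasurable_comp₂ hf.integrable.aestronglyMeasurable.comp_fst
        hg.integrable.aestronglyMeasurable.comp_snd
    · exact Eventually.of_forall fun p => by
        rw [← mul_assoc]; exact B.le_opNorm₂ _ _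
  have hS : MeasurableSet {p : ℝ × ℝ | p.2 ≤ p.1} := measurableSet_le measurable_snd measurable_fst
  have h1 := integral_add_compl hS hk
  -- The part below the diagonal.
  have h2 : ∫ p in {p : ℝ × ℝ | p.2 ≤ p.1}, B (f' p.1) (g' p.2) ∂(m.prod m) =
      ∫ s in Ioc 0 T, B (f' s) (g s - g 0) := by
    rw [← integral_indicator hS, integral_prod _ (hk.indicator hS)]
    refine setIntegral_congr_fun measurableSet_Ioc fun s hs => ?_
    have h3 : ∀ u, {p : ℝ × ℝ | p.2 ≤ p.1}.indicator (fun p : ℝ × ℝ => B (f' p.1) (g' p.2)) (s, u) =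
        B (f' s) ((Iic s).indicator g' u) := fun u => by
      by_cases hu : u ≤ s
      · rw [indicator_of_mem (by exact hu), indicator_of_mem (by exact hu)]
      · rw [indicator_of_notMem (by exact hu), indicator_of_notMem (by exact hu), map_zero]
    simp only [h3]
    rw [ContinuousLinearMap.integral_comp_comm _ (hg.integrable.indicator measurableSet_Iic),
      setIntegral_Iic_Ioc g' hs, hg.eq s (Ioc_subset_Icc_self hs), add_sub_cancel_left]
  -- The part above the diagonal; the diagonal itself is a null set.
  have h3 : ∫ p in {p : ℝ × ℝ | p.2 ≤ p.1}ᶜ, B (f' p.1) (g' p.2) ∂(m.prod m) =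
      ∫ s in Ioc 0 T, B (f s - f 0) (g' s) := by
    rw [← integral_indicator hS.compl, integral_prod_symm _ (hk.indicator hS.compl)]
    refine setIntegral_congr_fun measurableSet_Ioc fun u hu => ?_
    have h3 : (fun s => {p : ℝ × ℝ | p.2 ≤ p.1}ᶜ.indicator
        (fun p : ℝ × ℝ => B (f' p.1) (g' p.2)) (s, u)) =ᵐ[m]
        fun s => B.flip (g' u) ((Iic u).indicator f' s) := by
      have hne : ∀ᵐ s ∂m, s ≠ u := ae_restrict_of_ae (by simp [ae_iff] :
        ∀ᵐ s ∂(volume : Measure ℝ), s ≠ u)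
      filter_upwards [hne] with s hs
      by_cases hu : u ≤ s
      · rw [indicator_of_notMem (by simpa using hu), indicator_of_notMem (by
          simp only [mem_Iic, not_le]; exact lt_of_le_of_ne hu hs.symm), map_zero]
      · rw [indicator_of_mem (by simpa using hu), indicator_of_mem (by
          simp only [mem_Iic]; exact (not_le.1 hu).le)]
        rfl
    rw [integral_congr_ae h3, ContinuousLinearMap.integral_comp_comm _
      (hf.integrable.indicator measurableSet_Iic),
      setIntegral_Iic_Ioc f' hu, hf.eq u (Ioc_subset_Icc_self hu), add_sub_cancel_left]
    rfl
  have h4 : ∫ p, B (f' p.1) (g' p.2) ∂(m.prod m) = B (f T - f 0) (g T - g 0) := by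
    rw [integral_prod _ hk]
    have : ∀ s, ∫ u, B (f' s) (g' u) ∂m = B.flip (∫ u, g' u ∂m) (f' s) := fun s => by
      rw [ContinuousLinearMap.integral_comp_comm _ hg.integrable]; rfl
    simp only [this]
    rw [ContinuousLinearMap.integral_comp_comm _ hf.integrable, hf.eq T hTT, hg.eq T hTT,
      add_sub_cancel_left, add_sub_cancel_left]
    rfl
  rw [h2, h3, h4] at h1
  have i1 : IntegrableOn (fun s => B (f' s) (g s)) (Ioc 0 T) :=
    integrableOn_bilin B.flip hg.continuousOn hf.integrable
  have i2 : IntegrableOn (fun s => B (f s) (g' s)) (Ioc 0 T) :=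
    integrableOn_bilin B hf.continuousOn hg.integrable
  have i3 : IntegrableOn (fun s => B (f' s) (g 0)) (Ioc 0 T) :=
    (B.flip (g 0)).integrable_comp hf.integrable
  have i4 : IntegrableOn (fun s => B (f 0) (g' s)) (Ioc 0 T) :=
    (B (f 0)).integrable_comp hg.integrable
  have h5 : ∫ s in Ioc 0 T, B (f' s) (g 0) = B (f T - f 0) (g 0) := by
    rw [show (fun s => B (f' s) (g 0)) = fun s => B.flip (g 0) (f' s) from rfl,
      ContinuousLinearMap.integral_comp_comm _ hf.integrable, hf.eq T hTT, add_sub_cancel_left]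
    rfl
  have h6 : ∫ s in Ioc 0 T, B (f 0) (g' s) = B (f 0) (g T - g 0) := by
    rw [ContinuousLinearMap.integral_comp_comm _ hg.integrable, hg.eq T hTT, add_sub_cancel_left]
  simp only [map_sub, _root_.sub_apply] at h1 h5 h6
  rw [integral_sub i1 i3, integral_sub i2 i4, h5, h6] at h1
  rw [integral_add i1 i2]
  linear_combination (norm := module) (-1 : ℝ) • h1

omit [CompleteSpace F₁] in
lemma IsPrimitive.mono {f f' : ℝ → F₁} {t : ℝ} (ht : t ≤ T) (h : IsPrimitive T f f') :
    IsPrimitive t f f' :=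
  ⟨h.integrable.mono_set (Ioc_subset_Ioc_right ht), fun s hs => h.eq s ⟨hs.1, hs.2.trans ht⟩⟩

lemma IsPrimitive.bilin (B : F₁ →L[ℝ] F₂ →L[ℝ] F₃) {f f' : ℝ → F₁} {g g' : ℝ → F₂}
    (hf : IsPrimitive T f f') (hg : IsPrimitive T g g') :
    IsPrimitive T (fun s => B (f s) (g s)) (fun s => B (f' s) (g s) + B (f s) (g' s)) :=
  ⟨(integrableOn_bilin B.flip hg.continuousOn hf.integrable).add
    (integrableOn_bilin B hf.continuousOn hg.integrable),
    fun _ ht => (hf.mono ht.2).bilin_eq B ht.1 (hg.mono ht.2)⟩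

end ProductRule

section Multiplier

variable {d : ℕ} {O : Set (E d)}

lemma IsMul.mul {m n : E d → ℝ} (hm : IsMul O m) (hn : IsMul O n) : IsMul O fun ξ => m ξ * n ξ := by
  obtain ⟨h1, C, hC⟩ := hm
  obtain ⟨h2, C', hC'⟩ := hn
  refine ⟨h1.mul h2, C * C', ?_⟩
  filter_upwards [hC, hC'] with ξ h h'
  rw [abs_mul]
  exact mul_le_mul h h' (abs_nonneg _) ((abs_nonneg _).trans h)

lemma IsMul.exp {m : E d → ℝ} (hm : IsMul O m) : IsMul O fun ξ => Real.exp (m ξ) := by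
  obtain ⟨h1, C, hC⟩ := hm
  refine ⟨Real.continuous_exp.comp_aestronglyMeasurable h1, Real.exp C, ?_⟩
  filter_upwards [hC] with ξ h
  rw [Real.abs_exp]
  exact Real.exp_le_exp.2 ((le_abs_self _).trans h)

/-- The multiplication operators with `n e^{tm}` are differentiable in the operator norm. -/
lemma IsMul.hasDerivAt_exp {m n : E d → ℝ} (hm : IsMul O m) (hn : IsMul O n) (t : ℝ) :
    HasDerivAt (fun t : ℝ => (hn.mul (hm.const_mul t).exp).toCLM)
      ((hn.mul (hm.const_mul t).exp).toCLM ∘L hm.toCLM) t := by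
  obtain ⟨C, hC⟩ := (hn.mul (hm.const_mul t).exp).2
  obtain ⟨M, hM⟩ := hm.2
  rw [hasDerivAt_iff_isLittleO]
  refine Asymptotics.IsBigO.trans_isLittleO (g := fun s : ℝ => |s - t| ^ 2) ?_ ?_
  · refine Asymptotics.IsBigO.of_bound (|C| * M ^ 2) ?_
    have hnear : ∀ᶠ s in 𝓝 t, |s - t| * |M| < 1 := by
      have : Tendsto (fun s => |s - t| * |M|) (𝓝 t) (𝓝 (|t - t| * |M|)) :=
        Continuous.tendsto (by fun_prop) t
      rw [sub_self, abs_zero, zero_mul] at this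
      exact this.eventually_lt_const one_pos
    filter_upwards [hnear] with s hs
    refine ContinuousLinearMap.opNorm_le_bound _ (by positivity) fun z => ?_
    -- The remainder of the linear approximation is the multiplication by `w`.
    let w : E d → ℝ := fun ξ => n ξ * Real.exp (t * m ξ) *
      (Real.exp ((s - t) * m ξ) + (-1) * (1 + (s - t) * m ξ))
    have hw : IsMul O w := (hn.mul (hm.const_mul t).exp).mul ((hm.const_mul (s - t)).exp.add
      (((IsMul.const 1).add (hm.const_mul (s - t))).const_mul (-1)))
    have h1 : ((hn.mul (hm.const_mul s).exp).toCLM - (hn.mul (hm.const_mul t).exp).toCLM -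
        (s - t) • (hn.mul (hm.const_mul t).exp).toCLM ∘L hm.toCLM) z = StochObstacle.mul O w z := by
      have h2 : (hn.mul (hm.const_mul t).exp).toCLM (hm.toCLM z) =
          StochObstacle.mul O (fun ξ => n ξ * Real.exp (t * m ξ) * m ξ) z := by
        rw [toCLM_apply, toCLM_apply, hm.mul_mul]
      simp only [_root_.sub_apply, _root_.smul_apply,
        ContinuousLinearMap.comp_apply, h2]
      rw [toCLM_apply, toCLM_apply, ← ((hn.mul (hm.const_mul t).exp).mul hm).map_smul]
      refine Lp.ext ?_
      filter_upwards [Lp.coeFn_sub (StochObstacle.mul O (fun ξ => n ξ * Real.exp (s * m ξ)) z -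
        StochObstacle.mul O (fun ξ => n ξ * Real.exp (t * m ξ)) z)
        (StochObstacle.mul O (fun ξ => n ξ * Real.exp (t * m ξ) * m ξ) ((s - t) • z)),
        Lp.coeFn_sub (StochObstacle.mul O (fun ξ => n ξ * Real.exp (s * m ξ)) z)
        (StochObstacle.mul O (fun ξ => n ξ * Real.exp (t * m ξ)) z),
        (hn.mul (hm.const_mul s).exp).mul_ae z, (hn.mul (hm.const_mul t).exp).mul_ae z,
        ((hn.mul (hm.const_mul t).exp).mul hm).mul_ae ((s - t) • z), hw.mul_ae z,
        Lp.coeFn_smul (s - t) z] with ξ e1 e2 e3 e4 e5 e6 e7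
      rw [e1, Pi.sub_apply, e2, Pi.sub_apply, e3, e4, e5, e6, e7, Pi.smul_apply, smul_eq_mul]
      simp only [w]
      have : Real.exp (s * m ξ) = Real.exp (t * m ξ) * Real.exp ((s - t) * m ξ) := by
        rw [← Real.exp_add]; congr 1; ring
      rw [this]
      ring
    rw [h1, Real.norm_eq_abs, abs_pow, abs_abs]
    refine hw.norm_mul_le ?_ z
    filter_upwards [hC, hM] with ξ h2 h3
    have h4 : |(s - t) * m ξ| ≤ 1 := by
      rw [abs_mul]
      exact le_trans (mul_le_mul_of_nonneg_left (h3.trans (le_abs_self M)) (abs_nonneg _)) hs.le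
    have h5 := Real.abs_exp_sub_one_sub_id_le h4
    simp only [w]
    rw [abs_mul, show Real.exp ((s - t) * m ξ) + (-1) * (1 + (s - t) * m ξ) =
      Real.exp ((s - t) * m ξ) - 1 - (s - t) * m ξ by ring]
    calc _ ≤ |C| * ((s - t) * m ξ) ^ 2 :=
          mul_le_mul (h2.trans (le_abs_self C)) h5 (abs_nonneg _) (abs_nonneg _)
      _ ≤ _ := by
          rw [mul_pow, ← sq_abs (m ξ), ← sq_abs (s - t), mul_assoc, mul_comm (|s - t| ^ 2)]
          gcongr
  · exact (Asymptotics.isLittleO_pow_sub_sub t one_lt_two).congr_left fun s => by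
      rw [Real.norm_eq_abs]

lemma IsMul.isPrimitive_exp {m n : E d → ℝ} (hm : IsMul O m) (hn : IsMul O n) (T : ℝ) :
    IsPrimitive T (fun t : ℝ => (hn.mul (hm.const_mul t).exp).toCLM)
      (fun t : ℝ => (hn.mul (hm.const_mul t).exp).toCLM ∘L hm.toCLM) := by
  have hd := hm.hasDerivAt_exp hn
  have hc : Continuous fun t : ℝ => (hn.mul (hm.const_mul t).exp).toCLM :=
    continuous_iff_continuousAt.2 fun t => (hd t).continuousAt
  have hc' : Continuous fun t : ℝ => (hn.mul (hm.const_mul t).exp).toCLM ∘L hm.toCLM :=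
    hc.clm_comp continuous_const
  refine ⟨hc'.integrableOn_Ioc, fun t ht => ?_⟩
  have := intervalIntegral.integral_eq_sub_of_hasDerivAt (a := 0) (b := t) (fun s _ => hd s)
    (hc'.intervalIntegrable _ _)
  rw [intervalIntegral.integral_of_le ht.1] at this
  rw [this]; abel

end Multiplier

end

section

variable {d : ℕ} {Ω : Type*} [mΩ : MeasurableSpace Ω] {D : Data d Ω}

lemma aesm_rep {O : Set (E d)} {α : Type*} {m m₀ : MeasurableSpace α} {P : Measure[m₀] α}
    {y : α → L2 O} (hy : AEStronglyMeasurable[m] y P) :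
    ∃ f : α × E d → ℝ, Measurable[m.prod inferInstance] f ∧
      ∀ᵐ a ∂P, ∀ᵐ ξ ∂(vol O), f (a, ξ) = y a ξ := by
  obtain ⟨y', h1, h2⟩ := hy
  refine ⟨fun p => rep O (y' p.1) p.2, measurable_rep_comp (m := m) O h1, ?_⟩
  filter_upwards [h2] with a ha
  filter_upwards [rep_ae O (y' a)] with ξ hξ
  rw [hξ, ha]

lemma lintegral_enorm_mul_le {O : Set (E d)} (z w : L2 O) :
    ∫⁻ ξ, ‖z ξ * w ξ‖ₑ ∂(vol O) ≤ ‖z‖ₑ * ‖w‖ₑ := by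
  have h := ENNReal.lintegral_mul_le_Lp_mul_Lq (vol O) Real.HolderConjugate.two_two
    (Lp.aestronglyMeasurable z).enorm (Lp.aestronglyMeasurable w).enorm
  simp only [Pi.mul_apply] at h
  simp only [enorm_mul]
  refine h.trans (le_of_eq ?_)
  rw [Lp.enorm_def, Lp.enorm_def, eLpNorm_eq_lintegral_rpow_enorm_toReal (by norm_num) (by norm_num),
    eLpNorm_eq_lintegral_rpow_enorm_toReal (by norm_num) (by norm_num)]
  simp

namespace Standing

variable [IsProbabilityMeasure D.P] (hD : Standing D)
include hD

/-- The exponential martingale property for integrable functions. -/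
lemma integral_exp_W (k : ℝ) {s r : ℝ} (hs : 0 ≤ s) (hsr : s ≤ r) {c : Ω × E d → ℝ}
    (hc : Measurable[(D.ℱ s.toNNReal).prod inferInstance] c)
    (hi : ∫⁻ ω, ∫⁻ ξ, ENNReal.ofReal (Real.exp (k * D.W s ω ξ)) * ‖c (ω, ξ)‖ₑ ∂(vol D.O) ∂D.P < ∞) :
    ∫⁻ ω, ∫⁻ ξ, ENNReal.ofReal (Real.exp (k * D.W r ω ξ - k ^ 2 * D.μ ξ * (r - s))) * ‖c (ω, ξ)‖ₑ
      ∂(vol D.O) ∂D.P =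
      ∫⁻ ω, ∫⁻ ξ, ENNReal.ofReal (Real.exp (k * D.W s ω ξ)) * ‖c (ω, ξ)‖ₑ ∂(vol D.O) ∂D.P ∧
    ∫ ω, ∫ ξ, Real.exp (k * D.W r ω ξ - k ^ 2 * D.μ ξ * (r - s)) * c (ω, ξ) ∂(vol D.O) ∂D.P =
      ∫ ω, ∫ ξ, Real.exp (k * D.W s ω ξ) * c (ω, ξ) ∂(vol D.O) ∂D.P := by
  have hle : (D.ℱ s.toNNReal).prod (inferInstance : MeasurableSpace (E d)) ≤
      mΩ.prod inferInstance := sup_le_sup_right (MeasurableSpace.comap_mono (D.ℱ.le _)) _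
  have hc' : Measurable c := hc.mono hle le_rfl
  -- The factor `e^{-k²μ(r-s)}` does not depend on `ω`, so it may be moved into the data at time `s`.
  have key : ∀ f : Ω × E d → ℝ≥0∞, Measurable[(D.ℱ s.toNNReal).prod inferInstance] f →
      ∫⁻ ω, ∫⁻ ξ, ENNReal.ofReal (Real.exp (k * D.W r ω ξ - k ^ 2 * D.μ ξ * (r - s))) * f (ω, ξ)
        ∂(vol D.O) ∂D.P =
      ∫⁻ ω, ∫⁻ ξ, ENNReal.ofReal (Real.exp (k * D.W s ω ξ)) * f (ω, ξ) ∂(vol D.O) ∂D.P := by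
    intro f hf
    have h1 : Measurable[(D.ℱ s.toNNReal).prod inferInstance] fun p : Ω × E d =>
        ENNReal.ofReal (Real.exp (-(k ^ 2 * D.μ p.2 * (r - s)))) * f p := by
      refine Measurable.mul (Measurable.ennreal_ofReal (Real.measurable_exp.comp ?_)) hf
      exact (((measurable_μ.comp measurable_snd).const_mul _).mul_const _).neg
    have h2 := hD.lintegral_exp_W k hs hsr
      (c := fun ω ξ => ENNReal.ofReal (Real.exp (-(k ^ 2 * D.μ ξ * (r - s)))) * f (ω, ξ)) h1
    simp only [← mul_assoc, ← ENNReal.ofReal_mul (Real.exp_pos _).le, ← Real.exp_add,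
      add_neg_cancel_right] at h2
    simpa only [sub_eq_add_neg] using h2
  have hm : ∀ {g : Ω × E d → ℝ} (_ : Measurable g) {f : Ω × E d → ℝ≥0∞} (_ : Measurable f),
      ∫⁻ ω, ∫⁻ ξ, ENNReal.ofReal (Real.exp (g (ω, ξ))) * f (ω, ξ) ∂(vol D.O) ∂D.P =
      ∫⁻ p, ENNReal.ofReal (Real.exp (g p)) * f p ∂(D.P.prod (vol D.O)) := by
    intro g hg f hf
    exact (lintegral_prod _ (Measurable.aemeasurable
      ((Real.measurable_exp.comp hg).ennreal_ofReal.mul hf))).symm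
  have hgr : Measurable fun p : Ω × E d => k * D.W r p.1 p.2 - k ^ 2 * D.μ p.2 * (r - s) :=
    ((hD.measurable_W r).const_mul k).sub
      (((measurable_μ.comp measurable_snd).const_mul _).mul_const _)
  have hgs : Measurable fun p : Ω × E d => k * D.W s p.1 p.2 := (hD.measurable_W s).const_mul k
  have hkey := key (fun p => ‖c p‖ₑ) (measurable_enorm.comp hc)
  have hcp : Measurable[(D.ℱ s.toNNReal).prod inferInstance] fun p => ENNReal.ofReal (c p) :=
    ENNReal.measurable_ofReal.comp hc
  have hcn : Measurable[(D.ℱ s.toNNReal).prod inferInstance] fun p => ENNReal.ofReal (-c p) :=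
    ENNReal.measurable_ofReal.comp (measurable_neg.comp hc)
  refine ⟨hkey, ?_⟩
  have hint : ∀ {g : Ω × E d → ℝ} (_ : Measurable g),
      ∫⁻ ω, ∫⁻ ξ, ENNReal.ofReal (Real.exp (g (ω, ξ))) * ‖c (ω, ξ)‖ₑ ∂(vol D.O) ∂D.P < ∞ →
      Integrable (fun p => Real.exp (g p) * c p) (D.P.prod (vol D.O)) := by
    intro g hg h
    refine ⟨((Real.measurable_exp.comp hg).mul hc').aestronglyMeasurable, ?_⟩
    rw [hm hg hc'.enorm] at h
    refine lt_of_le_of_lt (lintegral_mono fun p => ?_) h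
    rw [enorm_mul, ← ofReal_norm, Real.norm_eq_abs, Real.abs_exp]
  have ir := hint hgr (hkey ▸ hi)
  have is := hint hgs hi
  -- The positive and negative parts of `c` are treated separately.
  have hpart : ∀ {g : Ω × E d → ℝ} (_ : Measurable g),
      Integrable (fun p => Real.exp (g p) * c p) (D.P.prod (vol D.O)) →
      ∫ ω, ∫ ξ, Real.exp (g (ω, ξ)) * c (ω, ξ) ∂(vol D.O) ∂D.P =
      (∫⁻ ω, ∫⁻ ξ, ENNReal.ofReal (Real.exp (g (ω, ξ))) * ENNReal.ofReal (c (ω, ξ))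
        ∂(vol D.O) ∂D.P).toReal -
      (∫⁻ ω, ∫⁻ ξ, ENNReal.ofReal (Real.exp (g (ω, ξ))) * ENNReal.ofReal (-c (ω, ξ))
        ∂(vol D.O) ∂D.P).toReal := by
    intro g hg h
    rw [hm hg (hcp.mono hle le_rfl), hm hg (hcn.mono hle le_rfl), ← integral_prod _ h,
      integral_eq_lintegral_pos_part_sub_lintegral_neg_part h]
    simp only [← ENNReal.ofReal_mul (Real.exp_pos _).le, mul_neg]
  rw [hpart hgr ir, hpart hgs is, key _ hcp, key _ hcn]

/-- Multiplication by `e^{kW}` increases the second moment by a bounded factor between the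
times `s` and `r`. -/
lemma lintegral_ex_sq_le {s r : ℝ} (hs : 0 ≤ s) (hsr : s ≤ r) (hr : r ≤ D.T) {y : Ω → D.H}
    (hy : AEStronglyMeasurable[D.ℱ s.toNNReal] y D.P) :
    ∫⁻ ω, ‖D.ex 1 r ω (y ω)‖ₑ ^ 2 ∂D.P ≤
      ENNReal.ofReal (Real.exp (2 * D.ν * (r - s))) * ∫⁻ ω, ‖D.ex 1 s ω (y ω)‖ₑ ^ 2 ∂D.P := by
  obtain ⟨f, hf, hfy⟩ := aesm_rep (m := D.ℱ s.toNNReal) hy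
  have h1 : ∀ t ∈ Icc 0 D.T, ∫⁻ ω, ‖D.ex 1 t ω (y ω)‖ₑ ^ 2 ∂D.P =
      ∫⁻ ω, ∫⁻ ξ, ENNReal.ofReal (Real.exp (2 * D.W t ω ξ)) * ‖f (ω, ξ)‖ₑ ^ 2 ∂(vol D.O) ∂D.P := by
    intro t ht
    refine lintegral_congr_ae ?_
    filter_upwards [hfy, hD.ae_goodPath] with ω h2 h3
    rw [Lp.enorm_def, eLpNorm_eq_lintegral_rpow_enorm_toReal (by norm_num) (by norm_num),
      ← ENNReal.rpow_natCast, ← ENNReal.rpow_mul]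
    norm_num
    refine lintegral_congr_ae ?_
    filter_upwards [h2, (h3.isMul_exp 1 ht).mul_ae (y ω)] with ξ h4 h5
    rw [Data.ex, h5, h4, enorm_mul, mul_pow, ← ofReal_norm (Real.exp _), Real.norm_eq_abs,
      Real.abs_exp, ← ENNReal.ofReal_pow (Real.exp_pos _).le, ← Real.exp_nat_mul]
    norm_num
  have hT : s ∈ Icc 0 D.T := ⟨hs, hsr.trans hr⟩
  rw [h1 r ⟨hs.trans hsr, hr⟩, h1 s hT, hD.lintegral_exp_W 2 hs hsr
    (c := fun ω ξ => ‖f (ω, ξ)‖ₑ ^ 2) ((measurable_enorm.comp hf).pow_const 2),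
    ← lintegral_const_mul' _ _ ENNReal.ofReal_ne_top]
  refine lintegral_mono fun ω => ?_
  rw [← lintegral_const_mul' _ _ ENNReal.ofReal_ne_top]
  refine lintegral_mono_ae ?_
  filter_upwards [hD.ae_μ_le] with ξ hξ
  rw [← mul_assoc, ← ENNReal.ofReal_mul (Real.exp_pos _).le, ← Real.exp_add]
  gcongr ENNReal.ofReal (Real.exp ?_) * _
  nlinarith [mul_le_mul_of_nonneg_right hξ (sub_nonneg.2 hsr)]

variable (D) in
omit hD [IsProbabilityMeasure D.P] in
/-- The multiplier `e^{kW(T) - k²μ(T-s)}`, whose conditional expectation at time `s` is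
`e^{kW(s)}`. -/
def _root_.StochObstacle.Data.mart (k s : ℝ) (ω : Ω) (z : D.H) : D.H :=
  mul D.O (fun ξ => Real.exp (k * D.W D.T ω ξ - k ^ 2 * D.μ ξ * (D.T - s))) z

omit [IsProbabilityMeasure D.P] in
lemma isMul_mart {ω : Ω} (h : GoodPath D ω) (k s : ℝ) :
    IsMul D.O fun ξ => Real.exp (k * D.W D.T ω ξ - k ^ 2 * D.μ ξ * (D.T - s)) := by
  obtain ⟨C, hC⟩ := h.bdd
  have h1 : IsMul D.O (D.W D.T ω) :=
    ⟨(h.measurable D.T).aestronglyMeasurable, C, hC D.T ⟨hD.T_pos.le, le_rfl⟩⟩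
  have h2 := ((h1.const_mul k).add (hD.isMul_μ.const_mul (-(k ^ 2 * (D.T - s))))).exp
  convert h2 using 4
  ring

/-- The martingale property at the level of `L²(O)`: in the expectation of a scalar product with
data known at time `s`, the multiplier `e^{kW(T) - k²μ(T-s)}` may be replaced by `e^{kW(s)}`. -/
lemma integral_mart {k σ : ℝ} (hk : k = 1 + σ) {s : ℝ} (hs : s ∈ Icc 0 D.T) {z w : Ω → D.H}
    (hz : AEStronglyMeasurable[D.ℱ s.toNNReal] z D.P)
    (hw : AEStronglyMeasurable[D.ℱ s.toNNReal] w D.P)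
    (hi : ∫⁻ ω, ‖D.ex 1 s ω (z ω)‖ₑ * ‖D.ex σ s ω (w ω)‖ₑ ∂D.P < ∞) :
    ∫⁻ ω, ‖(inner ℝ (D.mart k s ω (z ω)) (w ω) : ℝ)‖ₑ ∂D.P ≤
      ∫⁻ ω, ‖D.ex 1 s ω (z ω)‖ₑ * ‖D.ex σ s ω (w ω)‖ₑ ∂D.P ∧
    ∫ ω, inner ℝ (D.mart k s ω (z ω)) (w ω) ∂D.P =
      ∫ ω, inner ℝ (D.ex 1 s ω (z ω)) (D.ex σ s ω (w ω)) ∂D.P := by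
  obtain ⟨f, hf, hfz⟩ := aesm_rep (m := D.ℱ s.toNNReal) hz
  obtain ⟨g, hg, hgw⟩ := aesm_rep (m := D.ℱ s.toNNReal) hw
  have hfg : Measurable[(D.ℱ s.toNNReal).prod inferInstance] fun p => f p * g p := hf.mul hg
  have h1 : ∫⁻ ω, ∫⁻ ξ, ENNReal.ofReal (Real.exp (k * D.W s ω ξ)) * ‖f (ω, ξ) * g (ω, ξ)‖ₑ
      ∂(vol D.O) ∂D.P ≤ ∫⁻ ω, ‖D.ex 1 s ω (z ω)‖ₑ * ‖D.ex σ s ω (w ω)‖ₑ ∂D.P := by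
    refine lintegral_mono_ae ?_
    filter_upwards [hfz, hgw, hD.ae_goodPath] with ω h2 h3 h4
    refine le_trans (le_of_eq ?_) (lintegral_enorm_mul_le _ _)
    refine lintegral_congr_ae ?_
    filter_upwards [h2, h3, (h4.isMul_exp 1 hs).mul_ae (z ω), (h4.isMul_exp σ hs).mul_ae (w ω)]
      with ξ h5 h6 h7 h8
    rw [Data.ex, Data.ex, h7, h8, h5, h6, hk, add_mul, Real.exp_add,
      ← abs_of_pos (mul_pos (Real.exp_pos (1 * D.W s ω ξ)) (Real.exp_pos (σ * D.W s ω ξ))),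
      ← Real.norm_eq_abs, ofReal_norm, ← enorm_mul]
    congr 1
    ring
  have h2 := hD.integral_exp_W k hs.1 hs.2 hfg (h1.trans_lt hi)
  refine ⟨le_trans ?_ (h2.1.le.trans h1), ?_⟩
  · refine lintegral_mono_ae ?_
    filter_upwards [hfz, hgw, hD.ae_goodPath] with ω h3 h4 h5
    rw [Data.mart, (hD.isMul_mart h5 k s).inner_eq]
    refine (enorm_integral_le_lintegral_enorm _).trans (le_of_eq (lintegral_congr_ae ?_))
    filter_upwards [h3, h4] with ξ h6 h7
    rw [h6, h7, mul_assoc, enorm_mul, ← ofReal_norm (Real.exp _), Real.norm_eq_abs, Real.abs_exp]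
  · refine Eq.trans ?_ (h2.2.trans ?_)
    · refine integral_congr_ae ?_
      filter_upwards [hfz, hgw, hD.ae_goodPath] with ω h3 h4 h5
      rw [Data.mart, (hD.isMul_mart h5 k s).inner_eq]
      refine integral_congr_ae ?_
      filter_upwards [h3, h4] with ξ h6 h7
      rw [h6, h7, mul_assoc]
    · refine integral_congr_ae ?_
      filter_upwards [hfz, hgw, hD.ae_goodPath] with ω h3 h4 h5
      rw [← h5.inner_ex σ hs, h5.ex_ex _ _ hs, add_comm σ 1, ← hk, Data.ex,
        (h5.isMul_exp k hs).inner_eq]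
      refine integral_congr_ae ?_
      filter_upwards [h3, h4] with ξ h6 h7
      rw [h6, h7, mul_assoc]

end Standing

end

section

/-! ### Itô's product rule in expectation -/

variable {d : ℕ} {Ω : Type*} [mΩ : MeasurableSpace Ω] {D : Data d Ω}

namespace Standing

variable [IsProbabilityMeasure D.P] (hD : Standing D)

section

omit [IsProbabilityMeasure D.P]

lemma mart_terminal (k : ℝ) (ω : Ω) (z : D.H) : D.mart k D.T ω z = D.ex k D.T ω z := by
  simp only [Data.mart, Data.ex, sub_self, mul_zero, sub_zero]

include hD in
/-- The product rule along a path, with the multiplier `e^{kW(T) - k²μ(T-t)}`. -/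
lemma mart_product {ω : Ω} (h : GoodPath D ω) (k : ℝ) {a a' b b' : ℝ → D.H}
    (ha : IsPrimitive D.T a a') (hb : IsPrimitive D.T b b') :
    inner ℝ (D.ex k D.T ω (a D.T)) (b D.T) = inner ℝ (D.mart k 0 ω (a 0)) (b 0) +
      ∫ s in Ioc 0 D.T, (inner ℝ (D.mart k s ω (a' s)) (b s) + inner ℝ (D.mart k s ω (a s)) (b' s) +
        inner ℝ (D.mart k s ω (mul D.O (fun ξ => k ^ 2 * D.μ ξ) (a s))) (b s)) := by
  -- Along a path, `W(T)` is fixed, so that `t ↦ e^{kW(T) - k²μ(T-t)}` is smooth with derivative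
  -- `k²μ e^{kW(T) - k²μ(T-t)}`.
  have hm := hD.isMul_μ.const_mul (k ^ 2)
  have hn := hD.isMul_mart h k 0
  have hR : ∀ (s : ℝ) (z : D.H), (hn.mul (hm.const_mul s).exp).toCLM z = D.mart k s ω z := by
    intro s z
    rw [IsMul.toCLM_apply, Data.mart]
    congr 1
    funext ξ
    rw [← Real.exp_add]
    congr 1
    ring
  have h1 := (hm.isPrimitive_exp hn D.T).bilin
    (ContinuousLinearMap.id ℝ (D.H →L[ℝ] D.H)) ha
  have hin : ∀ u v : D.H, (innerSL ℝ : D.H →L[ℝ] D.H →L[ℝ] ℝ) u v = inner ℝ u v := fun _ _ => rfl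
  have h2 := h1.bilin_eq (innerSL ℝ : D.H →L[ℝ] D.H →L[ℝ] ℝ) hD.T_pos.le hb
  simp only [ContinuousLinearMap.id_apply, ContinuousLinearMap.comp_apply, hR, hin,
    inner_add_left, IsMul.toCLM_apply hm, mart_terminal] at h2
  rw [h2]
  congr 1
  refine integral_congr_ae (Eventually.of_forall fun s => ?_)
  simp only
  ring

end

include hD

omit [IsProbabilityMeasure D.P] in
lemma aesm_Q_mart (k : ℝ) {y : ℝ → Ω → D.H}
    (hy : AEStronglyMeasurable (fun p : ℝ × Ω => y p.1 p.2) D.Q) :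
    AEStronglyMeasurable (fun p : ℝ × Ω => D.mart k p.1 p.2 (y p.1 p.2)) D.Q := by
  obtain ⟨y', h1, h3⟩ := hy
  refine ⟨fun p => D.mart k p.1 p.2 (y' p), ?_, ?_⟩
  · refine stronglyMeasurable_mul D.O D.e (g := fun (p : ℝ × Ω) ξ =>
      Real.exp (k * D.W D.T p.2 ξ - k ^ 2 * D.μ ξ * (D.T - p.1))) (Real.measurable_exp.comp ?_) h1
    have h4 : Measurable fun q : (ℝ × Ω) × E d => D.W D.T q.1.2 q.2 :=
      measurable_limUnder_sum fun j => (((measurable_e j).comp measurable_snd).const_mul _).mul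
        ((hD.measurable_β j _).comp (measurable_snd.comp measurable_fst))
    exact (h4.const_mul k).sub (((measurable_μ.comp measurable_snd).const_mul _).mul
      ((measurable_fst.comp measurable_fst).const_sub _))
  · filter_upwards [h3] with p h4
    rw [h4]

/-- The martingale property for processes on `(0,T) × Ω`. -/
lemma integral_mart_Q {k σ : ℝ} (hk : k = 1 + σ) {z w : ℝ → Ω → D.H}
    (hz : D.HasAdaptedVersion z) (hw : D.HasAdaptedVersion w)
    (hz2 : MemLp (fun p : ℝ × Ω => D.ex 1 p.1 p.2 (z p.1 p.2)) 2 D.Q)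
    (hw2 : MemLp (fun p : ℝ × Ω => D.ex σ p.1 p.2 (w p.1 p.2)) 2 D.Q) :
    Integrable (fun p : ℝ × Ω => (inner ℝ (D.mart k p.1 p.2 (z p.1 p.2)) (w p.1 p.2) : ℝ)) D.Q ∧
    Integrable (fun p : ℝ × Ω =>
      (inner ℝ (D.ex 1 p.1 p.2 (z p.1 p.2)) (D.ex σ p.1 p.2 (w p.1 p.2)) : ℝ)) D.Q ∧
    ∫ p, inner ℝ (D.mart k p.1 p.2 (z p.1 p.2)) (w p.1 p.2) ∂D.Q =
      ∫ p, inner ℝ (D.ex 1 p.1 p.2 (z p.1 p.2)) (D.ex σ p.1 p.2 (w p.1 p.2)) ∂D.Q := by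
  have hm : AEStronglyMeasurable
      (fun p : ℝ × Ω => (inner ℝ (D.mart k p.1 p.2 (z p.1 p.2)) (w p.1 p.2) : ℝ)) D.Q :=
    (hD.aesm_Q_mart k hz.aesm).inner hw.aesm
  have hzw : Integrable (fun p : ℝ × Ω =>
      ‖D.ex 1 p.1 p.2 (z p.1 p.2)‖ * ‖D.ex σ p.1 p.2 (w p.1 p.2)‖) D.Q :=
    hz2.norm.integrable_mul hw2.norm
  have i2 : Integrable (fun p : ℝ × Ω =>
      (inner ℝ (D.ex 1 p.1 p.2 (z p.1 p.2)) (D.ex σ p.1 p.2 (w p.1 p.2)) : ℝ)) D.Q :=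
    hzw.mono' (hz2.aestronglyMeasurable.inner hw2.aestronglyMeasurable)
      (Eventually.of_forall fun p => norm_inner_le_norm _ _)
  have hfin : ∫⁻ p, ‖D.ex 1 p.1 p.2 (z p.1 p.2)‖ₑ * ‖D.ex σ p.1 p.2 (w p.1 p.2)‖ₑ ∂D.Q < ∞ := by
    have := hzw.2
    simpa only [HasFiniteIntegral, enorm_mul, enorm_norm] using this
  have hmeas : AEMeasurable
      (fun p : ℝ × Ω => ‖D.ex 1 p.1 p.2 (z p.1 p.2)‖ₑ * ‖D.ex σ p.1 p.2 (w p.1 p.2)‖ₑ) D.Q :=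
    hz2.aestronglyMeasurable.enorm.mul hw2.aestronglyMeasurable.enorm
  rw [lintegral_prod _ hmeas] at hfin
  have hae : ∀ᵐ t ∂((volume : Measure ℝ).restrict (Ioc 0 D.T)),
      ∫⁻ ω, ‖(inner ℝ (D.mart k t ω (z t ω)) (w t ω) : ℝ)‖ₑ ∂D.P ≤
      ∫⁻ ω, ‖D.ex 1 t ω (z t ω)‖ₑ * ‖D.ex σ t ω (w t ω)‖ₑ ∂D.P ∧
    ∫ ω, inner ℝ (D.mart k t ω (z t ω)) (w t ω) ∂D.P =
      ∫ ω, inner ℝ (D.ex 1 t ω (z t ω)) (D.ex σ t ω (w t ω)) ∂D.P := by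
    filter_upwards [hz.ae_aesm, hw.ae_aesm, ae_lt_top' hmeas.lintegral_prod_right' hfin.ne,
      ae_restrict_mem measurableSet_Ioc] with t h1 h2 h3 h4
    exact hD.integral_mart hk (Ioc_subset_Icc_self h4) h1 h2 h3
  have i1 : Integrable
      (fun p : ℝ × Ω => (inner ℝ (D.mart k p.1 p.2 (z p.1 p.2)) (w p.1 p.2) : ℝ)) D.Q := by
    refine ⟨hm, ?_⟩
    rw [HasFiniteIntegral, lintegral_prod _ hm.enorm]
    exact lt_of_le_of_lt (lintegral_mono_ae (hae.mono fun t h => h.1)) hfin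
  refine ⟨i1, i2, ?_⟩
  rw [integral_prod _ i1, integral_prod _ i2]
  exact integral_congr_ae (hae.mono fun t h => h.2)

/-- Itô's product rule for `e^{kW}` and Sobolev paths, in expectation: the drift `k²μ` is the one
produced by the exponential of the Wiener process. -/
lemma product_rule {k σ : ℝ} (hk : k = 1 + σ) {a a' b b' : ℝ → Ω → D.H}
    (ha : D.HasAdaptedVersion a) (ha' : D.HasAdaptedVersion a')
    (hb : D.HasAdaptedVersion b) (hb' : D.HasAdaptedVersion b')
    (ha2 : MemLp (fun p : ℝ × Ω => D.ex 1 p.1 p.2 (a p.1 p.2)) 2 D.Q)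
    (ha'2 : MemLp (fun p : ℝ × Ω => D.ex 1 p.1 p.2 (a' p.1 p.2)) 2 D.Q)
    (hb2 : MemLp (fun p : ℝ × Ω => D.ex σ p.1 p.2 (b p.1 p.2)) 2 D.Q)
    (hb'2 : MemLp (fun p : ℝ × Ω => D.ex σ p.1 p.2 (b' p.1 p.2)) 2 D.Q)
    (hpath : ∀ᵐ ω ∂D.P, IsPrimitive D.T (a · ω) (a' · ω) ∧ IsPrimitive D.T (b · ω) (b' · ω))
    (ha0 : AEStronglyMeasurable[D.ℱ 0] (a 0) D.P) (hb0 : AEStronglyMeasurable[D.ℱ 0] (b 0) D.P)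
    (h0 : ∫⁻ ω, ‖a 0 ω‖ₑ * ‖b 0 ω‖ₑ ∂D.P < ∞) :
    Integrable (fun p : ℝ × Ω =>
      (inner ℝ (D.ex 1 p.1 p.2 (a' p.1 p.2)) (D.ex σ p.1 p.2 (b p.1 p.2)) : ℝ)) D.Q ∧
    Integrable (fun p : ℝ × Ω =>
      (inner ℝ (D.ex 1 p.1 p.2 (a p.1 p.2)) (D.ex σ p.1 p.2 (b' p.1 p.2)) : ℝ)) D.Q ∧
    Integrable (fun p : ℝ × Ω => (inner ℝ (mul D.O (fun ξ => k ^ 2 * D.μ ξ)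
      (D.ex 1 p.1 p.2 (a p.1 p.2))) (D.ex σ p.1 p.2 (b p.1 p.2)) : ℝ)) D.Q ∧
    ∫ ω, inner ℝ (D.ex 1 D.T ω (a D.T ω)) (D.ex σ D.T ω (b D.T ω)) ∂D.P =
      ∫ ω, inner ℝ (a 0 ω) (b 0 ω) ∂D.P +
      (∫ p, inner ℝ (D.ex 1 p.1 p.2 (a' p.1 p.2)) (D.ex σ p.1 p.2 (b p.1 p.2)) ∂D.Q +
      ∫ p, inner ℝ (D.ex 1 p.1 p.2 (a p.1 p.2)) (D.ex σ p.1 p.2 (b' p.1 p.2)) ∂D.Q +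
      ∫ p, inner ℝ (mul D.O (fun ξ => k ^ 2 * D.μ ξ)
        (D.ex 1 p.1 p.2 (a p.1 p.2))) (D.ex σ p.1 p.2 (b p.1 p.2)) ∂D.Q) := by
  have hm := hD.isMul_μ.const_mul (k ^ 2)
  let c : ℝ → Ω → D.H := fun t ω => mul D.O (fun ξ => k ^ 2 * D.μ ξ) (a t ω)
  have hc : D.HasAdaptedVersion c := hasAdaptedVersion_map ha ha
    (f := fun p => mul D.O (fun ξ => k ^ 2 * D.μ ξ) p.1) (hm.toCLM.continuous.comp continuous_fst)
  have hce : ∀ᵐ p ∂D.Q, mul D.O (fun ξ => k ^ 2 * D.μ ξ) (D.ex 1 p.1 p.2 (a p.1 p.2)) =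
      D.ex 1 p.1 p.2 (c p.1 p.2) := by
    filter_upwards [hD.ae_Q_goodPath] with p hp
    exact (hp.2.ex_mul 1 (Ioc_subset_Icc_self hp.1) hm _).symm
  have hc2 : MemLp (fun p : ℝ × Ω => D.ex 1 p.1 p.2 (c p.1 p.2)) 2 D.Q :=
    (memLp_congr_ae hce).1 (hm.toCLM.comp_memLp' ha2)
  obtain ⟨i1, j1, e1⟩ := hD.integral_mart_Q hk ha' hb ha'2 hb2
  obtain ⟨i2, j2, e2⟩ := hD.integral_mart_Q hk ha hb' ha2 hb'2
  obtain ⟨i3, j3, e3⟩ := hD.integral_mart_Q hk hc hb hc2 hb2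
  have hce' : ∀ᵐ p ∂D.Q, (inner ℝ (D.ex 1 p.1 p.2 (c p.1 p.2)) (D.ex σ p.1 p.2 (b p.1 p.2)) : ℝ) =
      inner ℝ (mul D.O (fun ξ => k ^ 2 * D.μ ξ)
        (D.ex 1 p.1 p.2 (a p.1 p.2))) (D.ex σ p.1 p.2 (b p.1 p.2)) := by
    filter_upwards [hce] with p hp
    rw [hp]
  refine ⟨j1, j2, j3.congr hce', ?_⟩
  have hT0 : (0 : ℝ) ∈ Icc 0 D.T := ⟨le_rfl, hD.T_pos.le⟩
  have hTT : D.T ∈ Icc 0 D.T := ⟨hD.T_pos.le, le_rfl⟩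
  have e00 : ∀ᵐ ω ∂D.P, ∀ k z, D.ex k 0 ω z = z := by
    filter_upwards [hD.ae_goodPath] with ω h k z using h.ex_time_zero k z
  have h0' : ∫⁻ ω, ‖D.ex 1 0 ω (a 0 ω)‖ₑ * ‖D.ex σ 0 ω (b 0 ω)‖ₑ ∂D.P < ∞ := by
    refine lt_of_le_of_lt (le_of_eq (lintegral_congr_ae ?_)) h0
    filter_upwards [e00] with ω h
    rw [h, h]
  have hz : D.ℱ (0 : ℝ).toNNReal = D.ℱ 0 := by rw [Real.toNNReal_zero]
  obtain ⟨l0, e0⟩ := hD.integral_mart hk hT0 (z := a 0) (w := b 0) (hz ▸ ha0) (hz ▸ hb0) h0'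
  have e0' : ∫ ω, inner ℝ (D.mart k 0 ω (a 0 ω)) (b 0 ω) ∂D.P = ∫ ω, inner ℝ (a 0 ω) (b 0 ω) ∂D.P := by
    rw [e0]
    refine integral_congr_ae ?_
    filter_upwards [e00] with ω h
    rw [h, h]
  have i0 : Integrable (fun ω => (inner ℝ (D.mart k 0 ω (a 0 ω)) (b 0 ω) : ℝ)) D.P := by
    refine ⟨?_, l0.trans_lt h0'⟩
    obtain ⟨y', h1, h3⟩ := ha0.mono (D.ℱ.le 0)
    refine AEStronglyMeasurable.inner ⟨fun ω => D.mart k 0 ω (y' ω), ?_, ?_⟩ (hb0.mono (D.ℱ.le 0))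
    · refine stronglyMeasurable_mul D.O D.e (g := fun ω ξ =>
        Real.exp (k * D.W D.T ω ξ - k ^ 2 * D.μ ξ * (D.T - 0))) (Real.measurable_exp.comp ?_) h1
      exact ((hD.measurable_W D.T).const_mul k).sub
        (((measurable_μ.comp measurable_snd).const_mul _).mul_const _)
    · filter_upwards [h3] with ω h4
      rw [h4]
  have i123 : Integrable (fun p : ℝ × Ω =>
      (inner ℝ (D.mart k p.1 p.2 (a' p.1 p.2)) (b p.1 p.2) : ℝ) +
        inner ℝ (D.mart k p.1 p.2 (a p.1 p.2)) (b' p.1 p.2) +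
        inner ℝ (D.mart k p.1 p.2 (c p.1 p.2)) (b p.1 p.2)) D.Q := (i1.add i2).add i3
  have i5 : Integrable (fun ω => ∫ s in Ioc 0 D.T,
        ((inner ℝ (D.mart k s ω (a' s ω)) (b s ω) : ℝ) + inner ℝ (D.mart k s ω (a s ω)) (b' s ω) +
        inner ℝ (D.mart k s ω (c s ω)) (b s ω))) D.P := i123.integral_prod_right
  -- The deterministic product rule along the paths. In the expectation, the martingale property then
  -- replaces the anticipating multiplier by `e^{kW(s)}` in each term.
  have hL : ∫ ω, inner ℝ (D.ex 1 D.T ω (a D.T ω)) (D.ex σ D.T ω (b D.T ω)) ∂D.P =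
      ∫ ω, ((inner ℝ (D.mart k 0 ω (a 0 ω)) (b 0 ω) : ℝ) + ∫ s in Ioc 0 D.T,
        (inner ℝ (D.mart k s ω (a' s ω)) (b s ω) + inner ℝ (D.mart k s ω (a s ω)) (b' s ω) +
        inner ℝ (D.mart k s ω (c s ω)) (b s ω))) ∂D.P := by
    refine integral_congr_ae ?_
    filter_upwards [hpath, hD.ae_goodPath] with ω h h2
    rw [← hD.mart_product h2 k h.1 h.2, ← h2.inner_ex σ hTT, h2.ex_ex _ _ hTT, add_comm σ 1, ← hk]
  have i12 : Integrable (fun p : ℝ × Ω =>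
      (inner ℝ (D.mart k p.1 p.2 (a' p.1 p.2)) (b p.1 p.2) : ℝ) +
        inner ℝ (D.mart k p.1 p.2 (a p.1 p.2)) (b' p.1 p.2)) D.Q := i1.add i2
  have e4 := integral_prod_symm _ i123
  rw [hL, integral_add i0 i5, e0', ← e4, integral_add i12 i3, integral_add i1 i2, e1, e2, e3,
    integral_congr_ae hce']

end Standing

end

section

/-! ### Sobolev paths in a Hilbert space -/

section Sobolev

variable {H : Type*} [NormedAddCommGroup H] [InnerProductSpace ℝ H] {T : ℝ}

lemma W12.eval_eq (θ : W12 H T) {t : ℝ} (ht : t ≤ T) :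
    θ.eval t = θ.fst + ∫ s in Ioc 0 t, θ.snd s := by
  rw [W12.eval, Measure.restrict_restrict measurableSet_Ioc,
    inter_eq_left.2 (Ioc_subset_Ioc_right ht)]

lemma W12.eval_time_zero (θ : W12 H T) : θ.eval 0 = θ.fst := by
  simp [W12.eval]

lemma W12.isPrimitive (θ : W12 H T) : IsPrimitive T θ.eval θ.snd :=
  ⟨θ.integrable_snd, fun t ht => by rw [θ.eval_eq ht.2, θ.eval_time_zero]⟩

omit [InnerProductSpace ℝ H] in
lemma W12.norm_fst_le (θ : W12 H T) : ‖θ.fst‖ ≤ ‖θ‖ := by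
  refine le_of_sq_le_sq ?_ (norm_nonneg _)
  rw [WithLp.prod_norm_sq_eq_of_L2]
  nlinarith [sq_nonneg ‖θ.snd‖]

omit [InnerProductSpace ℝ H] in
lemma W12.norm_snd_le (θ : W12 H T) : ‖θ.snd‖ ≤ ‖θ‖ := by
  refine le_of_sq_le_sq ?_ (norm_nonneg _)
  rw [WithLp.prod_norm_sq_eq_of_L2]
  nlinarith [sq_nonneg ‖θ.fst‖]

/-- The Sobolev space is embedded in the space of bounded functions. -/
lemma W12.norm_eval_le (hT : 0 ≤ T) (θ : W12 H T) (t : ℝ) :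
    ‖θ.eval t‖ ≤ (1 + Real.sqrt T) * ‖θ‖ := by
  have h1 : ‖∫ s in Ioc 0 t, θ.snd s ∂((volume : Measure ℝ).restrict (Ioc 0 T))‖ ≤
      ∫ s in Ioc 0 T, ‖θ.snd s‖ := by
    refine (norm_integral_le_integral_norm _).trans ?_
    exact setIntegral_le_integral θ.integrable_snd.norm (Eventually.of_forall fun _ => norm_nonneg _)
  have h2 : ∫ s in Ioc 0 T, ‖θ.snd s‖ ≤ Real.sqrt T * ‖θ.snd‖ := by
    have h3 := eLpNorm_le_eLpNorm_mul_rpow_measure_univ (p := 1) (q := 2) (by norm_num)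
      (Lp.aestronglyMeasurable θ.snd)
    rw [Measure.restrict_apply_univ, Real.volume_Ioc, sub_zero] at h3
    have h4 := ENNReal.toReal_mono (ENNReal.mul_ne_top (Lp.eLpNorm_ne_top _)
      (ENNReal.rpow_ne_top_of_nonneg (by norm_num) ENNReal.ofReal_ne_top)) h3
    rw [ENNReal.toReal_mul, ← Lp.norm_def, ← ENNReal.toReal_rpow, ENNReal.toReal_ofReal hT,
      eLpNorm_one_eq_lintegral_enorm, ← integral_norm_eq_lintegral_enorm
        (Lp.aestronglyMeasurable θ.snd)] at h4
    refine h4.trans (le_of_eq ?_)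
    rw [mul_comm, Real.sqrt_eq_rpow]
    norm_num
  rw [W12.eval]
  refine (norm_add_le _ _).trans ?_
  rw [add_mul, one_mul]
  refine add_le_add θ.norm_fst_le ((h1.trans h2).trans ?_)
  gcongr
  exact θ.norm_snd_le

/-- Lebesgue's theorem: the difference quotients from the left converge to the derivative. -/
lemma IsPrimitive.ae_tendsto_quotient [CompleteSpace H] {f f' : ℝ → H} (h : IsPrimitive T f f')
    (hT : 0 ≤ T) : ∀ᵐ t ∂((volume : Measure ℝ).restrict (Ioc 0 T)),
      Tendsto (fun n : ℕ => ((n : ℝ) + 1) • (f t - f (t - 1 / ((n : ℝ) + 1)))) atTop (𝓝 (f' t)) := by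
  have h1 : IntervalIntegrable f' volume 0 T := (intervalIntegrable_iff_integrableOn_Ioc_of_le hT).2
    h.integrable
  have h2 := h1.ae_hasDerivAt_integral
  rw [ae_restrict_iff' measurableSet_Ioc]
  filter_upwards [h2] with t h2 ht
  have h3 := h2 (by rw [uIcc_of_le hT]; exact Ioc_subset_Icc_self ht) 0 (by simp [hT])
  have h4 : Tendsto (fun n : ℕ => t - 1 / ((n : ℝ) + 1)) atTop (𝓝 t) := by
    simpa using tendsto_const_nhds.sub (tendsto_one_div_add_atTop_nhds_zero_nat (𝕜 := ℝ))
  have h5 := (hasDerivAt_iff_tendsto_slope.1 h3).comp (f := fun n : ℕ => t - 1 / ((n : ℝ) + 1))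
    (x := atTop) (tendsto_nhdsWithin_iff.2 ⟨h4, Eventually.of_forall fun n => by
      simp only [mem_compl_iff, mem_singleton_iff]
      have : (0 : ℝ) < 1 / ((n : ℝ) + 1) := by positivity
      linarith⟩)
  refine h5.congr' ?_
  filter_upwards [h4.eventually (lt_mem_nhds ht.1)] with n hn
  have h6 : t - 1 / ((n : ℝ) + 1) ≤ T := by
    have : (0 : ℝ) < 1 / ((n : ℝ) + 1) := by positivity
    linarith [ht.2]
  simp only [Function.comp_apply, slope, vsub_eq_sub]
  rw [h.eq t (Ioc_subset_Icc_self ht), h.eq _ ⟨hn.le, h6⟩, intervalIntegral.integral_of_le hn.le,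
    intervalIntegral.integral_of_le ht.1.le, sub_sub_cancel_left, add_sub_add_left_eq_sub,
    ← neg_sub (∫ s in Ioc 0 t, f' s), smul_neg, ← neg_smul]
  congr 1
  rw [inv_neg, neg_neg, one_div, inv_inv]

end Sobolev

end

section

variable {d : ℕ} {Ω : Type*} [mΩ : MeasurableSpace Ω] {D : Data d Ω}

omit mΩ in
lemma aesm_const {m m₀ : MeasurableSpace Ω} {P : Measure[m₀] Ω} {F : Type*} [TopologicalSpace F]
    (z : F) : AEStronglyMeasurable[m] (fun _ => z) P :=
  ⟨_, @stronglyMeasurable_const _ _ m _ z, ae_of_all _ fun _ => rfl⟩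

lemma EI_congr {f g : ℝ → Ω → ℝ}
    (h : ∀ᵐ ω ∂D.P, ∀ᵐ t ∂((volume : Measure ℝ).restrict (Ioc 0 D.T)), f t ω = g t ω) :
    D.EI f = D.EI g :=
  integral_congr_ae (h.mono fun _ h => integral_congr_ae h)

section

variable [IsProbabilityMeasure D.P]

lemma EI_eq {f : ℝ → Ω → ℝ} (h : Integrable (fun p : ℝ × Ω => f p.1 p.2) D.Q) :
    D.EI f = ∫ p, f p.1 p.2 ∂D.Q := (integral_prod_symm _ h).symm

lemma EIpos_eq {f : ℝ → Ω → ℝ≥0∞} (h : AEMeasurable (fun p : ℝ × Ω => f p.1 p.2) D.Q) :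
    D.EIpos f = ∫⁻ p, f p.1 p.2 ∂D.Q := (lintegral_prod_symm _ h).symm

lemma ae_ae_of_ae_Q {p : ℝ × Ω → Prop} (h : ∀ᵐ z ∂D.Q, p z) :
    ∀ᵐ ω ∂D.P, ∀ᵐ t ∂((volume : Measure ℝ).restrict (Ioc 0 D.T)), p (t, ω) := by
  have h1 : ∀ᵐ z ∂(D.P.prod ((volume : Measure ℝ).restrict (Ioc 0 D.T))), p z.swap := by
    have h2 : ∀ᵐ z ∂((D.P.prod ((volume : Measure ℝ).restrict (Ioc 0 D.T))).map Prod.swap), p z := by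
      rw [Measure.prod_swap]; exact h
    exact ae_of_ae_map measurable_swap.aemeasurable h2
  exact Measure.ae_ae_of_ae_prod h1

lemma lintegral_enorm_sq_lt_top {α F : Type*} {m : MeasurableSpace α} [NormedAddCommGroup F]
    {P : Measure α} {f : α → F} (hf : MemLp f 2 P) : ∫⁻ a, ‖f a‖ₑ ^ 2 ∂P < ∞ := by
  have := (eLpNorm_lt_top_iff_lintegral_rpow_enorm_lt_top (by norm_num) (by norm_num)).1 hf.2
  simpa using this

lemma memLp_two_of_lintegral {α F : Type*} {m : MeasurableSpace α} [NormedAddCommGroup F]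
    {P : Measure α} {f : α → F} (hf : AEStronglyMeasurable f P) (h : ∫⁻ a, ‖f a‖ₑ ^ 2 ∂P < ∞) :
    MemLp f 2 P := by
  refine ⟨hf, (eLpNorm_lt_top_iff_lintegral_rpow_enorm_lt_top (by norm_num) (by norm_num)).2 ?_⟩
  simpa using h

end

namespace Standing

variable [IsProbabilityMeasure D.P] (hD : Standing D)
include hD

lemma lintegral_ex_const_le {t : ℝ} (ht : t ∈ Icc 0 D.T) (z : D.H) :
    ∫⁻ ω, ‖D.ex 1 t ω z‖ₑ ^ 2 ∂D.P ≤ ENNReal.ofReal (Real.exp (2 * D.ν * D.T)) * ‖z‖ₑ ^ 2 := by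
  have h0 := hD.lintegral_ex_sq_le (s := 0) (r := t) le_rfl ht.1 ht.2 (y := fun _ => z)
    (aesm_const z)
  refine h0.trans ?_
  have h1 : ∫⁻ ω, ‖D.ex 1 0 ω z‖ₑ ^ 2 ∂D.P = ‖z‖ₑ ^ 2 := by
    have : ∫⁻ ω, ‖D.ex 1 0 ω z‖ₑ ^ 2 ∂D.P = ∫⁻ _, ‖z‖ₑ ^ 2 ∂D.P := by
      refine lintegral_congr_ae ?_
      filter_upwards [hD.ae_goodPath] with ω h
      rw [h.ex_time_zero]
    rw [this, lintegral_const, measure_univ, mul_one]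
  rw [h1]
  have hν := ν_nonneg (D := D)
  gcongr ENNReal.ofReal (Real.exp ?_) * _
  have := mul_le_mul_of_nonneg_left ht.2 hν
  linarith

lemma memLp_ex_const_time {t : ℝ} (ht : t ∈ Icc 0 D.T) (z : D.H) :
    MemLp (fun ω => D.ex 1 t ω z) 2 D.P :=
  memLp_two_of_lintegral ((hD.aesm_ex 1 t (aesm_const z)).mono
    (D.ℱ.le _)) ((hD.lintegral_ex_const_le ht z).trans_lt
      (ENNReal.mul_lt_top ENNReal.ofReal_lt_top (ENNReal.pow_lt_top enorm_lt_top)))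

lemma memLp_ex_const (z : D.H) : MemLp (fun p : ℝ × Ω => D.ex 1 p.1 p.2 z) 2 D.Q := by
  have hm := hD.aesm_Q_ex 1 (y := fun _ _ => z) aestronglyMeasurable_const
  refine memLp_two_of_lintegral hm ?_
  rw [lintegral_prod _ (hm.enorm.pow_const 2)]
  refine lt_of_le_of_lt (setLIntegral_mono' measurableSet_Ioc fun t ht =>
    hD.lintegral_ex_const_le (Ioc_subset_Icc_self ht) z) ?_
  rw [setLIntegral_const, Real.volume_Ioc]
  exact ENNReal.mul_lt_top (ENNReal.mul_lt_top ENNReal.ofReal_lt_top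
    (ENNReal.pow_lt_top enorm_lt_top)) ENNReal.ofReal_lt_top

end Standing

section Test

lemma Test.isPrimitive (θ : D.Test) (ω : Ω) : IsPrimitive D.T (θ.val · ω) (θ.deriv · ω) :=
  W12.isPrimitive _

variable (hD : Standing D) (θ : D.Test)
include hD

omit hD in
lemma Test.aesm_val {t : ℝ} (ht : t ∈ Icc 0 D.T) :
    AEStronglyMeasurable[D.ℱ t.toNNReal] (θ.val t) D.P := θ.2 t ht

/-- Test processes and their derivatives have adapted versions. For the derivative, this is the
limit of the difference quotients to the left; as the representative of the derivative is chosen for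
each `ω` separately, the version is equal to it almost everywhere for almost every `ω`. -/
lemma Test.exists_version [IsProbabilityMeasure D.P] : D.HasAdaptedVersion θ.val ∧
    ∃ θ' : ℝ → Ω → D.H, D.HasAdaptedVersion θ' ∧ ∀ᵐ ω ∂D.P,
      ∀ᵐ t ∂((volume : Measure ℝ).restrict (Ioc 0 D.T)), θ.deriv t ω = θ' t ω := by
  obtain ⟨Y, h1, h2, h3⟩ := exists_adapted_version D.ℱ (P := D.P) θ.val hD.T_pos.le
    (fun t ht => Test.aesm_val θ ht) (Eventually.of_forall fun ω t ht =>
      ((Test.isPrimitive θ ω).continuousOn t ht).mono (Icc_subset_Icc_right ht.2))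
  refine ⟨⟨Y, h1, fun t _ => h2 t, ?_⟩, fun t ω => limUnder atTop fun n : ℕ =>
    ((n : ℝ) + 1) • (Y t ω - Y (t - 1 / ((n : ℝ) + 1)) ω), ⟨fun t ω => limUnder atTop fun n : ℕ =>
    ((n : ℝ) + 1) • (Y t ω - Y (t - 1 / ((n : ℝ) + 1)) ω), ?_, ?_, ae_of_all _ fun p => rfl⟩, ?_⟩
  · filter_upwards [Measure.quasiMeasurePreserving_snd.ae h3, hD.ae_Q_goodPath] with p h4 h5
    exact (h4 p.1 (Ioc_subset_Icc_self h5.1)).symm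
  · refine stronglyMeasurable_limUnder fun n => ?_
    have h4 : StronglyMeasurable fun p : ℝ × Ω => Y (p.1 - 1 / ((n : ℝ) + 1)) p.2 :=
      h1.comp_measurable ((measurable_fst.sub_const _).prodMk measurable_snd)
    exact (h1.sub h4).const_smul ((n : ℝ) + 1)
  · intro t ht
    refine stronglyMeasurable_limUnder (m := D.ℱ t.toNNReal) fun n => ?_
    have h4 : t - 1 / ((n : ℝ) + 1) ≤ t := by
      have : (0 : ℝ) < 1 / ((n : ℝ) + 1) := by positivity
      linarith
    exact ((h2 t).sub ((h2 _).mono (D.ℱ.mono (Real.toNNReal_le_toNNReal h4)))).const_smul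
      ((n : ℝ) + 1)
  · filter_upwards [h3] with ω h4
    filter_upwards [(Test.isPrimitive θ ω).ae_tendsto_quotient hD.T_pos.le,
      ae_restrict_mem measurableSet_Ioc] with t h5 ht
    refine (Tendsto.limUnder_eq (h5.congr' ?_)).symm
    have h6 : Tendsto (fun n : ℕ => t - 1 / ((n : ℝ) + 1)) atTop (𝓝 t) := by
      simpa using tendsto_const_nhds.sub (tendsto_one_div_add_atTop_nhds_zero_nat (𝕜 := ℝ))
    filter_upwards [h6.eventually (lt_mem_nhds ht.1)] with n hn
    have h7 : t - 1 / ((n : ℝ) + 1) ≤ D.T := by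
      have : (0 : ℝ) < 1 / ((n : ℝ) + 1) := by positivity
      linarith [ht.2]
    rw [h4 t (Ioc_subset_Icc_self ht), h4 _ ⟨hn.le, h7⟩]

variable [IsProbabilityMeasure D.P]

omit hD [IsProbabilityMeasure D.P] in
lemma Test.lintegral_enorm_sq : ∫⁻ ω, ‖(θ : Lp (W12 D.H D.T) 2 D.P) ω‖ₑ ^ 2 ∂D.P = ‖θ‖ₑ ^ 2 := by
  rw [show ‖θ‖ₑ = ‖(θ : Lp (W12 D.H D.T) 2 D.P)‖ₑ from rfl, Lp.enorm_def,
    eLpNorm_eq_lintegral_rpow_enorm_toReal (by norm_num) (by norm_num),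
    ← ENNReal.rpow_natCast, ← ENNReal.rpow_mul]
  norm_num

omit [IsProbabilityMeasure D.P] in
lemma Test.enorm_val_le (t : ℝ) (ω : Ω) : ‖θ.val t ω‖ₑ ^ 2 ≤
    ENNReal.ofReal ((1 + Real.sqrt D.T) ^ 2) * ‖(θ : Lp (W12 D.H D.T) 2 D.P) ω‖ₑ ^ 2 := by
  rw [ENNReal.ofReal_pow (by positivity), ← mul_pow]
  gcongr
  rw [← ofReal_norm, ← ofReal_norm, ← ENNReal.ofReal_mul (by positivity)]
  exact ENNReal.ofReal_le_ofReal (W12.norm_eval_le hD.T_pos.le _ _)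

omit [IsProbabilityMeasure D.P] in
lemma Test.lintegral_val_le (t : ℝ) : ∫⁻ ω, ‖θ.val t ω‖ₑ ^ 2 ∂D.P ≤
    ENNReal.ofReal ((1 + Real.sqrt D.T) ^ 2) * ‖θ‖ₑ ^ 2 := by
  rw [← Test.lintegral_enorm_sq, ← lintegral_const_mul' _ _ ENNReal.ofReal_ne_top]
  exact lintegral_mono fun ω => Test.enorm_val_le hD θ t ω

omit [IsProbabilityMeasure D.P] in
lemma Test.memLp_val_time {t : ℝ} (ht : t ∈ Icc 0 D.T) : MemLp (θ.val t) 2 D.P :=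
  memLp_two_of_lintegral ((Test.aesm_val θ ht).mono (D.ℱ.le _))
    ((Test.lintegral_val_le hD θ t).trans_lt (ENNReal.mul_lt_top ENNReal.ofReal_lt_top
      (ENNReal.pow_lt_top enorm_lt_top)))

lemma Test.lintegral_Q_val_le : ∫⁻ p, ‖θ.val p.1 p.2‖ₑ ^ 2 ∂D.Q ≤
    ENNReal.ofReal ((1 + Real.sqrt D.T) ^ 2 * D.T) * ‖θ‖ₑ ^ 2 := by
  have hm := (Test.exists_version hD θ).1.aesm
  rw [lintegral_prod _ (hm.enorm.pow_const 2)]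
  refine (lintegral_mono fun t => Test.lintegral_val_le hD θ t).trans (le_of_eq ?_)
  rw [lintegral_const, Measure.restrict_apply_univ, Real.volume_Ioc, sub_zero,
    ENNReal.ofReal_mul (by positivity)]
  ring

lemma Test.memLp_val : MemLp (fun p : ℝ × Ω => θ.val p.1 p.2) 2 D.Q :=
  memLp_two_of_lintegral (Test.exists_version hD θ).1.aesm
    ((Test.lintegral_Q_val_le hD θ).trans_lt (ENNReal.mul_lt_top ENNReal.ofReal_lt_top
      (ENNReal.pow_lt_top enorm_lt_top)))

omit hD in
lemma Test.lintegral_deriv_le {θ' : ℝ → Ω → D.H}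
    (hm : AEStronglyMeasurable (fun p : ℝ × Ω => θ' p.1 p.2) D.Q)
    (h : ∀ᵐ ω ∂D.P, ∀ᵐ t ∂((volume : Measure ℝ).restrict (Ioc 0 D.T)), θ.deriv t ω = θ' t ω) :
    ∫⁻ p, ‖θ' p.1 p.2‖ₑ ^ 2 ∂D.Q ≤ ‖θ‖ₑ ^ 2 := by
  rw [lintegral_prod_symm _ (hm.enorm.pow_const 2), ← Test.lintegral_enorm_sq]
  refine lintegral_mono_ae ?_
  filter_upwards [h] with ω h
  let v : W12 D.H D.T := (θ : Lp (W12 D.H D.T) 2 D.P) ω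
  have h1 : ∫⁻ t in Ioc 0 D.T, ‖θ' t ω‖ₑ ^ 2 = ‖v.snd‖ₑ ^ 2 := by
    rw [Lp.enorm_def, eLpNorm_eq_lintegral_rpow_enorm_toReal (by norm_num) (by norm_num),
      ← ENNReal.rpow_natCast, ← ENNReal.rpow_mul]
    norm_num
    refine lintegral_congr_ae ?_
    filter_upwards [h] with t h
    rw [← h]
    rfl
  rw [h1, ← ofReal_norm, ← ofReal_norm]
  gcongr
  exact v.norm_snd_le

omit hD in
lemma Test.memLp_deriv {θ' : ℝ → Ω → D.H} (hm : D.HasAdaptedVersion θ')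
    (h : ∀ᵐ ω ∂D.P, ∀ᵐ t ∂((volume : Measure ℝ).restrict (Ioc 0 D.T)), θ.deriv t ω = θ' t ω) :
    MemLp (fun p : ℝ × Ω => θ' p.1 p.2) 2 D.Q :=
  memLp_two_of_lintegral hm.aesm ((Test.lintegral_deriv_le θ hm.aesm h).trans_lt
    (ENNReal.pow_lt_top enorm_lt_top))

end Test

end

section

/-! ### The weak form of the operator -/

variable {d : ℕ} {Ω : Type*} [mΩ : MeasurableSpace Ω] {D : Data d Ω}

lemma enorm_toLp_sq {α F : Type*} {m : MeasurableSpace α} [NormedAddCommGroup F]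
    {P : Measure α} {f : α → F} (hf : MemLp f 2 P) :
    ‖hf.toLp f‖ₑ ^ 2 = ∫⁻ a, ‖f a‖ₑ ^ 2 ∂P := by
  rw [Lp.enorm_def, eLpNorm_congr_ae hf.coeFn_toLp,
    eLpNorm_eq_lintegral_rpow_enorm_toReal (by norm_num) (by norm_num),
    ← ENNReal.rpow_natCast, ← ENNReal.rpow_mul]
  norm_num

lemma norm_toLp_sq {α F : Type*} {m : MeasurableSpace α} [NormedAddCommGroup F]
    {P : Measure α} {f : α → F} (hf : MemLp f 2 P) :
    ‖hf.toLp f‖ ^ 2 = ∫ a, ‖f a‖ ^ 2 ∂P := by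
  have hm : AEStronglyMeasurable (fun a => ‖f a‖ ^ 2) P := hf.aestronglyMeasurable.norm.pow 2
  rw [← toReal_enorm, ← ENNReal.toReal_pow, enorm_toLp_sq hf,
    integral_eq_lintegral_of_nonneg_ae (Eventually.of_forall fun _ => by positivity) hm]
  congr 1
  refine lintegral_congr fun a => ?_
  rw [ENNReal.ofReal_pow (norm_nonneg _), ofReal_norm]

lemma norm_toLp_le {α F G : Type*} {m : MeasurableSpace α} [NormedAddCommGroup F]
    [NormedAddCommGroup G] {P : Measure α} {f : α → F} (hf : MemLp f 2 P) {C : ℝ} (hC : 0 ≤ C) {v : G}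
    (h : ∫⁻ a, ‖f a‖ₑ ^ 2 ∂P ≤ ENNReal.ofReal C * ‖v‖ₑ ^ 2) :
    ‖hf.toLp f‖ ≤ Real.sqrt C * ‖v‖ := by
  rw [← enorm_toLp_sq hf, ← ofReal_norm, ← ofReal_norm, ← ENNReal.ofReal_pow (norm_nonneg _),
    ← ENNReal.ofReal_pow (norm_nonneg _), ← ENNReal.ofReal_mul hC,
    ENNReal.ofReal_le_ofReal_iff (by positivity)] at h
  rw [← Real.sqrt_sq (norm_nonneg v), ← Real.sqrt_mul hC]
  exact Real.le_sqrt_of_sq_le h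

lemma inner_toLp {α F : Type*} {m : MeasurableSpace α} [NormedAddCommGroup F]
    [InnerProductSpace ℝ F] {P : Measure α} {f g : α → F} (hf : MemLp f 2 P) (hg : MemLp g 2 P) :
    inner ℝ (hf.toLp f) (hg.toLp g) = ∫ a, inner ℝ (f a) (g a) ∂P := by
  rw [L2.inner_def]
  refine integral_congr_ae ?_
  filter_upwards [hf.coeFn_toLp, hg.coeFn_toLp] with a h1 h2
  rw [h1, h2]

lemma integrable_inner {α F : Type*} {m : MeasurableSpace α} [NormedAddCommGroup F]
    [InnerProductSpace ℝ F] {P : Measure α} {f g : α → F} (hf : MemLp f 2 P) (hg : MemLp g 2 P) :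
    Integrable (fun a => (inner ℝ (f a) (g a) : ℝ)) P :=
  (hf.norm.integrable_mul hg.norm).mono' (hf.aestronglyMeasurable.inner hg.aestronglyMeasurable)
    (Eventually.of_forall fun _ => norm_inner_le_norm _ _)

lemma MemH_memLp {y : ℝ → Ω → D.H} (hy : D.MemH y) :
    MemLp (fun p : ℝ × Ω => D.ex 1 p.1 p.2 (y p.1 p.2)) 2 D.Q := by
  have h := hy.2
  simp only [expW_eq] at h
  exact h

lemma MemTerm_memLp {y : Ω → D.H} (hy : D.MemTerm y) : MemLp (fun ω => D.ex 1 D.T ω (y ω)) 2 D.P := by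
  have h : MemLp (fun ω => D.expW D.T ω (y ω)) 2 D.P := hy
  simp only [expW_eq] at h
  exact h

section Functionals

lemma Test.val_add (θ η : D.Test) : ∀ᵐ ω ∂D.P, ∀ t, (θ + η).val t ω = θ.val t ω + η.val t ω := by
  filter_upwards [Lp.coeFn_add (θ : Lp (W12 D.H D.T) 2 D.P) η] with ω h t
  rw [Data.Test.val, Submodule.coe_add, h]
  exact W12.eval_add _ _ t

lemma Test.val_smul (c : ℝ) (θ : D.Test) : ∀ᵐ ω ∂D.P, ∀ t, (c • θ).val t ω = c • θ.val t ω := by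
  filter_upwards [Lp.coeFn_smul c (θ : Lp (W12 D.H D.T) 2 D.P)] with ω h t
  rw [Data.Test.val, Submodule.coe_smul, h]
  exact W12.eval_smul _ _ t

lemma Test.deriv_add (θ η : D.Test) : ∀ᵐ ω ∂D.P,
    ∀ᵐ t ∂((volume : Measure ℝ).restrict (Ioc 0 D.T)),
      (θ + η).deriv t ω = θ.deriv t ω + η.deriv t ω := by
  filter_upwards [Lp.coeFn_add (θ : Lp (W12 D.H D.T) 2 D.P) η] with ω h
  have h1 : ∀ t, (θ + η).deriv t ω = (((θ : Lp (W12 D.H D.T) 2 D.P) ω).snd +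
      ((η : Lp (W12 D.H D.T) 2 D.P) ω).snd) t := fun t => by
    rw [Data.Test.deriv, Submodule.coe_add, h]; rfl
  filter_upwards [Lp.coeFn_add ((θ : Lp (W12 D.H D.T) 2 D.P) ω).snd
    ((η : Lp (W12 D.H D.T) 2 D.P) ω).snd] with t h2
  rw [h1, h2]; rfl

lemma Test.deriv_smul (c : ℝ) (θ : D.Test) : ∀ᵐ ω ∂D.P,
    ∀ᵐ t ∂((volume : Measure ℝ).restrict (Ioc 0 D.T)), (c • θ).deriv t ω = c • θ.deriv t ω := by
  filter_upwards [Lp.coeFn_smul c (θ : Lp (W12 D.H D.T) 2 D.P)] with ω h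
  have h1 : ∀ t, (c • θ).deriv t ω = (c • ((θ : Lp (W12 D.H D.T) 2 D.P) ω).snd) t := fun t => by
    rw [Data.Test.deriv, Submodule.coe_smul, h]; rfl
  filter_upwards [Lp.coeFn_smul c ((θ : Lp (W12 D.H D.T) 2 D.P) ω).snd] with t h2
  rw [h1, h2]; rfl

variable [IsProbabilityMeasure D.P] (hD : Standing D)
include hD

omit [IsProbabilityMeasure D.P] in
lemma exists_functional_term {h : Ω → D.H} (hh : MemLp h 2 D.P) :
    ∃ u : D.X, ∀ θ, u θ = ∫ ω, inner ℝ (h ω) (θ.val D.T ω) ∂D.P := by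
  have hTT : D.T ∈ Icc 0 D.T := ⟨hD.T_pos.le, le_rfl⟩
  have hm := fun θ : D.Test => Test.memLp_val_time hD θ hTT
  refine ⟨LinearMap.mkContinuous
    { toFun := fun θ => ∫ ω, inner ℝ (h ω) (θ.val D.T ω) ∂D.P, map_add' := fun θ η => ?_,
      map_smul' := fun c θ => ?_ } (‖hh.toLp h‖ * Real.sqrt ((1 + Real.sqrt D.T) ^ 2)) fun θ => ?_,
      fun θ => rfl⟩
  · rw [← integral_add (integrable_inner hh (hm θ)) (integrable_inner hh (hm η))]
    refine integral_congr_ae ?_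
    filter_upwards [Test.val_add θ η] with ω h1
    rw [h1, inner_add_right]
  · rw [RingHom.id_apply, ← integral_smul]
    refine integral_congr_ae ?_
    filter_upwards [Test.val_smul c θ] with ω h1
    rw [h1, inner_smul_right, smul_eq_mul]
  · simp only [LinearMap.coe_mk, AddHom.coe_mk]
    rw [← inner_toLp hh (hm θ), mul_assoc]
    refine (norm_inner_le_norm _ _).trans ?_
    gcongr
    exact norm_toLp_le (hm θ) (by positivity) (Test.lintegral_val_le hD θ _)

lemma exists_functional_val {h : ℝ → Ω → D.H} (hh : MemLp (fun p : ℝ × Ω => h p.1 p.2) 2 D.Q) :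
    ∃ u : D.X, ∀ θ, u θ = D.EI fun t ω => inner ℝ (h t ω) (θ.val t ω) := by
  have hm := fun θ : D.Test => Test.memLp_val hD θ
  have he : ∀ θ : D.Test, (D.EI fun t ω => inner ℝ (h t ω) (θ.val t ω)) =
      ∫ p, inner ℝ (h p.1 p.2) (θ.val p.1 p.2) ∂D.Q := fun θ => EI_eq (integrable_inner hh (hm θ))
  have hT := hD.T_pos
  refine ⟨LinearMap.mkContinuous
    { toFun := fun θ => D.EI fun t ω => inner ℝ (h t ω) (θ.val t ω), map_add' := fun θ η => ?_,
      map_smul' := fun c θ => ?_ }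
      (‖hh.toLp _‖ * Real.sqrt ((1 + Real.sqrt D.T) ^ 2 * D.T)) fun θ => ?_,
      fun θ => rfl⟩
  · rw [he θ, he η, ← integral_add (integrable_inner hh (hm θ)) (integrable_inner hh (hm η)), he]
    refine integral_congr_ae ?_
    filter_upwards [Measure.quasiMeasurePreserving_snd.ae (Test.val_add θ η)] with p h1
    rw [h1, inner_add_right]
  · rw [RingHom.id_apply, he, he, ← integral_smul]
    refine integral_congr_ae ?_
    filter_upwards [Measure.quasiMeasurePreserving_snd.ae (Test.val_smul c θ)] with p h1
    rw [h1, inner_smul_right, smul_eq_mul]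
  · simp only [LinearMap.coe_mk, AddHom.coe_mk]
    rw [he, ← inner_toLp hh (hm θ), mul_assoc]
    refine (norm_inner_le_norm _ _).trans ?_
    gcongr
    exact norm_toLp_le (hm θ) (by positivity) (Test.lintegral_Q_val_le hD θ)

/-- The pairing with the derivatives of test processes is a bounded functional. The integrand is
replaced by the adapted version of the derivative, as the representative of the derivative is not
known to be jointly measurable. -/
lemma exists_functional_deriv {h : ℝ → Ω → D.H} (hh : MemLp (fun p : ℝ × Ω => h p.1 p.2) 2 D.Q) :
    ∃ u : D.X, ∀ θ, u θ = D.EI fun t ω => inner ℝ (h t ω) (θ.deriv t ω) := by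
  choose θ' hθ hθ' using fun θ : D.Test => (Test.exists_version hD θ).2
  have hm := fun θ : D.Test => Test.memLp_deriv θ (hθ θ) (hθ' θ)
  have he : ∀ θ : D.Test, (D.EI fun t ω => inner ℝ (h t ω) (θ.deriv t ω)) =
      D.EI fun t ω => inner ℝ (h t ω) (θ' θ t ω) := fun θ => EI_congr (by
    filter_upwards [hθ' θ] with ω h1
    filter_upwards [h1] with t h1
    rw [h1])
  have he' : ∀ θ : D.Test, (D.EI fun t ω => inner ℝ (h t ω) (θ' θ t ω)) =
      ∫ p, inner ℝ (h p.1 p.2) (θ' θ p.1 p.2) ∂D.Q := fun θ => EI_eq (integrable_inner hh (hm θ))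
  refine ⟨LinearMap.mkContinuous
    { toFun := fun θ => D.EI fun t ω => inner ℝ (h t ω) (θ.deriv t ω), map_add' := fun θ η => ?_,
      map_smul' := fun c θ => ?_ } (‖hh.toLp _‖ * Real.sqrt 1) fun θ => ?_, fun θ => rfl⟩
  · have h1 : (D.EI fun t ω => inner ℝ (h t ω) ((θ + η).deriv t ω)) =
        D.EI fun t ω => inner ℝ (h t ω) (θ' θ t ω) + inner ℝ (h t ω) (θ' η t ω) := by
      refine EI_congr ?_
      filter_upwards [Test.deriv_add θ η, hθ' θ, hθ' η] with ω h1 h2 h3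
      filter_upwards [h1, h2, h3] with t h1 h2 h3
      rw [h1, h2, h3, inner_add_right]
    rw [h1, EI_eq ((integrable_inner hh (hm θ)).add (integrable_inner hh (hm η))),
      integral_add (integrable_inner hh (hm θ)) (integrable_inner hh (hm η)), he θ, he η, he', he']
  · have h1 : (D.EI fun t ω => inner ℝ (h t ω) ((c • θ).deriv t ω)) =
        D.EI fun t ω => c • inner ℝ (h t ω) (θ' θ t ω) := by
      refine EI_congr ?_
      filter_upwards [Test.deriv_smul c θ, hθ' θ] with ω h1 h2
      filter_upwards [h1, h2] with t h1 h2
      rw [h1, h2, inner_smul_right, smul_eq_mul]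
    rw [h1, EI_eq ((integrable_inner hh (hm θ)).smul c), integral_smul, RingHom.id_apply, he, he']
  · simp only [LinearMap.coe_mk, AddHom.coe_mk]
    rw [he, he', ← inner_toLp hh (hm θ), mul_assoc]
    refine (norm_inner_le_norm _ _).trans ?_
    gcongr
    refine norm_toLp_le (hm θ) zero_le_one ?_
    rw [ENNReal.ofReal_one, one_mul]
    exact Test.lintegral_deriv_le θ (hθ θ).aesm (hθ' θ)

/-- The part of the weak form of `e^W 𝓑` that does not depend on the process. -/
lemma memLp_drift : MemLp (fun p : ℝ × Ω =>
    D.ex 1 p.1 p.2 ((D.ν + D.δ) • D.x + mul D.O D.μ D.x)) 2 D.Q := hD.memLp_ex_const _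

lemma ae_drift {y : ℝ → Ω → D.H} : ∀ᵐ p ∂D.Q,
    D.expW p.1 p.2 ((D.ν + D.δ) • (y p.1 p.2 + D.x) + mul D.O D.μ D.x) =
      (D.ν + D.δ) • D.ex 1 p.1 p.2 (y p.1 p.2) +
        D.ex 1 p.1 p.2 ((D.ν + D.δ) • D.x + mul D.O D.μ D.x) := by
  filter_upwards [hD.ae_Q_goodPath] with p hp
  rw [expW_eq, smul_add, add_assoc, hp.2.ex_add 1 (Ioc_subset_Icc_self hp.1),
    hp.2.ex_smul 1 (Ioc_subset_Icc_self hp.1)]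

lemma memLp_drift_add {y : ℝ → Ω → D.H} (hy : D.MemH y) : MemLp (fun p : ℝ × Ω =>
      D.expW p.1 p.2 ((D.ν + D.δ) • (y p.1 p.2 + D.x) + mul D.O D.μ D.x)) 2 D.Q := by
  have h1 : MemLp (fun p : ℝ × Ω => (D.ν + D.δ) • D.ex 1 p.1 p.2 (y p.1 p.2)) 2 D.Q :=
    (MemH_memLp hy).const_smul (D.ν + D.δ)
  have h2 := h1.add (memLp_drift hD)
  refine h2.ae_eq ?_
  filter_upwards [ae_drift hD (y := y)] with p hp
  rw [hp, Pi.add_apply]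

/-- The constraint determines the third component of an admissible triple. -/
lemma exists_functional_Bweak {y : ℝ → Ω → D.H} {y₁ : Ω → D.H} (hy : D.MemH y) (hy₁ : D.MemTerm y₁) :
    ∃ u : D.X, ∀ θ, D.Bweak y y₁ θ + u θ = 0 := by
  have h2 : MemLp (fun p : ℝ × Ω =>
      D.expW p.1 p.2 ((D.ν + D.δ) • (y p.1 p.2 + D.x) + mul D.O D.μ D.x)) 2 D.Q :=
    memLp_drift_add hD hy
  obtain ⟨u₁, hu₁⟩ := exists_functional_term hD
    (h := fun ω => D.expW D.T ω (y₁ ω)) hy₁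
  obtain ⟨u₂, hu₂⟩ := exists_functional_val hD
    (h := fun t ω => D.expW t ω ((D.ν + D.δ) • (y t ω + D.x) + mul D.O D.μ D.x)) h2
  obtain ⟨u₃, hu₃⟩ := exists_functional_deriv hD (h := fun t ω => D.expW t ω (y t ω)) hy.2
  refine ⟨-(u₁ + u₂ - u₃), fun θ => ?_⟩
  simp only [Data.Bweak, _root_.neg_apply, _root_.sub_apply, _root_.add_apply, hu₁, hu₂, hu₃]
  ring

lemma EI_drift {y : ℝ → Ω → D.H} (hy : D.MemH y) {v : ℝ → Ω → D.H}
    (hv : MemLp (fun p : ℝ × Ω => v p.1 p.2) 2 D.Q) :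
    (D.EI fun t ω => inner ℝ
      (D.expW t ω ((D.ν + D.δ) • (y t ω + D.x) + mul D.O D.μ D.x)) (v t ω)) =
      (D.ν + D.δ) * ∫ p, inner ℝ (D.ex 1 p.1 p.2 (y p.1 p.2)) (v p.1 p.2) ∂D.Q +
      ∫ p, inner ℝ (D.ex 1 p.1 p.2 ((D.ν + D.δ) • D.x + mul D.O D.μ D.x)) (v p.1 p.2) ∂D.Q := by
  have i3 := (integrable_inner (MemH_memLp hy) hv).const_mul (D.ν + D.δ)
  have i4 := integrable_inner (memLp_drift hD) hv
  have h3 : ∀ᵐ p ∂D.Q, (inner ℝ (D.expW p.1 p.2 ((D.ν + D.δ) • (y p.1 p.2 + D.x) +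
      mul D.O D.μ D.x)) (v p.1 p.2) : ℝ) =
      (D.ν + D.δ) * inner ℝ (D.ex 1 p.1 p.2 (y p.1 p.2)) (v p.1 p.2) +
      inner ℝ (D.ex 1 p.1 p.2 ((D.ν + D.δ) • D.x + mul D.O D.μ D.x)) (v p.1 p.2) := by
    filter_upwards [ae_drift hD (y := y)] with p hp
    rw [hp, inner_add_left, real_inner_smul_left]
  have h4 : (D.EI fun t ω => inner ℝ
      (D.expW t ω ((D.ν + D.δ) • (y t ω + D.x) + mul D.O D.μ D.x)) (v t ω)) =
      ∫ p, inner ℝ (D.expW p.1 p.2 ((D.ν + D.δ) • (y p.1 p.2 + D.x) +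
        mul D.O D.μ D.x)) (v p.1 p.2) ∂D.Q := EI_eq ((integrable_congr h3).2 (i3.add i4))
  rw [h4, integral_congr_ae h3, integral_add i3 i4, integral_const_mul]

lemma Bweak_eq {y : ℝ → Ω → D.H} {y₁ : Ω → D.H} (hy : D.MemH y) {θ : D.Test}
    (hv : MemLp (fun p : ℝ × Ω => θ.val p.1 p.2) 2 D.Q) {θ' : ℝ → Ω → D.H}
    (hd : MemLp (fun p : ℝ × Ω => θ' p.1 p.2) 2 D.Q)
    (hθ' : ∀ᵐ ω ∂D.P,
      ∀ᵐ t ∂((volume : Measure ℝ).restrict (Ioc 0 D.T)), θ.deriv t ω = θ' t ω) :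
    D.Bweak y y₁ θ = ∫ ω, inner ℝ (D.ex 1 D.T ω (y₁ ω)) (θ.val D.T ω) ∂D.P +
      ((D.ν + D.δ) * ∫ p, inner ℝ (D.ex 1 p.1 p.2 (y p.1 p.2)) (θ.val p.1 p.2) ∂D.Q +
      ∫ p, inner ℝ (D.ex 1 p.1 p.2 ((D.ν + D.δ) • D.x + mul D.O D.μ D.x)) (θ.val p.1 p.2) ∂D.Q) -
      ∫ p, inner ℝ (D.ex 1 p.1 p.2 (y p.1 p.2)) (θ' p.1 p.2) ∂D.Q := by
  have h3 : (D.EI fun t ω => inner ℝ (D.expW t ω (y t ω)) (θ.deriv t ω)) =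
      ∫ p, inner ℝ (D.ex 1 p.1 p.2 (y p.1 p.2)) (θ' p.1 p.2) ∂D.Q := by
    refine Eq.trans (b := D.EI fun t ω => inner ℝ (D.ex 1 t ω (y t ω)) (θ' t ω)) (EI_congr ?_)
      (EI_eq (integrable_inner (MemH_memLp hy) hd))
    filter_upwards [hθ'] with ω h
    filter_upwards [h] with t h
    rw [h, expW_eq]
  rw [Data.Bweak, EI_drift hD hy hv, h3]
  simp only [expW_eq]

/-- The weak form of `e^W 𝓑` is an affine function of `(e^W y, e^{W(T)} y₁)`. -/
lemma exists_Bweak_eq (θ : D.Test) : ∃ (A : Lp D.H 2 D.Q) (B : Lp D.H 2 D.P) (c : ℝ),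
    ∀ y y₁ (hy : D.MemH y) (hy₁ : D.MemTerm y₁), D.Bweak y y₁ θ =
      inner ℝ ((MemH_memLp hy).toLp _) A + inner ℝ ((MemTerm_memLp hy₁).toLp _) B + c := by
  have hTT : D.T ∈ Icc 0 D.T := ⟨hD.T_pos.le, le_rfl⟩
  have hv := Test.memLp_val hD θ
  have hvT := Test.memLp_val_time hD θ hTT
  obtain ⟨θ', hθ, hθ'⟩ := (Test.exists_version hD θ).2
  have hd := Test.memLp_deriv θ hθ hθ'
  refine ⟨(D.ν + D.δ) • hv.toLp _ - hd.toLp _, hvT.toLp _,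
    ∫ p, inner ℝ (D.ex 1 p.1 p.2 ((D.ν + D.δ) • D.x + mul D.O D.μ D.x)) (θ.val p.1 p.2) ∂D.Q,
    fun y y₁ hy hy₁ => ?_⟩
  rw [Bweak_eq hD (y₁ := y₁) hy hv hd hθ', inner_sub_right, inner_smul_right,
    inner_toLp (MemH_memLp hy) hv, inner_toLp (MemH_memLp hy) hd, inner_toLp (MemTerm_memLp hy₁) hvT]
  ring

/-- The constant and the linear parts of `e^W 𝓑 z`. -/
lemma ae_eWB (z z' : ℝ → Ω → D.H) : ∀ᵐ p ∂D.Q, D.eWB z z' p.1 p.2 =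
    D.ex 1 p.1 p.2 (z' p.1 p.2) + mul D.O D.μ (D.ex 1 p.1 p.2 (z p.1 p.2)) +
      ((D.ν + D.δ) • D.ex 1 p.1 p.2 (z p.1 p.2) +
        D.ex 1 p.1 p.2 ((D.ν + D.δ) • D.x + mul D.O D.μ D.x)) := by
  filter_upwards [hD.ae_Q_goodPath] with p hp
  have hp1 := Ioc_subset_Icc_self hp.1
  rw [← hp.2.ex_mul 1 hp1 hD.isMul_μ, ← hp.2.ex_smul 1 hp1, ← hp.2.ex_add 1 hp1,
    ← hp.2.ex_add 1 hp1, ← hp.2.ex_add 1 hp1, Data.eWB, expW_eq]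
  congr 1
  have h3 : mul D.O (fun ξ => D.μ ξ + D.ν + D.δ) (z p.1 p.2 + D.x) =
      mul D.O D.μ (z p.1 p.2 + D.x) + (D.ν + D.δ) • (z p.1 p.2 + D.x) := by
    rw [← hD.isMul_μ.mul_add_const]
    simp only [add_assoc]
  rw [h3, hD.isMul_μ.map_add, smul_add]
  abel

lemma memLp_eWB {z z' : ℝ → Ω → D.H} (hz : D.MemH z) (hz' : D.MemH z') :
    MemLp (fun p : ℝ × Ω => D.eWB z z' p.1 p.2) 2 D.Q := by
  have h1 : MemLp (fun p : ℝ × Ω => (D.ν + D.δ) • D.ex 1 p.1 p.2 (z p.1 p.2)) 2 D.Q :=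
    (MemH_memLp hz).const_smul (D.ν + D.δ)
  have h2 : MemLp (fun p : ℝ × Ω => mul D.O D.μ (D.ex 1 p.1 p.2 (z p.1 p.2))) 2 D.Q :=
    hD.isMul_μ.toCLM.comp_memLp' (MemH_memLp hz)
  have h3 := ((MemH_memLp hz').add h2).add (h1.add (memLp_drift hD))
  refine h3.ae_eq ?_
  filter_upwards [ae_eWB hD z z'] with p hp
  rw [hp]
  simp only [Pi.add_apply]

/-- The product rule for `e^W`, a process in the domain of `𝓑` and a test process. -/
lemma integral_terminal_eq {z z' : ℝ → Ω → D.H} (hz : D.InDomB z z') (θ : D.Test)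
    {θ' : ℝ → Ω → D.H} (hθ : D.HasAdaptedVersion θ') (hθ' : ∀ᵐ ω ∂D.P,
      ∀ᵐ t ∂((volume : Measure ℝ).restrict (Ioc 0 D.T)), θ.deriv t ω = θ' t ω) :
    ∫ ω, inner ℝ (D.ex 1 D.T ω (z D.T ω)) (θ.val D.T ω) ∂D.P =
      ∫ p, inner ℝ (D.ex 1 p.1 p.2 (z' p.1 p.2)) (θ.val p.1 p.2) ∂D.Q +
      ∫ p, inner ℝ (D.ex 1 p.1 p.2 (z p.1 p.2)) (θ' p.1 p.2) ∂D.Q +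
      ∫ p, inner ℝ (mul D.O D.μ (D.ex 1 p.1 p.2 (z p.1 p.2))) (θ.val p.1 p.2) ∂D.Q := by
  have hv := Test.memLp_val hD θ
  have hva := (Test.exists_version hD θ).1
  have hd := Test.memLp_deriv θ hθ hθ'
  have hz0 : z 0 =ᵐ[D.P] fun _ => 0 := by
    filter_upwards [hz.path] with ω h
    rw [h.2 0 ⟨le_rfl, hD.T_pos.le⟩, Ioc_self, setIntegral_empty]
  have hpath : ∀ᵐ ω ∂D.P, IsPrimitive D.T (z · ω) (z' · ω) ∧
      IsPrimitive D.T (θ.val · ω) (θ' · ω) := by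
    filter_upwards [hz.path, hz0, hθ'] with ω h2 h3 h4
    refine ⟨⟨h2.1.integrable (by norm_num), fun t ht => ?_⟩, ?_⟩
    · rw [h3, zero_add]; exact h2.2 t ht
    · have h5 := Test.isPrimitive θ ω
      refine ⟨h5.integrable.congr h4, fun t ht => ?_⟩
      rw [h5.eq t ht]
      congr 1
      exact integral_congr_ae (ae_mono (Measure.restrict_mono (Ioc_subset_Ioc_right ht.2) le_rfl) h4)
  have hz0m : AEStronglyMeasurable[D.ℱ 0] (z 0) D.P := (aesm_const 0).congr hz0.symm
  have hθ0m : AEStronglyMeasurable[D.ℱ 0] (θ.val 0) D.P := by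
    have := Test.aesm_val θ (t := 0) ⟨le_rfl, hD.T_pos.le⟩
    rwa [Real.toNNReal_zero] at this
  have h00 : ∫⁻ ω, ‖z 0 ω‖ₑ * ‖θ.val 0 ω‖ₑ ∂D.P < ∞ := by
    have : ∫⁻ ω, ‖z 0 ω‖ₑ * ‖θ.val 0 ω‖ₑ ∂D.P = ∫⁻ _, 0 ∂D.P := by
      refine lintegral_congr_ae ?_
      filter_upwards [hz0] with ω h
      rw [h, enorm_zero, zero_mul]
    rw [this, lintegral_zero]
    exact ENNReal.zero_lt_top
  have hv' : MemLp (fun p : ℝ × Ω => D.ex 0 p.1 p.2 (θ.val p.1 p.2)) 2 D.Q := by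
    simpa only [GoodPath.ex_zero_left] using hv
  have hd' : MemLp (fun p : ℝ × Ω => D.ex 0 p.1 p.2 (θ' p.1 p.2)) 2 D.Q := by
    simpa only [GoodPath.ex_zero_left] using hd
  -- The test process carries no exponential, so `k = 1` and the drift is `μ`.
  have e := (hD.product_rule (k := 1) (σ := 0) (by norm_num) hz.memH.1
    hz.memH_deriv.1 hva hθ (MemH_memLp hz.memH) (MemH_memLp hz.memH_deriv) hv' hd' hpath
    hz0m hθ0m h00).2.2.2
  have e0 : ∫ ω, inner ℝ (z 0 ω) (θ.val 0 ω) ∂D.P = 0 := by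
    refine integral_eq_zero_of_ae ?_
    filter_upwards [hz0] with ω h
    rw [h, inner_zero_left]
    rfl
  simp only [GoodPath.ex_zero_left, one_pow, one_mul] at e
  rw [e0, zero_add] at e
  exact e

/-- On the domain of `𝓑`, the weak form is the pairing with `e^W 𝓑 z`. -/
lemma EI_eWB {z z' : ℝ → Ω → D.H} (hz : D.InDomB z z') (θ : D.Test) :
    (D.EI fun t ω => inner ℝ (-D.eWB z z' t ω) (θ.val t ω)) = -D.Bweak z (z D.T) θ := by
  have hv := Test.memLp_val hD θ
  obtain ⟨θ', hθ, hθ'⟩ := (Test.exists_version hD θ).2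
  have hd := Test.memLp_deriv θ hθ hθ'
  have hdr := memLp_drift hD
  have h1 := MemH_memLp hz.memH
  have h1' := MemH_memLp hz.memH_deriv
  have hμ : MemLp (fun p : ℝ × Ω => mul D.O D.μ (D.ex 1 p.1 p.2 (z p.1 p.2))) 2 D.Q :=
    hD.isMul_μ.toCLM.comp_memLp' h1
  have e := integral_terminal_eq hD hz θ hθ hθ'
  have hB := Bweak_eq hD (y₁ := z D.T) hz.memH hv hd hθ'
  have i1 := integrable_inner h1' hv
  have i2 := integrable_inner hμ hv
  have i3 := (integrable_inner h1 hv).const_mul (D.ν + D.δ)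
  have i4 := integrable_inner hdr hv
  have h2 : ∀ᵐ p ∂D.Q, (inner ℝ (-D.eWB z z' p.1 p.2) (θ.val p.1 p.2) : ℝ) =
      -((inner ℝ (D.ex 1 p.1 p.2 (z' p.1 p.2)) (θ.val p.1 p.2) +
        inner ℝ (mul D.O D.μ (D.ex 1 p.1 p.2 (z p.1 p.2))) (θ.val p.1 p.2)) +
        ((D.ν + D.δ) * inner ℝ (D.ex 1 p.1 p.2 (z p.1 p.2)) (θ.val p.1 p.2) +
        inner ℝ (D.ex 1 p.1 p.2 ((D.ν + D.δ) • D.x + mul D.O D.μ D.x)) (θ.val p.1 p.2))) := by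
    filter_upwards [ae_eWB hD z z'] with p hp
    rw [hp, inner_neg_left, inner_add_left, inner_add_left, inner_add_left, real_inner_smul_left]
  have h6 : (D.EI fun t ω => inner ℝ (-D.eWB z z' t ω) (θ.val t ω)) =
      ∫ p, inner ℝ (-D.eWB z z' p.1 p.2) (θ.val p.1 p.2) ∂D.Q :=
    EI_eq (integrable_inner (memLp_eWB hD hz.memH hz.memH_deriv).neg hv)
  have h7 := integral_add (i1.add i2) (i3.add i4)
  simp only [Pi.add_apply] at h7
  rw [h6, integral_congr_ae h2, integral_neg, h7, integral_add i1 i2, integral_add i3 i4,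
    integral_const_mul, hB, e]
  ring

end Functionals

end

section

/-! ### The Hilbert space of pairs -/

variable {d : ℕ} {Ω : Type*} [mΩ : MeasurableSpace Ω] {D : Data d Ω}

/-- The limit of a weakly convergent sequence in a convex set is in the closure of the set. -/
lemma mem_closure_of_weak_limit {V : Type*} [NormedAddCommGroup V] [InnerProductSpace ℝ V]
    [CompleteSpace V] {S : Set V} (hS : Convex ℝ S) {a : ℕ → V} {p : V} (ha : ∃ᶠ n in atTop, a n ∈ S)
    (h : ∀ v, Tendsto (fun n => (inner ℝ (a n) v : ℝ)) atTop (𝓝 (inner ℝ p v))) :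
    p ∈ closure S := by
  by_contra hp
  obtain ⟨f, r, h1, h2⟩ := geometric_hahn_banach_closed_point hS.closure isClosed_closure hp
  let v := (InnerProductSpace.toDual ℝ V).symm f
  have hv : ∀ w, f w = inner ℝ w v := fun w => by
    rw [real_inner_comm, InnerProductSpace.toDual_symm_apply]
  have h3 := h v
  rw [← hv] at h3
  have h4 := h3.eventually (lt_mem_nhds h2)
  obtain ⟨n, hn, hn'⟩ := (ha.and_eventually h4).exists
  have h5 := h1 _ (subset_closure hn)
  rw [hv] at h5
  exact lt_asymm h5 hn'

section

variable [IsProbabilityMeasure D.P]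

variable (D) in
/-- The Hilbert space of the pairs `(e^W y, e^{W(T)} y₁)`. -/
abbrev Data.Pt : Type _ := WithLp 2 (D.adapted × Lp D.H 2 D.P)

omit [IsProbabilityMeasure D.P] in
instance : CompleteSpace D.adapted := (isClosed_adapted (D := D)).completeSpace_coe

variable (hD : Standing D)
include hD

lemma mem_adapted_of_MemH {y : ℝ → Ω → D.H} (hy : D.MemH y) : (MemH_memLp hy).toLp _ ∈ D.adapted := by
  refine mem_adapted.2 (hasAdaptedVersion_congr (hD.hasAdaptedVersion_ex 1 hy.1) ?_)
  exact (MemH_memLp hy).coeFn_toLp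

/-- The point `(e^W y, e^{W(T)} y₁)`. -/
def toPt {y : ℝ → Ω → D.H} {y₁ : Ω → D.H} (hy : D.MemH y) (hy₁ : D.MemTerm y₁) : D.Pt :=
  WithLp.toLp 2 (⟨(MemH_memLp hy).toLp _, mem_adapted_of_MemH hD hy⟩, (MemTerm_memLp hy₁).toLp _)

lemma toPt_fst_ae {y : ℝ → Ω → D.H} {y₁ : Ω → D.H} (hy : D.MemH y) (hy₁ : D.MemTerm y₁) :
    ∀ᵐ p ∂D.Q, ((toPt hD hy hy₁).fst : Lp D.H 2 D.Q) p = D.ex 1 p.1 p.2 (y p.1 p.2) :=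
  (MemH_memLp hy).coeFn_toLp

lemma toPt_snd_ae {y : ℝ → Ω → D.H} {y₁ : Ω → D.H} (hy : D.MemH y) (hy₁ : D.MemTerm y₁) :
    ∀ᵐ ω ∂D.P, (toPt hD hy hy₁).snd ω = D.ex 1 D.T ω (y₁ ω) :=
  (MemTerm_memLp hy₁).coeFn_toLp

lemma ae_ex_ex_neg (h : ℝ × Ω → D.H) :
    ∀ᵐ p ∂D.Q, D.ex 1 p.1 p.2 (D.ex (-1) p.1 p.2 (h p)) = h p := by
  filter_upwards [hD.ae_Q_goodPath] with p hp
  exact hp.2.ex_ex_neg 1 (Ioc_subset_Icc_self hp.1) _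

omit [IsProbabilityMeasure D.P] in
lemma ae_ex_ex_neg_terminal (h : Ω → D.H) :
    ∀ᵐ ω ∂D.P, D.ex 1 D.T ω (D.ex (-1) D.T ω (h ω)) = h ω := by
  filter_upwards [hD.ae_goodPath] with ω hω
  exact hω.ex_ex_neg 1 ⟨hD.T_pos.le, le_rfl⟩ _

/-- Every square integrable adapted process is `e^W y` for some `y ∈ 𝓗`. -/
lemma memH_of_adapted {h : ℝ → Ω → D.H} (hh : D.HasAdaptedVersion h)
    (h2 : MemLp (fun p : ℝ × Ω => h p.1 p.2) 2 D.Q) : D.MemH fun t ω => D.ex (-1) t ω (h t ω) := by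
  refine ⟨hD.hasAdaptedVersion_ex (-1) hh, ?_⟩
  simp only [expW_eq]
  exact h2.ae_eq ((ae_ex_ex_neg hD fun p => h p.1 p.2).mono fun p hp => hp.symm)

omit [IsProbabilityMeasure D.P] in
lemma memTerm_of_memLp {h : Ω → D.H} (h2 : MemLp h 2 D.P) :
    D.MemTerm fun ω => D.ex (-1) D.T ω (h ω) := by
  rw [Data.MemTerm]
  simp only [expW_eq]
  exact h2.ae_eq ((ae_ex_ex_neg_terminal hD h).mono fun p hp => hp.symm)

lemma exists_toPt (p : D.Pt) : ∃ (y : ℝ → Ω → D.H) (y₁ : Ω → D.H) (hy : D.MemH y)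
    (hy₁ : D.MemTerm y₁), toPt hD hy hy₁ = p := by
  have hy := memH_of_adapted hD (h := fun t ω => (p.fst : Lp D.H 2 D.Q) (t, ω))
    (mem_adapted.1 p.fst.2) (Lp.memLp (p.fst : Lp D.H 2 D.Q))
  have hy₁ := memTerm_of_memLp hD (Lp.memLp p.snd)
  refine ⟨_, _, hy, hy₁, ?_⟩
  refine (WithLp.ofLp_injective 2) (Prod.ext (Subtype.ext (Lp.ext ?_)) (Lp.ext ?_))
  · filter_upwards [toPt_fst_ae hD hy hy₁,
      ae_ex_ex_neg hD fun q => (p.fst : Lp D.H 2 D.Q) (q.1, q.2)] with q h1 h2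
    exact h1.trans h2
  · filter_upwards [toPt_snd_ae hD hy hy₁, ae_ex_ex_neg_terminal hD p.snd] with ω h1 h2
    exact h1.trans h2

omit hD in
lemma innerH_eq {y w : ℝ → Ω → D.H} (hy : D.MemH y) (hw : D.MemH w) :
    D.innerH y w = inner ℝ ((MemH_memLp hy).toLp _) ((MemH_memLp hw).toLp _) := by
  rw [inner_toLp (MemH_memLp hy) (MemH_memLp hw), Data.innerH]
  simp only [expW_eq]
  exact EI_eq (integrable_inner (MemH_memLp hy) (MemH_memLp hw))

omit hD [IsProbabilityMeasure D.P] in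
lemma innerTerm_eq {y w : Ω → D.H} (hy : D.MemTerm y) (hw : D.MemTerm w) :
    D.innerTerm y w = inner ℝ ((MemTerm_memLp hy).toLp _) ((MemTerm_memLp hw).toLp _) := by
  rw [inner_toLp (MemTerm_memLp hy) (MemTerm_memLp hw), Data.innerTerm]
  simp only [expW_eq]

lemma inner_toPt {y w : ℝ → Ω → D.H} {y₁ w₁ : Ω → D.H} (hy : D.MemH y) (hy₁ : D.MemTerm y₁)
    (hw : D.MemH w) (hw₁ : D.MemTerm w₁) :
    inner ℝ (toPt hD hy hy₁) (toPt hD hw hw₁) = D.innerH y w + D.innerTerm y₁ w₁ := by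
  rw [innerH_eq hy hw, innerTerm_eq hy₁ hw₁, WithLp.prod_inner_apply]
  rfl

end

end

section

/-! ### Relaxation of the conjugate functional -/

variable {d : ℕ} {Ω : Type*} [mΩ : MeasurableSpace Ω] {D : Data d Ω}

variable [IsProbabilityMeasure D.P] (hD : Standing D)
include hD

lemma ae_ex_comb (s r : ℝ) (y w : ℝ → Ω → D.H) : ∀ᵐ p ∂D.Q,
    D.ex 1 p.1 p.2 (s • y p.1 p.2 + r • w p.1 p.2) =
      s • D.ex 1 p.1 p.2 (y p.1 p.2) + r • D.ex 1 p.1 p.2 (w p.1 p.2) := by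
  filter_upwards [hD.ae_Q_goodPath] with p hp
  have hp1 := Ioc_subset_Icc_self hp.1
  rw [hp.2.ex_add 1 hp1, hp.2.ex_smul 1 hp1, hp.2.ex_smul 1 hp1]

omit [IsProbabilityMeasure D.P] in
lemma ae_ex_comb_terminal (s r : ℝ) (y w : Ω → D.H) : ∀ᵐ ω ∂D.P,
    D.ex 1 D.T ω (s • y ω + r • w ω) = s • D.ex 1 D.T ω (y ω) + r • D.ex 1 D.T ω (w ω) := by
  filter_upwards [hD.ae_goodPath] with ω h
  have hT : D.T ∈ Icc 0 D.T := ⟨hD.T_pos.le, le_rfl⟩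
  rw [h.ex_add 1 hT, h.ex_smul 1 hT, h.ex_smul 1 hT]

lemma memH_comb (s r : ℝ) {y w : ℝ → Ω → D.H} (hy : D.MemH y) (hw : D.MemH w) :
    D.MemH fun t ω => s • y t ω + r • w t ω := by
  refine ⟨hasAdaptedVersion_map hy.1 hw.1 (f := fun p => s • p.1 + r • p.2) (by fun_prop), ?_⟩
  have h := ((MemH_memLp hy).const_smul s).add ((MemH_memLp hw).const_smul r)
  simp only [expW_eq]
  refine h.ae_eq ?_
  filter_upwards [ae_ex_comb hD s r y w] with p hp
  rw [hp]; rfl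

omit [IsProbabilityMeasure D.P] in
lemma memTerm_comb (s r : ℝ) {y w : Ω → D.H} (hy : D.MemTerm y) (hw : D.MemTerm w) :
    D.MemTerm fun ω => s • y ω + r • w ω := by
  have h := ((MemTerm_memLp hy).const_smul s).add ((MemTerm_memLp hw).const_smul r)
  rw [Data.MemTerm]
  simp only [expW_eq]
  refine h.ae_eq ?_
  filter_upwards [ae_ex_comb_terminal hD s r y w] with p hp
  rw [hp]; rfl

lemma toPt_comb (s r : ℝ) {y w : ℝ → Ω → D.H} {y₁ w₁ : Ω → D.H} (hy : D.MemH y)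
    (hy₁ : D.MemTerm y₁) (hw : D.MemH w) (hw₁ : D.MemTerm w₁) :
    toPt hD (memH_comb hD s r hy hw) (memTerm_comb hD s r hy₁ hw₁) =
      s • toPt hD hy hy₁ + r • toPt hD hw hw₁ := by
  refine (WithLp.ofLp_injective 2) (Prod.ext (Subtype.ext (Lp.ext ?_)) (Lp.ext ?_))
  · have h0 := Lp.coeFn_add (s • (MemH_memLp hy).toLp _) (r • (MemH_memLp hw).toLp _)
    have h1 := Lp.coeFn_smul s ((MemH_memLp hy).toLp _)
    have h2 := Lp.coeFn_smul r ((MemH_memLp hw).toLp _)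
    filter_upwards [(MemH_memLp (memH_comb hD s r hy hw)).coeFn_toLp, h0, h1, h2,
      (MemH_memLp hy).coeFn_toLp, (MemH_memLp hw).coeFn_toLp, ae_ex_comb hD s r y w]
      with p e1 e2 e3 e4 e5 e6 e7
    refine e1.trans (e7.trans (Eq.trans ?_ e2.symm))
    rw [Pi.add_apply, e3, e4, Pi.smul_apply, Pi.smul_apply, e5, e6]
  · have h0 := Lp.coeFn_add (s • (MemTerm_memLp hy₁).toLp _) (r • (MemTerm_memLp hw₁).toLp _)
    have h1 := Lp.coeFn_smul s ((MemTerm_memLp hy₁).toLp _)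
    have h2 := Lp.coeFn_smul r ((MemTerm_memLp hw₁).toLp _)
    filter_upwards [(MemTerm_memLp (memTerm_comb hD s r hy₁ hw₁)).coeFn_toLp, h0, h1, h2,
      (MemTerm_memLp hy₁).coeFn_toLp, (MemTerm_memLp hw₁).coeFn_toLp,
      ae_ex_comb_terminal hD s r y₁ w₁] with p e1 e2 e3 e4 e5 e6 e7
    refine e1.trans (e7.trans (Eq.trans ?_ e2.symm))
    rw [Pi.add_apply, e3, e4, Pi.smul_apply, Pi.smul_apply, e5, e6]

lemma inDomB_comb (s r : ℝ) {z z' w w' : ℝ → Ω → D.H} (hz : D.InDomB z z') (hw : D.InDomB w w') :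
    D.InDomB (fun t ω => s • z t ω + r • w t ω) (fun t ω => s • z' t ω + r • w' t ω) := by
  refine ⟨memH_comb hD s r hz.memH hw.memH, memH_comb hD s r hz.memH_deriv hw.memH_deriv, ?_⟩
  filter_upwards [hz.path, hw.path] with ω h1 h2
  refine ⟨(h1.1.const_smul s).add (h2.1.const_smul r), fun t ht => ?_⟩
  have i0 : IntegrableOn (fun s => z' s ω) (Ioc 0 D.T) := h1.1.integrable (by norm_num)
  have j0 : IntegrableOn (fun s => w' s ω) (Ioc 0 D.T) := h2.1.integrable (by norm_num)
  have i1 : Integrable (fun q => s • z' q ω) ((volume : Measure ℝ).restrict (Ioc 0 t)) :=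
    (i0.mono_set (Ioc_subset_Ioc_right ht.2)).smul s
  have i2 : Integrable (fun q => r • w' q ω) ((volume : Measure ℝ).restrict (Ioc 0 t)) :=
    (j0.mono_set (Ioc_subset_Ioc_right ht.2)).smul r
  rw [integral_add i1 i2, integral_smul, integral_smul, ← h1.2 t ht, ← h2.2 t ht]

lemma ae_eWB_comb {s r : ℝ} (hsr : s + r = 1) (z z' w w' : ℝ → Ω → D.H) : ∀ᵐ p ∂D.Q,
    D.eWB (fun t ω => s • z t ω + r • w t ω) (fun t ω => s • z' t ω + r • w' t ω) p.1 p.2 =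
      s • D.eWB z z' p.1 p.2 + r • D.eWB w w' p.1 p.2 := by
  filter_upwards [ae_eWB hD (fun t ω => s • z t ω + r • w t ω) (fun t ω => s • z' t ω + r • w' t ω),
    ae_eWB hD z z', ae_eWB hD w w', ae_ex_comb hD s r z w, ae_ex_comb hD s r z' w']
    with p h1 h2 h3 h4 h5
  rw [h1, h2, h3]
  rw [h4, h5, hD.isMul_μ.map_add, hD.isMul_μ.map_smul, hD.isMul_μ.map_smul]
  generalize D.ex 1 p.1 p.2 ((D.ν + D.δ) • D.x + mul D.O D.μ D.x) = c
  have hc : c = s • c + r • c := by rw [← add_smul, hsr, one_smul]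
  nth_rewrite 1 [hc]
  module

lemma G2_eq {z z' : ℝ → Ω → D.H} (hz : D.MemH z) (hz' : D.MemH z') :
    D.G2 (fun t ω => -D.eWB z z' t ω) =
      ∫⁻ p, (psiStar D.O D.δ (-D.eWB z z' p.1 p.2)).toENNReal ∂D.Q := by
  refine EIpos_eq (f := fun t ω => (psiStar D.O D.δ (-D.eWB z z' t ω)).toENNReal) ?_
  exact (measurable_psiStar D.O D.δ).comp_aemeasurable
    (memLp_eWB hD hz hz').neg.aestronglyMeasurable.aemeasurable

lemma G2_comb {s r : ℝ} (hs : 0 ≤ s) (hr : 0 ≤ r) (hsr : s + r = 1) {z z' w w' : ℝ → Ω → D.H}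
    (hz : D.InDomB z z') (hw : D.InDomB w w') :
    D.G2 (fun t ω => -D.eWB (fun t ω => s • z t ω + r • w t ω)
      (fun t ω => s • z' t ω + r • w' t ω) t ω) ≤
      ENNReal.ofReal s * D.G2 (fun t ω => -D.eWB z z' t ω) +
        ENNReal.ofReal r * D.G2 (fun t ω => -D.eWB w w' t ω) := by
  have hzw := inDomB_comb hD s r hz hw
  have hm : ∀ {z z' : ℝ → Ω → D.H}, D.InDomB z z' → AEMeasurable (fun p : ℝ × Ω =>
      (psiStar D.O D.δ (-D.eWB z z' p.1 p.2)).toENNReal) D.Q := fun h =>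
    (measurable_psiStar D.O D.δ).comp_aemeasurable
      (memLp_eWB hD h.memH h.memH_deriv).neg.aestronglyMeasurable.aemeasurable
  rw [G2_eq hD hzw.memH hzw.memH_deriv, G2_eq hD hz.memH hz.memH_deriv, G2_eq hD hw.memH hw.memH_deriv,
    ← lintegral_const_mul' _ _ ENNReal.ofReal_ne_top, ← lintegral_const_mul' _ _ ENNReal.ofReal_ne_top,
    ← lintegral_add_left' ((hm hz).const_mul _)]
  refine lintegral_mono_ae ?_
  filter_upwards [ae_eWB_comb hD hsr z z' w w'] with p hp
  rw [hp, neg_add, ← smul_neg, ← smul_neg]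
  exact psiStar_convex D.O D.δ _ _ hs hr hsr

/-- The points of the domain of `𝓑` at which `G₂` is at most `c`. -/
def sublevel (c : ℝ≥0∞) : Set D.Pt :=
  {p | ∃ (z z' : ℝ → Ω → D.H) (hz : D.InDomB z z') (hzT : D.MemTerm (z D.T)),
    p = toPt hD hz.memH hzT ∧ D.G2 (fun t ω => -D.eWB z z' t ω) ≤ c}

lemma sublevel_mono {c c' : ℝ≥0∞} (h : c ≤ c') : sublevel hD c ⊆ sublevel hD c' := by
  rintro p ⟨z, z', hz, hzT, h1, h2⟩
  exact ⟨z, z', hz, hzT, h1, h2.trans h⟩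

lemma sublevel_comb {s r : ℝ} (hs : 0 ≤ s) (hr : 0 ≤ r) (hsr : s + r = 1) {c c' : ℝ≥0∞} {p q : D.Pt}
    (hp : p ∈ sublevel hD c) (hq : q ∈ sublevel hD c') :
    s • p + r • q ∈ sublevel hD (ENNReal.ofReal s * c + ENNReal.ofReal r * c') := by
  obtain ⟨z, z', hz, hzT, rfl, h2⟩ := hp
  obtain ⟨w, w', hw, hwT, rfl, h4⟩ := hq
  refine ⟨_, _, inDomB_comb hD s r hz hw, memTerm_comb hD s r hzT hwT,
    (toPt_comb hD s r hz.memH hzT hw.memH hwT).symm, (G2_comb hD hs hr hsr hz hw).trans ?_⟩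
  gcongr

lemma convex_sublevel (c : ℝ≥0∞) : Convex ℝ (sublevel hD c) := by
  intro p hp q hq s r hs hr hsr
  have h := sublevel_comb hD hs hr hsr hp hq
  rwa [← add_mul, ← ENNReal.ofReal_add hs hr, hsr, ENNReal.ofReal_one, one_mul] at h

/-- The relaxation of `G₂` as a function of `(e^W y, e^{W(T)} y₁)`. As the sublevel sets are convex,
their weak and strong closures are the same. -/
def relaxation (p : D.Pt) : ℝ≥0∞ := sInf {c | p ∈ closure (sublevel hD c)}

lemma relaxation_le_iff {p : D.Pt} {c : ℝ≥0∞} :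
    relaxation hD p ≤ c ↔ ∀ c' > c, p ∈ closure (sublevel hD c') := by
  constructor
  · intro h c' hc'
    obtain ⟨b, hb, hbc⟩ := sInf_lt_iff.1 (h.trans_lt hc')
    exact closure_mono (sublevel_mono hD hbc.le) hb
  · intro h
    exact le_of_forall_gt_imp_ge_of_dense fun c' hc' => sInf_le (h c' hc')

lemma lowerSemicontinuous_relaxation : LowerSemicontinuous (relaxation hD) := by
  refine lowerSemicontinuous_iff_isClosed_preimage.2 fun c => ?_
  have : relaxation hD ⁻¹' Iic c = ⋂ (c') (_ : c' > c), closure (sublevel hD c') := by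
    ext p
    simp only [mem_preimage, mem_Iic, mem_iInter]
    exact relaxation_le_iff hD
  rw [this]
  exact isClosed_iInter fun _ => isClosed_iInter fun _ => isClosed_closure

lemma relaxation_midpoint (a b : D.Pt) :
    relaxation hD ((1 / 2 : ℝ) • (a + b)) ≤ (relaxation hD a + relaxation hD b) / 2 := by
  have key : ∀ c c', a ∈ closure (sublevel hD c) → b ∈ closure (sublevel hD c') →
      relaxation hD ((1 / 2 : ℝ) • (a + b)) ≤ (c + c') / 2 := by
    intro c c' ha hb
    refine sInf_le ?_
    have hf : Continuous fun p : D.Pt × D.Pt => (1 / 2 : ℝ) • (p.1 + p.2) := by fun_prop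
    have h1 : (a, b) ∈ closure (sublevel hD c ×ˢ sublevel hD c') := by
      rw [closure_prod_eq]; exact ⟨ha, hb⟩
    -- The midpoint map is continuous and maps pairs of points of the sublevel sets to a sublevel set.
    refine closure_mono ?_ (image_closure_subset_closure_image hf ⟨_, h1, rfl⟩)
    rintro _ ⟨⟨p, q⟩, ⟨hp, hq⟩, rfl⟩
    have h2 := sublevel_comb hD (s := 1 / 2) (r := 1 / 2) (by norm_num) (by norm_num) (by norm_num) hp hq
    have h3 : ENNReal.ofReal (1 / 2) = 2⁻¹ := by
      rw [one_div, ENNReal.ofReal_inv_of_pos (by norm_num), ENNReal.ofReal_ofNat]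
    rw [h3, ← mul_add, mul_comm, ← div_eq_mul_inv, ← smul_add] at h2
    exact h2
  have h2 : ∀ c', b ∈ closure (sublevel hD c') →
      relaxation hD ((1 / 2 : ℝ) • (a + b)) ≤ (relaxation hD a + c') / 2 := by
    intro c' hb
    rw [ENNReal.le_div_iff_mul_le (Or.inl two_ne_zero) (Or.inl ENNReal.ofNat_ne_top),
      relaxation, relaxation, ENNReal.sInf_add]
    refine le_iInf₂ fun c hc => ?_
    rw [← ENNReal.le_div_iff_mul_le (Or.inl two_ne_zero) (Or.inl ENNReal.ofNat_ne_top)]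
    exact key c c' hc hb
  rw [ENNReal.le_div_iff_mul_le (Or.inl two_ne_zero) (Or.inl ENNReal.ofNat_ne_top)]
  nth_rewrite 3 [relaxation]
  rw [ENNReal.add_sInf]
  refine le_iInf₂ fun c hc => ?_
  rw [← ENNReal.le_div_iff_mul_le (Or.inl two_ne_zero) (Or.inl ENNReal.ofNat_ne_top)]
  exact h2 c hc

/-- The relaxation bounds `G₂` along weakly convergent sequences from below. -/
lemma relaxation_le_G2relaxed {y : ℝ → Ω → D.H} {y₁ : Ω → D.H} (hy : D.MemH y) (hy₁ : D.MemTerm y₁)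
    (u : D.X) : relaxation hD (toPt hD hy hy₁) ≤ D.G2relaxed y y₁ u := by
  refine le_iInf fun z => le_iInf fun z' => le_iInf fun hz => ?_
  refine (relaxation_le_iff hD).2 fun c hc => ?_
  refine mem_closure_of_weak_limit (convex_sublevel hD c)
    (a := fun n => toPt hD (hz.mem n).memH (hz.memTerm n)) ?_ fun v => ?_
  · refine (frequently_lt_of_liminf_lt (by isBoundedDefault) hc).mono fun n hn => ?_
    exact ⟨z n, z' n, hz.mem n, hz.memTerm n, rfl, hn.le⟩
  · obtain ⟨w, w₁, hw, hw₁, rfl⟩ := exists_toPt hD v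
    simp only [inner_toPt hD]
    exact (hz.tendsto_H w hw).add (hz.tendsto_term w₁ hw₁)

/-- The relaxation is attained along strongly convergent sequences. The convergence in the dual
space of the test processes is automatic, because the weak form of `e^W 𝓑` is continuous. -/
lemma G2relaxed_le_relaxation {y : ℝ → Ω → D.H} {y₁ : Ω → D.H} (hy : D.MemH y) (hy₁ : D.MemTerm y₁)
    {u : D.X} (hu : ∀ θ, D.Bweak y y₁ θ + u θ = 0) :
    D.G2relaxed y y₁ u ≤ relaxation hD (toPt hD hy hy₁) := by
  refine le_of_forall_gt_imp_ge_of_dense fun c hc => ?_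
  obtain ⟨b, hb, hbc⟩ := sInf_lt_iff.1 hc
  obtain ⟨a, ha, hlim⟩ := mem_closure_iff_seq_limit.1 hb
  choose z z' hz hzT hza hG using ha
  have hlim' : Tendsto (fun n => toPt hD (hz n).memH (hzT n)) atTop (𝓝 (toPt hD hy hy₁)) := by
    simpa only [← hza] using hlim
  have hfst : Tendsto (fun n => (MemH_memLp (hz n).memH).toLp _) atTop
      (𝓝 ((MemH_memLp hy).toLp _)) := by
    have hc : Continuous fun p : D.Pt => (p.fst : Lp D.H 2 D.Q) := by fun_prop
    exact (hc.tendsto _).comp hlim'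
  have hsnd : Tendsto (fun n => (MemTerm_memLp (hzT n)).toLp _) atTop
      (𝓝 ((MemTerm_memLp hy₁).toLp _)) := by
    have hc : Continuous fun p : D.Pt => p.snd := by fun_prop
    exact (hc.tendsto _).comp hlim'
  have happ : D.Approximates z z' y y₁ u := by
    refine ⟨hz, hzT, fun w hw => ?_, fun h hh => ?_, fun θ => ?_⟩
    · rw [innerH_eq hy hw]
      simp only [innerH_eq (hz _).memH hw]
      exact hfst.inner tendsto_const_nhds
    · rw [innerTerm_eq hy₁ hh]
      simp only [innerTerm_eq (hzT _) hh]
      exact hsnd.inner tendsto_const_nhds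
    · obtain ⟨A, B, c, hABc⟩ := exists_Bweak_eq hD θ
      rw [show u θ = -D.Bweak y y₁ θ by linarith [hu θ], hABc y y₁ hy hy₁]
      simp only [EI_eWB hD (hz _), hABc _ _ (hz _).memH (hzT _)]
      exact (((hfst.inner tendsto_const_nhds).add (hsnd.inner tendsto_const_nhds)).add_const c).neg
  rw [Data.G2relaxed]
  refine iInf_le_of_le z <| iInf_le_of_le z' <| iInf_le_of_le happ ?_
  refine (liminf_le_of_le (by isBoundedDefault) fun e he => ?_)
  obtain ⟨n, hn⟩ := he.exists
  exact hn.trans ((hG n).trans hbc.le)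

end

section

/-! ### Time integrals of adapted processes -/

/-- The integral over a parameter of bounded functions that are measurable with respect to a
sub-σ-algebra is measurable with respect to it: it is orthogonal to the orthogonal complement of
the square integrable functions with this property. -/
lemma aesm_integral_of_bounded {Ω F : Type*} {m m₀ : MeasurableSpace Ω} {P : Measure Ω}
    [IsFiniteMeasure P] [NormedAddCommGroup F] [InnerProductSpace ℝ F] [CompleteSpace F]
    (hm : m ≤ m₀) {S : Type*} [MeasurableSpace S] {ρ : Measure S} [IsFiniteMeasure ρ]
    {y : S → Ω → F} (hy : StronglyMeasurable fun p : S × Ω => y p.1 p.2)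
    (hya : ∀ᵐ s ∂ρ, StronglyMeasurable[m] (y s)) {C : ℝ} (hC : ∀ s ω, ‖y s ω‖ ≤ C) :
    AEStronglyMeasurable[m] (fun ω => ∫ s, y s ω ∂ρ) P := by
  have hI : StronglyMeasurable fun ω => ∫ s, y s ω ∂ρ := hy.integral_prod_left
  have hI2 : MemLp (fun ω => ∫ s, y s ω ∂ρ) 2 P := by
    refine MemLp.of_bound hI.aestronglyMeasurable (C * ρ.real univ) (ae_of_all _ fun ω => ?_)
    exact norm_integral_le_of_norm_le_const (ae_of_all _ fun s => hC s ω)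
  have hys : ∀ s, MemLp (y s) 2 P := fun s =>
    MemLp.of_bound (hy.comp_measurable measurable_prodMk_left).aestronglyMeasurable C
      (ae_of_all _ fun ω => hC s ω)
  have : Fact (m ≤ m₀) := ⟨hm⟩
  let K : Submodule ℝ (Lp F 2 P) := lpMeas F ℝ m 2 P
  have hmem : hI2.toLp _ ∈ K := by
    -- `K` is closed, so it is its own double orthogonal complement.
    rw [← Submodule.orthogonal_orthogonal K, Submodule.mem_orthogonal]
    intro η hη
    have hint : Integrable (fun p : S × Ω => (inner ℝ (η p.2) (y p.1 p.2) : ℝ)) (ρ.prod P) := by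
      have h1 : Integrable (fun p : S × Ω => ‖η p.2‖ * C) (ρ.prod P) :=
        (((Lp.memLp η).integrable (by norm_num)).norm.mul_const C).comp_snd ρ
      refine h1.mono' ?_ (ae_of_all _ fun p => ?_)
      · exact ((Lp.aestronglyMeasurable η).comp_snd).inner hy.aestronglyMeasurable
      · exact (norm_inner_le_norm _ _).trans
          (mul_le_mul_of_nonneg_left (hC p.1 p.2) (norm_nonneg _))
    have h2 : inner ℝ η (hI2.toLp _) = ∫ ω, ∫ s, (inner ℝ (η ω) (y s ω) : ℝ) ∂ρ ∂P := by
      rw [L2.inner_def]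
      refine integral_congr_ae ?_
      filter_upwards [hI2.coeFn_toLp] with ω hω
      rw [hω, integral_inner]
      refine Integrable.of_bound (C := C) ?_ (ae_of_all _ fun s => hC s ω)
      exact (hy.comp_measurable measurable_prodMk_right).aestronglyMeasurable
    rw [h2, integral_integral_swap (f := fun ω s => (inner ℝ (η ω) (y s ω) : ℝ)) hint.swap]
    refine integral_eq_zero_of_ae ?_
    filter_upwards [hya] with s hs
    have h3 : (hys s).toLp _ ∈ K :=
      mem_lpMeas_iff_aestronglyMeasurable.2 (hs.aestronglyMeasurable.congr (hys s).coeFn_toLp.symm)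
    have h4 := (Submodule.mem_orthogonal' K η).1 hη _ h3
    rw [L2.inner_def] at h4
    rw [Pi.zero_apply, ← h4]
    refine integral_congr_ae ?_
    filter_upwards [(hys s).coeFn_toLp] with ω hω
    rw [hω]
  exact (mem_lpMeas_iff_aestronglyMeasurable.1 hmem).congr hI2.coeFn_toLp

variable {d : ℕ} {Ω : Type*} [mΩ : MeasurableSpace Ω] {D : Data d Ω} [IsProbabilityMeasure D.P]

/-- The time integral of an adapted process up to `t` is measurable at time `t`. -/
lemma aesm_integral {y : ℝ → Ω → D.H} (hy : D.HasAdaptedVersion y)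
    (hint : ∀ᵐ ω ∂D.P, IntegrableOn (fun s => y s ω) (Ioc 0 D.T)) {t : ℝ} (ht : t ∈ Icc 0 D.T) :
    AEStronglyMeasurable[D.ℱ t.toNNReal] (fun ω => ∫ s in Ioc 0 t, y s ω) D.P := by
  obtain ⟨y', h1, h2, h3⟩ := hy
  have h3' := ae_ae_of_ae_Q h3
  -- Truncation reduces the assertion to bounded processes.
  let f : ℕ → D.H → D.H := fun n z => if ‖z‖ ≤ n then z else 0
  have hf : ∀ n, StronglyMeasurable (f n) := fun n =>
    stronglyMeasurable_id.ite (measurableSet_le measurable_norm measurable_const)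
      stronglyMeasurable_const
  have hfn : ∀ n z, ‖f n z‖ ≤ n := fun n z => by
    by_cases h : ‖z‖ ≤ n
    · simp only [f, if_pos h, h]
    · simp [f, if_neg h]
  have hfz : ∀ n z, ‖f n z‖ ≤ ‖z‖ := fun n z => by
    by_cases h : ‖z‖ ≤ n
    · simp only [f, if_pos h, le_refl]
    · simp [f, if_neg h]
  have key : ∀ n, AEStronglyMeasurable[D.ℱ t.toNNReal]
      (fun ω => ∫ s in Ioc 0 t, f n (y' s ω)) D.P := by
    intro n
    refine aesm_integral_of_bounded (y := fun s ω => f n (y' s ω)) (D.ℱ.le _)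
      ((hf n).comp_measurable h1.measurable) ?_ (fun s ω => hfn n _)
    filter_upwards [ae_restrict_mem measurableSet_Ioc] with s hs
    have h4 := h2 s ⟨hs.1.le, hs.2.trans ht.2⟩
    exact ((hf n).comp_measurable h4.measurable).mono (D.ℱ.mono (Real.toNNReal_le_toNNReal hs.2))
  choose g hg hgf using key
  refine ⟨fun ω => limUnder atTop fun n => g n ω, stronglyMeasurable_limUnder hg, ?_⟩
  filter_upwards [hint, h3', ae_all_iff.2 hgf] with ω h4 h5 h8
  refine (Tendsto.limUnder_eq ?_).symm
  simp only [← h8]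
  have h6 : ∀ᵐ s ∂((volume : Measure ℝ).restrict (Ioc 0 t)), y s ω = y' s ω :=
    ae_mono (Measure.restrict_mono (Ioc_subset_Ioc_right ht.2) le_rfl) h5
  rw [integral_congr_ae h6]
  have h7 : IntegrableOn (fun s => y' s ω) (Ioc 0 t) :=
    (h4.mono_set (Ioc_subset_Ioc_right ht.2)).congr h6
  refine tendsto_integral_of_dominated_convergence (fun s => ‖y' s ω‖) (fun n => ?_) h7.norm
    (fun n => ae_of_all _ fun s => hfz n _) (ae_of_all _ fun s => ?_)
  · exact ((hf n).comp_measurable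
      (h1.measurable.comp measurable_prodMk_right)).aestronglyMeasurable
  · refine tendsto_const_nhds.congr' ?_
    obtain ⟨N, hN⟩ := exists_nat_ge ‖y' s ω‖
    filter_upwards [eventually_ge_atTop N] with n hn
    simp only [f]
    rw [if_pos (hN.trans (by exact_mod_cast hn))]

lemma hasAdaptedVersion_integral (hT : 0 ≤ D.T) {y : ℝ → Ω → D.H} (hy : D.HasAdaptedVersion y)
    (hint : ∀ᵐ ω ∂D.P, IntegrableOn (fun s => y s ω) (Ioc 0 D.T)) :
    D.HasAdaptedVersion fun t ω => ∫ s in Ioc 0 t, y s ω := by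
  obtain ⟨Y, h1, h2, h3⟩ := exists_adapted_version D.ℱ (P := D.P)
    (fun t ω => ∫ s in Ioc 0 t, y s ω) hT (fun t ht => aesm_integral hy hint ht) (by
      filter_upwards [hint] with ω h t ht
      have h4 : IsPrimitive D.T (fun t => ∫ s in Ioc 0 t, y s ω) (fun s => y s ω) :=
        ⟨h, fun t _ => by simp⟩
      exact (h4.continuousOn t ht).mono (Icc_subset_Icc_right ht.2))
  refine ⟨Y, h1, fun t _ => h2 t, ?_⟩
  filter_upwards [Measure.quasiMeasurePreserving_snd.ae h3,
    Measure.quasiMeasurePreserving_fst.ae (ae_restrict_mem measurableSet_Ioc)] with p h4 h5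
  exact (h4 p.1 (Ioc_subset_Icc_self h5)).symm

end

section

/-! ### The linear equation with multiplicative noise and a given drift -/

lemma lintegral_sq_le {α : Type*} {m : MeasurableSpace α} {P : Measure α} {f : α → ℝ≥0∞}
    (hf : AEMeasurable f P) : (∫⁻ a, f a ∂P) ^ 2 ≤ P univ * ∫⁻ a, f a ^ 2 ∂P := by
  have h := ENNReal.lintegral_mul_le_Lp_mul_Lq P (p := 2) (q := 2)
    (by rw [Real.holderConjugate_iff]; norm_num) (f := fun _ => 1) (g := f) aemeasurable_const hf
  simp only [Pi.mul_apply, one_mul, ENNReal.one_rpow, lintegral_const] at h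
  calc (∫⁻ a, f a ∂P) ^ 2 ≤ (P univ ^ (1 / 2 : ℝ) * (∫⁻ a, f a ^ (2 : ℝ) ∂P) ^ (1 / 2 : ℝ)) ^ 2 := by
        gcongr
    _ = P univ * ∫⁻ a, f a ^ 2 ∂P := by
        rw [mul_pow, ← ENNReal.rpow_natCast, ← ENNReal.rpow_natCast, ← ENNReal.rpow_mul,
          ← ENNReal.rpow_mul]
        norm_num

variable {d : ℕ} {Ω : Type*} [mΩ : MeasurableSpace Ω] {D : Data d Ω}

variable (D) in
/-- The process `e^{W(t)} ∫₀ᵗ e^{-W(s)} G(s) ds`. It vanishes at time `0` and solves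
`dY = G dt + Y dW + μ Y dt`. -/
def Data.volterra (G : ℝ → Ω → D.H) (t : ℝ) (ω : Ω) : D.H :=
  D.ex 1 t ω (∫ s in Ioc 0 t, D.ex (-1) s ω (G s ω))

variable [IsProbabilityMeasure D.P] (hD : Standing D)
include hD

lemma ae_memLp_ex_neg {G : ℝ → Ω → D.H} (hG : MemLp (fun p : ℝ × Ω => G p.1 p.2) 2 D.Q) :
    ∀ᵐ ω ∂D.P, MemLp (fun s => D.ex (-1) s ω (G s ω)) 2
      ((volume : Measure ℝ).restrict (Ioc 0 D.T)) := by
  have hm := hD.aesm_Q_ex (-1) hG.1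
  have h1 : ∀ᵐ ω ∂D.P, AEStronglyMeasurable (fun s => D.ex (-1) s ω (G s ω))
      ((volume : Measure ℝ).restrict (Ioc 0 D.T)) := hm.prod_swap.prodMk_left
  have h2 : ∫⁻ ω, (∫⁻ s in Ioc 0 D.T, ‖G s ω‖ₑ ^ 2) ∂D.P < ∞ := by
    have h3 := lintegral_enorm_sq_lt_top hG
    rwa [lintegral_prod_symm _ (hG.1.enorm.pow_const 2)] at h3
  have h4 : AEMeasurable (fun ω => ∫⁻ s in Ioc 0 D.T, ‖G s ω‖ₑ ^ 2) D.P :=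
    (hG.1.enorm.pow_const 2).lintegral_prod_left'
  filter_upwards [h1, ae_lt_top' h4 h2.ne, hD.ae_goodPath] with ω h5 h6 h7
  obtain ⟨C, hC0, hC⟩ := h7.norm_ex_le (-1)
  refine memLp_two_of_lintegral h5 ?_
  calc ∫⁻ s in Ioc 0 D.T, ‖D.ex (-1) s ω (G s ω)‖ₑ ^ 2
      ≤ ∫⁻ s in Ioc 0 D.T, ENNReal.ofReal C ^ 2 * ‖G s ω‖ₑ ^ 2 := by
        refine setLIntegral_mono' measurableSet_Ioc fun s hs => ?_
        rw [← mul_pow]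
        gcongr
        rw [← ofReal_norm, ← ofReal_norm, ← ENNReal.ofReal_mul hC0]
        exact ENNReal.ofReal_le_ofReal (hC s (Ioc_subset_Icc_self hs) _)
    _ < ∞ := by
        rw [lintegral_const_mul' _ _ (ENNReal.pow_ne_top ENNReal.ofReal_ne_top)]
        exact ENNReal.mul_lt_top (ENNReal.pow_lt_top ENNReal.ofReal_lt_top) h6

lemma ae_integrableOn_ex_neg {G : ℝ → Ω → D.H} (hG : MemLp (fun p : ℝ × Ω => G p.1 p.2) 2 D.Q) :
    ∀ᵐ ω ∂D.P, IntegrableOn (fun s => D.ex (-1) s ω (G s ω)) (Ioc 0 D.T) :=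
  (ae_memLp_ex_neg hD hG).mono fun _ h => h.integrable (by norm_num)

lemma hasAdaptedVersion_primitive {G : ℝ → Ω → D.H} (hGa : D.HasAdaptedVersion G)
    (hG : MemLp (fun p : ℝ × Ω => G p.1 p.2) 2 D.Q) :
    D.HasAdaptedVersion fun t ω => ∫ s in Ioc 0 t, D.ex (-1) s ω (G s ω) :=
  hasAdaptedVersion_integral hD.T_pos.le (hD.hasAdaptedVersion_ex (-1) hGa)
    (ae_integrableOn_ex_neg hD hG)

lemma hasAdaptedVersion_volterra {G : ℝ → Ω → D.H} (hGa : D.HasAdaptedVersion G)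
    (hG : MemLp (fun p : ℝ × Ω => G p.1 p.2) 2 D.Q) : D.HasAdaptedVersion (D.volterra G) :=
  hD.hasAdaptedVersion_ex 1 (hasAdaptedVersion_primitive hD hGa hG)

lemma ae_volterra_sub {G G' : ℝ → Ω → D.H} (hG : MemLp (fun p : ℝ × Ω => G p.1 p.2) 2 D.Q)
    (hG' : MemLp (fun p : ℝ × Ω => G' p.1 p.2) 2 D.Q) : ∀ᵐ ω ∂D.P, ∀ t ∈ Icc 0 D.T,
      D.volterra (fun t ω => G t ω - G' t ω) t ω = D.volterra G t ω - D.volterra G' t ω := by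
  filter_upwards [ae_integrableOn_ex_neg hD hG, ae_integrableOn_ex_neg hD hG', hD.ae_goodPath]
    with ω h1 h2 h3 t ht
  have h4 : ∀ s ∈ Ioc 0 t, D.ex (-1) s ω (G s ω - G' s ω) =
      D.ex (-1) s ω (G s ω) - D.ex (-1) s ω (G' s ω) := fun s hs =>
    h3.ex_sub (-1) ⟨hs.1.le, hs.2.trans ht.2⟩ _ _
  rw [Data.volterra, setIntegral_congr_fun measurableSet_Ioc h4, integral_sub
    (h1.mono_set (Ioc_subset_Ioc_right ht.2)) (h2.mono_set (Ioc_subset_Ioc_right ht.2)),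
    h3.ex_sub 1 ht]
  rfl

/-- The second moment of the solution of the linear equation at time `t` is bounded by the integral
of the second moments of the drift up to `t`. -/
lemma lintegral_volterra_le {G : ℝ → Ω → D.H} (hGa : D.HasAdaptedVersion G)
    (hG : MemLp (fun p : ℝ × Ω => G p.1 p.2) 2 D.Q) {t : ℝ} (ht : t ∈ Icc 0 D.T) :
    ∫⁻ ω, ‖D.volterra G t ω‖ₑ ^ 2 ∂D.P ≤
      ENNReal.ofReal (D.T * Real.exp (2 * D.ν * D.T)) *
        ∫⁻ s in Ioc 0 t, ∫⁻ ω, ‖G s ω‖ₑ ^ 2 ∂D.P := by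
  obtain ⟨y, h1, h2, h3⟩ := hD.hasAdaptedVersion_ex (-1) hGa
  have h3' := ae_ae_of_ae_Q h3
  have hmy : StronglyMeasurable fun p : Ω × ℝ => D.ex 1 t p.1 (y p.2 p.1) := by
    refine stronglyMeasurable_mul D.O D.e
      (g := fun (p : Ω × ℝ) ξ => Real.exp (1 * D.W t p.1 ξ)) ?_ (h1.comp_measurable measurable_swap)
    have h4 : Measurable fun p : (Ω × ℝ) × E d => D.W t p.1.1 p.2 :=
      measurable_limUnder_sum_prod (f := fun j (p : Ω × ℝ) => D.β j t.toNNReal p.1)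
        Standing.measurable_e fun j => (hD.measurable_β j _).comp measurable_fst
    exact Real.measurable_exp.comp (h4.const_mul 1)
  have step : ∫⁻ ω, ‖D.volterra G t ω‖ₑ ^ 2 ∂D.P ≤
      ∫⁻ ω, ENNReal.ofReal D.T * (∫⁻ s in Ioc 0 t, ‖D.ex 1 t ω (y s ω)‖ₑ ^ 2) ∂D.P := by
    refine lintegral_mono_ae ?_
    filter_upwards [h3', hD.ae_goodPath, ae_integrableOn_ex_neg hD hG] with ω h4 h5 h6
    have h7 : ∀ᵐ s ∂((volume : Measure ℝ).restrict (Ioc 0 t)), D.ex (-1) s ω (G s ω) = y s ω :=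
      ae_mono (Measure.restrict_mono (Ioc_subset_Ioc_right ht.2) le_rfl) h4
    have h8 : Integrable (fun s => y s ω) ((volume : Measure ℝ).restrict (Ioc 0 t)) :=
      (IntegrableOn.mono_set h6 (Ioc_subset_Ioc_right ht.2)).congr h7
    have h9 : D.volterra G t ω = ∫ s in Ioc 0 t, D.ex 1 t ω (y s ω) := by
      rw [Data.volterra, integral_congr_ae h7]
      exact ((h5.isMul_exp 1 ht).toCLM.integral_comp_comm h8).symm
    have h10 : ‖D.volterra G t ω‖ₑ ≤ ∫⁻ s in Ioc 0 t, ‖D.ex 1 t ω (y s ω)‖ₑ := by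
      rw [h9]
      exact enorm_integral_le_lintegral_enorm _
    -- The Cauchy–Schwarz inequality in time.
    have h11 := lintegral_sq_le (P := (volume : Measure ℝ).restrict (Ioc 0 t))
      (f := fun s => ‖D.ex 1 t ω (y s ω)‖ₑ)
      (hmy.comp_measurable measurable_prodMk_left).aestronglyMeasurable.enorm
    refine (pow_le_pow_left' h10 2).trans (h11.trans ?_)
    gcongr
    rw [Measure.restrict_apply_univ, Real.volume_Ioc]
    exact ENNReal.ofReal_le_ofReal (by linarith [ht.2])
  refine step.trans ?_
  rw [lintegral_const_mul' _ _ ENNReal.ofReal_ne_top, lintegral_lintegral_swap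
    (f := fun ω s => ‖D.ex 1 t ω (y s ω)‖ₑ ^ 2) (hmy.enorm.pow_const 2).aemeasurable,
    ENNReal.ofReal_mul hD.T_pos.le, mul_assoc]
  refine mul_le_mul_right ?_ _
  rw [← lintegral_const_mul' _ _ ENNReal.ofReal_ne_top]
  have h12 : ∀ᵐ s ∂((volume : Measure ℝ).restrict (Ioc 0 t)), ∀ᵐ ω ∂D.P,
      D.ex (-1) s ω (G s ω) = y s ω ∧ D.ex 1 s ω (D.ex (-1) s ω (G s ω)) = G s ω := by
    refine ae_mono (Measure.restrict_mono (Ioc_subset_Ioc_right ht.2) le_rfl) ?_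
    refine Measure.ae_ae_of_ae_prod (p := fun p : ℝ × Ω => D.ex (-1) p.1 p.2 (G p.1 p.2) = y p.1 p.2 ∧
      D.ex 1 p.1 p.2 (D.ex (-1) p.1 p.2 (G p.1 p.2)) = G p.1 p.2) ?_
    filter_upwards [h3, hD.ae_Q_goodPath] with p h4 h5
    exact ⟨h4, h5.2.ex_ex_neg 1 (Ioc_subset_Icc_self h5.1) _⟩
  refine lintegral_mono_ae ?_
  filter_upwards [h12, ae_restrict_mem measurableSet_Ioc] with s h13 hs
  -- From the time `s` to `t`, the multiplication by `e^W` increases the second moment by a bounded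
  -- factor.
  refine (hD.lintegral_ex_sq_le hs.1.le hs.2 ht.2
    (h2 s ⟨hs.1.le, hs.2.trans ht.2⟩).aestronglyMeasurable).trans ?_
  have h14 : ∫⁻ ω, ‖D.ex 1 s ω (y s ω)‖ₑ ^ 2 ∂D.P = ∫⁻ ω, ‖G s ω‖ₑ ^ 2 ∂D.P := by
    refine lintegral_congr_ae ?_
    filter_upwards [h13] with ω h
    rw [← h.1, h.2]
  rw [h14]
  gcongr ENNReal.ofReal (Real.exp ?_) * _
  exact mul_le_mul_of_nonneg_left (by linarith [hs.1, ht.2])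
    (mul_nonneg (by norm_num) (Standing.ν_nonneg (D := D)))

lemma memLp_volterra {G : ℝ → Ω → D.H} (hGa : D.HasAdaptedVersion G)
    (hG : MemLp (fun p : ℝ × Ω => G p.1 p.2) 2 D.Q) :
    MemLp (fun p : ℝ × Ω => D.volterra G p.1 p.2) 2 D.Q := by
  have hm := (hasAdaptedVersion_volterra hD hGa hG).aesm
  refine memLp_two_of_lintegral hm ?_
  have h1 := lintegral_enorm_sq_lt_top hG
  rw [lintegral_prod _ (hG.1.enorm.pow_const 2)] at h1
  rw [lintegral_prod _ (hm.enorm.pow_const 2)]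
  refine lt_of_le_of_lt (setLIntegral_mono' measurableSet_Ioc fun t ht =>
    (lintegral_volterra_le hD hGa hG (Ioc_subset_Icc_self ht)).trans (mul_le_mul_right
      (lintegral_mono_set (Ioc_subset_Ioc_right ht.2)) _)) ?_
  rw [setLIntegral_const, Real.volume_Ioc]
  exact ENNReal.mul_lt_top (ENNReal.mul_lt_top ENNReal.ofReal_lt_top h1) ENNReal.ofReal_lt_top

end

section

/-! ### Linear multiplicative noise with a Lipschitz drift -/

variable {d : ℕ} {Ω : Type*} [mΩ : MeasurableSpace Ω] {D : Data d Ω}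
  [IsProbabilityMeasure D.P] (hD : Standing D)

omit [IsProbabilityMeasure D.P] in
lemma hasAdaptedVersion_lipschitz {F : D.H → D.H} {L : ℝ≥0} (hF : LipschitzWith L F)
    {X : ℝ → Ω → D.H} (hX : D.HasAdaptedVersion X) : D.HasAdaptedVersion fun t ω => F (X t ω) :=
  hasAdaptedVersion_map hX hX (f := fun p => F p.1) (hF.continuous.comp continuous_fst)

include hD

omit hD [IsProbabilityMeasure D.P] in
lemma hasAdaptedVersion_coe (h : D.adapted) : D.HasAdaptedVersion fun t ω => (h : Lp D.H 2 D.Q) (t, ω) :=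
  mem_adapted.1 h.2

omit hD [IsProbabilityMeasure D.P] in
lemma memLp_lipschitz {F : D.H → D.H} {L : ℝ≥0} (hF : LipschitzWith L F) (hF0 : F 0 = 0)
    (h : D.adapted) : MemLp (fun p : ℝ × Ω => F ((h : Lp D.H 2 D.Q) (p.1, p.2))) 2 D.Q :=
  hF.comp_memLp hF0 (Lp.memLp (h : Lp D.H 2 D.Q))

section Picard

variable {F : D.H → D.H} {L : ℝ≥0} (hF : LipschitzWith L F) (hF0 : F 0 = 0)

/-- The process `e^W (x + ∫ e^{-W} F(h) ds)`, whose fixed points are the solutions. -/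
def picardFun (F : D.H → D.H) (h : D.adapted) (t : ℝ) (ω : Ω) : D.H :=
  D.ex 1 t ω D.x + D.volterra (fun s ω => F ((h : Lp D.H 2 D.Q) (s, ω))) t ω

include hF hF0

lemma memLp_picardFun (h : D.adapted) : MemLp (fun p : ℝ × Ω => picardFun F h p.1 p.2) 2 D.Q :=
  (hD.memLp_ex_const D.x).add (memLp_volterra hD
    (hasAdaptedVersion_lipschitz hF (hasAdaptedVersion_coe h)) (memLp_lipschitz hF hF0 h))

lemma hasAdaptedVersion_picardFun (h : D.adapted) : D.HasAdaptedVersion (picardFun F h) :=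
  hasAdaptedVersion_map (hD.hasAdaptedVersion_ex 1 (hasAdaptedVersion_const D.x))
    (hasAdaptedVersion_volterra hD
      (hasAdaptedVersion_lipschitz hF (hasAdaptedVersion_coe h))
      (memLp_lipschitz hF hF0 h)) continuous_add

/-- The Picard map on the square integrable adapted processes. -/
def picard (h : D.adapted) : D.adapted :=
  ⟨(memLp_picardFun hD hF hF0 h).toLp _, mem_adapted.2
    (hasAdaptedVersion_congr (hasAdaptedVersion_picardFun hD hF hF0 h)
      (memLp_picardFun hD hF hF0 h).coeFn_toLp)⟩

omit hD hF hF0 in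
/-- `𝔼 ∫₀ᵗ |f|² ds`. -/
def energyUpTo (t : ℝ) (f : Lp D.H 2 D.Q) : ℝ≥0∞ :=
  ∫⁻ s in Ioc 0 t, ∫⁻ ω, ‖f (s, ω)‖ₑ ^ 2 ∂D.P

omit hD hF hF0 in
lemma energyUpTo_eq (f : Lp D.H 2 D.Q) : energyUpTo D.T f = ‖f‖ₑ ^ 2 := by
  rw [energyUpTo, ← lintegral_prod (fun p : ℝ × Ω => ‖f p‖ₑ ^ 2)
    ((Lp.aestronglyMeasurable f).enorm.pow_const 2), Lp.enorm_def,
    eLpNorm_eq_lintegral_rpow_enorm_toReal (by norm_num) (by norm_num),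
    ← ENNReal.rpow_natCast, ← ENNReal.rpow_mul]
  norm_num

omit hD hF hF0 in
lemma energyUpTo_congr {t : ℝ} (ht : t ≤ D.T) {f : Lp D.H 2 D.Q} {g : ℝ → Ω → D.H}
    (h : ∀ᵐ p ∂D.Q, f p = g p.1 p.2) :
    energyUpTo t f = ∫⁻ s in Ioc 0 t, ∫⁻ ω, ‖g s ω‖ₑ ^ 2 ∂D.P := by
  refine lintegral_congr_ae ?_
  filter_upwards [ae_mono (Measure.restrict_mono (Ioc_subset_Ioc_right ht) le_rfl)
    (Measure.ae_ae_of_ae_prod h)] with s hs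
  refine lintegral_congr_ae ?_
  filter_upwards [hs] with ω h
  rw [h]

/-- The constant in the contraction estimate. -/
def picardConst (D : Data d Ω) (L : ℝ≥0) : ℝ := D.T * Real.exp (2 * D.ν * D.T) * L ^ 2

omit [IsProbabilityMeasure D.P] hF hF0 in
lemma picardConst_nonneg : 0 ≤ picardConst D L :=
  mul_nonneg (mul_nonneg hD.T_pos.le (Real.exp_pos _).le) (by positivity)

lemma energyUpTo_picard_sub_le {t : ℝ} (ht : t ∈ Icc 0 D.T) (h k : D.adapted) :
    energyUpTo t ((picard hD hF hF0 h - picard hD hF hF0 k : D.adapted) : Lp D.H 2 D.Q) ≤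
      ENNReal.ofReal (picardConst D L) *
        ∫⁻ r in Ioc 0 t, energyUpTo r ((h - k : D.adapted) : Lp D.H 2 D.Q) := by
  have hFh := memLp_lipschitz hF hF0 h
  have hFk := memLp_lipschitz hF hF0 k
  have hFha := hasAdaptedVersion_lipschitz hF (hasAdaptedVersion_coe h)
  have hFka := hasAdaptedVersion_lipschitz hF (hasAdaptedVersion_coe k)
  let G : ℝ → Ω → D.H := fun s ω => F ((h : Lp D.H 2 D.Q) (s, ω)) - F ((k : Lp D.H 2 D.Q) (s, ω))
  have hG : MemLp (fun p : ℝ × Ω => G p.1 p.2) 2 D.Q := hFh.sub hFk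
  have hGa : D.HasAdaptedVersion G := hasAdaptedVersion_map hFha hFka continuous_sub
  have h1 : ∀ᵐ p ∂D.Q, ((picard hD hF hF0 h - picard hD hF hF0 k : D.adapted) : Lp D.H 2 D.Q) p = D.volterra G p.1 p.2 := by
    filter_upwards [Lp.coeFn_sub (picard hD hF hF0 h : Lp D.H 2 D.Q) (picard hD hF hF0 k : D.adapted),
      (memLp_picardFun hD hF hF0 h).coeFn_toLp, (memLp_picardFun hD hF hF0 k).coeFn_toLp,
      Measure.quasiMeasurePreserving_snd.ae (ae_volterra_sub hD
        (G := fun s ω => F ((h : Lp D.H 2 D.Q) (s, ω)))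
        (G' := fun s ω => F ((k : Lp D.H 2 D.Q) (s, ω))) hFh hFk), hD.ae_Q_goodPath]
      with p e1 e2 e3 e4 e5
    rw [e4 p.1 (Ioc_subset_Icc_self e5.1)]
    refine e1.trans ((congrArg₂ (· - ·) e2 e3).trans ?_)
    simp only [picardFun]
    abel
  rw [energyUpTo_congr ht.2 h1, ← lintegral_const_mul' _ _ ENNReal.ofReal_ne_top]
  refine setLIntegral_mono' measurableSet_Ioc fun r hr => ?_
  have hr' : r ∈ Icc 0 D.T := ⟨hr.1.le, hr.2.trans ht.2⟩
  refine (lintegral_volterra_le hD hGa hG hr').trans ?_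
  have h2 : ∀ᵐ p ∂D.Q, ((h - k : D.adapted) : Lp D.H 2 D.Q) p =
      (h : Lp D.H 2 D.Q) (p.1, p.2) - (k : Lp D.H 2 D.Q) (p.1, p.2) := Lp.coeFn_sub _ _
  rw [energyUpTo_congr hr'.2 (g := fun s ω => (h : Lp D.H 2 D.Q) (s, ω) - (k : Lp D.H 2 D.Q) (s, ω)) h2,
    picardConst, ENNReal.ofReal_mul (mul_nonneg hD.T_pos.le (Real.exp_pos _).le),
    mul_assoc (ENNReal.ofReal _) (ENNReal.ofReal _)]
  refine mul_le_mul_right ?_ _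
  rw [← lintegral_const_mul' _ _ ENNReal.ofReal_ne_top]
  refine lintegral_mono fun s => ?_
  rw [← lintegral_const_mul' _ _ ENNReal.ofReal_ne_top]
  refine lintegral_mono fun ω => ?_
  rw [ENNReal.ofReal_pow (p := (L : ℝ)) L.2, ENNReal.ofReal_coe_nnreal, ← mul_pow]
  gcongr
  simpa only [edist_eq_enorm_sub] using hF ((h : Lp D.H 2 D.Q) (s, ω)) ((k : Lp D.H 2 D.Q) (s, ω))

/-- The iterates of the Picard map satisfy the factorial bound of Volterra operators. -/
lemma energyUpTo_iterate_le (h k : D.adapted) (n : ℕ) {t : ℝ} (ht : t ∈ Icc 0 D.T) :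
    energyUpTo t (((picard hD hF hF0)^[n] h - (picard hD hF hF0)^[n] k : D.adapted) : Lp D.H 2 D.Q) ≤
      ENNReal.ofReal ((picardConst D L * t) ^ n / n.factorial) * ‖h - k‖ₑ ^ 2 := by
  induction n generalizing t with
  | zero =>
    have h1 : ‖h - k‖ₑ = ‖((h - k : D.adapted) : Lp D.H 2 D.Q)‖ₑ := rfl
    simp only [Function.iterate_zero, id_eq, pow_zero, Nat.factorial_zero, Nat.cast_one, div_one,
      ENNReal.ofReal_one, one_mul]
    rw [h1, ← energyUpTo_eq]
    exact lintegral_mono_set (Ioc_subset_Ioc_right ht.2)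
  | succ n ih =>
    rw [Function.iterate_succ_apply', Function.iterate_succ_apply']
    refine (energyUpTo_picard_sub_le hD hF hF0 ht _ _).trans ?_
    have hc := picardConst_nonneg hD (L := L)
    have h1 : ∫⁻ r in Ioc 0 t, energyUpTo r
        (((picard hD hF hF0)^[n] h - (picard hD hF hF0)^[n] k : D.adapted) : Lp D.H 2 D.Q) ≤
        ∫⁻ r in Ioc 0 t, ENNReal.ofReal ((picardConst D L * r) ^ n / n.factorial) * ‖h - k‖ₑ ^ 2 :=
      setLIntegral_mono' measurableSet_Ioc fun r hr => ih ⟨hr.1.le, hr.2.trans ht.2⟩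
    have h2 : ∫⁻ r in Ioc 0 t, ENNReal.ofReal ((picardConst D L * r) ^ n / n.factorial) =
        ENNReal.ofReal (picardConst D L ^ n * t ^ (n + 1) / (n + 1).factorial) := by
      rw [← ofReal_integral_eq_lintegral_ofReal]
      · congr 1
        rw [← intervalIntegral.integral_of_le ht.1]
        simp only [mul_pow, intervalIntegral.integral_div, intervalIntegral.integral_const_mul,
          integral_pow, Nat.factorial_succ]
        push_cast
        have : (n.factorial : ℝ) ≠ 0 := by positivity
        have : (n : ℝ) + 1 ≠ 0 := by positivity
        field_simp
        simp
      · exact (Continuous.integrableOn_Icc (by fun_prop)).mono_set Ioc_subset_Icc_self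
      · filter_upwards [ae_restrict_mem measurableSet_Ioc] with r hr
        have := hr.1.le
        positivity
    refine (mul_le_mul_right h1 _).trans (le_of_eq ?_)
    rw [lintegral_mul_const' _ _ (ENNReal.pow_ne_top enorm_ne_top), h2, ← mul_assoc,
      ← ENNReal.ofReal_mul hc]
    congr 2
    ring

/-- Existence of a solution for a Lipschitz drift: an iterate of the Picard map is a
contraction. -/
lemma exists_mild_solution : ∃ X : ℝ → Ω → D.H, D.HasAdaptedVersion X ∧
    MemLp (fun p : ℝ × Ω => X p.1 p.2) 2 D.Q ∧
    ∀ᵐ p ∂D.Q, X p.1 p.2 = D.ex 1 p.1 p.2 (D.x + ∫ s in Ioc 0 p.1, D.ex (-1) s p.2 (F (X s p.2))) := by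
  obtain ⟨n, hn⟩ := ((FloorSemiring.tendsto_pow_div_factorial_atTop
    (picardConst D L * D.T)).eventually (gt_mem_nhds (show (0 : ℝ) < 1 / 4 by norm_num))).exists
  have hcontr : ContractingWith (1 / 2) (picard hD hF hF0)^[n] := by
    refine ⟨by norm_num [← NNReal.coe_lt_coe], fun h k => ?_⟩
    rw [edist_eq_enorm_sub, edist_eq_enorm_sub]
    have h1 := energyUpTo_iterate_le hD hF hF0 h k n (t := D.T) ⟨hD.T_pos.le, le_rfl⟩
    rw [energyUpTo_eq] at h1
    have h2 : ‖(picard hD hF hF0)^[n] h - (picard hD hF hF0)^[n] k‖ₑ ^ 2 ≤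
        (((1 / 2 : ℝ≥0) : ℝ≥0∞) * ‖h - k‖ₑ) ^ 2 := by
      refine h1.trans ?_
      rw [mul_pow ((1 / 2 : ℝ≥0) : ℝ≥0∞)]
      refine mul_le_mul' ?_ le_rfl
      refine (ENNReal.ofReal_le_ofReal hn.le).trans (le_of_eq ?_)
      rw [← ENNReal.coe_pow, ENNReal.ofReal, ENNReal.coe_inj]
      refine NNReal.eq ?_
      rw [Real.coe_toNNReal _ (by norm_num)]
      norm_num
    rw [← ENNReal.rpow_ofNat, ← ENNReal.rpow_ofNat] at h2
    exact (ENNReal.rpow_le_rpow_iff two_pos).1 h2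
  have hfix := hcontr.isFixedPt_fixedPoint_iterate
  set h := ContractingWith.fixedPoint _ hcontr
  refine ⟨fun t ω => (h : Lp D.H 2 D.Q) (t, ω), hasAdaptedVersion_coe h, Lp.memLp _, ?_⟩
  have h3 := (memLp_picardFun hD hF hF0 h).coeFn_toLp
  have h4 : (memLp_picardFun hD hF hF0 h).toLp _ = (h : Lp D.H 2 D.Q) := congrArg Subtype.val hfix
  rw [h4] at h3
  filter_upwards [h3, hD.ae_Q_goodPath] with p h5 h6
  rw [h6.2.ex_add 1 (Ioc_subset_Icc_self h6.1)]
  exact h5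

end Picard

end

section

/-! ### The energy identity -/

variable {d : ℕ} {Ω : Type*} [mΩ : MeasurableSpace Ω] {D : Data d Ω}
  [IsProbabilityMeasure D.P] (hD : Standing D)
include hD

section Drift

variable {G : ℝ → Ω → D.H} (hGa : D.HasAdaptedVersion G)
  (hG : MemLp (fun p : ℝ × Ω => G p.1 p.2) 2 D.Q)
include hG

lemma memLp_ex_ex_neg : MemLp (fun p : ℝ × Ω => D.ex 1 p.1 p.2 (D.ex (-1) p.1 p.2 (G p.1 p.2))) 2 D.Q :=
  hG.ae_eq ((ae_ex_ex_neg hD fun p => G p.1 p.2).mono fun _ h => h.symm)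

include hGa

lemma inDomB_primitive : D.InDomB (fun t ω => ∫ s in Ioc 0 t, D.ex (-1) s ω (G s ω))
    (fun t ω => D.ex (-1) t ω (G t ω)) := by
  refine ⟨⟨hasAdaptedVersion_primitive hD hGa hG, ?_⟩, memH_of_adapted hD hGa hG, ?_⟩
  · simp only [expW_eq]
    exact memLp_volterra hD hGa hG
  · filter_upwards [ae_memLp_ex_neg hD hG] with ω h
    exact ⟨h, fun t _ => rfl⟩

lemma memTerm_primitive :
    D.MemTerm fun ω => ∫ s in Ioc 0 D.T, D.ex (-1) s ω (G s ω) := by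
  have hTT : D.T ∈ Icc 0 D.T := ⟨hD.T_pos.le, le_rfl⟩
  have h1 := aesm_integral (hD.hasAdaptedVersion_ex (-1) hGa) (ae_integrableOn_ex_neg hD hG) hTT
  have h2 : AEStronglyMeasurable (fun ω => D.volterra G D.T ω) D.P :=
    (hD.aesm_ex 1 D.T h1).mono (D.ℱ.le _)
  have h3 := lintegral_enorm_sq_lt_top hG
  rw [lintegral_prod _ (hG.1.enorm.pow_const 2)] at h3
  rw [Data.MemTerm]
  simp only [expW_eq]
  exact memLp_two_of_lintegral h2 ((lintegral_volterra_le hD hGa hG hTT).trans_lt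
    (ENNReal.mul_lt_top ENNReal.ofReal_lt_top h3))

variable {X : ℝ → Ω → D.H} (hX : MemLp (fun p : ℝ × Ω => X p.1 p.2) 2 D.Q)
  (hXG : ∀ᵐ p ∂D.Q, X p.1 p.2 =
    D.ex 1 p.1 p.2 (D.x + ∫ s in Ioc 0 p.1, D.ex (-1) s p.2 (G s p.2)))
include hXG

omit hGa hG in
lemma ae_eWB_primitive : ∀ᵐ p ∂D.Q,
    D.eWB (fun t ω => ∫ s in Ioc 0 t, D.ex (-1) s ω (G s ω))
      (fun t ω => D.ex (-1) t ω (G t ω)) p.1 p.2 =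
    G p.1 p.2 + mul D.O D.μ (X p.1 p.2) + (D.ν + D.δ) • X p.1 p.2 := by
  filter_upwards [hXG, hD.ae_Q_goodPath] with p h1 hp
  have hp1 := Ioc_subset_Icc_self hp.1
  have h3 : ∀ z : D.H, mul D.O (fun ξ => D.μ ξ + D.ν + D.δ) z =
      mul D.O D.μ z + (D.ν + D.δ) • z := by
    intro z
    rw [← hD.isMul_μ.mul_add_const]
    simp only [add_assoc]
  rw [Data.eWB, expW_eq, h3, hp.2.ex_add 1 hp1, hp.2.ex_add 1 hp1, hp.2.ex_ex_neg 1 hp1,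
    hp.2.ex_mul 1 hp1 hD.isMul_μ, hp.2.ex_smul 1 hp1, add_comm _ D.x, ← h1, add_assoc]

include hX

/-- Itô's formula for `|X|²`, in expectation. -/
lemma energy_identity :
    ∫ ω, ‖D.ex 1 D.T ω (D.x + ∫ s in Ioc 0 D.T, D.ex (-1) s ω (G s ω))‖ ^ 2 ∂D.P =
      ‖D.x‖ ^ 2 + 2 * ∫ p, inner ℝ (G p.1 p.2) (X p.1 p.2) ∂D.Q +
        4 * ∫ p, inner ℝ (mul D.O D.μ (X p.1 p.2)) (X p.1 p.2) ∂D.Q := by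
  let q : ℝ → Ω → D.H := fun t ω => D.x + ∫ s in Ioc 0 t, D.ex (-1) s ω (G s ω)
  let q' : ℝ → Ω → D.H := fun t ω => D.ex (-1) t ω (G t ω)
  have hq : D.HasAdaptedVersion q :=
    hasAdaptedVersion_map (hasAdaptedVersion_const D.x) (hasAdaptedVersion_primitive hD hGa hG)
      continuous_add
  have hq' : D.HasAdaptedVersion q' := hD.hasAdaptedVersion_ex (-1) hGa
  have hq2 : MemLp (fun p : ℝ × Ω => D.ex 1 p.1 p.2 (q p.1 p.2)) 2 D.Q := hX.ae_eq hXG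
  have hq'2 : MemLp (fun p : ℝ × Ω => D.ex 1 p.1 p.2 (q' p.1 p.2)) 2 D.Q := memLp_ex_ex_neg hD hG
  have hpath : ∀ᵐ ω ∂D.P, IsPrimitive D.T (q · ω) (q' · ω) := by
    filter_upwards [ae_integrableOn_ex_neg hD hG] with ω h
    refine ⟨h, fun t _ => ?_⟩
    simp only [q, q', Ioc_self, setIntegral_empty, add_zero]
  have hq0 : q 0 = fun _ => D.x := by
    funext ω
    simp only [q, Ioc_self, setIntegral_empty, add_zero]
  have hm0 : AEStronglyMeasurable[D.ℱ 0] (q 0) D.P := by rw [hq0]; exact aesm_const _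
  -- Both factors carry `e^W`, so `k = 2` and the drift is `4μ`.
  obtain ⟨-, -, -, h⟩ := hD.product_rule (k := 2) (σ := 1) (by norm_num) hq hq' hq hq' hq2 hq'2 hq2
    hq'2 (hpath.mono fun _ h => ⟨h, h⟩) hm0 hm0 (by
      rw [hq0, lintegral_const, measure_univ, mul_one]
      exact ENNReal.mul_lt_top enorm_lt_top enorm_lt_top)
  have hq'G := ae_ex_ex_neg hD fun p => G p.1 p.2
  have e1 : ∫ p, inner ℝ (D.ex 1 p.1 p.2 (q' p.1 p.2)) (D.ex 1 p.1 p.2 (q p.1 p.2)) ∂D.Q =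
      ∫ p, inner ℝ (G p.1 p.2) (X p.1 p.2) ∂D.Q := by
    refine integral_congr_ae ?_
    filter_upwards [hXG, hq'G] with p h1 h2
    rw [h1]
    exact congrArg (inner ℝ · _) h2
  have e2 : ∫ p, inner ℝ (D.ex 1 p.1 p.2 (q p.1 p.2)) (D.ex 1 p.1 p.2 (q' p.1 p.2)) ∂D.Q =
      ∫ p, inner ℝ (G p.1 p.2) (X p.1 p.2) ∂D.Q := by
    rw [← e1]
    exact integral_congr_ae (ae_of_all _ fun p => real_inner_comm _ _)
  have e3 : ∫ p, inner ℝ (mul D.O (fun ξ => (2 : ℝ) ^ 2 * D.μ ξ) (D.ex 1 p.1 p.2 (q p.1 p.2)))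
      (D.ex 1 p.1 p.2 (q p.1 p.2)) ∂D.Q =
      4 * ∫ p, inner ℝ (mul D.O D.μ (X p.1 p.2)) (X p.1 p.2) ∂D.Q := by
    rw [← integral_const_mul]
    refine integral_congr_ae ?_
    filter_upwards [hXG] with p h1
    have h2 : mul D.O (fun ξ => (2 : ℝ) ^ 2 * D.μ ξ) (X p.1 p.2) = (4 : ℝ) • mul D.O D.μ (X p.1 p.2) := by
      refine Lp.ext ?_
      filter_upwards [(hD.isMul_μ.const_mul (2 ^ 2)).mul_ae (X p.1 p.2), hD.isMul_μ.mul_ae (X p.1 p.2),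
        Lp.coeFn_smul (4 : ℝ) (mul D.O D.μ (X p.1 p.2))] with ξ h3 h4 h5
      rw [h3, h5, Pi.smul_apply, h4, smul_eq_mul]
      ring
    change inner ℝ (mul D.O (fun ξ => (2 : ℝ) ^ 2 * D.μ ξ) (D.ex 1 p.1 p.2 (D.x + _)))
      (D.ex 1 p.1 p.2 (D.x + _)) = _
    rw [← h1, h2, real_inner_smul_left]
  rw [e1, e2, e3, hq0] at h
  simp only [real_inner_self_eq_norm_sq, integral_const, probReal_univ, one_smul] at h
  rw [h]
  ring

end Drift

end

section

/-! ### The penalized equation -/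

variable {d : ℕ} {Ω : Type*} [mΩ : MeasurableSpace Ω] {D : Data d Ω} (hD : Standing D)
include hD

omit hD in
variable (D) in
/-- The constant in the bound for `ψ*` along the solutions of the penalized equation. -/
def penalConst : ℝ := (|1 - D.δ| + D.ν / 2) ^ 2 / (2 * D.δ)

/-- The bound for `ψ*` at the drift of the penalized equation. The value of the conjugate of `φ` at
the Yosida approximation `f` is at most `(f, X)`, and the remainder is absorbed by the quadratic
term of `ψ`. -/
lemma psiStar_penalized_le {f J X : D.H} {ε : ℝ} (hε : 0 < ε) (hJ : X - J = ε • f)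
    (hsub : ∀ w, phi D.O w ≠ ∞ → inner ℝ f (w - J) ≤ (phi D.O w).toReal - (phi D.O J).toReal) :
    (psiStar D.O D.δ (f + (1 - D.δ) • X - mul D.O D.μ X)).toENNReal ≤
      ENNReal.ofReal (inner ℝ f X + penalConst D * ‖X‖ ^ 2) := by
  refine psiStar_le D.O D.δ (fun w hw => ?_) hD.δ_pos.le
  have hδ := hD.δ_pos
  have h1 := hsub w hw
  have h2 : inner ℝ f X = inner ℝ f J + ε * ‖f‖ ^ 2 := by
    rw [show X = J + ε • f by rw [← hJ]; abel, inner_add_right, real_inner_smul_right,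
      real_inner_self_eq_norm_sq]
  have h3 : (0 : ℝ) ≤ (phi D.O J).toReal := ENNReal.toReal_nonneg
  have h4 : ‖(1 - D.δ) • X - mul D.O D.μ X‖ ≤ (|1 - D.δ| + D.ν / 2) * ‖X‖ := by
    refine (norm_sub_le _ _).trans ?_
    rw [norm_smul, Real.norm_eq_abs, add_mul]
    exact add_le_add le_rfl (hD.norm_μ_le X)
  set g := (1 - D.δ) • X - mul D.O D.μ X
  set C := |1 - D.δ| + D.ν / 2 with hC
  have hC0 : 0 ≤ C := add_nonneg (abs_nonneg _) (div_nonneg Standing.ν_nonneg two_pos.le)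
  have h5 : inner ℝ g w ≤ C * ‖X‖ * ‖w‖ :=
    (real_inner_le_norm _ _).trans (mul_le_mul_of_nonneg_right h4 (norm_nonneg _))
  -- Young's inequality; this is where the constant comes from.
  have h6 : C * ‖X‖ * ‖w‖ ≤ D.δ / 2 * ‖w‖ ^ 2 + penalConst D * ‖X‖ ^ 2 := by
    have h7 : D.δ / 2 * ‖w‖ ^ 2 + penalConst D * ‖X‖ ^ 2 - C * ‖X‖ * ‖w‖ =
        (D.δ * ‖w‖ - C * ‖X‖) ^ 2 / (2 * D.δ) := by
      rw [penalConst, ← hC]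
      field_simp
      ring
    have h8 : 0 ≤ (D.δ * ‖w‖ - C * ‖X‖) ^ 2 / (2 * D.δ) := by positivity
    linarith
  rw [add_sub_assoc, inner_add_left]
  rw [inner_sub_right] at h1
  nlinarith [mul_nonneg hε.le (sq_nonneg ‖f‖)]

variable [IsProbabilityMeasure D.P]

omit hD [IsProbabilityMeasure D.P] in
variable (D) in
/-- The drift `-f(z) - (ν + 1) z` of the penalized equation. The linear part makes the energy of
the solutions decrease. -/
def penalDrift (f : D.H → D.H) (z : D.H) : D.H := -f z - (D.ν + 1) • z

omit hD [IsProbabilityMeasure D.P] in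
variable (D) in
/-- The process `X` solves the equation in which the subdifferential of `φ` is replaced by its
Yosida approximation `f`, with resolvent `J`. -/
structure IsPenalized (ε : ℝ) (J f : D.H → D.H) (X : ℝ → Ω → D.H) : Prop where
  pos : 0 < ε
  resolvent : ∀ z, z - J z = ε • f z
  finite : ∀ z, phi D.O (J z) ≠ ∞
  subgradient : ∀ z w, phi D.O w ≠ ∞ →
    inner ℝ (f z) (w - J z) ≤ (phi D.O w).toReal - (phi D.O (J z)).toReal
  map_zero : f 0 = 0
  lipschitz : LipschitzWith (Real.toNNReal ε⁻¹) f
  adapted : D.HasAdaptedVersion X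
  memLp : MemLp (fun p : ℝ × Ω => X p.1 p.2) 2 D.Q
  eq : ∀ᵐ p ∂D.Q, X p.1 p.2 = D.ex 1 p.1 p.2
    (D.x + ∫ s in Ioc 0 p.1, D.ex (-1) s p.2 (penalDrift D f (X s p.2)))

omit hD [IsProbabilityMeasure D.P] in
lemma lipschitzWith_penalDrift {f : D.H → D.H} {L : ℝ≥0} (hf : LipschitzWith L f) :
    LipschitzWith (L + Real.toNNReal (D.ν + 1)) (penalDrift D f) := by
  have hν : 0 ≤ D.ν := Standing.ν_nonneg
  refine LipschitzWith.of_dist_le_mul fun z w => ?_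
  rw [NNReal.coe_add, Real.coe_toNNReal _ (by positivity), dist_eq_norm,
    show penalDrift D f z - penalDrift D f w = -(f z - f w) - (D.ν + 1) • (z - w) by
      simp only [penalDrift]; module, add_mul]
  refine (norm_sub_le _ _).trans ?_
  rw [norm_neg, norm_smul, Real.norm_eq_abs, abs_of_nonneg (by positivity), ← dist_eq_norm,
    ← dist_eq_norm]
  exact add_le_add (hf.dist_le_mul z w) le_rfl

lemma exists_isPenalized {ε : ℝ} (hε : 0 < ε) : ∃ J f X, IsPenalized D ε J f X := by
  obtain ⟨J, f, hJ, hJfin, hsub, hf0, hfL⟩ := exists_yosida (phi D.O)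
    (lowerSemicontinuous_phi D.O) (phi_convex D.O) (phi_zero D.O) hε
  have hfl : LipschitzWith (Real.toNNReal ε⁻¹) f := by
    refine LipschitzWith.of_dist_le_mul fun z w => ?_
    rw [Real.coe_toNNReal _ (inv_nonneg.2 hε.le), dist_eq_norm, dist_eq_norm]
    exact hfL z w
  obtain ⟨X, hXa, hX, hXG⟩ := exists_mild_solution hD (lipschitzWith_penalDrift hfl)
    (show penalDrift D f 0 = 0 by rw [penalDrift, hf0, neg_zero, smul_zero, sub_zero])
  exact ⟨J, f, X, hε, hJ, hJfin, hsub, hf0, hfl, hXa, hX, hXG⟩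

namespace IsPenalized

variable {ε : ℝ} {J f : D.H → D.H} {X : ℝ → Ω → D.H} (h : IsPenalized D ε J f X)
include h

omit hD [IsProbabilityMeasure D.P] in
/-- The value of the Yosida approximation bounds the potential at the resolvent. -/
lemma phi_add_le (v : D.H) : (phi D.O (J v)).toReal + ε * ‖f v‖ ^ 2 ≤ inner ℝ (f v) v := by
  have h1 := h.subgradient v 0 (by rw [phi_zero]; exact ENNReal.zero_ne_top)
  rw [phi_zero, zero_sub, inner_neg_right, ENNReal.toReal_zero, zero_sub] at h1
  have h2 : inner ℝ (f v) v = inner ℝ (f v) (J v) + ε * ‖f v‖ ^ 2 := by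
    nth_rewrite 2 [show v = J v + ε • f v by rw [← h.resolvent]; abel]
    rw [inner_add_right, real_inner_smul_right, real_inner_self_eq_norm_sq]
  linarith

omit hD [IsProbabilityMeasure D.P] in
lemma inner_nonneg (v : D.H) : 0 ≤ inner ℝ (f v) v :=
  le_trans (add_nonneg ENNReal.toReal_nonneg (mul_nonneg h.pos.le (sq_nonneg _))) (h.phi_add_le v)

omit hD [IsProbabilityMeasure D.P] in
lemma memLp_f : MemLp (fun p : ℝ × Ω => f (X p.1 p.2)) 2 D.Q :=
  h.lipschitz.comp_memLp h.map_zero h.memLp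

omit hD [IsProbabilityMeasure D.P] in
lemma integrable_inner_f :
    Integrable (fun p : ℝ × Ω => (inner ℝ (f (X p.1 p.2)) (X p.1 p.2) : ℝ)) D.Q :=
  integrable_inner h.memLp_f h.memLp

omit hD [IsProbabilityMeasure D.P] in
lemma integrable_norm_sq : Integrable (fun p : ℝ × Ω => ‖X p.1 p.2‖ ^ 2) D.Q :=
  h.memLp.integrable_norm_pow (by norm_num)

omit hD [IsProbabilityMeasure D.P] in
lemma adapted_drift : D.HasAdaptedVersion fun t ω => penalDrift D f (X t ω) :=
  hasAdaptedVersion_lipschitz (lipschitzWith_penalDrift h.lipschitz) h.adapted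

omit hD [IsProbabilityMeasure D.P] in
lemma memLp_drift : MemLp (fun p : ℝ × Ω => penalDrift D f (X p.1 p.2)) 2 D.Q :=
  (lipschitzWith_penalDrift h.lipschitz).comp_memLp
    (by rw [penalDrift, h.map_zero, neg_zero, smul_zero, sub_zero]) h.memLp

/-- The a priori estimate. -/
lemma energy_le : ∫ ω, ‖D.ex 1 D.T ω
      (D.x + ∫ s in Ioc 0 D.T, D.ex (-1) s ω (penalDrift D f (X s ω)))‖ ^ 2 ∂D.P +
    2 * ∫ p, inner ℝ (f (X p.1 p.2)) (X p.1 p.2) ∂D.Q + 2 * ∫ p, ‖X p.1 p.2‖ ^ 2 ∂D.Q ≤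
      ‖D.x‖ ^ 2 := by
  have hen := energy_identity hD h.adapted_drift h.memLp_drift h.memLp h.eq
  have hμX : MemLp (fun p : ℝ × Ω => mul D.O D.μ (X p.1 p.2)) 2 D.Q :=
    hD.isMul_μ.toCLM.comp_memLp' h.memLp
  have i1 := h.integrable_inner_f
  have i2 : Integrable (fun p : ℝ × Ω => (D.ν + 1) * ‖X p.1 p.2‖ ^ 2) D.Q :=
    h.integrable_norm_sq.const_mul _
  have i3 : Integrable (fun p : ℝ × Ω => -(inner ℝ (f (X p.1 p.2)) (X p.1 p.2) : ℝ)) D.Q := i1.neg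
  have e1 : ∫ p, inner ℝ (penalDrift D f (X p.1 p.2)) (X p.1 p.2) ∂D.Q =
      -∫ p, inner ℝ (f (X p.1 p.2)) (X p.1 p.2) ∂D.Q -
        (D.ν + 1) * ∫ p, ‖X p.1 p.2‖ ^ 2 ∂D.Q := by
    rw [← integral_neg, ← integral_const_mul, ← integral_sub i3 i2]
    refine integral_congr_ae (ae_of_all _ fun p => ?_)
    simp only [penalDrift]
    rw [inner_sub_left, inner_neg_left, real_inner_smul_left, real_inner_self_eq_norm_sq]
  have e2 : ∫ p, inner ℝ (mul D.O D.μ (X p.1 p.2)) (X p.1 p.2) ∂D.Q ≤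
      D.ν / 2 * ∫ p, ‖X p.1 p.2‖ ^ 2 ∂D.Q := by
    rw [← integral_const_mul]
    exact integral_mono (integrable_inner hμX h.memLp) (h.integrable_norm_sq.const_mul _)
      fun p => hD.inner_μ_le _
  rw [e1] at hen
  linarith

lemma integrals_le : 0 ≤ ∫ p, inner ℝ (f (X p.1 p.2)) (X p.1 p.2) ∂D.Q ∧
    0 ≤ ∫ p, ‖X p.1 p.2‖ ^ 2 ∂D.Q ∧
    ∫ p, inner ℝ (f (X p.1 p.2)) (X p.1 p.2) ∂D.Q ≤ ‖D.x‖ ^ 2 ∧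
    ∫ p, ‖X p.1 p.2‖ ^ 2 ∂D.Q ≤ ‖D.x‖ ^ 2 ∧
    ∫ ω, ‖D.ex 1 D.T ω
      (D.x + ∫ s in Ioc 0 D.T, D.ex (-1) s ω (penalDrift D f (X s ω)))‖ ^ 2 ∂D.P ≤ ‖D.x‖ ^ 2 := by
  have h1 := h.energy_le hD
  have h2 : 0 ≤ ∫ p, inner ℝ (f (X p.1 p.2)) (X p.1 p.2) ∂D.Q :=
    integral_nonneg fun p => h.inner_nonneg _
  have h3 : 0 ≤ ∫ p, ‖X p.1 p.2‖ ^ 2 ∂D.Q := integral_nonneg fun p => by positivity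
  have h4 : 0 ≤ ∫ ω, ‖D.ex 1 D.T ω
      (D.x + ∫ s in Ioc 0 D.T, D.ex (-1) s ω (penalDrift D f (X s ω)))‖ ^ 2 ∂D.P :=
    integral_nonneg fun p => by positivity
  exact ⟨h2, h3, by linarith, by linarith, by linarith⟩

/-- The bound for `G₂` does not depend on `ε`. -/
lemma G2_le : D.G2 (fun t ω => -D.eWB
      (fun t ω => ∫ s in Ioc 0 t, D.ex (-1) s ω (penalDrift D f (X s ω)))
      (fun t ω => D.ex (-1) t ω (penalDrift D f (X t ω))) t ω) ≤
    ENNReal.ofReal ((1 + penalConst D) * ‖D.x‖ ^ 2) := by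
  have hz := inDomB_primitive hD h.adapted_drift h.memLp_drift
  rw [G2_eq hD hz.memH hz.memH_deriv]
  have hK : 0 ≤ penalConst D :=
    div_nonneg (sq_nonneg _) (mul_nonneg two_pos.le hD.δ_pos.le)
  have i1 := h.integrable_inner_f
  have i2 : Integrable (fun p : ℝ × Ω => penalConst D * ‖X p.1 p.2‖ ^ 2) D.Q :=
    h.integrable_norm_sq.const_mul _
  have i3 : Integrable (fun p : ℝ × Ω => inner ℝ (f (X p.1 p.2)) (X p.1 p.2) +
    penalConst D * ‖X p.1 p.2‖ ^ 2) D.Q := i1.add i2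
  have h1 : ∀ᵐ p ∂D.Q, (psiStar D.O D.δ (-D.eWB
      (fun t ω => ∫ s in Ioc 0 t, D.ex (-1) s ω (penalDrift D f (X s ω)))
      (fun t ω => D.ex (-1) t ω (penalDrift D f (X t ω))) p.1 p.2)).toENNReal ≤
      ENNReal.ofReal (inner ℝ (f (X p.1 p.2)) (X p.1 p.2) +
        penalConst D * ‖X p.1 p.2‖ ^ 2) := by
    filter_upwards [ae_eWB_primitive hD (G := fun t ω => penalDrift D f (X t ω)) (X := X) h.eq] with p hp
    rw [hp]
    -- The terms `ν X` cancel.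
    have h2 : -(penalDrift D f (X p.1 p.2) + mul D.O D.μ (X p.1 p.2) + (D.ν + D.δ) • X p.1 p.2) =
        f (X p.1 p.2) + (1 - D.δ) • X p.1 p.2 - mul D.O D.μ (X p.1 p.2) := by
      rw [penalDrift]
      generalize mul D.O D.μ (X p.1 p.2) = w
      generalize f (X p.1 p.2) = v
      module
    rw [h2]
    exact psiStar_penalized_le hD h.pos (h.resolvent (X p.1 p.2)) (h.subgradient (X p.1 p.2))
  refine (lintegral_mono_ae h1).trans ?_
  have h6 : 0 ≤ᵐ[D.Q] fun p : ℝ × Ω => inner ℝ (f (X p.1 p.2)) (X p.1 p.2) +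
      penalConst D * ‖X p.1 p.2‖ ^ 2 :=
    ae_of_all _ fun p => add_nonneg (h.inner_nonneg _) (mul_nonneg hK (sq_nonneg _))
  rw [← ofReal_integral_eq_lintegral_ofReal i3 h6,
    integral_add i1 i2, integral_const_mul]
  obtain ⟨-, -, h4, h5, -⟩ := h.integrals_le hD
  refine ENNReal.ofReal_le_ofReal ?_
  rw [add_mul, one_mul]
  exact add_le_add h4 (mul_le_mul_of_nonneg_left h5 hK)

omit hD [IsProbabilityMeasure D.P] in
lemma memLp_resolvent : MemLp (fun p : ℝ × Ω => J (X p.1 p.2)) 2 D.Q := by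
  refine (h.memLp.sub (h.memLp_f.const_smul ε)).ae_eq (ae_of_all _ fun p => ?_)
  simp only [Pi.sub_apply, Pi.smul_apply]
  rw [← h.resolvent, sub_sub_cancel]

lemma lintegral_phi_le :
    ∫⁻ p, phi D.O (J (X p.1 p.2)) ∂D.Q ≤ ENNReal.ofReal (‖D.x‖ ^ 2) := by
  have h1 : ∀ p : ℝ × Ω, phi D.O (J (X p.1 p.2)) ≤
      ENNReal.ofReal (inner ℝ (f (X p.1 p.2)) (X p.1 p.2)) := fun p =>
    (ENNReal.le_ofReal_iff_toReal_le (h.finite _) (h.inner_nonneg _)).2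
      (le_trans (le_add_of_nonneg_right (mul_nonneg h.pos.le (sq_nonneg _))) (h.phi_add_le _))
  refine (lintegral_mono h1).trans ?_
  rw [← ofReal_integral_eq_lintegral_ofReal h.integrable_inner_f (ae_of_all _ fun p => h.inner_nonneg _)]
  exact ENNReal.ofReal_le_ofReal (h.integrals_le hD).2.2.1

lemma integral_resolvent_sub_le :
    ∫ p, ‖J (X p.1 p.2) - X p.1 p.2‖ ^ 2 ∂D.Q ≤ ε * ‖D.x‖ ^ 2 := by
  have h1 : ∫ p, ‖J (X p.1 p.2) - X p.1 p.2‖ ^ 2 ∂D.Q ≤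
      ε * ∫ p, inner ℝ (f (X p.1 p.2)) (X p.1 p.2) ∂D.Q := by
    rw [← integral_const_mul]
    refine integral_mono_of_nonneg (ae_of_all _ fun p => sq_nonneg _)
      (h.integrable_inner_f.const_mul _) (ae_of_all _ fun p => ?_)
    simp only
    rw [norm_sub_rev, h.resolvent, norm_smul, Real.norm_eq_abs, abs_of_pos h.pos, mul_pow, sq ε,
      mul_assoc]
    refine mul_le_mul_of_nonneg_left ?_ h.pos.le
    exact le_trans (le_add_of_nonneg_left ENNReal.toReal_nonneg) (h.phi_add_le _)
  exact h1.trans (mul_le_mul_of_nonneg_left (h.integrals_le hD).2.2.1 h.pos.le)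

end IsPenalized

/-- Elements of the domain of `𝓑` with bounds that do not depend on `ε`, near processes with finite
potential. -/
lemma exists_penalized {ε : ℝ} (hε : 0 < ε) : ∃ (z z' : ℝ → Ω → D.H) (hz : D.InDomB z z')
    (hzT : D.MemTerm (z D.T)) (a : Lp D.H 2 D.Q),
    D.G2 (fun t ω => -D.eWB z z' t ω) ≤ ENNReal.ofReal ((1 + penalConst D) * ‖D.x‖ ^ 2) ∧
    ∫⁻ p, phi D.O (a p) ∂D.Q ≤ ENNReal.ofReal (‖D.x‖ ^ 2) ∧
    ‖a - ((MemH_memLp hz.memH).toLp _ + (hD.memLp_ex_const D.x).toLp _)‖ ^ 2 ≤ ε * ‖D.x‖ ^ 2 ∧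
    ‖(MemH_memLp hz.memH).toLp _ + (hD.memLp_ex_const D.x).toLp _‖ ^ 2 ≤ ‖D.x‖ ^ 2 ∧
    ‖(MemTerm_memLp hzT).toLp _ +
      (hD.memLp_ex_const_time ⟨hD.T_pos.le, le_rfl⟩ D.x).toLp _‖ ^ 2 ≤ ‖D.x‖ ^ 2 := by
  have hTT : D.T ∈ Icc 0 D.T := ⟨hD.T_pos.le, le_rfl⟩
  obtain ⟨J, f, X, h⟩ := exists_isPenalized hD hε
  have hz := inDomB_primitive hD h.adapted_drift h.memLp_drift
  have hzT := memTerm_primitive hD h.adapted_drift h.memLp_drift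
  have hsum : ∀ᵐ p ∂D.Q, ((MemH_memLp hz.memH).toLp _ + (hD.memLp_ex_const D.x).toLp _ :
      Lp D.H 2 D.Q) p = X p.1 p.2 := by
    filter_upwards [Lp.coeFn_add ((MemH_memLp hz.memH).toLp _) ((hD.memLp_ex_const D.x).toLp _),
      (MemH_memLp hz.memH).coeFn_toLp, (hD.memLp_ex_const D.x).coeFn_toLp, h.eq, hD.ae_Q_goodPath]
      with p h1 h2 h3 h4 h5
    rw [h1, Pi.add_apply, h2, h3, h4, h5.2.ex_add 1 (Ioc_subset_Icc_self h5.1), add_comm]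
  have hsum' : (MemH_memLp hz.memH).toLp _ + (hD.memLp_ex_const D.x).toLp _ = h.memLp.toLp _ := by
    refine Lp.ext ?_
    filter_upwards [hsum, h.memLp.coeFn_toLp] with p h1 h2
    rw [h1, h2]
  refine ⟨_, _, hz, hzT, h.memLp_resolvent.toLp _, h.G2_le hD, ?_, ?_, ?_, ?_⟩
  · refine (le_of_eq ?_).trans (h.lintegral_phi_le hD)
    refine lintegral_congr_ae ?_
    filter_upwards [h.memLp_resolvent.coeFn_toLp] with p hp
    rw [hp]
  · rw [hsum', ← MemLp.toLp_sub, norm_toLp_sq]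
    exact h.integral_resolvent_sub_le hD
  · rw [hsum', norm_toLp_sq]
    exact (h.integrals_le hD).2.2.2.1
  · rw [← MemLp.toLp_add, norm_toLp_sq]
    refine (le_of_eq ?_).trans (h.integrals_le hD).2.2.2.2
    refine integral_congr_ae ?_
    filter_upwards [hD.ae_goodPath] with ω h
    rw [Pi.add_apply, h.ex_add 1 hTT, add_comm]

end

section

/-! ### The integral of the potential and a point where the functionals are finite -/

variable {d : ℕ} {Ω : Type*} [mΩ : MeasurableSpace Ω] {D : Data d Ω}

variable (D) in
/-- The integral `𝔼 ∫₀ᵀ φ(h) dt`. -/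
def potential (h : Lp D.H 2 D.Q) : ℝ≥0∞ := ∫⁻ p, phi D.O (h p) ∂D.Q

lemma lowerSemicontinuous_potential : LowerSemicontinuous (potential D) := by
  refine lowerSemicontinuous_iff_isClosed_preimage.2 fun c => ?_
  refine isClosed_of_closure_subset fun f hf => ?_
  obtain ⟨u, hu, huf⟩ := mem_closure_iff_seq_limit.1 hf
  obtain ⟨ns, -, hns⟩ := (tendstoInMeasure_of_tendsto_Lp huf).exists_seq_tendsto_ae
  have hm : ∀ n, AEMeasurable (fun p => phi D.O (u (ns n) p)) D.Q := fun n =>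
    (measurable_phi D.O).comp_aemeasurable (Lp.aestronglyMeasurable _).aemeasurable
  have h1 : ∀ᵐ p ∂D.Q, phi D.O (f p) ≤ liminf (fun n => phi D.O (u (ns n) p)) atTop := by
    filter_upwards [hns] with p hp
    exact ((lowerSemicontinuous_phi D.O).lowerSemicontinuousAt _).le_liminf.trans
      (liminf_le_liminf_of_le hp)
  calc potential D f ≤ ∫⁻ p, liminf (fun n => phi D.O (u (ns n) p)) atTop ∂D.Q := lintegral_mono_ae h1
    _ ≤ liminf (fun n => potential D (u (ns n))) atTop := lintegral_liminf_le' hm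
    _ ≤ c := liminf_le_of_le (by isBoundedDefault) fun b hb => by
      obtain ⟨n, hn⟩ := hb.exists
      exact hn.trans (hu (ns n))

lemma potential_comb {s r : ℝ} (hs : 0 ≤ s) (hr : 0 ≤ r) (hsr : s + r = 1) (a b : Lp D.H 2 D.Q) :
    potential D (s • a + r • b) ≤
      ENNReal.ofReal s * potential D a + ENNReal.ofReal r * potential D b := by
  have hm : ∀ f : Lp D.H 2 D.Q, AEMeasurable (fun p => phi D.O (f p)) D.Q := fun f =>
    (measurable_phi D.O).comp_aemeasurable (Lp.aestronglyMeasurable _).aemeasurable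
  simp only [potential]
  rw [← lintegral_const_mul' _ _ ENNReal.ofReal_ne_top, ← lintegral_const_mul' _ _ ENNReal.ofReal_ne_top,
    ← lintegral_add_left' ((hm a).const_mul _)]
  refine lintegral_mono_ae ?_
  filter_upwards [Lp.coeFn_add (s • a) (r • b), Lp.coeFn_smul s a, Lp.coeFn_smul r b] with p h1 h2 h3
  rw [h1, Pi.add_apply, h2, h3, Pi.smul_apply, Pi.smul_apply, show r = 1 - s by linarith]
  exact phi_convex D.O _ _ s hs (by linarith)

lemma potential_midpoint (a b : Lp D.H 2 D.Q) :
    potential D ((1 / 2 : ℝ) • (a + b)) ≤ (potential D a + potential D b) / 2 := by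
  have h := potential_comb (s := 1 / 2) (r := 1 / 2) (by norm_num) (by norm_num) (by norm_num) a b
  have h3 : ENNReal.ofReal (1 / 2) = 2⁻¹ := by
    rw [one_div, ENNReal.ofReal_inv_of_pos (by norm_num), ENNReal.ofReal_ofNat]
  rw [h3, ← mul_add, mul_comm, ← div_eq_mul_inv, ← smul_add] at h
  exact h

lemma convex_potential_le (c : ℝ≥0∞) : Convex ℝ {a | potential D a ≤ c} := by
  intro a ha b hb s r hs hr hsr
  rw [mem_ofPred_eq] at ha hb ⊢
  refine (potential_comb hs hr hsr a b).trans ?_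
  calc ENNReal.ofReal s * potential D a + ENNReal.ofReal r * potential D b
      ≤ ENNReal.ofReal s * c + ENNReal.ofReal r * c := by gcongr
    _ = c := by rw [← add_mul, ← ENNReal.ofReal_add hs hr, hsr, ENNReal.ofReal_one, one_mul]

lemma norm_withLp_le {A B : Type*} [NormedAddCommGroup A] [NormedAddCommGroup B]
    (v : WithLp 2 (A × B)) : ‖v‖ ≤ ‖v.fst‖ + ‖v.snd‖ := by
  refine abs_le_of_sq_le_sq' ?_ (by positivity) |>.2
  rw [WithLp.prod_norm_sq_eq_of_L2]
  nlinarith [norm_nonneg v.fst, norm_nonneg v.snd]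

variable [IsProbabilityMeasure D.P] (hD : Standing D)
include hD

/-- There is a point at which both convex functionals are finite. The solutions of the penalized
equations are bounded together with the values of `G₂`, while the potential is bounded only at
nearby processes; so the point is found in an intersection of closed convex sets of pairs. -/
lemma exists_feasible : ∃ p : D.Pt, relaxation hD p ≠ ∞ ∧
    potential D ((p.fst : Lp D.H 2 D.Q) + (hD.memLp_ex_const D.x).toLp _) ≠ ∞ := by
  set c := (hD.memLp_ex_const D.x).toLp (fun p : ℝ × Ω => D.ex 1 p.1 p.2 D.x) with hc
  set c₁ := (hD.memLp_ex_const_time ⟨hD.T_pos.le, le_rfl⟩ D.x).toLp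
    (fun ω : Ω => D.ex 1 D.T ω D.x) with hc₁
  set M := ENNReal.ofReal ((1 + penalConst D) * ‖D.x‖ ^ 2) with hM
  set M' := ENNReal.ofReal (‖D.x‖ ^ 2) with hM'
  -- Pairs of a point and a process of finite potential that is near the process of the point.
  let V := WithLp 2 (D.Pt × Lp D.H 2 D.Q)
  let ρ : ℕ → ℝ := fun n => 1 / ((n : ℝ) + 1) * ‖D.x‖
  let K : ℕ → Set V := fun n => {v | v.fst ∈ closure (sublevel hD M) ∧ potential D v.snd ≤ M' ∧
    v.snd - (v.fst.fst : Lp D.H 2 D.Q) ∈ Metric.closedBall c (ρ n)}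
  have hl1 : IsLinearMap ℝ fun v : V => v.fst := ⟨fun _ _ => rfl, fun _ _ => rfl⟩
  have hl2 : IsLinearMap ℝ fun v : V => v.snd := ⟨fun _ _ => rfl, fun _ _ => rfl⟩
  have hl3 : IsLinearMap ℝ fun v : V => v.snd - (v.fst.fst : Lp D.H 2 D.Q) :=
    ⟨fun v w => add_sub_add_comm v.snd w.snd (v.fst.fst : Lp D.H 2 D.Q) w.fst.fst,
      fun r v => (smul_sub r v.snd (v.fst.fst : Lp D.H 2 D.Q)).symm⟩
  have hne : (⋂ n, K n).Nonempty := by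
    refine nonempty_iInter_of_convex_closed K ?_ (fun n => ?_) (fun n => ?_)
      (‖D.x‖ + ‖c‖ + (‖D.x‖ + ‖c₁‖) + 2 * ‖D.x‖) fun n => ?_
    · intro m n hmn v hv
      refine ⟨hv.1, hv.2.1, Metric.closedBall_subset_closedBall ?_ hv.2.2⟩
      refine mul_le_mul_of_nonneg_right ?_ (norm_nonneg _)
      exact one_div_le_one_div_of_le (by positivity) (by exact_mod_cast Nat.succ_le_succ hmn)
    · refine IsClosed.inter ?_ (IsClosed.inter ?_ ?_)
      · exact isClosed_closure.preimage (by fun_prop : Continuous fun v : V => v.fst)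
      · exact (lowerSemicontinuous_iff_isClosed_preimage.1 lowerSemicontinuous_potential M').preimage
          (by fun_prop : Continuous fun v : V => v.snd)
      · exact Metric.isClosed_closedBall.preimage
          (by fun_prop : Continuous fun v : V => v.snd - (v.fst.fst : Lp D.H 2 D.Q))
    · refine Convex.inter ?_ (Convex.inter ?_ ?_)
      · exact (convex_sublevel hD M).closure.is_linear_preimage hl1
      · exact (convex_potential_le M').is_linear_preimage hl2
      · exact (convex_closedBall c (ρ n)).is_linear_preimage hl3
    · have hr : (0 : ℝ) < 1 / ((n : ℝ) + 1) := by positivity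
      have hr1 : 1 / ((n : ℝ) + 1) ≤ 1 := by
        rw [div_le_one (by positivity)]
        linarith [n.cast_nonneg (α := ℝ)]
      obtain ⟨z, z', hz, hzT, a, h1, h2, h3, h4, h5⟩ :=
        exists_penalized hD (ε := (1 / ((n : ℝ) + 1)) ^ 2) (by positivity)
      rw [← mul_pow] at h3
      have h3' := abs_le_of_sq_le_sq' h3 (by positivity) |>.2
      have h4' := abs_le_of_sq_le_sq' h4 (norm_nonneg _) |>.2
      have h5' := abs_le_of_sq_le_sq' h5 (norm_nonneg _) |>.2
      refine ⟨WithLp.toLp 2 (toPt hD hz.memH hzT, a),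
        ⟨subset_closure ⟨z, z', hz, hzT, rfl, h1⟩, h2, ?_⟩, ?_⟩
      · rw [mem_closedBall_iff_norm]
        refine le_trans (le_of_eq ?_) h3'
        rw [← sub_sub]
        rfl
      · set h := (MemH_memLp hz.memH).toLp _
        set h₁ := (MemTerm_memLp hzT).toLp _
        have n1 : ‖h‖ ≤ ‖h + c‖ + ‖c‖ := by simpa using norm_sub_le (h + c) c
        have n2 : ‖h₁‖ ≤ ‖h₁ + c₁‖ + ‖c₁‖ := by simpa using norm_sub_le (h₁ + c₁) c₁
        have n3 : ‖a‖ ≤ ‖a - (h + c)‖ + ‖h + c‖ := by simpa using norm_add_le (a - (h + c)) (h + c)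
        have n4 : ‖toPt hD hz.memH hzT‖ ≤ ‖h‖ + ‖h₁‖ := norm_withLp_le _
        have n5 : 1 / ((n : ℝ) + 1) * ‖D.x‖ ≤ ‖D.x‖ := mul_le_of_le_one_left (norm_nonneg _) hr1
        refine (norm_withLp_le _).trans ?_
        change ‖toPt hD hz.memH hzT‖ + ‖a‖ ≤ _
        linarith
  obtain ⟨v, hv⟩ := hne
  rw [mem_iInter] at hv
  refine ⟨v.fst, ?_, ?_⟩
  · exact ne_top_of_le_ne_top ENNReal.ofReal_ne_top (sInf_le (hv 0).1 : relaxation hD v.fst ≤ M)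
  -- The radii `ρ n` tend to zero, so in the intersection the two processes are the same.
  · have h1 : v.snd - (v.fst.fst : Lp D.H 2 D.Q) = c := by
      rw [← sub_eq_zero, ← norm_eq_zero]
      refine le_antisymm (ge_of_tendsto' (x := atTop) (f := ρ) ?_ fun n => ?_) (norm_nonneg _)
      · have := tendsto_one_div_add_atTop_nhds_zero_nat (𝕜 := ℝ).mul_const ‖D.x‖
        rwa [zero_mul] at this
      · exact mem_closedBall_iff_norm.1 (hv n).2.2
    rw [← h1, add_sub_cancel]
    exact ne_top_of_le_ne_top ENNReal.ofReal_ne_top (hv 0).2.1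

end

section

/-! ### The quadratic part of the functional -/

/-- A quadratic function of two variables. -/
def quadForm {V W : Type*} [NormedAddCommGroup V] [InnerProductSpace ℝ V] [NormedAddCommGroup W]
    [InnerProductSpace ℝ W] (δ ν : ℝ) (M : V →L[ℝ] V) (c w : V) (c₁ : W) (x : V) (x₁ : W) : ℝ :=
  δ / 2 * ‖x + c‖ ^ 2 + ((ν + δ) * ‖x‖ ^ 2 - inner ℝ (M x) x) + 1 / 2 * ‖x₁‖ ^ 2 +
    inner ℝ x w + inner ℝ x₁ c₁

/-- The quadratic form is strongly convex: as `M ≤ ν / 2`, the coefficient of `‖x‖²` is at least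
`δ`. -/
lemma quadForm_midpoint {V W : Type*} [NormedAddCommGroup V] [InnerProductSpace ℝ V]
    [NormedAddCommGroup W] [InnerProductSpace ℝ W] {δ ν : ℝ} (hδ : 0 ≤ δ) (hν : 0 ≤ ν)
    {M : V →L[ℝ] V} (hM : ∀ h, inner ℝ (M h) h ≤ ν / 2 * ‖h‖ ^ 2) (c w : V) (c₁ : W) (x y : V)
    (x₁ y₁ : W) :
    quadForm δ ν M c w c₁ ((1 / 2 : ℝ) • (x + y)) ((1 / 2 : ℝ) • (x₁ + y₁)) +
      min δ (1 / 2) / 4 * (‖x - y‖ ^ 2 + ‖x₁ - y₁‖ ^ 2) ≤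
      (quadForm δ ν M c w c₁ x x₁ + quadForm δ ν M c w c₁ y y₁) / 2 := by
  have h1 := norm_midpoint_sub_sq x y (-c)
  have h2 := norm_midpoint_sub_sq x y 0
  have h3 := norm_midpoint_sub_sq x₁ y₁ 0
  simp only [sub_neg_eq_add, sub_zero] at h1 h2 h3
  have h4 : inner ℝ (M ((1 / 2 : ℝ) • (x + y))) ((1 / 2 : ℝ) • (x + y)) =
      (inner ℝ (M x) x + inner ℝ (M y) y) / 2 - inner ℝ (M (x - y)) (x - y) / 4 := by
    simp only [_root_.map_smul, _root_.map_add, _root_.map_sub, real_inner_smul_left,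
      real_inner_smul_right, inner_add_left, inner_add_right, inner_sub_left, inner_sub_right]
    ring
  have h5 := hM (x - y)
  have h6 : min δ (1 / 2) * ‖x - y‖ ^ 2 ≤ δ * ‖x - y‖ ^ 2 :=
    mul_le_mul_of_nonneg_right (min_le_left _ _) (sq_nonneg _)
  have h7 : min δ (1 / 2) * ‖x₁ - y₁‖ ^ 2 ≤ 1 / 2 * ‖x₁ - y₁‖ ^ 2 :=
    mul_le_mul_of_nonneg_right (min_le_right _ _) (sq_nonneg _)
  have h8 : 0 ≤ δ * ‖x - y‖ ^ 2 := by positivity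
  have h9 : 0 ≤ ν * ‖x - y‖ ^ 2 := by positivity
  have e1 : ‖(1 / 2 : ℝ) • (x + y) + c‖ ^ 2 =
      (‖x + c‖ ^ 2 + ‖y + c‖ ^ 2) / 2 - ‖x - y‖ ^ 2 / 4 := by linarith
  have e2 : ‖(1 / 2 : ℝ) • (x + y)‖ ^ 2 = (‖x‖ ^ 2 + ‖y‖ ^ 2) / 2 - ‖x - y‖ ^ 2 / 4 := by linarith
  have e3 : ‖(1 / 2 : ℝ) • (x₁ + y₁)‖ ^ 2 = (‖x₁‖ ^ 2 + ‖y₁‖ ^ 2) / 2 - ‖x₁ - y₁‖ ^ 2 / 4 := by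
    linarith
  simp only [quadForm]
  rw [h4, e1, e2, e3]
  simp only [real_inner_smul_left, inner_add_left]
  nlinarith

lemma quadForm_ge {V W : Type*} [NormedAddCommGroup V] [InnerProductSpace ℝ V]
    [NormedAddCommGroup W] [InnerProductSpace ℝ W] {δ ν : ℝ} (hδ : 0 < δ) (hν : 0 ≤ ν)
    {M : V →L[ℝ] V} (hM : ∀ h, inner ℝ (M h) h ≤ ν / 2 * ‖h‖ ^ 2) (c w : V) (c₁ : W) (x : V)
    (x₁ : W) : -(‖w‖ ^ 2 / (4 * δ)) - ‖c₁‖ ^ 2 / 2 ≤ quadForm δ ν M c w c₁ x x₁ := by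
  have h1 := hM x
  have h2 := abs_le.1 (abs_real_inner_le_norm x w)
  have h3 := abs_le.1 (abs_real_inner_le_norm x₁ c₁)
  have h4 : 0 ≤ δ / 2 * ‖x + c‖ ^ 2 := by positivity
  have h5 : ‖x‖ * ‖w‖ ≤ δ * ‖x‖ ^ 2 + ‖w‖ ^ 2 / (4 * δ) := by
    have h6 : δ * ‖x‖ ^ 2 + ‖w‖ ^ 2 / (4 * δ) - ‖x‖ * ‖w‖ =
        (2 * δ * ‖x‖ - ‖w‖) ^ 2 / (4 * δ) := by
      field_simp
      ring
    have h7 : 0 ≤ (2 * δ * ‖x‖ - ‖w‖) ^ 2 / (4 * δ) := by positivity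
    linarith
  have h8 : 0 ≤ ν * ‖x‖ ^ 2 := by positivity
  have h9 := sq_nonneg (‖x₁‖ - ‖c₁‖)
  rw [quadForm]
  nlinarith

variable {d : ℕ} {Ω : Type*} [mΩ : MeasurableSpace Ω] {D : Data d Ω}
  [IsProbabilityMeasure D.P] (hD : Standing D)
include hD

/-- The process `e^W x` as an element of `L²`. -/
def initLp : Lp D.H 2 D.Q := (hD.memLp_ex_const D.x).toLp fun p : ℝ × Ω => D.ex 1 p.1 p.2 D.x

/-- The terminal value `e^{W(T)} x` as an element of `L²`. -/
def initTermLp : Lp D.H 2 D.P :=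
  (hD.memLp_ex_const_time ⟨hD.T_pos.le, le_rfl⟩ D.x).toLp fun ω : Ω => D.ex 1 D.T ω D.x

/-- Multiplication by `μ` on the square integrable processes. -/
def μLp : Lp D.H 2 D.Q →L[ℝ] Lp D.H 2 D.Q := hD.isMul_μ.toCLM.compLpL 2 D.Q

omit [IsProbabilityMeasure D.P] in
lemma μLp_ae (h : Lp D.H 2 D.Q) : ∀ᵐ p ∂D.Q, μLp hD h p = mul D.O D.μ (h p) :=
  hD.isMul_μ.toCLM.coeFn_compLpL h

omit [IsProbabilityMeasure D.P] in
lemma inner_μLp_le (h : Lp D.H 2 D.Q) : inner ℝ (μLp hD h) h ≤ D.ν / 2 * ‖h‖ ^ 2 := by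
  rw [← real_inner_self_eq_norm_sq, L2.inner_def, L2.inner_def, ← integral_const_mul]
  refine integral_mono_ae (L2.integrable_inner _ _) ((L2.integrable_inner h h).const_mul _) ?_
  filter_upwards [μLp_ae hD h] with p hp
  rw [hp, real_inner_self_eq_norm_sq]
  exact hD.inner_μ_le _

/-- The quadratic part of the functional, as a function of `(e^W y, e^{W(T)} y₁)`. Here `κ` is the
coefficient of the cross term. -/
def quadPart (κ : E d → ℝ) (p : D.Pt) : ℝ :=
  quadForm D.δ D.ν (μLp hD) (initLp hD)
    ((D.ν + D.δ) • initLp hD - (hD.memLp_ex_const (mul D.O κ D.x)).toLp _) (initTermLp hD)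
    (p.fst : Lp D.H 2 D.Q) p.snd +
    inner ℝ ((memLp_drift hD).toLp _) (initLp hD)

lemma continuous_quadPart (κ : E d → ℝ) : Continuous (quadPart hD κ) := by
  unfold quadPart quadForm
  fun_prop

lemma quadPart_midpoint (κ : E d → ℝ) (a b : D.Pt) :
    quadPart hD κ ((1 / 2 : ℝ) • (a + b)) + min D.δ (1 / 2) / 4 * ‖a - b‖ ^ 2 ≤
      (quadPart hD κ a + quadPart hD κ b) / 2 := by
  have h := quadForm_midpoint hD.δ_pos.le Standing.ν_nonneg (inner_μLp_le hD) (initLp hD)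
    ((D.ν + D.δ) • initLp hD - (hD.memLp_ex_const (mul D.O κ D.x)).toLp _) (initTermLp hD)
    (a.fst : Lp D.H 2 D.Q) b.fst a.snd b.snd
  have hn : ‖a - b‖ ^ 2 = ‖(a.fst : Lp D.H 2 D.Q) - b.fst‖ ^ 2 + ‖a.snd - b.snd‖ ^ 2 :=
    WithLp.prod_norm_sq_eq_of_L2 (a - b)
  have h0 : quadPart hD κ ((1 / 2 : ℝ) • (a + b)) = quadForm D.δ D.ν (μLp hD) (initLp hD)
    ((D.ν + D.δ) • initLp hD - (hD.memLp_ex_const (mul D.O κ D.x)).toLp _) (initTermLp hD)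
    ((1 / 2 : ℝ) • ((a.fst : Lp D.H 2 D.Q) + b.fst)) ((1 / 2 : ℝ) • (a.snd + b.snd)) +
      inner ℝ ((memLp_drift hD).toLp _) (initLp hD) := rfl
  rw [hn, h0, quadPart, quadPart]
  linarith

lemma exists_quadPart_ge (κ : E d → ℝ) : ∃ C, ∀ p, C ≤ quadPart hD κ p :=
  ⟨_, fun p => add_le_add_left (quadForm_ge hD.δ_pos Standing.ν_nonneg (inner_μLp_le hD) (initLp hD)
    ((D.ν + D.δ) • initLp hD - (hD.memLp_ex_const (mul D.O κ D.x)).toLp _) (initTermLp hD)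
    (p.fst : Lp D.H 2 D.Q) p.snd) _⟩

/-- The convex part of the functional, with values in `[0,∞]`. -/
def convexPart (p : D.Pt) : ℝ≥0∞ :=
  potential D ((p.fst : Lp D.H 2 D.Q) + initLp hD) + relaxation hD p

lemma lowerSemicontinuous_convexPart : LowerSemicontinuous (convexPart hD) := by
  refine LowerSemicontinuous.add ?_ (lowerSemicontinuous_relaxation hD)
  exact lowerSemicontinuous_potential.comp
    (by fun_prop : Continuous fun p : D.Pt => (p.fst : Lp D.H 2 D.Q) + initLp hD)

lemma convexPart_midpoint (a b : D.Pt) :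
    convexPart hD ((1 / 2 : ℝ) • (a + b)) ≤ (convexPart hD a + convexPart hD b) / 2 := by
  have h1 : (((1 / 2 : ℝ) • (a + b)).fst : Lp D.H 2 D.Q) + initLp hD =
      (1 / 2 : ℝ) • (((a.fst : Lp D.H 2 D.Q) + initLp hD) + (b.fst + initLp hD)) := by
    have : (((1 / 2 : ℝ) • (a + b)).fst : Lp D.H 2 D.Q) =
      (1 / 2 : ℝ) • ((a.fst : Lp D.H 2 D.Q) + b.fst) := rfl
    rw [this]
    module
  rw [convexPart, convexPart, convexPart, h1]
  refine (add_le_add (potential_midpoint _ _) (relaxation_midpoint hD a b)).trans (le_of_eq ?_)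
  rw [← ENNReal.add_div]
  congr 1
  abel

/-- The minimization problem in the variables `(e^W y, e^{W(T)} y₁)`. -/
lemma exists_unique_point (κ : E d → ℝ) : ∃ a : D.Pt, convexPart hD a ≠ ∞ ∧
    (∀ b, ((convexPart hD a : ℝ≥0∞) : EReal) + (quadPart hD κ a : ℝ) ≤
      (convexPart hD b : ℝ≥0∞) + (quadPart hD κ b : ℝ)) ∧
    ∀ b, ((convexPart hD b : ℝ≥0∞) : EReal) + (quadPart hD κ b : ℝ) ≤
      (convexPart hD a : ℝ≥0∞) + (quadPart hD κ a : ℝ) → b = a := by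
  obtain ⟨C, hC⟩ := exists_quadPart_ge hD κ
  obtain ⟨p, h1, h2⟩ := exists_feasible hD
  exact exists_unique_minimizer (convexPart hD) (quadPart hD κ) (min D.δ (1 / 2) / 4) C
    (div_pos (lt_min hD.δ_pos (by norm_num)) (by norm_num))
    (lowerSemicontinuous_convexPart hD) (convexPart_midpoint hD) (continuous_quadPart hD κ) hC
    (quadPart_midpoint hD κ) ⟨p, ENNReal.add_ne_top.2 ⟨h2, h1⟩⟩

section Identification

variable {y : ℝ → Ω → D.H} {y₁ : Ω → D.H} (hy : D.MemH y) (hy₁ : D.MemTerm y₁)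
include hy

lemma ae_toLp_add_init : ∀ᵐ p ∂D.Q, ((MemH_memLp hy).toLp _ + initLp hD : Lp D.H 2 D.Q) p =
    D.expW p.1 p.2 (y p.1 p.2 + D.x) := by
  filter_upwards [Lp.coeFn_add ((MemH_memLp hy).toLp _) (initLp hD), (MemH_memLp hy).coeFn_toLp,
    (hD.memLp_ex_const D.x).coeFn_toLp, hD.ae_Q_goodPath] with p h1 h2 h3 h5
  rw [h1, Pi.add_apply, h2, initLp, h3, expW_eq, h5.2.ex_add 1 (Ioc_subset_Icc_self h5.1)]

lemma EIpos_phi_eq : D.EIpos (fun t ω => phi D.O (D.expW t ω (y t ω + D.x))) =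
    potential D ((MemH_memLp hy).toLp _ + initLp hD) := by
  have h := ae_toLp_add_init hD hy
  have hm : AEMeasurable (fun p : ℝ × Ω => phi D.O (D.expW p.1 p.2 (y p.1 p.2 + D.x))) D.Q :=
    (measurable_phi D.O).comp_aemeasurable
      (((Lp.aestronglyMeasurable _).congr h).aemeasurable)
  rw [EIpos_eq (f := fun t ω => phi D.O (D.expW t ω (y t ω + D.x))) hm, potential]
  refine lintegral_congr_ae ?_
  filter_upwards [h] with p hp
  rw [hp]

lemma EI_quad_eq : D.EI (fun t ω =>
      inner ℝ (D.expW t ω ((D.ν + D.δ) • (y t ω + D.x) + mul D.O D.μ D.x)) (D.expW t ω D.x)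
      + D.δ / 2 * ‖D.expW t ω (y t ω + D.x)‖ ^ 2 + D.η (D.expW t ω (y t ω))) =
    (D.ν + D.δ) * inner ℝ ((MemH_memLp hy).toLp _) (initLp hD) +
      inner ℝ ((memLp_drift hD).toLp _) (initLp hD) +
      D.δ / 2 * ‖(MemH_memLp hy).toLp _ + initLp hD‖ ^ 2 +
      ((D.ν + D.δ) * ‖(MemH_memLp hy).toLp _‖ ^ 2 -
        inner ℝ (μLp hD ((MemH_memLp hy).toLp _)) ((MemH_memLp hy).toLp _)) := by
  set h := (MemH_memLp hy).toLp (fun p : ℝ × Ω => D.ex 1 p.1 p.2 (y p.1 p.2)) with hh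
  set g := (memLp_drift hD).toLp (fun p : ℝ × Ω =>
    D.ex 1 p.1 p.2 ((D.ν + D.δ) • D.x + mul D.O D.μ D.x)) with hg
  set c := initLp hD with hc
  have i1 : Integrable (fun p : ℝ × Ω => (D.ν + D.δ) * (inner ℝ (h p) (c p) : ℝ)) D.Q :=
    (L2.integrable_inner h c).const_mul _
  have i2 : Integrable (fun p : ℝ × Ω => (inner ℝ (g p) (c p) : ℝ)) D.Q := L2.integrable_inner g c
  have i3 : Integrable (fun p : ℝ × Ω => D.δ / 2 * (inner ℝ ((h + c) p) ((h + c) p) : ℝ)) D.Q :=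
    (L2.integrable_inner (h + c) (h + c)).const_mul _
  have i4 : Integrable (fun p : ℝ × Ω => (D.ν + D.δ) * (inner ℝ (h p) (h p) : ℝ)) D.Q :=
    (L2.integrable_inner h h).const_mul _
  have i5 : Integrable (fun p : ℝ × Ω => (inner ℝ (μLp hD h p) (h p) : ℝ)) D.Q :=
    L2.integrable_inner (μLp hD h) h
  have i12 : Integrable (fun p : ℝ × Ω => (D.ν + D.δ) * (inner ℝ (h p) (c p) : ℝ) +
    (inner ℝ (g p) (c p) : ℝ)) D.Q := i1.add i2
  have i123 : Integrable (fun p : ℝ × Ω => (D.ν + D.δ) * (inner ℝ (h p) (c p) : ℝ) +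
    (inner ℝ (g p) (c p) : ℝ) + D.δ / 2 * (inner ℝ ((h + c) p) ((h + c) p) : ℝ)) D.Q := i12.add i3
  have i45 : Integrable (fun p : ℝ × Ω => (D.ν + D.δ) * (inner ℝ (h p) (h p) : ℝ) -
    (inner ℝ (μLp hD h p) (h p) : ℝ)) D.Q := i4.sub i5
  have hae : ∀ᵐ p ∂D.Q, (inner ℝ (D.expW p.1 p.2 ((D.ν + D.δ) • (y p.1 p.2 + D.x) +
        mul D.O D.μ D.x)) (D.expW p.1 p.2 D.x) +
      D.δ / 2 * ‖D.expW p.1 p.2 (y p.1 p.2 + D.x)‖ ^ 2 + D.η (D.expW p.1 p.2 (y p.1 p.2)) : ℝ) =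
      (D.ν + D.δ) * (inner ℝ (h p) (c p) : ℝ) + (inner ℝ (g p) (c p) : ℝ) +
      D.δ / 2 * (inner ℝ ((h + c) p) ((h + c) p) : ℝ) +
      ((D.ν + D.δ) * (inner ℝ (h p) (h p) : ℝ) - (inner ℝ (μLp hD h p) (h p) : ℝ)) := by
    filter_upwards [ae_drift hD (y := y), ae_toLp_add_init hD hy, (MemH_memLp hy).coeFn_toLp,
      (memLp_drift hD).coeFn_toLp, (hD.memLp_ex_const D.x).coeFn_toLp, μLp_ae hD h]
      with p h1 h2 h3 h4 h5 h6
    rw [h1, h2, h6, hD.η_eq, real_inner_self_eq_norm_sq, real_inner_self_eq_norm_sq, hh, hg, hc,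
      initLp, h3, h4, h5, expW_eq, inner_add_left, real_inner_smul_left]
  have e := i123.add i45
  have e1 : D.EI (fun t ω =>
      inner ℝ (D.expW t ω ((D.ν + D.δ) • (y t ω + D.x) + mul D.O D.μ D.x)) (D.expW t ω D.x)
      + D.δ / 2 * ‖D.expW t ω (y t ω + D.x)‖ ^ 2 + D.η (D.expW t ω (y t ω))) =
    ∫ p, (inner ℝ (D.expW p.1 p.2 ((D.ν + D.δ) • (y p.1 p.2 + D.x) +
        mul D.O D.μ D.x)) (D.expW p.1 p.2 D.x) +
      D.δ / 2 * ‖D.expW p.1 p.2 (y p.1 p.2 + D.x)‖ ^ 2 +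
        D.η (D.expW p.1 p.2 (y p.1 p.2)) : ℝ) ∂D.Q :=
    EI_eq (e.congr (hae.mono fun p hp => hp.symm))
  rw [e1, integral_congr_ae hae, integral_add i123 i45, integral_add i12 i3, integral_add i1 i2,
    integral_sub i4 i5, integral_const_mul, integral_const_mul, integral_const_mul,
    ← real_inner_self_eq_norm_sq, ← real_inner_self_eq_norm_sq]
  rfl

lemma EI_cross_eq (κ : E d → ℝ) :
    D.EI (fun t ω => inner ℝ (D.expW t ω (y t ω)) (D.expW t ω (mul D.O κ D.x))) =
      inner ℝ ((MemH_memLp hy).toLp _) ((hD.memLp_ex_const (mul D.O κ D.x)).toLp _) := by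
  rw [inner_toLp (MemH_memLp hy) (hD.memLp_ex_const (mul D.O κ D.x))]
  simp only [expW_eq]
  exact EI_eq (integrable_inner (MemH_memLp hy) (hD.memLp_ex_const (mul D.O κ D.x)))

/-- On the admissible triples, the functional is the sum of the convex and the quadratic part at the
point `(e^W y, e^{W(T)} y₁)`. -/
lemma Gbar_eq (κ : E d → ℝ) {u : D.X} (hu : ∀ θ, D.Bweak y y₁ θ + u θ = 0) :
    D.Gbar κ y y₁ u = ((convexPart hD (toPt hD hy hy₁) : ℝ≥0∞) : EReal) +
      (quadPart hD κ (toPt hD hy hy₁) : ℝ) := by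
  have h1 : D.G2relaxed y y₁ u = relaxation hD (toPt hD hy hy₁) :=
    le_antisymm (G2relaxed_le_relaxation hD hy hy₁ hu) (relaxation_le_G2relaxed hD hy hy₁ u)
  have h2 : ∫ ω, ‖D.expW D.T ω (y₁ ω)‖ ^ 2 ∂D.P = ‖(MemTerm_memLp hy₁).toLp _‖ ^ 2 := by
    rw [norm_toLp_sq]
    simp only [expW_eq]
  have h3 : D.innerTerm y₁ (fun _ => D.x) = inner ℝ ((MemTerm_memLp hy₁).toLp _) (initTermLp hD) := by
    rw [initTermLp, inner_toLp (MemTerm_memLp hy₁), Data.innerTerm]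
    simp only [expW_eq]
  have hq : (D.EI (fun t ω =>
      inner ℝ (D.expW t ω ((D.ν + D.δ) • (y t ω + D.x) + mul D.O D.μ D.x)) (D.expW t ω D.x)
      + D.δ / 2 * ‖D.expW t ω (y t ω + D.x)‖ ^ 2 + D.η (D.expW t ω (y t ω)))
    - D.EI (fun t ω => inner ℝ (D.expW t ω (y t ω)) (D.expW t ω (mul D.O κ D.x)))
    + 1 / 2 * (∫ ω, ‖D.expW D.T ω (y₁ ω)‖ ^ 2 ∂D.P)
    + D.innerTerm y₁ (fun _ => D.x)) = quadPart hD κ (toPt hD hy hy₁) := by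
    rw [EI_quad_eq hD hy, EI_cross_eq hD hy κ, h2, h3, quadPart]
    change _ = D.δ / 2 * ‖(MemH_memLp hy).toLp _ + initLp hD‖ ^ 2 +
      ((D.ν + D.δ) * ‖(MemH_memLp hy).toLp _‖ ^ 2 -
        inner ℝ (μLp hD ((MemH_memLp hy).toLp _)) ((MemH_memLp hy).toLp _)) +
      1 / 2 * ‖(MemTerm_memLp hy₁).toLp _‖ ^ 2 +
      inner ℝ ((MemH_memLp hy).toLp _) ((D.ν + D.δ) • initLp hD -
        (hD.memLp_ex_const (mul D.O κ D.x)).toLp _) +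
      inner ℝ ((MemTerm_memLp hy₁).toLp _) (initTermLp hD) +
      inner ℝ ((memLp_drift hD).toLp _) (initLp hD)
    rw [inner_sub_right, real_inner_smul_right]
    ring
  rw [Data.Gbar, Data.G1, hq, h1, EIpos_phi_eq hD hy, convexPart, EReal.coe_ennreal_add, add_right_comm]
  rfl

end Identification

end

section

/-! ### Existence and uniqueness of the minimizer, and the regularity of the solution -/

variable {d : ℕ} {Ω : Type*} [mΩ : MeasurableSpace Ω] {D : Data d Ω}
  [IsProbabilityMeasure D.P] (hD : Standing D)
include hD

/-- Equal points are represented by processes that are equal almost everywhere. -/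
lemma ae_eq_of_toPt_eq {y w : ℝ → Ω → D.H} {y₁ w₁ : Ω → D.H} (hy : D.MemH y) (hy₁ : D.MemTerm y₁)
    (hw : D.MemH w) (hw₁ : D.MemTerm w₁) (h : toPt hD hw hw₁ = toPt hD hy hy₁) :
    (∀ᵐ p ∂D.Q, w p.1 p.2 = y p.1 p.2) ∧ w₁ =ᵐ[D.P] y₁ := by
  constructor
  · have h1 := toPt_fst_ae hD hw hw₁
    rw [h] at h1
    filter_upwards [h1, toPt_fst_ae hD hy hy₁, hD.ae_Q_goodPath] with p h2 h3 h4
    have h5 := Ioc_subset_Icc_self h4.1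
    rw [← h4.2.ex_neg_ex 1 h5 (w p.1 p.2), ← h2, h3, h4.2.ex_neg_ex 1 h5]
  · have h1 := toPt_snd_ae hD hw hw₁
    rw [h] at h1
    filter_upwards [h1, toPt_snd_ae hD hy hy₁, hD.ae_goodPath] with ω h2 h3 h4
    have h5 : D.T ∈ Icc 0 D.T := ⟨hD.T_pos.le, le_rfl⟩
    rw [← h4.ex_neg_ex 1 h5 (w₁ ω), ← h2, h3, h4.ex_neg_ex 1 h5]

/-- The minimization problem has a unique solution, and its potential is finite. -/
lemma exists_unique_isMinimizer (κ : E d → ℝ) : ∃ y y₁ u, D.IsMinimizer κ y y₁ u ∧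
    (∀ w w₁ v, D.IsMinimizer κ w w₁ v →
      (∀ᵐ p ∂D.Q, w p.1 p.2 = y p.1 p.2) ∧ w₁ =ᵐ[D.P] y₁ ∧ v = u) ∧
    ∃ hy : D.MemH y, potential D ((MemH_memLp hy).toLp _ + initLp hD) ≠ ∞ := by
  obtain ⟨a, hfin, hmin, huniq⟩ := exists_unique_point hD κ
  obtain ⟨y, y₁, hy, hy₁, rfl⟩ := exists_toPt hD a
  obtain ⟨u, hu⟩ := exists_functional_Bweak hD hy hy₁
  refine ⟨y, y₁, u, ⟨⟨hy, hy₁, hu⟩, fun w w₁ v hw => ?_⟩, fun w w₁ v hw => ?_, hy,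
    (ENNReal.add_ne_top.1 hfin).1⟩
  · rw [Gbar_eq hD hy hy₁ κ hu, Gbar_eq hD hw.memH hw.memTerm κ hw.constraint]
    exact hmin _
  · have h1 := hw.2 y y₁ u ⟨hy, hy₁, hu⟩
    rw [Gbar_eq hD hy hy₁ κ hu, Gbar_eq hD hw.1.memH hw.1.memTerm κ hw.1.constraint] at h1
    have h2 := huniq _ h1
    have h3 := ae_eq_of_toPt_eq hD hy hy₁ hw.1.memH hw.1.memTerm h2
    refine ⟨h3.1, h3.2, ContinuousLinearMap.ext fun θ => ?_⟩
    -- The third component is determined by the constraint.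
    obtain ⟨A, B, c, h4⟩ := exists_Bweak_eq hD θ
    have h5 : (MemH_memLp hw.1.memH).toLp _ = (MemH_memLp hy).toLp _ :=
      congrArg (fun p : D.Pt => (p.fst : Lp D.H 2 D.Q)) h2
    have h6 : (MemTerm_memLp hw.1.memTerm).toLp _ = (MemTerm_memLp hy₁).toLp _ :=
      congrArg (fun p : D.Pt => p.snd) h2
    have h7 := hw.1.constraint θ
    have h8 := hu θ
    rw [h4 w w₁ hw.1.memH hw.1.memTerm, h5, h6] at h7
    rw [h4 y y₁ hy hy₁] at h8
    linarith

/-- Finite potential means square integrability in `H¹₀`, and nonnegativity. -/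
lemma regularity_of_potential_ne_top {y : ℝ → Ω → D.H} (hy : D.MemH y)
    (hfin : potential D ((MemH_memLp hy).toLp _ + initLp hD) ≠ ∞) :
    D.MemL2H10 (fun t ω => D.expW t ω (y t ω + D.x)) ∧
    ∀ᵐ p ∂D.Q, ∀ᵐ ξ ∂(vol D.O), 0 ≤ D.expW p.1 p.2 (y p.1 p.2 + D.x) ξ := by
  have hY := ae_toLp_add_init hD hy
  set h := (MemH_memLp hy).toLp _ + initLp hD
  have hm : AEMeasurable (fun p => phi D.O (h p)) D.Q :=
    (measurable_phi D.O).comp_aemeasurable (Lp.aestronglyMeasurable _).aemeasurable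
  have hφ : ∀ᵐ p ∂D.Q, phi D.O (h p) ≠ ∞ := (ae_lt_top' hm hfin).mono fun _ h => h.ne
  obtain ⟨G, hG, hGz⟩ := exists_measurable_gradient D.O
  have hGm : AEStronglyMeasurable (fun p => G (h p)) D.Q :=
    (hG.comp_aemeasurable (Lp.aestronglyMeasurable h).aemeasurable).aestronglyMeasurable
  have hle : ∀ z, phi D.O z ≠ ∞ → (z, G z) ∈ h10Graph D.O ∧ ‖G z‖ₑ ^ 2 ≤ 2 * phi D.O z := by
    intro z hz
    obtain ⟨h1, h2⟩ := hGz z (ENNReal.add_ne_top.1 hz).1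
    refine ⟨h1, ?_⟩
    rw [ENNReal.ofReal_mul (by norm_num), ENNReal.ofReal_pow (norm_nonneg _), ofReal_norm, one_div,
      ENNReal.ofReal_inv_of_pos (by norm_num), ENNReal.ofReal_ofNat] at h2
    calc ‖G z‖ₑ ^ 2 = 2 * (2⁻¹ * ‖G z‖ₑ ^ 2) := by
          rw [← mul_assoc, ENNReal.mul_inv_cancel two_ne_zero ENNReal.ofNat_ne_top, one_mul]
      _ ≤ 2 * phi D.O z := by
          gcongr
          exact h2.trans le_self_add
  refine ⟨⟨(Lp.memLp h).ae_eq hY, fun p => G (h p), memLp_two_of_lintegral hGm ?_, ?_⟩, ?_⟩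
  · calc ∫⁻ p, ‖G (h p)‖ₑ ^ 2 ∂D.Q ≤ ∫⁻ p, 2 * phi D.O (h p) ∂D.Q :=
          lintegral_mono_ae (hφ.mono fun p hp => (hle _ hp).2)
      _ < ∞ := by
          rw [lintegral_const_mul' _ _ ENNReal.ofNat_ne_top]
          exact ENNReal.mul_lt_top ENNReal.ofNat_lt_top (lt_top_iff_ne_top.2 hfin)
  · filter_upwards [hY, hφ] with p h1 h2
    rw [← h1]
    exact (hle _ h2).1
  · filter_upwards [hY, hφ] with p h1 h2
    rw [← h1]
    exact mem_cone_of_phi_ne_top D.O h2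

end

end StochObstacle

end

open StochObstacle in
theorem corollary4p2 {d : ℕ} {Ω : Type*} [MeasurableSpace Ω] (D : Data d Ω)
    [IsProbabilityMeasure D.P]
    (hO : IsOpen D.O) (hObdd : Bornology.IsBounded D.O) (hT : 0 < D.T)
    (hβ : IsBrownianSystem D.P D.ℱ D.β)
    (he : ∀ j, multNorm D.O (D.e j) ≠ ∞ ∧ multNorm D.O (fun ξ => D.e j ξ ^ 2) ≠ ∞)
    (hν : D.νInf < ENNReal.ofReal D.lam)
    (hW : D.ExpWMultiplier)
    (κ : E d → ℝ) (hκ : κ = (fun ξ => 3 * D.μ ξ) ∨ κ = (fun ξ => 1 + D.μ ξ)) :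
    (∃ y y₁ u, D.IsMinimizer κ y y₁ u ∧
      ∀ w w₁ v, D.IsMinimizer κ w w₁ v →
        (∀ᵐ p ∂D.Q, w p.1 p.2 = y p.1 p.2) ∧ w₁ =ᵐ[D.P] y₁ ∧ v = u) ∧
    ∃ Y : ℝ → Ω → D.H, D.IsVariationalSolution κ Y ∧
      (∀ Y', D.IsVariationalSolution κ Y' → ∀ᵐ p ∂D.Q, Y' p.1 p.2 = Y p.1 p.2) ∧
      D.MemL2H10 Y ∧
      ∀ᵐ p ∂D.Q, ∀ᵐ ξ ∂(vol D.O), 0 ≤ Y p.1 p.2 ξ := by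
  have hD : Standing D := ⟨hT, hβ, he, hν, hW⟩
  obtain ⟨y, y₁, u, hmin, huniq, hy, hfin⟩ := exists_unique_isMinimizer hD κ
  obtain ⟨h1, h2⟩ := regularity_of_potential_ne_top hD hy hfin
  refine ⟨⟨y, y₁, u, hmin, huniq⟩, fun t ω => D.expW t ω (y t ω + D.x),
    ⟨y, y₁, u, hmin, ae_of_all _ fun _ => rfl⟩, ?_, h1, h2⟩
  rintro Y' ⟨w, w₁, v, hw, hY'⟩
  filter_upwards [hY', (huniq w w₁ v hw).1] with p h3 h4
  rw [h3, h4]
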